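/- **Setting.** Let $S$ be a closed connected oriented surface and $Z\subset S$ a finite set. A *topological triangulation* $\tau$ of $(S,Z)$ is a decomposition of $S$ into finitely many triangular faces glued along their sides in pairs, with vertex set $Z$; vertices or sides of one face are allowed to coincide in $S$. Let $E$ and $F$ be its sets of edges and faces, and $H$ its set of half-edges, i.e. pairs $(f,e)$ of a face $f$ and a side $e$ of $f$. The group $\mathbb Z/3$ acts on $H$: $(f,e+1)$ is the side of $f$ that follows $(f,e)$ counterclockwise. The dual graph $\Gamma$ has vertex set $E\sqcup F$ and edge set $H$, with $\partial(f,e)=e-f$, so that $H_1(\Gamma)=\ker\partial\subset\mathbb Z\langle H\rangle$. A *triangle matching* is a bijection $\iota:H\to H$ that commutes with $\mathbb Z/3$ and whose linear extension satisfies $\iota(\alpha)=-\alpha$ for all $\alpha\in H_1(\Gamma)$. *Angle space.* $\mathcal A$ is the set of functions $\theta$ assigning to each angle $(f;e,e+1)$ between consecutive sides of a face a number in $(0,\pi)$, with sum $\pi$ in each face; thus $\mathcal A\subset\mathbb R^{3\#F}$. Put $\theta(f;e+1,e)=-\theta(f;e,e+1)$. $\mathcal A^\iota\subset\mathcal A$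 is the set of $\theta$ with $\theta(f;e,e+1)=\theta(f';e',e'+1)$ whenever $\iota(f,e)=(f',e')$. $\mathcal D\subset\mathcal A$ is the set of $\theta$ such that for every edge of $\tau$ the two angles opposite to it have sum $<\pi$. For $\theta\in\mathcal A$ a passage through $f$ from the side $e$ to the side $e+1$ contributes $\frac{\sin\theta(f;e+1,e+2)}{\sin\theta(f;e+2,e)}\,e^{i\theta(f;e,e+1)}$, the reverse passage contributes the inverse, and the holonomy of a simple cycle of $\Gamma$ is the product of the contributions of its passages; this determines a homomorphism $\mathrm{Hol}^\theta:H_1(\Gamma)\to\mathbb C^*$. Let $\mathcal V\subset\mathcal A$ be the set of $\theta$ with $\mathrm{Hol}^\theta$ trivial (equivalently, with holonomy $1$ along every simple cycle). *Strata.* For $\kappa:Z\to\mathbb Z_{\ge0}$, let $\Omega\mathcal T(\kappa)$ be the set of translation surface structures $(X,\omega)$ on $S$, compatible with the orientation, with a zero of order $\kappa(z)$ at each $z\in Z$ and no zero outside $Z$, modulo homeomorphisms of $S$ isotopic to the identity rel $Z$. It carries the weakest topology for which the periods $\int_\gamma\omega$, $\gamma\in H_1(S,Z;\mathbb Z)$,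 are continuous, and $\mathbb P\Omega\mathcal T(\kappa)$ is its quotient by $\mathbb C^*$ acting by $\omega\mapsto\lambda\omega$. The *iso-triangulable region* $\Delta(\tau)\subset\mathbb P\Omega\mathcal T(\kappa)$ is the set of classes of $(X,\omega)$ for which every face of $\tau$ is a Euclidean triangle, and the *angle map* $\Theta:\Delta(\tau)\to\mathcal A$ records the angles of these triangles. The *iso-Delaunay region* $\Delta_{\mathcal D}(\tau)\subset\Delta(\tau)$ is the set of classes of such $(X,\omega)$ for which $\tau$ is a nondegenerate Delaunay triangulation: for each face $f$ there is a continuous map $d$ from a closed Euclidean disk to $S$, mapping the open disk to $S\setminus Z$ by a local isometry, such that $d^{-1}(Z)$ consists of exactly three points and $f$ is the image under $d$ of the triangle they span. **Theorem A.** Let $\tau$ be a topological triangulation of $(S,Z)$ that admits a triangle matching $\iota$. Then: 1. $\mathcal V=\mathcal A^\iota$. 2. $\mathcal D\cap\mathcal A^\iota$ is a convex subset of $\mathbb R^{3\#F}$. 3. There is $\kappa:Z\to\mathbb Z_{\ge0}$ for which $\Delta_{\mathcal D}(\tau)\subset\mathbb P\Omega\mathcal T(\kappa)$ is nonempty. 4.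 For every $\kappa$ for which $\Delta(\tau)\subset\mathbb P\Omega\mathcal T(\kappa)$ is nonempty (in particular whenever $\Delta_{\mathcal D}(\tau)$ is nonempty), $\Theta$ restricts to a homeomorphism from $\Delta_{\mathcal D}(\tau)$ onto $\mathcal D\cap\mathcal A^\iota$. Consequently $\Delta_{\mathcal D}(\tau)$ is connected and contractible. -/

import Mathlib

open Set Filter Topology

noncomputable section

/-! ### Trivalent ribbon graphs, triangle matchings, angle space, combinatorial holonomy -/

/-- A trivalent ribbon graph with 2-valent vertices `E` and 3-valent vertices `F`.  The half-edges
are the pairs `(f, j)` with `j : Fin 3`; `ℤ/3` acts on the half-edges at `f` by adding to `j`, and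
`edge h` is the endpoint in `E` of the half-edge `h`. -/
structure RibbonGraph (E F : Type*) where
  edge : F × Fin 3 → E
  valence_two : ∀ e, Nat.card {h // edge h = e} = 2

namespace RibbonGraph

variable {E F : Type*}

/-- The action of `n : ℤ/3` on half-edges, `(f, e) ↦ (f, e + n)`. -/
def shift (n : Fin 3) (h : F × Fin 3) : F × Fin 3 := (h.1, h.2 + n)

/-- The boundary map `∂ (f, e) = e - f` from `ℤ⟨H⟩` to `ℤ⟨E ∪ F⟩`. -/
def boundary (Γ : RibbonGraph E F) : (F × Fin 3 →₀ ℤ) →ₗ[ℤ] (E ⊕ F →₀ ℤ) :=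
  Finsupp.lmapDomain ℤ ℤ (fun h => Sum.inl (Γ.edge h)) -
    Finsupp.lmapDomain ℤ ℤ (fun h : F × Fin 3 => Sum.inr h.1)

/-- The first homology group of the graph: the group of simplicial 1-cycles. -/
def homology (Γ : RibbonGraph E F) : Submodule ℤ (F × Fin 3 →₀ ℤ) := LinearMap.ker Γ.boundary

/-- A triangle matching: a bijection of the half-edges that commutes with `ℤ/3` and acts as `-1`
on the first homology. -/
structure IsTriangleMatching (Γ : RibbonGraph E F) (ι : Equiv.Perm (F × Fin 3)) : Prop where
  commutes : ∀ n h, ι (shift n h) = shift n (ι h)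
  neg_homology : ∀ α ∈ Γ.homology, Finsupp.mapDomain ι α = -α

/-- The angle space.  The half-edge `h = (f, e)` stands for the combinatorial angle
`(f; e, e + 1)`, so an angle assignment is a function on half-edges. -/
def angleSpace (F : Type*) : Set (F × Fin 3 → ℝ) :=
  {θ | (∀ h, θ h ∈ Ioo 0 Real.pi) ∧ ∀ f, ∑ j, θ (f, j) = Real.pi}

/-- Angle assignments invariant under `ι`, where `ι (f; e, e + 1) = (f'; e', e' + 1)` if
`ι (f, e) = (f', e')`. -/
def invariantAngles (ι : Equiv.Perm (F × Fin 3)) : Set (F × Fin 3 → ℝ) :=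
  {θ | θ ∈ angleSpace F ∧ ∀ h, θ (ι h) = θ h}

/-- Angle assignments for which, at every `e : E`, the two angles opposite `e` (the angles
`(f; e + 1, e + 2)` for the two half-edges `(f, e)` at `e`) have sum less than `π`. -/
def delaunayAngles (Γ : RibbonGraph E F) : Set (F × Fin 3 → ℝ) :=
  {θ | θ ∈ angleSpace F ∧
    ∀ h h', h ≠ h' → Γ.edge h = Γ.edge h' → θ (shift 1 h) + θ (shift 1 h') < Real.pi}

/-- A simple cycle `∑ j, ((e_{j-1}, f_j) + (f_j, e_j))` with indices modulo its length; `enter j` is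
the half-edge `(f_j, e_{j-1})` and `exit j` is the half-edge `(f_j, e_j)`. -/
structure SimpleCycle (Γ : RibbonGraph E F) where
  n : ℕ
  enter : Fin (n + 1) → F × Fin 3
  exit : Fin (n + 1) → F × Fin 3
  face_eq : ∀ j, (enter j).1 = (exit j).1
  ne : ∀ j, enter j ≠ exit j
  edge_eq : ∀ j, Γ.edge (exit j) = Γ.edge (enter (j + 1))
  face_injective : Function.Injective fun j => (exit j).1
  edge_injective : Function.Injective fun j => Γ.edge (exit j)

/-- Rotational contribution of the combinatorial angle `(f; e, e + 1)`. -/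
def rotation (θ : F × Fin 3 → ℝ) (h : F × Fin 3) : ℂ := Complex.exp (Complex.I * θ h)

/-- Dilational contribution of the combinatorial angle `(f; e, e + 1)`. -/
def dilation (θ : F × Fin 3 → ℝ) (h : F × Fin 3) : ℝ :=
  Real.sin (θ (shift 1 h)) / Real.sin (θ (shift (-1) h))

open Classical in
/-- Contribution to holonomy of the passage `(f; e, e')` through a face, where `h = (f, e)`,
`h' = (f, e')` and `e' = e ± 1`; recall `(f; e, e - 1) = -(f; e - 1, e)`. -/
def contribution (θ : F × Fin 3 → ℝ) (h h' : F × Fin 3) : ℂ :=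
  if h' = shift 1 h then dilation θ h * rotation θ h
  else (dilation θ h' * rotation θ h')⁻¹

/-- The combinatorial holonomy along a simple cycle. -/
def SimpleCycle.holonomy {Γ : RibbonGraph E F} (α : Γ.SimpleCycle) (θ : F × Fin 3 → ℝ) : ℂ :=
  ∏ j, contribution θ (α.enter j) (α.exit j)

/-- The locus of trivial holonomy.  The simple cycles generate the first homology, so the
holonomy character on homology is trivial if and only if it is `1` on every simple cycle. -/
def trivialHolonomy (Γ : RibbonGraph E F) : Set (F × Fin 3 → ℝ) :=
  {θ | θ ∈ angleSpace F ∧ ∀ α : Γ.SimpleCycle, α.holonomy θ = 1}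

end RibbonGraph

/-! ### Oriented surfaces -/

/-- A map that is a homeomorphism near `z` preserves the orientation at `z`: the image of every
small circle around `z` winds once, counterclockwise, around the image of `z`. -/
def OrientationPreservingAt (f : ℂ → ℂ) (z : ℂ) : Prop :=
  ∀ᶠ r : ℝ in 𝓝[>] 0, ∃ g : ℝ → ℂ, Continuous g ∧
    (∀ t, Complex.exp (g t) = f (circleMap z r t) - f z) ∧
    g (2 * Real.pi) = g 0 + 2 * Real.pi * Complex.I

/-- The atlas of the topological surface `S` is oriented. -/
class OrientedSurface (S : Type*) [TopologicalSpace S] [ChartedSpace ℂ S] : Prop where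
  oriented : ∀ e ∈ atlas ℂ S, ∀ e' ∈ atlas ℂ S, ∀ p ∈ e.source ∩ e'.source,
    OrientationPreservingAt (e' ∘ e.symm) (e p)

/-! ### Translation structures and their strata -/

/-- A translation structure on the oriented surface `S` with a zero of order `κ z` at every
`z ∈ Z` and no other zeros: an atlas of `S \ Z` of orientation-preserving charts `e` (local
primitives of the differential `ω`, so `ω = de`) that differ by translations, such that
`ω = ζ ^ k dζ` in some coordinate `ζ` centred at `z`, where `k = κ z`. -/
structure TranslationStructure (S : Type*) [TopologicalSpace S] [ChartedSpace ℂ S]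
    (Z : Set S) (κ : Z → ℕ) where
  charts : Set (OpenPartialHomeomorph S ℂ)
  covers : ⋃ e ∈ charts, e.source = Zᶜ
  translation : ∀ e ∈ charts, ∀ e' ∈ charts, ∀ p ∈ e.source, p ∈ e'.source →
    ∀ᶠ q in 𝓝 p, e' q - e' p = e q - e p
  oriented : ∀ e ∈ charts, ∀ p ∈ e.source,
    OrientationPreservingAt (e ∘ (chartAt ℂ p).symm) (chartAt ℂ p p)
  zeros : ∀ z : Z, ∃ ζ : OpenPartialHomeomorph S ℂ, (z : S) ∈ ζ.source ∧ ζ z = 0 ∧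
    ∀ e ∈ charts, ∀ p ∈ e.source, p ∈ ζ.source →
      ∀ᶠ q in 𝓝 p, e q - e p = (ζ q ^ (κ z + 1) - ζ p ^ (κ z + 1)) / (κ z + 1)

/-- `ψ` is isotopic to the identity relative to `Z`; the isotopy is given by its (level-preserving)
track, a homeomorphism of `[0, 1] × S`. -/
def IsotopicToId {S : Type*} [TopologicalSpace S] (Z : Set S) (ψ : S ≃ₜ S) : Prop :=
  ∃ H : (unitInterval × S) ≃ₜ (unitInterval × S), (∀ x, (H x).1 = x.1) ∧
    (∀ t, ∀ z ∈ Z, H (t, z) = (t, z)) ∧ (∀ p, H (0, p) = (0, p)) ∧ ∀ p, H (1, p) = (1, ψ p)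

theorem IsotopicToId.fixes {S : Type*} [TopologicalSpace S] {Z : Set S} {ψ : S ≃ₜ S}
    (h : IsotopicToId Z ψ) {z : S} (hz : z ∈ Z) : ψ z = z := by
  obtain ⟨H, -, h2, -, h4⟩ := h
  have := (h4 z).symm.trans (h2 1 z hz)
  exact (Prod.ext_iff.1 this).2

namespace TranslationStructure

variable {S : Type*} [TopologicalSpace S] [ChartedSpace ℂ S] {Z : Set S} {κ : Z → ℕ}

theorem exists_chart (X : TranslationStructure S Z κ) {p : S} (hp : p ∉ Z) :
    ∃ e ∈ X.charts, p ∈ e.source := by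
  have : p ∈ ⋃ e ∈ X.charts, e.source := X.covers ▸ hp
  simpa using this

theorem notMem_of_mem_source (X : TranslationStructure S Z κ) {e : OpenPartialHomeomorph S ℂ}
    (he : e ∈ X.charts) {p : S} (hp : p ∈ e.source) : p ∉ Z := by
  have : p ∈ Zᶜ := X.covers ▸ mem_biUnion he hp
  exact this

/-- `ψ` pulls the differential of `X'` back to the differential of `X`. -/
def PullsBack (X X' : TranslationStructure S Z κ) (ψ : S ≃ₜ S) : Prop :=
  ∀ e ∈ X.charts, ∀ e' ∈ X'.charts, ∀ p ∈ e.source, ψ p ∈ e'.source →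
    ∀ᶠ q in 𝓝 p, e' (ψ q) - e' (ψ p) = e q - e p

/-- Teichmüller equivalence of translation structures on `(S, Z)`. -/
def Equivalent (X X' : TranslationStructure S Z κ) : Prop :=
  ∃ ψ : S ≃ₜ S, X.PullsBack X' ψ ∧ IsotopicToId Z ψ

theorem equivalent_equivalence : Equivalence (Equivalent (Z := Z) (κ := κ)) where
  refl X := by
    refine ⟨Homeomorph.refl S, fun e he e' he' p hp hp' => X.translation e he e' he' p hp hp',
      Homeomorph.refl _, fun _ => rfl, fun _ _ _ => rfl, fun _ => rfl, fun _ => rfl⟩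
  symm := by
    rintro X X' ⟨ψ, hψ, H, h1, h2, h3, h4⟩
    refine ⟨ψ.symm, fun e he e' he' p hp hp' => ?_, H.symm, fun x => ?_, fun t z hz => ?_,
      fun p => ?_, fun p => ?_⟩
    · have := hψ e' he' e he (ψ.symm p) hp' (by simpa using hp)
      have := (ψ.symm.continuous.tendsto p).eventually this
      filter_upwards [this] with q hq
      simpa using hq.symm
    · simpa using (h1 (H.symm x)).symm
    · rw [Homeomorph.symm_apply_eq, h2 t z hz]
    · rw [Homeomorph.symm_apply_eq, h3]
    · rw [Homeomorph.symm_apply_eq, h4]; simp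
  trans := by
    rintro X X' X'' ⟨ψ, hψ, hI⟩ ⟨ψ', hψ', hI'⟩
    refine ⟨ψ.trans ψ', fun e he e'' he'' p hp hp'' => ?_, ?_⟩
    · have hpZ : ψ p ∉ Z := fun h => by
        have h1 : ψ (ψ p) = ψ p := hI.fixes h
        have h2 := ψ.injective h1
        exact X.notMem_of_mem_source he hp (h2 ▸ h)
      obtain ⟨e', he', hp'⟩ := X'.exists_chart hpZ
      have a := hψ e he e' he' p hp hp'
      have b := (ψ.continuous.tendsto p).eventually (hψ' e' he' e'' he'' (ψ p) hp' hp'')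
      filter_upwards [a, b] with q hq hq'
      exact hq'.trans hq
    · obtain ⟨H, h1, h2, h3, h4⟩ := hI
      obtain ⟨K, k1, k2, k3, k4⟩ := hI'
      refine ⟨H.trans K, fun x => ?_, fun t z hz => ?_, fun p => ?_, fun p => ?_⟩
      · simp [k1, h1]
      · simp [h2 t z hz, k2 t z hz]
      · simp [h3, k3]
      · simp [h4, k4]

/-- Rescaling of the differential `ω ↦ c ω`. -/
def scale (c : ℂˣ) (X : TranslationStructure S Z κ) : TranslationStructure S Z κ where
  charts := (fun e => e.transHomeomorph (Homeomorph.mulLeft₀ (c : ℂ) c.ne_zero)) '' X.charts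
  covers := by
    rw [← X.covers, biUnion_image]; rfl
  translation := by
    rintro _ ⟨e, he, rfl⟩ _ ⟨e', he', rfl⟩ p hp hp'
    filter_upwards [X.translation e he e' he' p hp hp'] with q hq
    simp [← mul_sub, hq]
  oriented := by
    rintro _ ⟨e, he, rfl⟩ p hp
    filter_upwards [X.oriented e he p hp] with r hr
    obtain ⟨g, hg, hg1, hg2⟩ := hr
    refine ⟨fun t => Complex.log c + g t, by fun_prop, fun t => ?_, ?_⟩
    · rw [Complex.exp_add, Complex.exp_log c.ne_zero, hg1]
      simp [mul_sub]
    · simp only [hg2]; ring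
  zeros := by
    intro z
    obtain ⟨ζ, h1, h2, h3⟩ := X.zeros z
    obtain ⟨μ, hμ⟩ := IsAlgClosed.exists_pow_nat_eq (c : ℂ) (n := κ z + 1) (by omega)
    have hμ0 : μ ≠ 0 := by
      rintro rfl
      exact c.ne_zero (by rw [← hμ]; simp)
    refine ⟨ζ.transHomeomorph (Homeomorph.mulLeft₀ μ hμ0), h1, by simp [h2], ?_⟩
    rintro _ ⟨e, he, rfl⟩ p hp hp'
    filter_upwards [h3 e he p hp hp'] with q hq
    simp only [OpenPartialHomeomorph.transHomeomorph_apply, Function.comp_apply,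
      Homeomorph.coe_mulLeft₀, mul_pow, hμ]
    rw [← mul_sub, hq]; ring

/-- `P` is, on a neighbourhood of `p`, a continuous primitive of the differential. -/
def IsPrimitiveAt (X : TranslationStructure S Z κ) (p : S) (P : S → ℂ) : Prop :=
  ∀ᶠ q in 𝓝 p, ContinuousAt P q ∧
    ∀ e ∈ X.charts, q ∈ e.source → ∀ᶠ q' in 𝓝 q, P q' - P q = e q' - e q

/-- The integral of the differential along the path `γ` is `c`, computed with a primitive along
the path. -/
def HasPeriod (X : TranslationStructure S Z κ) {a b : S} (γ : Path a b) (c : ℂ) : Prop :=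
  ∃ G : unitInterval → ℂ, G 1 - G 0 = c ∧
    ∀ t, ∃ P, X.IsPrimitiveAt (γ t) P ∧ ∀ᶠ s in 𝓝 t, G s - G t = P (γ s) - P (γ t)

/-- The integral of the differential along the path `γ`. -/
def period (X : TranslationStructure S Z κ) {a b : S} (γ : Path a b) : ℂ :=
  Classical.epsilon (X.HasPeriod γ)

/-- An immersed empty disk: a continuous map of the closed disk of centre `c` and radius `r`
that maps the open disk to `S \ Z` by a local isometry for the Euclidean metric. -/
structure IsEmptyDisk (X : TranslationStructure S Z κ) (d : ℂ → S) (c : ℂ) (r : ℝ) : Prop where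
  pos : 0 < r
  continuousOn : ContinuousOn d (Metric.closedBall c r)
  empty : ∀ z ∈ Metric.ball c r, d z ∉ Z
  isometric : ∀ z ∈ Metric.ball c r, ∀ e ∈ X.charts, d z ∈ e.source →
    ∀ᶠ x in 𝓝 (z, z), dist (e (d x.1)) (e (d x.2)) = dist x.1 x.2

end TranslationStructure

/-- Teichmüller equivalence as a setoid. -/
def teichmullerSetoid {S : Type*} [TopologicalSpace S] [ChartedSpace ℂ S] (Z : Set S)
    (κ : Z → ℕ) : Setoid (TranslationStructure S Z κ) :=
  ⟨TranslationStructure.Equivalent, TranslationStructure.equivalent_equivalence⟩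

/-- The Teichmüller stratum of translation surfaces marked by `(S, Z)`. -/
def Stratum {S : Type*} [TopologicalSpace S] [ChartedSpace ℂ S] (Z : Set S) (κ : Z → ℕ) :=
  Quotient (teichmullerSetoid Z κ)

section Strata

variable {S : Type*} [TopologicalSpace S] [ChartedSpace ℂ S] {Z : Set S} {κ : Z → ℕ}

/-- The class of a translation structure in the stratum. -/
def Stratum.mk (X : TranslationStructure S Z κ) : Stratum Z κ :=
  Quotient.mk (teichmullerSetoid Z κ) X

/-- The period of a class along a path with endpoints in `Z`, computed on a representative. -/
def Stratum.period {a b : Z} (γ : Path (a : S) (b : S)) (M : Stratum Z κ) : ℂ :=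
  TranslationStructure.period (Quotient.out M) γ

/-- The weakest topology for which all periods are continuous.  As `S` is path connected, paths
between points of `Z` generate the relative homology `H₁(S, Z; ℤ)`. -/
instance : TopologicalSpace (Stratum Z κ) :=
  ⨅ (a : Z) (b : Z) (γ : Path (a : S) (b : S)),
    TopologicalSpace.induced (Stratum.period γ) (inferInstance : TopologicalSpace ℂ)

/-- Two classes lie in the same orbit of the action of `ℂ*` by rescaling the differential. -/
def Stratum.SameOrbit (M M' : Stratum Z κ) : Prop :=
  ∃ (c : ℂˣ) (X : TranslationStructure S Z κ), M = Stratum.mk X ∧ M' = Stratum.mk (X.scale c)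

end Strata

/-- The projectivized Teichmüller stratum, with the quotient topology. -/
def ProjStratum {S : Type*} [TopologicalSpace S] [ChartedSpace ℂ S] (Z : Set S) (κ : Z → ℕ) :=
  Quot (Stratum.SameOrbit (Z := Z) (κ := κ))

instance {S : Type*} [TopologicalSpace S] [ChartedSpace ℂ S] (Z : Set S) (κ : Z → ℕ) :
    TopologicalSpace (ProjStratum Z κ) :=
  inferInstanceAs (TopologicalSpace (Quot _))

/-- The class of a translation structure in the projectivized stratum. -/
def ProjStratum.mk {S : Type*} [TopologicalSpace S] [ChartedSpace ℂ S] {Z : Set S} {κ : Z → ℕ}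
    (X : TranslationStructure S Z κ) : ProjStratum Z κ :=
  Quot.mk _ (Stratum.mk X)

/-! ### Triangulations -/

/-- The vertices `0, 1, i` of the reference triangle, in counterclockwise order. -/
def corner : Fin 3 → ℂ := ![0, 1, Complex.I]

/-- The closed reference triangle. -/
def refTriangle : Set ℂ := convexHull ℝ (range corner)

/-- The side of the reference triangle from `corner j` to `corner (j + 1)`, parametrized by
`[0, 1]`; these sides follow each other counterclockwise. -/
def side (j : Fin 3) (s : ℝ) : ℂ := AffineMap.lineMap (corner j) (corner (j + 1)) s

/-- A topological triangulation of `(S, Z)` with edge set `E` and face set `F`: the closed faces are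
images of the reference triangle, the half-edge `(f, j)` is side `j` of the face `f`, the two
half-edges of an edge are identified by reversing the parameter, there are no other
identifications except between vertices, and `Z` is the set of vertices.  Several vertices or
edges of one face may coincide in `S`.  The faces are parametrized orientation-preservingly. -/
structure Triangulation (S : Type*) [TopologicalSpace S] [ChartedSpace ℂ S] (Z : Set S)
    (E F : Type*) extends RibbonGraph E F where
  finite_faces : Finite F
  cell : F → ℂ → S
  continuousOn_cell : ∀ f, ContinuousOn (cell f) refTriangle
  covers : ∀ p, ∃ f, ∃ z ∈ refTriangle, cell f z = p
  vertices : ∀ p, p ∈ Z ↔ ∃ f j, cell f (corner j) = p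
  face_inj : ∀ f f', ∀ z ∈ interior refTriangle, ∀ z' ∈ refTriangle,
    cell f z = cell f' z' → f = f' ∧ z = z'
  glue : ∀ h h', h ≠ h' → edge h = edge h' → ∀ s ∈ Icc (0 : ℝ) 1,
    cell h.1 (side h.2 s) = cell h'.1 (side h'.2 (1 - s))
  edge_inj : ∀ h h', ∀ s ∈ Ioo (0 : ℝ) 1, ∀ s' ∈ Icc (0 : ℝ) 1,
    cell h.1 (side h.2 s) = cell h'.1 (side h'.2 s') →
      (h = h' ∧ s' = s) ∨ (h ≠ h' ∧ edge h = edge h' ∧ s' = 1 - s)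
  oriented : ∀ f, ∀ z ∈ interior refTriangle,
    OrientationPreservingAt (chartAt ℂ (cell f z) ∘ cell f) z

namespace Triangulation

variable {S : Type*} [TopologicalSpace S] [ChartedSpace ℂ S] {Z : Set S} {E F : Type*}
  {κ : Z → ℕ}

/-- The face `f` is, in the translation structure `X`, the Euclidean triangle with vertices
`w 0, w 1, w 2`: a primitive `D` of the differential on the face maps the face bijectively to this
triangle, vertices to vertices and sides to sides. -/
structure IsEuclideanFace (τ : Triangulation S Z E F) (X : TranslationStructure S Z κ) (f : F)
    (w : Fin 3 → ℂ) (D : ℂ → ℂ) : Prop where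
  nondegenerate : AffineIndependent ℝ w
  continuousOn : ContinuousOn D refTriangle
  bijOn : BijOn D refTriangle (convexHull ℝ (range w))
  corners : ∀ j, D (corner j) = w j
  sides : ∀ j, D '' (side j '' Icc 0 1) = segment ℝ (w j) (w (j + 1))
  primitive : ∀ z ∈ refTriangle, ∀ e ∈ X.charts, τ.cell f z ∈ e.source →
    ∀ᶠ z' in 𝓝[refTriangle] z, D z' - D z = e (τ.cell f z') - e (τ.cell f z)

/-- `τ` is a geometric triangulation of `X`. -/
def IsGeometric (τ : Triangulation S Z E F) (X : TranslationStructure S Z κ) : Prop :=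
  ∀ f, ∃ w D, τ.IsEuclideanFace X f w D

/-- `τ` is a nondegenerate Delaunay triangulation of `X`: every face is the image of a triangle
inscribed in an immersed empty disk, whose vertices are the only points of the closed disk that
are mapped to `Z`. -/
def IsNondegenerateDelaunay (τ : Triangulation S Z E F) (X : TranslationStructure S Z κ) : Prop :=
  τ.IsGeometric X ∧ ∀ f, ∃ (d : ℂ → S) (c : ℂ) (r : ℝ) (p : Fin 3 → ℂ),
    X.IsEmptyDisk d c r ∧ Function.Injective p ∧
    {z ∈ Metric.closedBall c r | d z ∈ Z} = range p ∧
    d '' convexHull ℝ (range p) = τ.cell f '' refTriangle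

/-- The iso-triangulable region of `τ` in the projectivized stratum. -/
def isoTriangulable (τ : Triangulation S Z E F) (κ : Z → ℕ) : Set (ProjStratum Z κ) :=
  {M | ∃ X : TranslationStructure S Z κ, τ.IsGeometric X ∧ ProjStratum.mk X = M}

/-- The iso-Delaunay region of `τ` in the projectivized stratum. -/
def isoDelaunay (τ : Triangulation S Z E F) (κ : Z → ℕ) : Set (ProjStratum Z κ) :=
  {M | ∃ X : TranslationStructure S Z κ, τ.IsNondegenerateDelaunay X ∧ ProjStratum.mk X = M}

theorem isoDelaunay_subset (τ : Triangulation S Z E F) (κ : Z → ℕ) :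
    τ.isoDelaunay κ ⊆ τ.isoTriangulable κ :=
  fun _ ⟨X, hX, h⟩ => ⟨X, hX.1, h⟩

/-- The angle map: choose a representative of `M` for which `τ` is a geometric triangulation;
the angle `(f; e, e + 1)` between the consecutive sides `e = [w j, w (j + 1)]` and
`e + 1 = [w (j + 1), w (j + 2)]` of the face `f` is the angle of this triangle at `w (j + 1)`. -/
def angleMap (τ : Triangulation S Z E F) (κ : Z → ℕ) (M : τ.isoTriangulable κ) :
    F × Fin 3 → ℝ := fun h =>
  let w : Fin 3 → ℂ := (M.2.choose_spec.1 h.1).choose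
  EuclideanGeometry.angle (w h.2) (w (h.2 + 1)) (w (h.2 + 2))

/-- The restriction of the angle map to the iso-Delaunay region. -/
def delaunayAngleMap (τ : Triangulation S Z E F) (κ : Z → ℕ) (M : τ.isoDelaunay κ) :
    F × Fin 3 → ℝ :=
  τ.angleMap κ ⟨M, τ.isoDelaunay_subset κ M.2⟩

end Triangulation

end

namespace RibbonGraph

variable {E F : Type*}

/-! ### Half-edges -/

theorem shift_fst (n : Fin 3) (h : F × Fin 3) : (shift n h).1 = h.1 := rfl

theorem shift_shift (m n : Fin 3) (h : F × Fin 3) : shift m (shift n h) = shift (n + m) h := by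
  simp [shift, add_assoc]

theorem eq_shift_of_ne {h h' : F × Fin 3} (hf : h.1 = h'.1) (hne : h ≠ h') :
    h' = shift 1 h ∨ h = shift 1 h' := by
  obtain ⟨f, j⟩ := h
  obtain ⟨f', j'⟩ := h'
  obtain rfl : f = f' := hf
  have : j ≠ j' := fun h => hne (by rw [h])
  simp only [shift, Prod.mk.injEq, true_and]
  clear hne
  revert j j'; decide

theorem ne_shift_one_shift_one (h : F × Fin 3) : h ≠ shift 1 (shift 1 h) := by
  obtain ⟨f, j⟩ := h
  simp only [shift, ne_eq, Prod.mk.injEq, true_and]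
  revert j; decide

section Partner

variable (Γ : RibbonGraph E F)

theorem exists_partner (h : F × Fin 3) : ∃ h', h' ≠ h ∧ Γ.edge h' = Γ.edge h ∧
    ∀ h'', Γ.edge h'' = Γ.edge h → h'' = h ∨ h'' = h' := by
  obtain ⟨a, b, hab, hu⟩ := Nat.card_eq_two_iff.1 (Γ.valence_two (Γ.edge h))
  have key : ∀ x : {x // Γ.edge x = Γ.edge h}, x = a ∨ x = b := fun x => by
    have : x ∈ ({a, b} : Set _) := hu ▸ mem_univ x
    simpa using this
  rcases key ⟨h, rfl⟩ with h1 | h1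
  · refine ⟨b, fun hb => hab ?_, b.2, fun h'' h2 => ?_⟩
    · rw [← h1]; exact Subtype.ext hb.symm
    · rcases key ⟨h'', h2⟩ with h3 | h3
      · left; rw [← h1] at h3; exact congrArg Subtype.val h3
      · right; exact congrArg Subtype.val h3
  · refine ⟨a, fun hb => hab ?_, a.2, fun h'' h2 => ?_⟩
    · rw [← h1]; exact Subtype.ext hb
    · rcases key ⟨h'', h2⟩ with h3 | h3
      · right; exact congrArg Subtype.val h3
      · left; rw [← h1] at h3; exact congrArg Subtype.val h3

/-- The other half-edge with the same endpoint in `E`. -/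
noncomputable def partner (h : F × Fin 3) : F × Fin 3 := (Γ.exists_partner h).choose

theorem partner_ne (h : F × Fin 3) : Γ.partner h ≠ h := (Γ.exists_partner h).choose_spec.1

theorem edge_partner (h : F × Fin 3) : Γ.edge (Γ.partner h) = Γ.edge h :=
  (Γ.exists_partner h).choose_spec.2.1

theorem eq_partner {h h' : F × Fin 3} (hne : h ≠ h') (he : Γ.edge h = Γ.edge h') :
    h' = Γ.partner h :=
  ((Γ.exists_partner h).choose_spec.2.2 h' he.symm).resolve_left hne.symm

theorem partner_partner (h : F × Fin 3) : Γ.partner (Γ.partner h) = h :=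
  (Γ.eq_partner (Γ.partner_ne h) (Γ.edge_partner h)).symm

theorem exists_edge_eq (e : E) : ∃ h, Γ.edge h = e := by
  obtain ⟨a, -⟩ := Nat.card_eq_two_iff.1 (Γ.valence_two e)
  exact ⟨a, a.2⟩

/-- Complex 1-cycles of the graph: systems of side vectors such that the sides of every face sum to
zero and opposite sides of an edge carry opposite vectors. -/
noncomputable def cycleSpace : Submodule ℂ (F × Fin 3 → ℂ) where
  carrier := {v | (∀ f, ∑ j, v (f, j) = 0) ∧ ∀ h, v (Γ.partner h) = -v h}
  zero_mem' := by simp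
  add_mem' := by
    rintro v w ⟨hv, hv'⟩ ⟨hw, hw'⟩
    refine ⟨fun f => ?_, fun h => ?_⟩
    · simp only [Pi.add_apply, Finset.sum_add_distrib, hv, hw, add_zero]
    · simp only [Pi.add_apply, hv', hw']; ring
  smul_mem' := by
    rintro c v ⟨hv, hv'⟩
    refine ⟨fun f => ?_, fun h => ?_⟩
    · simp only [Pi.smul_apply, ← Finset.smul_sum, hv, smul_zero]
    · simp only [Pi.smul_apply, hv', smul_neg]

theorem boundary_single (h : F × Fin 3) (n : ℤ) :
    Γ.boundary (Finsupp.single h n) =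
      Finsupp.single (Sum.inl (Γ.edge h)) n - Finsupp.single (Sum.inr h.1) n := by
  simp [boundary, Finsupp.mapDomain_single]

theorem mem_homology [Finite F] {α : F × Fin 3 →₀ ℤ} (h1 : ∀ f, ∑ j, α (f, j) = 0)
    (h2 : ∀ h, α (Γ.partner h) = -α h) : α ∈ Γ.homology := by
  classical
  have := Fintype.ofFinite F
  rw [homology, LinearMap.mem_ker]
  have hα : α = ∑ h, Finsupp.single h (α h) := by
    rw [Finsupp.univ_sum_single]
  rw [hα, map_sum]
  ext x
  simp only [boundary_single, Finsupp.coe_finsetSum, Finset.sum_apply, Finsupp.coe_sub,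
    Pi.sub_apply, Finsupp.coe_zero, Pi.zero_apply]
  rcases x with e | f
  · obtain ⟨h, rfl⟩ := Γ.exists_edge_eq e
    have : ∀ x : F × Fin 3, (Finsupp.single (Sum.inl (Γ.edge x)) (α x) : E ⊕ F →₀ ℤ)
        (Sum.inl (Γ.edge h)) - (Finsupp.single (Sum.inr x.1) (α x) : E ⊕ F →₀ ℤ)
        (Sum.inl (Γ.edge h)) = if x = h ∨ x = Γ.partner h then α x else 0 := by
      intro x
      have hx : Γ.edge x = Γ.edge h ↔ x = h ∨ x = Γ.partner h := by
        refine ⟨fun hx => (Γ.exists_partner h).choose_spec.2.2 x hx, ?_⟩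
        rintro (rfl | rfl)
        · rfl
        · exact Γ.edge_partner h
      simp [Finsupp.single_apply, hx]
    simp only [this]
    rw [← Finset.sum_filter]
    have hs : (Finset.univ.filter fun x => x = h ∨ x = Γ.partner h) = {h, Γ.partner h} := by
      ext x; simp
    rw [hs, Finset.sum_pair (Γ.partner_ne h).symm, h2, add_neg_cancel]
  · rw [Fintype.sum_prod_type]
    have : ∀ g : F, ∀ j : Fin 3, (Finsupp.single (Sum.inl (Γ.edge (g, j))) (α (g, j)) :
        E ⊕ F →₀ ℤ) (Sum.inr f) - (Finsupp.single (Sum.inr (g, j).1) (α (g, j)) : E ⊕ F →₀ ℤ)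
        (Sum.inr f) = if g = f then -α (g, j) else 0 := by
      intro g j
      by_cases hg : g = f <;> simp [hg]
    simp only [this]
    rw [Finset.sum_eq_single f]
    · simp [h1]
    · intro g _ hg; simp [hg]
    · simp

end Partner

/-! ### Triangle matchings -/

namespace IsTriangleMatching

variable {Γ : RibbonGraph E F} {ι : Equiv.Perm (F × Fin 3)}

theorem fst_eq (hι : Γ.IsTriangleMatching ι) {h h' : F × Fin 3} (hh : h.1 = h'.1) : (ι h).1 = (ι h').1 := by
  have : h' = shift (h'.2 - h.2) h := by
    ext1
    · exact hh.symm
    · simp [shift]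
  rw [this, hι.commutes, shift_fst]

theorem apply_eq_neg [Finite F] (hι : Γ.IsTriangleMatching ι) {v : F × Fin 3 → ℂ}
    (hv : v ∈ Γ.cycleSpace) (h : F × Fin 3) : v (ι h) = -v h := by
  classical
  have := Fintype.ofFinite F
  let M := Submodule.span ℤ (range v)
  have hfin : Module.Finite ℤ M := Module.Finite.span_of_finite ℤ (finite_range v)
  let b := Module.Free.chooseBasis ℤ M
  have hb : ∀ x : M, (∀ i, b.coord i x = 0) → x = 0 := fun x hx => b.forall_coord_eq_zero_iff.1 hx
  let w : F × Fin 3 → M := fun h => ⟨v h, Submodule.subset_span (mem_range_self h)⟩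
  have hw1 : ∀ f, ∑ j, w (f, j) = 0 := fun f => by
    apply Subtype.ext
    simpa [w] using hv.1 f
  have hw2 : ∀ h, w (Γ.partner h) = -w h := fun h => Subtype.ext (hv.2 h)
  suffices w (ι h) + w h = 0 by
    have := congrArg Subtype.val this
    simp only [w, Submodule.coe_add, ZeroMemClass.coe_zero] at this
    linear_combination this
  refine hb _ fun i => ?_
  let α : F × Fin 3 →₀ ℤ := Finsupp.equivFunOnFinite.symm fun h => b.coord i (w h)
  have hα : α ∈ Γ.homology := by
    refine Γ.mem_homology (fun f => ?_) (fun h => ?_)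
    · simp only [α, Finsupp.coe_equivFunOnFinite_symm, ← map_sum, hw1, map_zero]
    · simp only [α, Finsupp.coe_equivFunOnFinite_symm, hw2, map_neg]
  have := DFunLike.congr_fun (hι.neg_homology α hα) (ι h)
  rw [Finsupp.mapDomain_apply ι.injective] at this
  simp only [α, Finsupp.coe_equivFunOnFinite_symm, Finsupp.coe_neg, Pi.neg_apply] at this
  rw [map_add]; omega

end IsTriangleMatching

namespace SimpleCycle

variable {Γ : RibbonGraph E F} (α : Γ.SimpleCycle)

/-- The homology class of a simple cycle. -/
noncomputable def chain : F × Fin 3 →₀ ℤ :=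
  ∑ j, (Finsupp.single (α.exit j) 1 - Finsupp.single (α.enter j) 1)

theorem chain_mem : α.chain ∈ Γ.homology := by
  rw [homology, LinearMap.mem_ker, chain, map_sum]
  simp only [map_sub, boundary_single, α.face_eq, sub_sub_sub_cancel_right, α.edge_eq]
  rw [Finset.sum_sub_distrib, sub_eq_zero]
  exact Equiv.sum_comp (Equiv.addRight (1 : Fin (α.n + 1)))
    (fun j => (Finsupp.single (Sum.inl (Γ.edge (α.enter j))) 1 : E ⊕ F →₀ ℤ))

theorem exit_inj {i j} (h : (α.exit i).1 = (α.exit j).1) : i = j := α.face_injective h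

theorem enter_ne_exit (i j) : α.enter i ≠ α.exit j := fun h => by
  have : i = j := α.exit_inj (by rw [← α.face_eq, h])
  subst this
  exact α.ne i h

theorem chain_apply [DecidableEq (F × Fin 3)] (h : F × Fin 3) : α.chain h =
    ∑ j, ((if α.exit j = h then 1 else 0) - (if α.enter j = h then 1 else 0)) := by
  simp [chain, Finsupp.single_apply]

theorem chain_exit (i) : α.chain (α.exit i) = 1 := by
  classical
  rw [chain_apply, Finset.sum_eq_single i]
  · simp [α.ne i]
  · intro j _ hj
    rw [if_neg, if_neg (α.enter_ne_exit j i), sub_zero]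
    exact fun h => hj (α.exit_inj (congrArg Prod.fst h))
  · simp

theorem chain_enter (i) : α.chain (α.enter i) = -1 := by
  classical
  rw [chain_apply, Finset.sum_eq_single i]
  · simp [(α.ne i).symm]
  · intro j _ hj
    rw [if_neg (α.enter_ne_exit i j).symm, if_neg, sub_zero]
    exact fun h => hj (α.exit_inj (by rw [← α.face_eq, h, α.face_eq]))
  · simp

theorem exists_enter_of_chain_neg {h} (hh : α.chain h = -1) : ∃ k, h = α.enter k := by
  classical
  by_contra! hne
  rw [chain_apply] at hh
  have : ∀ j, α.enter j ≠ h := fun j => (hne j).symm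
  simp only [this, if_false, sub_zero] at hh
  have h0 : (0 : ℤ) ≤ ∑ j, (if α.exit j = h then 1 else 0) :=
    Finset.sum_nonneg fun j _ => by split_ifs <;> norm_num
  omega

theorem exists_exit_of_chain_pos {h} (hh : α.chain h = 1) : ∃ k, h = α.exit k := by
  classical
  by_contra! hne
  rw [chain_apply] at hh
  have : ∀ j, α.exit j ≠ h := fun j => (hne j).symm
  simp only [this, if_false, zero_sub] at hh
  have h0 : ∑ j, (-(if α.enter j = h then 1 else 0) : ℤ) ≤ 0 :=
    Finset.sum_nonpos fun j _ => by split_ifs <;> norm_num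
  omega

/-- A triangle matching reverses the passages of a simple cycle. -/
theorem exists_reversed {ι : Equiv.Perm (F × Fin 3)} (hι : Γ.IsTriangleMatching ι) (j) :
    ∃ k, ι (α.exit j) = α.enter k ∧ ι (α.enter j) = α.exit k := by
  have hneg := hι.neg_homology _ α.chain_mem
  have h1 : ∀ h, α.chain (ι h) = -α.chain h := fun h => by
    have := DFunLike.congr_fun hneg (ι h)
    rw [Finsupp.mapDomain_apply ι.injective] at this
    simp only [Finsupp.coe_neg, Pi.neg_apply] at this
    omega
  obtain ⟨k, hk⟩ := α.exists_enter_of_chain_neg (h := ι (α.exit j)) (by rw [h1, chain_exit])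
  obtain ⟨k', hk'⟩ := α.exists_exit_of_chain_pos (h := ι (α.enter j))
    (by rw [h1, chain_enter, neg_neg])
  have := hι.fst_eq (α.face_eq j)
  rw [hk, hk', α.face_eq] at this
  obtain rfl := α.exit_inj this
  exact ⟨_, hk, hk'⟩

end SimpleCycle

theorem IsTriangleMatching.partner_fst_ne {Γ : RibbonGraph E F} {ι : Equiv.Perm (F × Fin 3)}
    (hι : Γ.IsTriangleMatching ι) (h : F × Fin 3) : (Γ.partner h).1 ≠ h.1 := by
  intro hf
  let α : Γ.SimpleCycle :=
    { n := 0
      enter := fun _ => Γ.partner h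
      exit := fun _ => h
      face_eq := fun _ => hf
      ne := fun _ => Γ.partner_ne h
      edge_eq := fun _ => (Γ.edge_partner h).symm
      face_injective := fun _ _ _ => Subsingleton.elim (α := Fin 1) _ _
      edge_injective := fun _ _ _ => Subsingleton.elim (α := Fin 1) _ _ }
  obtain ⟨k, h1, h2⟩ := α.exists_reversed hι 0
  change ι h = Γ.partner h at h1
  change ι (Γ.partner h) = h at h2
  rcases eq_shift_of_ne hf (Γ.partner_ne h) with h3 | h3
  · have h4 : ι h = shift 1 h := by
      conv_lhs => rw [h3, hι.commutes, h2]
    rw [h1] at h4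
    rw [h4] at h3
    exact ne_shift_one_shift_one h h3
  · have h4 : ι (Γ.partner h) = shift 1 (Γ.partner h) := by
      conv_lhs => rw [h3, hι.commutes, h1]
    rw [h2] at h4
    exact ne_shift_one_shift_one _ (h3.trans (congrArg (shift 1) h4))

theorem contribution_swap (θ : F × Fin 3 → ℝ) {h h' : F × Fin 3} (hf : h.1 = h'.1) (hne : h ≠ h') :
    contribution θ h' h = (contribution θ h h')⁻¹ := by
  rcases eq_shift_of_ne hf hne with h1 | h1
  · have : h ≠ shift 1 h' := h1 ▸ ne_shift_one_shift_one h
    simp [contribution, h1, ne_shift_one_shift_one h]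
  · have : h' ≠ shift 1 h := h1 ▸ ne_shift_one_shift_one h'
    simp [contribution, h1, ne_shift_one_shift_one h']

theorem IsTriangleMatching.contribution_apply {Γ : RibbonGraph E F} {ι : Equiv.Perm (F × Fin 3)}
    (hι : Γ.IsTriangleMatching ι) {θ : F × Fin 3 → ℝ} (hθ : ∀ h, θ (ι h) = θ h)
    (h h' : F × Fin 3) : contribution θ (ι h) (ι h') = contribution θ h h' := by
  have h1 : ι h' = shift 1 (ι h) ↔ h' = shift 1 h := by
    rw [← hι.commutes, ι.injective.eq_iff]
  unfold contribution
  by_cases h2 : h' = shift 1 h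
  · rw [if_pos h2, if_pos (h1.2 h2)]
    simp only [dilation, rotation, ← hι.commutes, hθ]
  · rw [if_neg h2, if_neg (mt h1.1 h2)]
    simp only [dilation, rotation, ← hι.commutes, hθ]

theorem contribution_ne_zero {θ : F × Fin 3 → ℝ} (hθ : θ ∈ angleSpace F) (h h' : F × Fin 3) :
    contribution θ h h' ≠ 0 := by
  have hs : ∀ h, (Real.sin (θ h) : ℂ) ≠ 0 := fun h => by
    exact_mod_cast (Real.sin_pos_of_mem_Ioo (hθ.1 h)).ne'
  unfold contribution dilation rotation
  split_ifs
  · rw [Complex.ofReal_div]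
    exact mul_ne_zero (div_ne_zero (hs _) (hs _)) (Complex.exp_ne_zero _)
  · rw [Complex.ofReal_div]
    exact inv_ne_zero (mul_ne_zero (div_ne_zero (hs _) (hs _)) (Complex.exp_ne_zero _))

theorem invariantAngles_subset_trivialHolonomy {Γ : RibbonGraph E F} {ι : Equiv.Perm (F × Fin 3)}
    (hι : Γ.IsTriangleMatching ι) : invariantAngles ι ⊆ Γ.trivialHolonomy := by
  classical
  rintro θ ⟨hθ, hinv⟩
  refine ⟨hθ, fun α => ?_⟩
  choose σ hσ1 hσ2 using α.exists_reversed hι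
  have hc : ∀ j, contribution θ (α.enter (σ j)) (α.exit (σ j)) =
      (contribution θ (α.enter j) (α.exit j))⁻¹ := fun j => by
    rw [← hσ1, ← hσ2, hι.contribution_apply hinv, contribution_swap θ (α.face_eq j) (α.ne j)]
  have hinj : Function.Injective σ := fun i j hij => by
    have : ι (α.exit i) = ι (α.exit j) := by rw [hσ1, hσ1, hij]
    exact α.exit_inj (congrArg Prod.fst (ι.injective this))
  let left : Fin (α.n + 1) → Prop := fun j => α.exit j = shift 1 (α.enter j)
  have hl : ∀ j, left (σ j) ↔ ¬ left j := fun j => by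
    simp only [left, ← hσ1, ← hσ2, ← hι.commutes, ι.injective.eq_iff]
    rcases eq_shift_of_ne (α.face_eq j) (α.ne j) with h1 | h1
    · simp only [h1, not_true_eq_false, iff_false]
      exact ne_shift_one_shift_one _
    · have : α.exit j ≠ shift 1 (α.enter j) := by
        rw [h1]; exact ne_shift_one_shift_one _
      simp [← h1, this]
  rw [SimpleCycle.holonomy, ← Finset.prod_filter_mul_prod_filter_not Finset.univ left]
  have hcard : ∏ j ∈ Finset.univ.filter (fun j => ¬ left j),
      contribution θ (α.enter j) (α.exit j) =
      ∏ j ∈ Finset.univ.filter left, (contribution θ (α.enter j) (α.exit j))⁻¹ := by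
    symm
    refine Finset.prod_bij (fun j _ => σ j) (fun j hj => ?_) (fun i _ j _ h => hinj h)
      (fun k hk => ?_) (fun j _ => (hc j).symm)
    · simp only [Finset.mem_filter, Finset.mem_univ, true_and] at hj ⊢
      rw [hl]; simpa using hj
    · obtain ⟨j, rfl⟩ := (Finite.injective_iff_surjective.1 hinj) k
      refine ⟨j, ?_, rfl⟩
      simp only [Finset.mem_filter, Finset.mem_univ, true_and] at hk ⊢
      by_contra h
      exact hk ((hl j).2 h)
  rw [hcard, ← Finset.prod_mul_distrib]
  refine Finset.prod_eq_one fun j _ => mul_inv_cancel₀ (contribution_ne_zero hθ _ _)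

end RibbonGraph

/-- The oriented area of the parallelogram spanned by two complex numbers. -/
def cross (a b : ℂ) : ℝ := a.re * b.im - a.im * b.re

theorem cross_mul_left (c a b : ℂ) : cross (c * a) (c * b) = Complex.normSq c * cross a b := by
  simp only [cross, Complex.mul_re, Complex.mul_im, Complex.normSq_apply]; ring

theorem cross_ne_zero_left {a b : ℂ} (h : 0 < cross a b) : a ≠ 0 := by
  rintro rfl; simp [cross] at h

theorem neg_div_im (a b : ℂ) : (-a / b).im = cross a b / Complex.normSq b := by
  simp only [cross, Complex.div_im, Complex.neg_im, Complex.neg_re]; ring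

namespace RibbonGraph

variable {E F : Type*}

/-- The triangle spanned by the side vectors of every face is positively oriented. -/
def IsPositive (v : F × Fin 3 → ℂ) : Prop := ∀ h, 0 < cross (v h) (v (shift 1 h))

/-- The angle between the sides `h` and `shift 1 h` of a triangle with side vectors `v`. -/
noncomputable def angleOf (v : F × Fin 3 → ℂ) (h : F × Fin 3) : ℝ :=
  InnerProductGeometry.angle (-v h) (v (shift 1 h))

theorem IsPositive.ne_zero {v : F × Fin 3 → ℂ} (hv : IsPositive v) (h : F × Fin 3) : v h ≠ 0 :=
  cross_ne_zero_left (hv h)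

theorem angleOf_mem {v : F × Fin 3 → ℂ} (hv : IsPositive v) (h : F × Fin 3) :
    angleOf v h ∈ Ioo 0 Real.pi ∧ angleOf v h = Complex.arg (-v h / v (shift 1 h)) := by
  have him : 0 < (-v h / v (shift 1 h)).im := by
    rw [neg_div_im]
    exact div_pos (hv h) (Complex.normSq_pos.2 (hv.ne_zero _))
  have h0 : 0 < Complex.arg (-v h / v (shift 1 h)) :=
    lt_of_le_of_ne (Complex.arg_nonneg_iff.2 him.le) fun h0 => by
      have := Complex.arg_eq_zero_iff.1 h0.symm
      exact him.ne' this.2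
  have hpi : Complex.arg (-v h / v (shift 1 h)) < Real.pi := Complex.arg_lt_pi_iff.2 (Or.inr him.ne')
  have : angleOf v h = Complex.arg (-v h / v (shift 1 h)) := by
    rw [angleOf, Complex.angle_eq_abs_arg (neg_ne_zero.2 (hv.ne_zero h)) (hv.ne_zero _),
      abs_of_pos h0]
  exact ⟨by rw [this]; exact ⟨h0, hpi⟩, this⟩

theorem angleOf_mem_angleSpace {v : F × Fin 3 → ℂ} (hv : IsPositive v)
    (hs : ∀ f, ∑ j, v (f, j) = 0) : angleOf v ∈ angleSpace F := by
  refine ⟨fun h => (angleOf_mem hv h).1, fun f => ?_⟩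
  have h0 := hs f
  rw [Fin.sum_univ_three] at h0 ⊢
  have key := EuclideanGeometry.angle_add_angle_add_angle_eq_pi (p₁ := (0 : ℂ)) (p₂ := v (f, 0))
    (v (f, 0) + v (f, 1)) (hv.ne_zero _)
  simp only [EuclideanGeometry.angle, vsub_eq_sub, zero_sub, sub_zero, add_sub_cancel_left,
    sub_add_cancel_left] at key
  have h2 : v (f, 0) + v (f, 1) = -v (f, 2) := by linear_combination h0
  simp only [angleOf, shift, Fin.reduceAdd, Fin.isValue, zero_add]
  rw [h2] at key
  simp only [neg_neg] at key
  have e2 : InnerProductGeometry.angle (-v (f, 1)) (v (f, 2)) =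
    InnerProductGeometry.angle (v (f, 2)) (-v (f, 1)) := InnerProductGeometry.angle_comm _ _
  linarith

theorem neg_div_eq {v : F × Fin 3 → ℂ} (hv : IsPositive v) (h : F × Fin 3) :
    ∃ r : ℝ, 0 < r ∧ -v h = r * Complex.exp (angleOf v h * Complex.I) * v (shift 1 h) := by
  refine ⟨‖-v h / v (shift 1 h)‖, norm_pos_iff.2
    (div_ne_zero (neg_ne_zero.2 (hv.ne_zero _)) (hv.ne_zero _)), ?_⟩
  rw [(angleOf_mem hv h).2, Complex.norm_mul_exp_arg_mul_I, div_mul_cancel₀ _ (hv.ne_zero _)]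

/-- Positively oriented triangles with the same angles are similar. -/
theorem exists_scale_of_angleOf_eq {v w : F × Fin 3 → ℂ} (hv : IsPositive v) (hw : IsPositive w)
    (hvs : ∀ f, ∑ j, v (f, j) = 0) (hws : ∀ f, ∑ j, w (f, j) = 0) (f : F)
    (h : ∀ j, angleOf v (f, j) = angleOf w (f, j)) : ∃ c : ℂ, c ≠ 0 ∧ ∀ j, w (f, j) = c * v (f, j) := by
  have key : ∀ {u : F × Fin 3 → ℂ}, IsPositive u → (∀ f, ∑ j, u (f, j) = 0) → ∃ a b : ℝ,
      u (f, 1) = -(a * Complex.exp (-(angleOf u (f, 0)) * Complex.I)) * u (f, 0) ∧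
      u (f, 2) = -(b * Complex.exp ((angleOf u (f, 2)) * Complex.I)) * u (f, 0) ∧
      a * Real.sin (angleOf u (f, 0)) = b * Real.sin (angleOf u (f, 2)) ∧
      a * Real.cos (angleOf u (f, 0)) + b * Real.cos (angleOf u (f, 2)) = 1 := by
    intro u hu hus
    obtain ⟨r, hr, h1⟩ := neg_div_eq hu (f, 0)
    obtain ⟨s, hs, h2⟩ := neg_div_eq hu (f, 2)
    simp only [shift, Fin.reduceAdd, Fin.isValue, zero_add] at h1 h2
    have hr' : (r : ℂ) ≠ 0 := by exact_mod_cast hr.ne'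
    have e1 : u (f, 1) = -((r⁻¹ : ℝ) * Complex.exp (-(angleOf u (f, 0)) * Complex.I)) * u (f, 0) := by
      have : u (f, 0) = -(r * Complex.exp (angleOf u (f, 0) * Complex.I) * u (f, 1)) := by
        rw [← h1, neg_neg]
      conv_rhs => rw [this]
      rw [neg_mul (angleOf u (f, 0) : ℂ) Complex.I, Complex.exp_neg, Complex.ofReal_inv]
      have := Complex.exp_ne_zero (angleOf u (f, 0) * Complex.I)
      field_simp
    have e2 : u (f, 2) = -(s * Complex.exp ((angleOf u (f, 2)) * Complex.I)) * u (f, 0) := by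
      linear_combination -h2
    refine ⟨r⁻¹, s, e1, e2, ?_⟩
    have h0 := hus f
    rw [Fin.sum_univ_three, e1, e2] at h0
    have h3 : (1 : ℂ) - (r⁻¹ : ℝ) * Complex.exp (-(angleOf u (f, 0)) * Complex.I) -
        s * Complex.exp ((angleOf u (f, 2)) * Complex.I) = 0 := by
      have := hu.ne_zero (f, 0)
      apply mul_right_cancel₀ this
      linear_combination h0
    rw [Complex.exp_mul_I, ← Complex.ofReal_neg, Complex.exp_mul_I, ← Complex.ofReal_cos,
      ← Complex.ofReal_sin, ← Complex.ofReal_cos, ← Complex.ofReal_sin] at h3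
    have hre := congrArg Complex.re h3
    have him := congrArg Complex.im h3
    simp [-Complex.ofReal_sin, -Complex.ofReal_cos] at hre him
    constructor
    · linarith
    · linarith
  obtain ⟨a, b, ha1, ha2, ha3, ha4⟩ := key hv hvs
  obtain ⟨a', b', hb1, hb2, hb3, hb4⟩ := key hw hws
  rw [← h 0] at hb1
  rw [← h 2] at hb2
  rw [← h 0, ← h 2] at hb3 hb4
  have hsin : 0 < Real.sin (angleOf v (f, 0) + angleOf v (f, 2)) := by
    have h1 := (angleOf_mem_angleSpace hv hvs).2 f
    rw [Fin.sum_univ_three] at h1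
    have h2 := (angleOf_mem hv (f, 1)).1
    have h3 := (angleOf_mem hv (f, 0)).1
    have h4 := (angleOf_mem hv (f, 2)).1
    apply Real.sin_pos_of_mem_Ioo
    constructor
    · linarith [h3.1, h4.1]
    · linarith [h2.1]
  rw [Real.sin_add] at hsin
  set s0 := Real.sin (angleOf v (f, 0))
  set c0 := Real.cos (angleOf v (f, 0))
  set s2 := Real.sin (angleOf v (f, 2))
  set c2 := Real.cos (angleOf v (f, 2))
  have hs2 : 0 < s2 := Real.sin_pos_of_mem_Ioo (angleOf_mem hv (f, 2)).1
  have haa : a = a' := by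
    have : (a - a') * (s0 * c2 + c0 * s2) = 0 := by
      linear_combination c2 * ha3 + s2 * ha4 - c2 * hb3 - s2 * hb4
    have := (mul_eq_zero.1 this).resolve_right hsin.ne'
    linarith
  have hbb : b = b' := by
    have : b * s2 = b' * s2 := by rw [← ha3, ← hb3, haa]
    exact mul_right_cancel₀ hs2.ne' this
  subst haa hbb
  have hv0 := hv.ne_zero (f, 0)
  have hw0 := hw.ne_zero (f, 0)
  have e0 : w (f, 0) = w (f, 0) / v (f, 0) * v (f, 0) := by field_simp
  refine ⟨w (f, 0) / v (f, 0), div_ne_zero hw0 hv0, fun j => ?_⟩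
  fin_cases j
  · exact e0
  · change w (f, 1) = w (f, 0) / v (f, 0) * v (f, 1)
    rw [hb1, ha1]; field_simp
  · change w (f, 2) = w (f, 0) / v (f, 0) * v (f, 2)
    rw [hb2, ha2]; field_simp

/-- A triangle with angles `θ` in every face. -/
noncomputable def modelTriangle (θ : F × Fin 3 → ℝ) (h : F × Fin 3) : ℂ :=
  ![(Real.sin (θ (h.1, 1)) : ℂ), -(Real.sin (θ (h.1, 2)) * Complex.exp (-(θ (h.1, 0) * Complex.I))),
    Real.sin (θ (h.1, 0)) * Complex.exp (-((θ (h.1, 0) + θ (h.1, 1)) * Complex.I))] h.2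

theorem continuous_modelTriangle (h : F × Fin 3) :
    Continuous fun θ : F × Fin 3 → ℝ => modelTriangle θ h := by
  obtain ⟨f, j⟩ := h
  unfold modelTriangle
  fin_cases j <;> simp <;> fun_prop

section Model

variable {θ : F × Fin 3 → ℝ}

theorem modelTriangle_ratio (hθ : θ ∈ angleSpace F) (h : F × Fin 3) :
    -modelTriangle θ h = dilation θ h * rotation θ h * modelTriangle θ (shift 1 h) := by
  obtain ⟨f, j⟩ := h
  have hs : ∀ h, (Real.sin (θ h) : ℂ) ≠ 0 := fun h => by
    exact_mod_cast (Real.sin_pos_of_mem_Ioo (hθ.1 h)).ne'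
  have hsum := hθ.2 f
  rw [Fin.sum_univ_three] at hsum
  have hsum' : (θ (f, 0) + θ (f, 1) + θ (f, 2) : ℂ) = Real.pi := by exact_mod_cast hsum
  have e0 := Complex.exp_ne_zero (θ (f, 0) * Complex.I)
  have e1 := Complex.exp_ne_zero (θ (f, 1) * Complex.I)
  have h0 := hs (f, 0)
  have h1 := hs (f, 1)
  have h2 := hs (f, 2)
  have e2 : Complex.exp (θ (f, 2) * Complex.I) = - (Complex.exp (θ (f, 0) * Complex.I))⁻¹ *
      (Complex.exp (θ (f, 1) * Complex.I))⁻¹ := by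
    have : (θ (f, 2) : ℂ) * Complex.I = Real.pi * Complex.I + (-(θ (f, 0) * Complex.I) +
      -(θ (f, 1) * Complex.I)) := by rw [← hsum']; ring
    rw [this, Complex.exp_add, Complex.exp_pi_mul_I, Complex.exp_add, Complex.exp_neg,
      Complex.exp_neg]; ring
  unfold dilation rotation modelTriangle
  rw [Complex.ofReal_div]
  fin_cases j
  all_goals
    simp [shift, -Complex.ofReal_sin, add_mul, Complex.exp_add, Complex.exp_neg,
      mul_comm Complex.I, e2]
  · rw [show (-1 : Fin 3) = 2 from rfl]; field_simp
  · field_simp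
  · rw [show (2 + -1 : Fin 3) = 1 from rfl]; field_simp

theorem modelTriangle_ne_zero (hθ : θ ∈ angleSpace F) (h : F × Fin 3) : modelTriangle θ h ≠ 0 := by
  obtain ⟨f, j⟩ := h
  have hs : ∀ h, (Real.sin (θ h) : ℂ) ≠ 0 := fun h => by
    exact_mod_cast (Real.sin_pos_of_mem_Ioo (hθ.1 h)).ne'
  unfold modelTriangle
  fin_cases j
  all_goals simp [-Complex.ofReal_sin, hs, Complex.exp_ne_zero]

theorem modelTriangle_sum (hθ : θ ∈ angleSpace F) (f : F) : ∑ j, modelTriangle θ (f, j) = 0 := by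
  have hsum := hθ.2 f
  rw [Fin.sum_univ_three] at hsum
  have h2 : θ (f, 2) = Real.pi - (θ (f, 0) + θ (f, 1)) := by linarith
  rw [Fin.sum_univ_three]
  simp only [modelTriangle, Matrix.cons_val_zero, Matrix.cons_val_one, Matrix.cons_val, h2,
    Real.sin_pi_sub, add_mul, neg_add, Complex.exp_add]
  simp only [← neg_mul ((θ _ : ℝ) : ℂ), Complex.exp_mul_I, Real.sin_add]
  push_cast
  simp only [Complex.cos_neg, Complex.sin_neg]
  have a := Complex.sin_sq_add_cos_sq (θ (f, 0))
  have I2 := Complex.I_sq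
  linear_combination (-Complex.sin (θ (f, 1))) * a + (Complex.sin (θ (f, 0)) ^ 2 *
    Complex.sin (θ (f, 1))) * I2

theorem ratio_eq (hθ : θ ∈ angleSpace F) (h : F × Fin 3) :
    -modelTriangle θ h / modelTriangle θ (shift 1 h) =
      dilation θ h * Complex.exp (θ h * Complex.I) := by
  rw [modelTriangle_ratio hθ, mul_div_cancel_right₀ _ (modelTriangle_ne_zero hθ _), rotation,
    mul_comm Complex.I]

theorem dilation_pos (hθ : θ ∈ angleSpace F) (h : F × Fin 3) : 0 < dilation θ h :=
  div_pos (Real.sin_pos_of_mem_Ioo (hθ.1 _)) (Real.sin_pos_of_mem_Ioo (hθ.1 _))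

theorem modelTriangle_positive (hθ : θ ∈ angleSpace F) : IsPositive (modelTriangle θ) := by
  intro h
  have h1 := neg_div_im (modelTriangle θ h) (modelTriangle θ (shift 1 h))
  have h2 := Complex.normSq_pos.2 (modelTriangle_ne_zero hθ (shift 1 h))
  rw [ratio_eq hθ, Complex.exp_mul_I, ← Complex.ofReal_cos, ← Complex.ofReal_sin] at h1
  simp only [Complex.mul_im, Complex.ofReal_re, Complex.add_im, Complex.ofReal_im,
    Complex.I_im, mul_one, Complex.I_re, mul_zero, add_zero, zero_add, zero_mul] at h1
  have h3 := mul_pos (dilation_pos hθ h) (Real.sin_pos_of_mem_Ioo (hθ.1 h))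
  rw [h1] at h3
  exact (div_pos_iff_of_pos_right h2).1 h3

theorem angleOf_modelTriangle (hθ : θ ∈ angleSpace F) : angleOf (modelTriangle θ) = θ := by
  ext h
  rw [(angleOf_mem (modelTriangle_positive hθ) h).2, ratio_eq hθ,
    Complex.arg_real_mul _ (dilation_pos hθ h), Complex.arg_exp_mul_I]
  rw [toIocMod_eq_self]
  exact ⟨by linarith [(hθ.1 h).1, Real.pi_pos], by linarith [(hθ.1 h).2]⟩

theorem contribution_eq (hθ : θ ∈ angleSpace F) {h h' : F × Fin 3} (hf : h.1 = h'.1)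
    (hne : h ≠ h') : contribution θ h h' = -modelTriangle θ h / modelTriangle θ h' := by
  have h0 := modelTriangle_ne_zero hθ
  have aux : ∀ h, contribution θ h (shift 1 h) =
      -modelTriangle θ h / modelTriangle θ (shift 1 h) := fun h => by
    rw [contribution, if_pos rfl, modelTriangle_ratio hθ, mul_div_cancel_right₀ _ (h0 _)]
  rcases eq_shift_of_ne hf hne with h1 | h1
  · rw [h1, aux]
  · rw [contribution_swap θ hf.symm hne.symm, h1, aux]
    have := h0 h'
    have := h0 (shift 1 h')
    field_simp

end Model

end RibbonGraph

namespace RibbonGraph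

variable {E F : Type*} (Γ : RibbonGraph E F)

/-- Any two faces are joined by a chain of adjacent faces. -/
def FaceConnected : Prop :=
  ∀ A : Set F, A.Nonempty → (∀ h : F × Fin 3, h.1 ∈ A → (Γ.partner h).1 ∈ A) → A = univ

/-- `l` is the list of the half-edges through which a walk from face to face leaves the faces. -/
def IsWalk : F → List (F × Fin 3) → F → Prop
  | f, [], g => f = g
  | f, h :: l, g => h.1 = f ∧ IsWalk (Γ.partner h).1 l g

variable {Γ}

theorem isWalk_append {f g : F} {l l' : List (F × Fin 3)} :
    Γ.IsWalk f (l ++ l') g ↔ ∃ m, Γ.IsWalk f l m ∧ Γ.IsWalk m l' g := by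
  induction l generalizing f with
  | nil => simp [IsWalk]
  | cons h l ih =>
    simp only [List.cons_append, IsWalk, ih]
    constructor
    · rintro ⟨h1, m, h2, h3⟩; exact ⟨m, ⟨h1, h2⟩, h3⟩
    · rintro ⟨m, ⟨h1, h2⟩, h3⟩; exact ⟨h1, m, h2, h3⟩

theorem IsWalk.fst_getElem_zero {f g : F} {l : List (F × Fin 3)} (hl : Γ.IsWalk f l g)
    (h : 0 < l.length) : (l[0]).1 = f := by
  cases l with
  | nil => simp at h
  | cons a l => exact hl.1

theorem IsWalk.fst_drop {g : F} {l : List (F × Fin 3)} {m : F} {i : ℕ}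
    (hl : Γ.IsWalk m (l.drop i) g) (h : i < l.length) : (l[i]).1 = m := by
  have := hl.fst_getElem_zero (by simpa using h)
  simpa using this

theorem IsWalk.fst_partner_getElem {f g : F} {l : List (F × Fin 3)} (hl : Γ.IsWalk f l g)
    (i : ℕ) (h : i < l.length) :
    (Γ.partner l[i]).1 = if h' : i + 1 < l.length then (l[i + 1]).1 else g := by
  induction l generalizing f i with
  | nil => simp at h
  | cons a l ih =>
    cases i with
    | zero =>
      simp only [List.getElem_cons_zero, zero_add, List.length_cons, Nat.lt_add_left_iff_pos,
        List.getElem_cons_succ]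
      split_ifs with h'
      · exact (hl.2.fst_getElem_zero h').symm
      · have : l = [] := List.length_eq_zero_iff.1 (by omega)
        subst this
        exact hl.2
    | succ i =>
      have := ih hl.2 i (by simpa using h)
      simpa using this

theorem FaceConnected.induction (hΓ : Γ.FaceConnected) {p : F → Prop} (f₀ : F) (h₀ : p f₀)
    (hp : ∀ h : F × Fin 3, p h.1 → p (Γ.partner h).1) (f : F) : p f := by
  have h : {f | p f} = univ := hΓ _ ⟨f₀, h₀⟩ hp
  have h1 : f ∈ {f | p f} := h ▸ mem_univ f
  exact h1

theorem FaceConnected.exists_walk (hΓ : Γ.FaceConnected) (f g : F) : ∃ l, Γ.IsWalk f l g := by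
  refine hΓ.induction (p := fun g => ∃ l, Γ.IsWalk f l g) f ⟨[], rfl⟩ ?_ g
  rintro h ⟨l, hl⟩
  exact ⟨l ++ [h], isWalk_append.2 ⟨_, hl, rfl, rfl⟩⟩

/-- If a multiplicative cocycle is trivial along simple cycles it is trivial along closed walks. -/
theorem prod_eq_one_of_closed_walk {u : F × Fin 3 → ℂ} (hu : ∀ h, u h ≠ 0)
    (hc : ∀ α : Γ.SimpleCycle, ∏ j, (-u (α.enter j) / u (α.exit j)) = 1) (n : ℕ) :
    ∀ (f : F) (l : List (F × Fin 3)), l.length = n → Γ.IsWalk f l f →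
      (l.map fun h => -u h / u (Γ.partner h)).prod = 1 := by
  induction n using Nat.strong_induction_on with
  | _ n ih =>
  intro f l hn hl
  by_cases hnd : ∃ i j, ∃ hij : i < j, ∃ hj : j < l.length, (l[i]).1 = (l[j]).1
  · obtain ⟨i, j, hij, hj, hf⟩ := hnd
    have e1 : l = l.take i ++ ((l.drop i).take (j - i) ++ l.drop j) := by
      have : l.drop j = (l.drop i).drop (j - i) := by rw [List.drop_drop]; congr 1; omega
      rw [this, List.take_append_drop, List.take_append_drop]
    rw [e1] at hl
    obtain ⟨m, h1, h2⟩ := isWalk_append.1 hl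
    obtain ⟨m', h3, h4⟩ := isWalk_append.1 h2
    have hm' : (l[j]).1 = m' := h4.fst_drop hj
    have hm : (l[i]).1 = m := by
      have := h3.fst_getElem_zero (by simp; omega)
      simpa using this
    have hmm : m = m' := by rw [← hm, ← hm', hf]
    subst hmm
    have p1 := ih (j - i) (by omega) m ((l.drop i).take (j - i)) (by simp; omega) h3
    have p2 := ih (i + (l.length - j)) (by omega) f (l.take i ++ l.drop j)
      (by simp; omega) (isWalk_append.2 ⟨m, h1, h4⟩)
    rw [List.map_append, List.prod_append] at p2
    rw [e1, List.map_append, List.map_append, List.prod_append, List.prod_append, p1, one_mul, p2]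
  push Not at hnd
  obtain _ | n := n
  · rw [List.length_eq_zero_iff.1 hn]; rfl
  have hinj : ∀ i j : Fin (n + 1), (l[i.1]).1 = (l[j.1]).1 → i = j := by
    intro i j hij
    rcases lt_trichotomy i j with h | h | h
    · exact absurd hij (hnd i j h (by omega))
    · exact h
    · exact absurd hij.symm (hnd j i h (by omega))
  let ex : Fin (n + 1) → F × Fin 3 := fun i => l[i.1]
  have hnext : ∀ i : Fin (n + 1), (Γ.partner (ex i)).1 = (ex (i + 1)).1 := by
    intro i
    have h1 := hl.fst_partner_getElem i.1 (by omega)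
    rw [h1]
    by_cases hi : i = Fin.last n
    · subst hi
      rw [dif_neg (by simp; omega)]
      have h2 := hl.fst_getElem_zero (by omega)
      simp only [ex, Fin.last_add_one]
      exact h2.symm
    · have h2 : (i + 1).1 = i.1 + 1 := Fin.val_add_one_of_lt (Fin.lt_last_iff_ne_last.2 hi)
      have := i.2
      have h3 : i.1 + 1 < l.length := by
        have := (i + 1).2; omega
      rw [dif_pos h3]
      simp only [ex, h2]
  have hprod : (l.map fun h => -u h / u (Γ.partner h)).prod =
      ∏ i, (-u (ex i) / u (Γ.partner (ex i))) := by
    have : l = List.ofFn ex := by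
      apply List.ext_getElem
      · simp [hn]
      · intro i h1 h2; simp only [List.getElem_ofFn, ex]
    conv_lhs => rw [this, List.map_ofFn, List.prod_ofFn]
    rfl
  rw [hprod]
  by_cases hback : ∃ i, Γ.partner (ex i) = ex (i + 1)
  · obtain ⟨i, hi⟩ := hback
    have h1 := hnext (i + 1)
    rw [← hi, Γ.partner_partner] at h1
    have h2 := hinj _ _ h1
    have h0 : (1 : Fin (n + 1)) + 1 = 0 := by
      rw [add_assoc] at h2
      exact left_eq_add.1 h2
    have hn1 : n = 0 ∨ n = 1 := by
      by_contra! hcon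
      have : 2 ≤ n := by omega
      have := congrArg Fin.val h0
      rw [Fin.val_add, Fin.val_one', Fin.val_zero, Nat.mod_eq_of_lt (show 1 < n + 1 by omega),
        Nat.mod_eq_of_lt (show 1 + 1 < n + 1 by omega)] at this
      omega
    rcases hn1 with rfl | rfl
    · exact absurd hi (by rw [show i + 1 = i from Subsingleton.elim (α := Fin 1) _ _]; exact Γ.partner_ne _)
    · have h3 : ex 1 = Γ.partner (ex 0) := by
        fin_cases i
        · exact hi.symm
        · change Γ.partner (ex 1) = ex 0 at hi
          rw [← hi, Γ.partner_partner]
      rw [Fin.prod_univ_two, h3, Γ.partner_partner]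
      have := hu (ex 0)
      have := hu (Γ.partner (ex 0))
      field_simp
  push Not at hback
  let α : Γ.SimpleCycle :=
    { n := n
      enter := fun i => Γ.partner (ex (i - 1))
      exit := ex
      face_eq := fun i => by simpa using hnext (i - 1)
      ne := fun i => by simpa using hback (i - 1)
      edge_eq := fun i => by simpa using (Γ.edge_partner (ex i)).symm
      face_injective := fun i j h => hinj i j h
      edge_injective := fun i j h => by
        by_contra hij
        have h1 : ex i ≠ ex j := fun h => hij (hinj i j (congrArg Prod.fst h))
        have h2 := Γ.eq_partner h1 h
        have h3 := hnext i
        rw [← h2] at h3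
        have h4 := hinj _ _ h3
        exact hback i (by rw [← h2, h4]) }
  have h1 := hc α
  have h2 : ∏ j, u (Γ.partner (ex (j - 1))) = ∏ j, u (Γ.partner (ex j)) :=
    Equiv.prod_comp (Equiv.subRight (1 : Fin (n + 1))) (fun j => u (Γ.partner (ex j)))
  have h3 : ∏ j, (-u (Γ.partner (ex (j - 1))) / u (ex j)) = 1 := h1
  simp only [neg_div, Finset.prod_neg, Finset.prod_div_distrib, h2] at h3 ⊢
  have h4 : ∏ j, u (ex j) ≠ 0 := Finset.prod_ne_zero_iff.2 fun j _ => hu _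
  have h5 : ∏ j, u (Γ.partner (ex j)) ≠ 0 := Finset.prod_ne_zero_iff.2 fun j _ => hu _
  have hs : ((-1 : ℂ) ^ (Finset.univ : Finset (Fin (n + 1))).card) ^ 2 = 1 := by
    rw [← pow_mul, mul_comm, pow_mul]; simp
  field_simp at h3 ⊢
  linear_combination (-(-1 : ℂ) ^ (Finset.univ : Finset (Fin (n + 1))).card) * h3 +
    (∏ j, u (Γ.partner (ex j))) * hs

theorem exists_cycle_of_trivialHolonomy (hΓ : Γ.FaceConnected) {θ : F × Fin 3 → ℝ}
    (hθ : θ ∈ Γ.trivialHolonomy) (f₀ : F) :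
    ∃ c : F → ℂ, c f₀ = 1 ∧ (∀ f, c f ≠ 0) ∧
      (fun h : F × Fin 3 => c h.1 * modelTriangle θ h) ∈ Γ.cycleSpace := by
  have hu := modelTriangle_ne_zero hθ.1
  have hc : ∀ α : Γ.SimpleCycle,
      ∏ j, (-modelTriangle θ (α.enter j) / modelTriangle θ (α.exit j)) = 1 := fun α => by
    rw [← hθ.2 α, SimpleCycle.holonomy]
    exact Finset.prod_congr rfl fun j _ => (contribution_eq hθ.1 (α.face_eq j) (α.ne j)).symm
  have key := prod_eq_one_of_closed_walk hu hc
  set t : F × Fin 3 → ℂ := fun h => -modelTriangle θ h / modelTriangle θ (Γ.partner h) with ht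
  choose l hl using hΓ.exists_walk f₀
  refine ⟨fun f => ((l f).map t).prod, key _ f₀ (l f₀) rfl (hl f₀), fun f => ?_, fun f => ?_,
    fun h => ?_⟩
  · refine List.prod_ne_zero fun h0 => ?_
    obtain ⟨h, -, h1⟩ := List.mem_map.1 h0
    exact div_ne_zero (neg_ne_zero.2 (hu _)) (hu _) h1
  · change ∑ j, ((l f).map t).prod * modelTriangle θ (f, j) = 0
    rw [← Finset.mul_sum, modelTriangle_sum hθ.1, mul_zero]
  · obtain ⟨l', hl'⟩ := hΓ.exists_walk (Γ.partner h).1 f₀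
    have h1 := key _ f₀ (l (Γ.partner h).1 ++ l') rfl (isWalk_append.2 ⟨_, hl _, hl'⟩)
    have h2 := key _ f₀ (l h.1 ++ (h :: l')) rfl (isWalk_append.2 ⟨_, hl _, rfl, hl'⟩)
    rw [List.map_append, List.prod_append] at h1 h2
    rw [List.map_cons, List.prod_cons] at h2
    have h3 : (List.map t l').prod ≠ 0 := right_ne_zero_of_mul_eq_one h1
    have h4 : ((l (Γ.partner h).1).map t).prod = ((l h.1).map t).prod * t h := by
      apply mul_right_cancel₀ h3
      rw [h1, mul_assoc, h2]
    change ((l (Γ.partner h).1).map t).prod * modelTriangle θ (Γ.partner h) =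
      -(((l h.1).map t).prod * modelTriangle θ h)
    have h5 : t h * modelTriangle θ (Γ.partner h) = -modelTriangle θ h :=
      div_mul_cancel₀ _ (hu _)
    rw [h4, mul_assoc, h5, mul_neg]

theorem IsPositive.smul {v : F × Fin 3 → ℂ} (hv : IsPositive v) {c : F → ℂ} (hc : ∀ f, c f ≠ 0) :
    IsPositive fun h : F × Fin 3 => c h.1 * v h := fun h => by
  simp only [shift_fst, cross_mul_left]
  exact mul_pos (Complex.normSq_pos.2 (hc _)) (hv h)

theorem angleOf_smul {v : F × Fin 3 → ℂ} (hv : IsPositive v) {c : F → ℂ} (hc : ∀ f, c f ≠ 0) :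
    angleOf (fun h : F × Fin 3 => c h.1 * v h) = angleOf v := by
  ext h
  rw [(angleOf_mem (hv.smul hc) h).2, (angleOf_mem hv h).2]
  congr 1
  have := hc h.1
  have := hv.ne_zero (shift 1 h)
  simp only [shift_fst]
  field_simp

theorem IsTriangleMatching.angleOf_mem_invariantAngles [Finite F] {ι : Equiv.Perm (F × Fin 3)}
    (hι : Γ.IsTriangleMatching ι) {v : F × Fin 3 → ℂ} (hv : v ∈ Γ.cycleSpace) (hp : IsPositive v) :
    angleOf v ∈ invariantAngles ι := by
  refine ⟨angleOf_mem_angleSpace hp hv.1, fun h => ?_⟩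
  rw [angleOf, ← hι.commutes, hι.apply_eq_neg hv, hι.apply_eq_neg hv,
    InnerProductGeometry.angle_neg_neg, angleOf]

theorem IsTriangleMatching.trivialHolonomy_eq [Finite F] (hΓ : Γ.FaceConnected) [Nonempty F]
    {ι : Equiv.Perm (F × Fin 3)} (hι : Γ.IsTriangleMatching ι) :
    Γ.trivialHolonomy = invariantAngles ι := by
  refine Subset.antisymm (fun θ hθ => ?_) (invariantAngles_subset_trivialHolonomy hι)
  obtain ⟨c, -, hc, hv⟩ := exists_cycle_of_trivialHolonomy hΓ hθ (Classical.arbitrary F)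
  have hp := modelTriangle_positive hθ.1
  have := hι.angleOf_mem_invariantAngles hv (hp.smul hc)
  rwa [angleOf_smul hp hc, angleOf_modelTriangle hθ.1] at this

theorem convex_angleSpace : Convex ℝ (angleSpace F) := by
  rintro θ ⟨h1, h2⟩ θ' ⟨h1', h2'⟩ a b ha hb hab
  refine ⟨fun h => convex_Ioo 0 Real.pi (h1 h) (h1' h) ha hb hab, fun f => ?_⟩
  simp only [Pi.add_apply, Pi.smul_apply, smul_eq_mul, Finset.sum_add_distrib, ← Finset.mul_sum,
    h2, h2']
  rw [← add_mul, hab, one_mul]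

theorem convex_invariantAngles (ι : Equiv.Perm (F × Fin 3)) : Convex ℝ (invariantAngles ι) := by
  rintro θ ⟨h1, h2⟩ θ' ⟨h1', h2'⟩ a b ha hb hab
  refine ⟨convex_angleSpace h1 h1' ha hb hab, fun h => ?_⟩
  simp [h2, h2']

theorem convex_delaunayAngles (Γ : RibbonGraph E F) : Convex ℝ Γ.delaunayAngles := by
  rintro θ ⟨h1, h2⟩ θ' ⟨h1', h2'⟩ a b ha hb hab
  refine ⟨convex_angleSpace h1 h1' ha hb hab, fun h h' hne he => ?_⟩
  have := convex_Iio Real.pi (mem_Iio.2 (h2 h h' hne he)) (mem_Iio.2 (h2' h h' hne he)) ha hb hab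
  simp only [Pi.add_apply, Pi.smul_apply, smul_eq_mul, mem_Iio] at this ⊢
  linarith

theorem const_mem (Γ : RibbonGraph E F) (ι : Equiv.Perm (F × Fin 3)) :
    (fun _ => Real.pi / 3) ∈ Γ.delaunayAngles ∩ invariantAngles ι := by
  have h : (fun _ => Real.pi / 3) ∈ angleSpace F := by
    refine ⟨fun _ => ⟨by positivity, by linarith [Real.pi_pos]⟩, fun f => ?_⟩
    rw [Fin.sum_univ_three]; ring
  exact ⟨⟨h, fun _ _ _ _ => by linarith [Real.pi_pos]⟩, h, fun _ => rfl⟩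

/-- The side vectors of triangles with given invariant angles can be chosen continuously and so
that they fit together along the edges. -/
theorem IsTriangleMatching.exists_continuous_cycle [Finite F] (hΓ : Γ.FaceConnected) [Nonempty F]
    {ι : Equiv.Perm (F × Fin 3)} (hι : Γ.IsTriangleMatching ι) :
    ∃ V : invariantAngles ι → Γ.cycleSpace, (∀ h, Continuous fun θ => (V θ : F × Fin 3 → ℂ) h) ∧
      (∀ θ, IsPositive (V θ : F × Fin 3 → ℂ)) ∧
      ∀ θ : invariantAngles ι, angleOf (V θ : F × Fin 3 → ℂ) = θ := by
  let f₀ := Classical.arbitrary F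
  choose c hc1 hc2 hc3 using fun θ : invariantAngles ι =>
    exists_cycle_of_trivialHolonomy hΓ (invariantAngles_subset_trivialHolonomy hι θ.2) f₀
  have hp := fun θ : invariantAngles ι => modelTriangle_positive θ.2.1
  have hcont : ∀ f, Continuous fun θ => c θ f := by
    refine hΓ.induction f₀ ?_ fun h hh => ?_
    · simp only [hc1]; exact continuous_const
    · have : (fun θ => c θ (Γ.partner h).1) = fun θ : invariantAngles ι =>
          -(c θ h.1 * modelTriangle θ h) / modelTriangle θ (Γ.partner h) := by
        ext θ
        rw [← (hc3 θ).2 h, mul_div_cancel_right₀ _ (modelTriangle_ne_zero θ.2.1 _)]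
      rw [this]
      have h1 : ∀ h, Continuous fun θ : invariantAngles ι => modelTriangle (θ : F × Fin 3 → ℝ) h :=
        fun h => (continuous_modelTriangle h).comp continuous_subtype_val
      exact ((Continuous.mul hh (h1 h)).neg).div (h1 _) fun θ => modelTriangle_ne_zero θ.2.1 _
  refine ⟨fun θ => ⟨_, hc3 θ⟩, fun h => ?_, fun θ => (hp θ).smul (hc2 θ), fun θ => ?_⟩
  · exact Continuous.mul (hcont h.1) ((continuous_modelTriangle h).comp continuous_subtype_val)
  · rw [angleOf_smul (hp θ) (hc2 θ), angleOf_modelTriangle θ.2.1]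

/-- A cycle with the same angles is a multiple. -/
theorem exists_smul_of_angleOf_eq (hΓ : Γ.FaceConnected) [Nonempty F] {v w : F × Fin 3 → ℂ}
    (hv : v ∈ Γ.cycleSpace) (hw : w ∈ Γ.cycleSpace) (hvp : IsPositive v) (hwp : IsPositive w)
    (h : angleOf v = angleOf w) : ∃ c : ℂ, c ≠ 0 ∧ ∀ h, w h = c * v h := by
  have key := fun f => exists_scale_of_angleOf_eq hvp hwp hv.1 hw.1 f fun j => congrFun h (f, j)
  choose c hc0 hc using key
  let f₀ := Classical.arbitrary F
  have : ∀ f, c f = c f₀ := by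
    refine hΓ.induction f₀ rfl fun h hh => ?_
    have h1 : w (Γ.partner h) = c (Γ.partner h).1 * v (Γ.partner h) := hc _ (Γ.partner h).2
    have h2 : w h = c h.1 * v h := hc _ h.2
    rw [hw.2, hv.2, h2, hh] at h1
    exact mul_right_cancel₀ (hvp.ne_zero h) (by linear_combination h1)
  refine ⟨c f₀, hc0 _, fun h => ?_⟩
  rw [← this h.1]
  exact hc _ h.2

end RibbonGraph

/-! ### Winding numbers -/

theorem Convex.exists_log {V : Type*} [NormedAddCommGroup V] [NormedSpace ℝ V] {U : Set V}
    (hU : Convex ℝ U) (hUo : IsOpen U) (hne : U.Nonempty) {g : V → ℂ} (hg : ContinuousOn g U)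
    (h0 : ∀ x ∈ U, g x ≠ 0) : ∃ f : V → ℂ, ContinuousOn f U ∧ ∀ x ∈ U, Complex.exp (f x) = g x := by
  have := hU.contractibleSpace hne
  exact Complex.exists_continuousOn_eqOn_exp_comp (U := U)
    (SimplyConnectedSpace.ofContractible U) hUo hg (by rintro ⟨x, hx, h⟩; exact h0 x hx h)

theorem IsPreconnected.sub_eq_sub_of_exp_eq {V : Type*} [TopologicalSpace V] {U : Set V}
    (hU : IsPreconnected U) {f g : V → ℂ} (hf : ContinuousOn f U) (hg : ContinuousOn g U)
    (h : ∀ x ∈ U, Complex.exp (f x) = Complex.exp (g x)) {x y : V} (hx : x ∈ U) (hy : y ∈ U) :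
    f x - g x = f y - g y := by
  have hd : DiscreteTopology (AddSubgroup.zmultiples (2 * Real.pi * Complex.I)) :=
    NormedSpace.discreteTopology_zmultiples _
  refine hU.constant_of_mapsTo (T := (AddSubgroup.zmultiples (2 * Real.pi * Complex.I) : Set ℂ))
    (f := fun x => f x - g x) ?_ (hf.sub hg) (fun z hz => ?_) hx hy
  · exact isDiscrete_iff_discreteTopology.2 hd
  · obtain ⟨n, hn⟩ := Complex.exp_eq_exp_iff_exists_int.1 (h z hz)
    refine AddSubgroup.mem_zmultiples_iff.2 ⟨n, ?_⟩
    rw [zsmul_eq_mul]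
    linear_combination -hn

/-- The loop `γ`, parametrized by `[0, 2π]`, winds `n` times around zero. -/
def HasWinding (γ : ℝ → ℂ) (n : ℤ) : Prop :=
  ∃ g : ℝ → ℂ, Continuous g ∧ (∀ t, Complex.exp (g t) = γ t) ∧
    g (2 * Real.pi) = g 0 + n * (2 * Real.pi * Complex.I)

theorem exists_hasWinding {γ : ℝ → ℂ} (hγ : Continuous γ) (h0 : ∀ t, γ t ≠ 0)
    (hp : γ (2 * Real.pi) = γ 0) : ∃ n, HasWinding γ n := by
  obtain ⟨g, hg, hg'⟩ := (convex_univ (𝕜 := ℝ) (E := ℝ)).exists_log isOpen_univ univ_nonempty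
    hγ.continuousOn fun t _ => h0 t
  obtain ⟨n, hn⟩ := Complex.exp_eq_exp_iff_exists_int.1
    ((hg' (2 * Real.pi) (mem_univ _)).trans (hp.trans (hg' 0 (mem_univ _)).symm))
  exact ⟨n, g, continuousOn_univ.1 hg, fun t => hg' t (mem_univ _), hn⟩

theorem HasWinding.sub_eq {γ : ℝ → ℂ} {n : ℤ} (h : HasWinding γ n) {g : ℝ → ℂ}
    (hg : Continuous g) (hg' : ∀ t, Complex.exp (g t) = γ t) :
    g (2 * Real.pi) - g 0 = n * (2 * Real.pi * Complex.I) := by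
  obtain ⟨g', h1, h2, h3⟩ := h
  have := (isPreconnected_univ (α := ℝ)).sub_eq_sub_of_exp_eq hg.continuousOn h1.continuousOn
    (fun t _ => by rw [hg', h2]) (mem_univ (2 * Real.pi)) (mem_univ 0)
  linear_combination this + h3

theorem HasWinding.unique {γ : ℝ → ℂ} {m n : ℤ} (h : HasWinding γ m) (h' : HasWinding γ n) :
    m = n := by
  obtain ⟨g, h1, h2, h3⟩ := h
  have := h'.sub_eq h1 h2
  rw [h3, add_sub_cancel_left] at this
  have h4 := mul_right_cancel₀ Complex.two_pi_I_ne_zero this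
  exact_mod_cast h4

/-- The winding number is invariant under homotopies of loops that avoid zero. -/
theorem HasWinding.homotopy {H : ℝ × ℝ → ℂ} (hH : ContinuousOn H (Icc 0 1 ×ˢ univ))
    (h0 : ∀ s ∈ Icc (0 : ℝ) 1, ∀ t, H (s, t) ≠ 0)
    (hp : ∀ s ∈ Icc (0 : ℝ) 1, H (s, 2 * Real.pi) = H (s, 0)) {n : ℤ}
    (h : HasWinding (fun t => H (0, t)) n) : HasWinding (fun t => H (1, t)) n := by
  let c : ℝ → ℝ := fun s => max 0 (min s 1)
  have hc : ∀ s, c s ∈ Icc (0 : ℝ) 1 := fun s => ⟨le_max_left _ _, max_le zero_le_one (min_le_right _ _)⟩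
  have hcc : Continuous c := by fun_prop
  let K : ℝ × ℝ → ℂ := fun x => H (c x.1, x.2)
  have hK : Continuous K := by
    refine hH.comp_continuous (by fun_prop) fun x => ⟨hc _, mem_univ _⟩
  obtain ⟨L, hL, hL'⟩ := (convex_univ (𝕜 := ℝ) (E := ℝ × ℝ)).exists_log isOpen_univ univ_nonempty
    hK.continuousOn fun x _ => h0 _ (hc _) _
  rw [continuousOn_univ] at hL
  have hL1 := fun x => hL' x (mem_univ x)
  have c0 : c 0 = 0 := by simp [c]
  have c1 : c 1 = 1 := by simp [c]
  refine ⟨fun t => L (1, t), by fun_prop, fun t => by rw [hL1]; simp [K, c1], ?_⟩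
  have h1 := (isPreconnected_univ (α := ℝ)).sub_eq_sub_of_exp_eq (f := fun s => L (s, 2 * Real.pi))
    (g := fun s => L (s, 0)) (by fun_prop) (by fun_prop)
    (fun s _ => by rw [hL1, hL1]; exact hp _ (hc _)) (mem_univ 0) (mem_univ 1)
  have h2 := h.sub_eq (g := fun t => L (0, t)) (by fun_prop) fun t => by rw [hL1]; simp [K, c0]
  simp only at h1 h2 ⊢
  linear_combination h2 - h1

/-- The winding number of the image of a loop in a punctured disk under a map of the punctured disk
to the punctured plane. -/
theorem HasWinding.comp {γ : ℝ → ℂ} {w : ℂ} {r : ℝ} {m n : ℤ} {f : ℂ → ℂ}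
    (hγ : HasWinding (fun t => γ t - w) m) (hγr : ∀ t, dist (γ t) w < r)
    (hf : ContinuousOn f (Metric.ball w r \ {w})) (hf0 : ∀ x ∈ Metric.ball w r \ {w}, f x ≠ 0)
    {ρ : ℝ} (hρ : 0 < ρ) (hρr : ρ < r) (hn : HasWinding (fun t => f (circleMap w ρ t)) n) :
    HasWinding (fun t => f (γ t)) (m * n) := by
  have hr : 0 < r := hρ.trans hρr
  let U : Set ℂ := {ξ | ξ.re < Real.log r}
  have hU : Convex ℝ U := convex_halfSpace_re_lt _
  have hUo : IsOpen U := isOpen_lt Complex.continuous_re continuous_const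
  have hρU : ∀ t : ℝ, (Real.log ρ + t * Complex.I : ℂ) ∈ U := fun t => by
    change (Real.log ρ + t * Complex.I : ℂ).re < _
    simpa using Real.log_lt_log hρ hρr
  have hmem : ∀ ξ ∈ U, w + Complex.exp ξ ∈ Metric.ball w r \ {w} := fun ξ hξ => by
    refine ⟨?_, by simp [Complex.exp_ne_zero]⟩
    rw [Metric.mem_ball, dist_eq_norm, add_sub_cancel_left, Complex.norm_exp,
      ← Real.lt_log_iff_exp_lt hr]
    exact hξ
  obtain ⟨L, hL, hL'⟩ := hU.exists_log hUo ⟨_, hρU 0⟩ (g := fun ξ => f (w + Complex.exp ξ))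
    (hf.comp (by fun_prop) hmem) fun ξ hξ => hf0 _ (hmem ξ hξ)
  have hshift : ∀ ξ ∈ U, ∀ k : ℤ, ξ + k * (2 * Real.pi * Complex.I) ∈ U := fun ξ hξ k => by
    change (ξ + k * (2 * Real.pi * Complex.I)).re < _
    have hξ' : ξ.re < Real.log r := hξ
    simpa using hξ'
  have hper : ∀ ξ ∈ U, L (ξ + 2 * Real.pi * Complex.I) = L ξ + n * (2 * Real.pi * Complex.I) := by
    intro ξ hξ
    have hs : ∀ ξ ∈ U, ξ + 2 * Real.pi * Complex.I ∈ U := fun ξ hξ => by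
      simpa using hshift ξ hξ 1
    have h1 := hU.isPreconnected.sub_eq_sub_of_exp_eq (f := fun ξ => L (ξ + 2 * Real.pi * Complex.I))
      (g := L) (hL.comp (by fun_prop) hs) hL
      (fun ξ hξ => by
        rw [hL' ξ hξ, hL' _ (hs ξ hξ), Complex.exp_add, Complex.exp_two_pi_mul_I, mul_one])
      hξ (hρU 0)
    have h2 := hn.sub_eq (g := fun t : ℝ => L (Real.log ρ + t * Complex.I))
      (hL.comp_continuous (by fun_prop) hρU) fun t => by
        rw [hL' _ (hρU t), Complex.exp_add, ← Complex.ofReal_exp, Real.exp_log hρ, circleMap]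
    simp only [Complex.ofReal_mul, Complex.ofReal_ofNat, Complex.ofReal_zero, zero_mul,
      add_zero] at h1 h2
    linear_combination h1 + h2
  have hperk : ∀ k : ℤ, ∀ ξ ∈ U, L (ξ + k * (2 * Real.pi * Complex.I)) =
      L ξ + k * (n * (2 * Real.pi * Complex.I)) := by
    intro k ξ hξ
    induction k using Int.induction_on with
    | zero => simp
    | succ k ih =>
      have := hper _ (hshift ξ hξ k)
      rw [ih] at this
      push_cast at this ⊢
      rw [add_mul, one_mul, ← add_assoc, this]; ring
    | pred k ih =>
      have := hper _ (hshift ξ hξ (-k - 1))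
      push_cast at this ih ⊢
      have e : ξ + (-k - 1) * (2 * Real.pi * Complex.I) + 2 * Real.pi * Complex.I =
        ξ + -k * (2 * Real.pi * Complex.I) := by ring
      rw [e, ih] at this
      linear_combination -this
  obtain ⟨g, hg, hg1, hg2⟩ := hγ
  have hgU : ∀ t, g t ∈ U := fun t => by
    have := hγr t
    rw [dist_eq_norm, ← show _ = γ t - w from hg1 t, Complex.norm_exp, ← Real.lt_log_iff_exp_lt hr] at this
    exact this
  refine ⟨fun t => L (g t), hL.comp_continuous hg hgU, fun t => ?_, ?_⟩
  · rw [hL' _ (hgU t), hg1, add_sub_cancel]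
  · simp only [hg2]
    rw [hperk m _ (hgU 0)]; push_cast; ring

/-! ### Local degree -/

theorem dist_circleMap (z : ℂ) {r : ℝ} (hr : 0 < r) (t : ℝ) : dist (circleMap z r t) z = r := by
  simp [circleMap, dist_eq_norm, abs_of_pos hr]

/-- The local degree of a planar map at a point. -/
def HasLocalDegree (f : ℂ → ℂ) (z : ℂ) (n : ℤ) : Prop :=
  ∀ᶠ r : ℝ in 𝓝[>] 0, HasWinding (fun t => f (circleMap z r t) - f z) n

theorem orientationPreservingAt_iff {f : ℂ → ℂ} {z : ℂ} :
    OrientationPreservingAt f z ↔ HasLocalDegree f z 1 := by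
  simp only [OrientationPreservingAt, HasLocalDegree, HasWinding, Int.cast_one, one_mul]

theorem HasLocalDegree.unique {f : ℂ → ℂ} {z : ℂ} {m n : ℤ} (h : HasLocalDegree f z m)
    (h' : HasLocalDegree f z n) : m = n := by
  obtain ⟨r, h1, h2⟩ := (h.and h').exists
  exact h1.unique h2

theorem HasLocalDegree.congr {f g : ℂ → ℂ} {z : ℂ} {n : ℤ} (h : HasLocalDegree f z n)
    (hfg : ∀ᶠ x in 𝓝 z, g x - g z = f x - f z) : HasLocalDegree g z n := by
  obtain ⟨ε, hε, hball⟩ := Metric.eventually_nhds_iff_ball.1 hfg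
  filter_upwards [h, Ioo_mem_nhdsGT hε] with r hr hrε
  convert! hr using 2 with t
  exact hball _ ((dist_circleMap z hrε.1 t).trans_lt hrε.2)

theorem circleMap_two_pi (z : ℂ) (r : ℝ) : circleMap z r (2 * Real.pi) = circleMap z r 0 := by
  simp [circleMap]

/-- A continuous injective map of a disk has the same degree on all circles in the disk. -/
theorem exists_hasWinding_of_injOn {f : ℂ → ℂ} {z : ℂ} {R : ℝ} (hR : 0 < R)
    (hf : ContinuousOn f (Metric.ball z R)) (hi : InjOn f (Metric.ball z R)) :
    ∃ n, ∀ w r, 0 < r → dist w z + r < R →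
      HasWinding (fun t => f (circleMap w r t) - f w) n := by
  have key : ∀ w r, 0 < r → dist w z + r < R → ∀ t, circleMap w r t ∈ Metric.ball z R ∧
      w ∈ Metric.ball z R ∧ f (circleMap w r t) - f w ≠ 0 := by
    intro w r hr hwr t
    have h1 : circleMap w r t ∈ Metric.ball z R := by
      rw [Metric.mem_ball]
      calc dist (circleMap w r t) z ≤ dist (circleMap w r t) w + dist w z := dist_triangle _ _ _
        _ < R := by
          rw [dist_circleMap w hr]; linarith
    have h2 : w ∈ Metric.ball z R := by rw [Metric.mem_ball]; linarith
    exact ⟨h1, h2, sub_ne_zero.2 fun h => circleMap_ne_center hr.ne' (hi h1 h2 h)⟩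
  have hex : ∃ n, HasWinding (fun t => f (circleMap z (R / 2) t) - f z) n := by
    have hk := key z (R / 2) (by positivity) (by simp; linarith)
    refine exists_hasWinding ?_ (fun t => (hk t).2.2) (by rw [circleMap_two_pi])
    exact (hf.comp_continuous (continuous_circleMap _ _) fun t => (hk t).1).sub continuous_const
  obtain ⟨n, hn⟩ := hex
  refine ⟨n, fun w r hr hwr => ?_⟩
  let W : ℝ → ℂ := fun s => (1 - s : ℝ) * z + (s : ℝ) * w
  let ρ : ℝ → ℝ := fun s => (1 - s) * (R / 2) + s * r
  have hρ : ∀ s ∈ Icc (0 : ℝ) 1, 0 < ρ s ∧ dist (W s) z + ρ s < R := by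
    rintro s ⟨h0, h1⟩
    have hd : dist (W s) z = s * dist w z := by
      rw [dist_eq_norm, dist_eq_norm, ← abs_of_nonneg h0, ← Real.norm_eq_abs, ← Complex.norm_real,
        ← norm_mul, Complex.norm_real, Real.norm_eq_abs, abs_of_nonneg h0]
      congr 1; simp only [W]; push_cast; ring
    constructor
    · simp only [ρ]
      rcases h1.lt_or_eq with h1 | rfl
      · have : 0 < (1 - s) * (R / 2) := mul_pos (by linarith) (by linarith)
        have : 0 ≤ s * r := by positivity
        linarith
      · simpa using hr
    · rw [hd]; simp only [ρ]
      rcases h0.lt_or_eq with h0 | rfl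
      · nlinarith [mul_lt_mul_of_pos_left hwr h0]
      · simp; linarith
  have hh := HasWinding.homotopy (n := n)
    (H := fun x : ℝ × ℝ => f (circleMap (W x.1) (ρ x.1) x.2) - f (W x.1)) ?_ ?_ ?_ ?_
  · simpa [W, ρ] using hh
  · have hW : Continuous W := by fun_prop
    have hρc : Continuous ρ := by fun_prop
    refine (hf.comp ?_ ?_).sub (hf.comp ?_ ?_)
    · refine Continuous.continuousOn ?_
      simp only [circleMap]
      fun_prop
    · rintro x ⟨hx, -⟩
      exact (key _ _ (hρ _ hx).1 (hρ _ hx).2 _).1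
    · fun_prop
    · rintro x ⟨hx, -⟩
      exact (key _ _ (hρ _ hx).1 (hρ _ hx).2 0).2.1
  · exact fun s hs t => (key _ _ (hρ _ hs).1 (hρ _ hs).2 t).2.2
  · intro s _; simp only [circleMap_two_pi]
  · simpa [W, ρ] using hn

theorem exists_hasLocalDegree {f : ℂ → ℂ} {z : ℂ} {U : Set ℂ} (hU : U ∈ 𝓝 z)
    (hf : ContinuousOn f U) (hi : InjOn f U) :
    ∃ n, ∀ᶠ w in 𝓝 z, HasLocalDegree f w n := by
  obtain ⟨R, hR, hball⟩ := Metric.mem_nhds_iff.1 hU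
  obtain ⟨n, hn⟩ := exists_hasWinding_of_injOn hR (hf.mono hball) (hi.mono hball)
  refine ⟨n, ?_⟩
  filter_upwards [Metric.ball_mem_nhds z hR] with w hw
  rw [Metric.mem_ball] at hw
  filter_upwards [Ioo_mem_nhdsGT (sub_pos.2 hw)] with r hr
  exact hn w r hr.1 (by linarith [hr.2])

theorem HasLocalDegree.comp {f g : ℂ → ℂ} {z : ℂ} {m n : ℤ} {V : Set ℂ}
    (hfd : HasLocalDegree f z m) (hfc : ContinuousAt f z)
    (hV : V ∈ 𝓝 (f z)) (hgc : ContinuousOn g V) (hgi : InjOn g V)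
    (hgd : HasLocalDegree g (f z) n) : HasLocalDegree (g ∘ f) z (m * n) := by
  obtain ⟨R, hR, hball⟩ := Metric.mem_nhds_iff.1 hV
  obtain ⟨ρ, hρ1, hρ2⟩ := (hgd.and (Ioo_mem_nhdsGT hR)).exists
  obtain ⟨δ, hδ, hδ'⟩ := Metric.eventually_nhds_iff_ball.1
    (hfc.eventually (Metric.ball_mem_nhds (f z) hR))
  have hmem : f z ∈ V := hball (Metric.mem_ball_self hR)
  filter_upwards [hfd, Ioo_mem_nhdsGT hδ] with r hr hrδ
  refine HasWinding.comp (γ := fun t => f (circleMap z r t)) (w := f z) (r := R)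
    (f := fun x => g x - g (f z)) hr ?_ ?_ ?_ hρ2.1 hρ2.2 hρ1
  · intro t
    exact hδ' _ ((dist_circleMap z hrδ.1 t).trans_lt hrδ.2)
  · exact (hgc.mono (sdiff_subset.trans hball)).sub continuousOn_const
  · rintro x ⟨hx, hx'⟩
    exact sub_ne_zero.2 fun h => hx' (hgi (hball hx) hmem h)

/-- The degree of a real linear map is the sign of its determinant. -/
theorem hasWinding_linear (x y : ℂ) {r : ℝ} (hr : 0 < r) :
    (0 < cross x y → HasWinding (fun t => ((r * Real.cos t : ℝ) : ℂ) * x + (r * Real.sin t : ℝ) * y) 1) ∧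
    (cross x y < 0 →
      HasWinding (fun t => ((r * Real.cos t : ℝ) : ℂ) * x + (r * Real.sin t : ℝ) * y) (-1)) := by
  set a : ℂ := (x - Complex.I * y) / 2 with ha
  set b : ℂ := (x + Complex.I * y) / 2 with hb
  have hab : Complex.normSq a - Complex.normSq b = cross x y := by
    simp only [ha, hb, Complex.normSq_apply, cross, Complex.div_re, Complex.div_im,
      Complex.sub_re, Complex.sub_im, Complex.add_re, Complex.add_im, Complex.mul_re,
      Complex.mul_im, Complex.I_re, Complex.I_im]
    norm_num; ring
  have hform : ∀ t : ℝ, ((r * Real.cos t : ℝ) : ℂ) * x + (r * Real.sin t : ℝ) * y =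
      r * a * Complex.exp (t * Complex.I) + r * b * Complex.exp (-(t * Complex.I)) := fun t => by
    rw [← neg_mul, Complex.exp_mul_I, Complex.exp_mul_I, Complex.cos_neg, Complex.sin_neg]
    push_cast
    linear_combination (r * y * Complex.sin t) * Complex.I_sq
  have e1 : Complex.exp (((2 * Real.pi : ℝ) : ℂ) * Complex.I) = 1 := by
    push_cast; exact Complex.exp_two_pi_mul_I
  have hr' : (r : ℂ) ≠ 0 := by exact_mod_cast hr.ne'
  have hn1 : ∀ t : ℝ, ‖Complex.exp (t * Complex.I)‖ = 1 := Complex.norm_exp_ofReal_mul_I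
  have hn2 : ∀ t : ℝ, ‖Complex.exp (-(t * Complex.I))‖ = 1 := fun t => by
    rw [Complex.exp_neg, norm_inv, hn1, inv_one]
  have hlt : ∀ {c d : ℂ}, Complex.normSq d < Complex.normSq c → ‖d‖ < ‖c‖ := fun {c d} h => by
    rw [Complex.normSq_eq_norm_sq, Complex.normSq_eq_norm_sq] at h
    exact lt_of_pow_lt_pow_left₀ 2 (norm_nonneg _) h
  have hne : ∀ {c d u u' : ℂ} {s : ℝ}, s ∈ Icc (0 : ℝ) 1 → ‖d‖ < ‖c‖ → ‖u‖ = 1 → ‖u'‖ = 1 →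
      r * c * u + s * (r * d * u') ≠ 0 := by
    intro c d u u' s hs hcd hu hu' h
    have h1 : ‖r * c * u‖ = ‖s * (r * d * u')‖ := by
      rw [eq_neg_of_add_eq_zero_left h, norm_neg]
    simp only [norm_mul, hu, hu', Complex.norm_real, Real.norm_eq_abs, abs_of_pos hr,
      abs_of_nonneg hs.1, mul_one] at h1
    have h2 : s * (r * ‖d‖) ≤ r * ‖d‖ := mul_le_of_le_one_left (by positivity) hs.2
    nlinarith [mul_lt_mul_of_pos_left hcd hr]
  simp only [hform]
  constructor
  · intro h
    have hcd : ‖b‖ < ‖a‖ := hlt (by linarith)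
    have ha0 : (r : ℂ) * a ≠ 0 := mul_ne_zero hr' (norm_pos_iff.1 ((norm_nonneg _).trans_lt hcd))
    have := HasWinding.homotopy (n := 1) (H := fun p : ℝ × ℝ =>
      r * a * Complex.exp (p.2 * Complex.I) + p.1 * (r * b * Complex.exp (-(p.2 * Complex.I))))
      (by fun_prop) (fun s hs t => hne hs hcd (hn1 t) (hn2 t))
      (fun s _ => by simp only [e1, Complex.exp_neg, Complex.ofReal_zero, zero_mul, Complex.exp_zero])
      ⟨fun t => Complex.log (r * a) + t * Complex.I, by fun_prop, fun t => ?_, ?_⟩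
    · simpa using this
    · rw [Complex.exp_add, Complex.exp_log ha0]; simp
    · push_cast; ring
  · intro h
    have hcd : ‖a‖ < ‖b‖ := hlt (by linarith)
    have hb0 : (r : ℂ) * b ≠ 0 := mul_ne_zero hr' (norm_pos_iff.1 ((norm_nonneg _).trans_lt hcd))
    have := HasWinding.homotopy (n := -1) (H := fun p : ℝ × ℝ =>
      r * b * Complex.exp (-(p.2 * Complex.I)) + p.1 * (r * a * Complex.exp (p.2 * Complex.I)))
      (by fun_prop) (fun s hs t => hne hs hcd (hn2 t) (hn1 t))
      (fun s _ => by simp only [e1, Complex.exp_neg, Complex.ofReal_zero, zero_mul, Complex.exp_zero])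
      ⟨fun t => Complex.log (r * b) - t * Complex.I, by fun_prop, fun t => ?_, ?_⟩
    · simpa [add_comm] using this
    · simp only [sub_eq_add_neg]
      rw [Complex.exp_add, Complex.exp_log hb0]; simp
    · push_cast; ring

/-! ### The reference triangle -/

/-- Barycentric coordinates with respect to the reference triangle. -/
def bary (j : Fin 3) (z : ℂ) : ℝ := ![1 - z.re - z.im, z.re, z.im] j

theorem continuous_bary (j : Fin 3) : Continuous (bary j) := by
  fin_cases j
  · exact (continuous_const.sub Complex.continuous_re).sub Complex.continuous_im
  · exact Complex.continuous_re
  · exact Complex.continuous_im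

theorem bary_sum (j : Fin 3) (z : ℂ) : bary j z + bary (j + 1) z + bary (j + 2) z = 1 := by
  fin_cases j <;> simp [bary]
  ring

theorem bary_ext {z w : ℂ} (j : Fin 3) (h1 : bary j z = bary j w)
    (h2 : bary (j + 1) z = bary (j + 1) w) : z = w := by
  have h3 : bary (j + 2) z = bary (j + 2) w := by
    linarith [bary_sum j z, bary_sum j w]
  apply Complex.ext
  · fin_cases j <;> first | exact h1 | exact h2 | exact h3
  · fin_cases j <;> first | exact h1 | exact h2 | exact h3

theorem bary_combo (j : Fin 3) {a b : ℝ} (hab : a + b = 1) (z w : ℂ) :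
    bary j (a • z + b • w) = a * bary j z + b * bary j w := by
  fin_cases j <;> simp [bary]
  linear_combination -hab

theorem bary_corner (j k : Fin 3) : bary j (corner k) = if j = k then 1 else 0 := by
  fin_cases j <;> fin_cases k <;> simp [bary, corner]

theorem side_eq (j : Fin 3) (s : ℝ) :
    side j s = (1 - s) • corner j + s • corner (j + 1) := by
  rw [side, AffineMap.lineMap_apply_module]

theorem side_zero (j : Fin 3) : side j 0 = corner j := by simp [side]

theorem side_one (j : Fin 3) : side j 1 = corner (j + 1) := by simp [side]

theorem continuous_side (j : Fin 3) : Continuous (side j) := AffineMap.lineMap_continuous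

theorem bary_side (k j : Fin 3) (s : ℝ) : bary k (side j s) =
    (1 - s) * (if k = j then 1 else 0) + s * (if k = j + 1 then 1 else 0) := by
  rw [side_eq, bary_combo k (by ring), bary_corner, bary_corner]

theorem bary_side_self (j : Fin 3) (s : ℝ) : bary j (side j s) = 1 - s := by
  rw [bary_side]; simp

theorem bary_side_add_one (j : Fin 3) (s : ℝ) : bary (j + 1) (side j s) = s := by
  rw [bary_side]; simp

theorem bary_side_add_two (j : Fin 3) (s : ℝ) : bary (j + 2) (side j s) = 0 := by
  rw [bary_side, if_neg, if_neg] <;> simp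

theorem eq_side_of_bary {j : Fin 3} {z : ℂ} (h : bary (j + 2) z = 0) :
    z = side j (bary (j + 1) z) := by
  refine bary_ext j ?_ ?_
  · rw [bary_side_self]; linarith [bary_sum j z]
  · rw [bary_side_add_one]

theorem side_injective (j : Fin 3) : Function.Injective (side j) := fun s t h => by
  rw [← bary_side_add_one j s, h, bary_side_add_one]

theorem mem_refTriangle_iff {z : ℂ} : z ∈ refTriangle ↔ ∀ j, 0 ≤ bary j z := by
  constructor
  · intro hz j
    have hconv : Convex ℝ {z : ℂ | 0 ≤ bary j z} := by
      intro z hz w hw a b ha hb hab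
      change 0 ≤ bary j _
      rw [bary_combo j hab]
      exact add_nonneg (mul_nonneg ha hz) (mul_nonneg hb hw)
    refine convexHull_min ?_ hconv hz
    rintro _ ⟨k, rfl⟩
    change 0 ≤ bary j _
    rw [bary_corner]; split_ifs <;> norm_num
  · intro h
    have : z = ∑ j, bary j z • corner j := by
      rw [Fin.sum_univ_three]
      apply Complex.ext <;> simp [bary, corner]
    rw [this]
    refine (convex_convexHull ℝ _).sum_mem (fun j _ => h j) ?_
      fun j _ => subset_convexHull ℝ _ (mem_range_self j)
    rw [Fin.sum_univ_three]; exact bary_sum 0 z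

theorem convex_refTriangle : Convex ℝ refTriangle := convex_convexHull ℝ _

theorem isCompact_refTriangle : IsCompact refTriangle :=
  (finite_range corner).isCompact_convexHull ℝ

theorem corner_mem (j : Fin 3) : corner j ∈ refTriangle :=
  subset_convexHull ℝ _ (mem_range_self j)

theorem side_mem (j : Fin 3) {s : ℝ} (hs : s ∈ Icc (0 : ℝ) 1) : side j s ∈ refTriangle :=
  convex_refTriangle.lineMap_mem (corner_mem j) (corner_mem _) hs

theorem isOpen_bary_pos : IsOpen {z : ℂ | ∀ j, 0 < bary j z} := by
  have : {z : ℂ | ∀ j, 0 < bary j z} = ⋂ j, {z | 0 < bary j z} := by ext; simp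
  rw [this]
  exact isOpen_iInter_of_finite fun j => isOpen_lt continuous_const (continuous_bary j)

theorem mem_interior_refTriangle_iff {z : ℂ} : z ∈ interior refTriangle ↔ ∀ j, 0 < bary j z := by
  constructor
  · intro hz j
    by_contra! hneg
    have hT := mem_refTriangle_iff.1 (interior_subset hz)
    have h0 : bary j z = 0 := le_antisymm hneg (hT j)
    have hc : Continuous fun t : ℝ => (1 + t) • z + (-t) • corner j := by fun_prop
    have h1 : ∀ᶠ t : ℝ in 𝓝 0, (1 + t) • z + (-t) • corner j ∈ refTriangle :=
      hc.continuousAt.eventually (by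
        simpa using mem_interior_iff_mem_nhds.1 hz)
    obtain ⟨ε, hε, hball⟩ := Metric.eventually_nhds_iff_ball.1 h1
    have h2 := mem_refTriangle_iff.1 (hball (ε / 2) (by simp [abs_of_pos hε, hε])) j
    rw [bary_combo j (by ring), h0, bary_corner, if_pos rfl] at h2
    linarith
  · intro h
    have : {z : ℂ | ∀ j, 0 < bary j z} ⊆ refTriangle :=
      fun w hw => mem_refTriangle_iff.2 fun j => (hw j).le
    exact interior_maximal this isOpen_bary_pos h

theorem corner_notMem_interior (j : Fin 3) : corner j ∉ interior refTriangle := fun h => by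
  have := mem_interior_refTriangle_iff.1 h (j + 1)
  rw [bary_corner, if_neg (by simp)] at this
  exact lt_irrefl _ this

theorem side_notMem_interior (j : Fin 3) (s : ℝ) : side j s ∉ interior refTriangle := fun h => by
  have := mem_interior_refTriangle_iff.1 h (j + 2)
  rw [bary_side_add_two] at this
  exact lt_irrefl _ this

/-- Points of the boundary of the reference triangle lie on a side. -/
theorem exists_side_of_notMem_interior {z : ℂ} (hz : z ∈ refTriangle)
    (hi : z ∉ interior refTriangle) : ∃ j, ∃ s ∈ Icc (0 : ℝ) 1, z = side j s := by
  rw [mem_interior_refTriangle_iff] at hi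
  push Not at hi
  obtain ⟨k, hk⟩ := hi
  have hT := mem_refTriangle_iff.1 hz
  have h0 : bary (k + 1 + 2) z = 0 := by
    have : k + 1 + 2 = k := by rw [add_assoc]; simp
    rw [this]; exact le_antisymm hk (hT k)
  refine ⟨k + 1, bary (k + 1 + 1) z, ⟨hT _, ?_⟩, eq_side_of_bary h0⟩
  linarith [bary_sum (k + 1) z, hT (k + 1)]

theorem refTriangle_cases {z : ℂ} (hz : z ∈ refTriangle) : z ∈ interior refTriangle ∨
    (∃ j, ∃ s ∈ Ioo (0 : ℝ) 1, z = side j s) ∨ ∃ j, z = corner j := by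
  by_cases hi : z ∈ interior refTriangle
  · exact Or.inl hi
  obtain ⟨j, s, hs, rfl⟩ := exists_side_of_notMem_interior hz hi
  rcases hs.1.eq_or_lt with rfl | h0
  · exact Or.inr (Or.inr ⟨j, side_zero j⟩)
  rcases hs.2.eq_or_lt with rfl | h1
  · exact Or.inr (Or.inr ⟨j + 1, side_one j⟩)
  · exact Or.inr (Or.inl ⟨j, s, ⟨h0, h1⟩, rfl⟩)

theorem side_ne_corner (j k : Fin 3) {s : ℝ} (hs : s ∈ Ioo (0 : ℝ) 1) : side j s ≠ corner k := by
  intro h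
  have h0 := bary_side_self j s
  have h1 := bary_side_add_one j s
  rw [h, bary_corner] at h0 h1
  have := hs.1
  have := hs.2
  split_ifs at h0 h1 with ha hb <;> linarith

theorem bary_lipschitz (j : Fin 3) (z w : ℂ) : |bary j z - bary j w| ≤ 2 * dist z w := by
  have h1 := Complex.abs_re_le_norm (z - w)
  have h2 := Complex.abs_im_le_norm (z - w)
  rw [Complex.sub_re] at h1
  rw [Complex.sub_im] at h2
  have h0 := norm_nonneg (z - w)
  rw [dist_eq_norm]
  fin_cases j
  · change |1 - z.re - z.im - (1 - w.re - w.im)| ≤ _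
    rw [abs_le] at *
    constructor <;> linarith [h1.1, h1.2, h2.1, h2.2]
  · change |z.re - w.re| ≤ _
    linarith
  · change |z.im - w.im| ≤ _
    linarith

theorem dist_side (j : Fin 3) (s t : ℝ) : dist (side j s) (side j t) ≤ 2 * |s - t| := by
  rw [side, side, dist_lineMap_lineMap, Real.dist_eq, mul_comm]
  gcongr
  have hc : ∀ j, dist (corner j) 0 ≤ 1 := fun j => by fin_cases j <;> simp [corner]
  calc dist (corner j) (corner (j + 1)) ≤ dist (corner j) 0 + dist 0 (corner (j + 1)) :=
        dist_triangle _ _ _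
    _ ≤ 2 := by
      rw [dist_comm 0]; linarith [hc j, hc (j + 1)]

theorem interior_mem_nhdsWithin {z : ℂ} (hz : z ∈ interior refTriangle) :
    𝓝[refTriangle] z = 𝓝 z :=
  nhdsWithin_eq_nhds.2 (mem_interior_iff_mem_nhds.1 hz)

/-- The barycentre of the reference triangle. -/
noncomputable def barycenter : ℂ := ⟨1 / 3, 1 / 3⟩

theorem bary_barycenter (j : Fin 3) : bary j barycenter = 1 / 3 := by
  fin_cases j <;> norm_num [bary, barycenter]

theorem barycenter_mem_interior : barycenter ∈ interior refTriangle :=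
  mem_interior_refTriangle_iff.2 fun j => by rw [bary_barycenter]; norm_num

theorem mem_closure_interior {z : ℂ} (hz : z ∈ refTriangle) : z ∈ closure (interior refTriangle) := by
  rw [convex_refTriangle.closure_interior_eq_closure_of_nonempty_interior
    ⟨_, barycenter_mem_interior⟩]
  exact subset_closure hz

/-! ### Topology of a triangulation -/

namespace Triangulation

variable {S : Type*} [TopologicalSpace S] [ChartedSpace ℂ S] {Z : Set S} {E F : Type*}
  (τ : Triangulation S Z E F)

theorem cell_side_partner (h : F × Fin 3) {s : ℝ} (hs : s ∈ Icc (0 : ℝ) 1) :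
    τ.cell h.1 (side h.2 s) = τ.cell (τ.partner h).1 (side (τ.partner h).2 (1 - s)) :=
  τ.glue h _ (τ.partner_ne h).symm (τ.edge_partner h).symm s hs

/-- The points in the fibre of an interior point of an edge. -/
theorem fiber_side {h : F × Fin 3} {s : ℝ} (hs : s ∈ Ioo (0 : ℝ) 1) {f' : F} {z' : ℂ}
    (hz' : z' ∈ refTriangle) (he : τ.cell h.1 (side h.2 s) = τ.cell f' z') :
    (f' = h.1 ∧ z' = side h.2 s) ∨
      (f' = (τ.partner h).1 ∧ z' = side (τ.partner h).2 (1 - s)) := by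
  have hni : z' ∉ interior refTriangle := fun hi => by
    have := τ.face_inj f' h.1 z' hi _ (side_mem h.2 (Ioo_subset_Icc_self hs)) he.symm
    exact side_notMem_interior h.2 s (this.2 ▸ hi)
  obtain ⟨j', s', hs', rfl⟩ := exists_side_of_notMem_interior hz' hni
  rcases τ.edge_inj h (f', j') s hs s' hs' he with ⟨h1, h2⟩ | ⟨h1, h2, h3⟩
  · left
    subst h1
    exact ⟨rfl, by rw [h2]⟩
  · right
    have := τ.eq_partner h1 h2
    rw [← this]
    exact ⟨rfl, by rw [h3]⟩

theorem cell_mem_iff {f : F} {z : ℂ} (hz : z ∈ refTriangle) :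
    τ.cell f z ∈ Z ↔ ∃ j, z = corner j := by
  constructor
  · intro h
    obtain ⟨f', j', h'⟩ := (τ.vertices _).1 h
    rcases refTriangle_cases hz with hi | ⟨j, s, hs, rfl⟩ | hc
    · have := τ.face_inj f f' z hi _ (corner_mem j') h'.symm
      exact absurd (this.2 ▸ hi) (corner_notMem_interior j')
    · rcases τ.fiber_side (h := (f, j)) hs (corner_mem j') h'.symm with ⟨-, h1⟩ | ⟨-, h1⟩
      · exact absurd h1.symm (side_ne_corner _ _ hs)
      · exact absurd h1.symm (side_ne_corner _ _ ⟨by linarith [hs.2], by linarith [hs.1]⟩)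
    · exact hc
  · rintro ⟨j, rfl⟩
    exact (τ.vertices _).2 ⟨f, j, rfl⟩

theorem finite_vertices (τ : Triangulation S Z E F) : Z.Finite := by
  have := τ.finite_faces
  refine (finite_range fun x : F × Fin 3 => τ.cell x.1 (corner x.2)).subset fun p hp => ?_
  obtain ⟨f, j, h⟩ := (τ.vertices p).1 hp
  exact ⟨(f, j), h⟩

/-- If a property holds near all points of the fibre of `p`, then it holds on the fibres of all
points near `p`. -/
theorem eventually_fiber [T2Space S] {p : S} {Q : F → ℂ → Prop}
    (h : ∀ f, ∀ z ∈ refTriangle, τ.cell f z = p → ∀ᶠ z' in 𝓝[refTriangle] z, Q f z') :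
    ∀ᶠ q in 𝓝 p, ∀ f, ∀ z ∈ refTriangle, τ.cell f z = q → Q f z := by
  have := τ.finite_faces
  rw [eventually_all]
  intro f
  have : CompactSpace refTriangle := isCompact_iff_compactSpace.1 isCompact_refTriangle
  have hc : Continuous fun z : refTriangle => τ.cell f z :=
    continuousOn_iff_continuous_domRestrict.1 (τ.continuousOn_cell f)
  have h1 := hc.isClosedMap.eventually_nhds_fiber (p := fun z => Q f z) p fun z hz => by
    have := h f z z.2 hz
    rw [nhdsWithin_eq_map_subtype_coe z.2] at this
    exact this
  filter_upwards [h1] with q hq z hz hzq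
  exact hq ⟨z, hz⟩ hzq

theorem eventually_nhds [T2Space S] {p : S} {Q : S → Prop}
    (h : ∀ f, ∀ z ∈ refTriangle, τ.cell f z = p → ∀ᶠ z' in 𝓝[refTriangle] z, Q (τ.cell f z')) :
    ∀ᶠ q in 𝓝 p, Q q := by
  filter_upwards [τ.eventually_fiber (Q := fun f z => Q (τ.cell f z)) h] with q hq
  obtain ⟨f, z, hz, rfl⟩ := τ.covers q
  exact hq f z hz rfl

theorem tendsto_cell {f : F} {z : ℂ} (hz : z ∈ refTriangle) :
    Tendsto (τ.cell f) (𝓝[refTriangle] z) (𝓝 (τ.cell f z)) := τ.continuousOn_cell f z hz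

theorem isCompact_cell (f : F) : IsCompact (τ.cell f '' refTriangle) :=
  isCompact_refTriangle.image_of_continuousOn (τ.continuousOn_cell f)

theorem finite_fiber (p : S) : {x : F × ℂ | x.2 ∈ refTriangle ∧ τ.cell x.1 x.2 = p}.Finite := by
  have := τ.finite_faces
  obtain ⟨f, z, hz, rfl⟩ := τ.covers p
  rcases refTriangle_cases hz with hi | ⟨j, s, hs, rfl⟩ | ⟨j, rfl⟩
  · refine (finite_singleton (f, z)).subset ?_
    rintro ⟨f', z'⟩ ⟨hz', h⟩
    obtain ⟨rfl, rfl⟩ := τ.face_inj f f' z hi z' hz' h.symm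
    rfl
  · refine ((finite_singleton (f, side j s)).union (finite_singleton
      ((τ.partner (f, j)).1, side (τ.partner (f, j)).2 (1 - s)))).subset ?_
    rintro ⟨f', z'⟩ ⟨hz', h⟩
    rcases τ.fiber_side (h := (f, j)) hs hz' h.symm with ⟨h1, h2⟩ | ⟨h1, h2⟩
    · left; simp only [mem_singleton_iff]; simp only at h1 h2; rw [h1, h2]
    · right; simp only [mem_singleton_iff]; simp only at h1 h2; rw [h1, h2]
  · refine (finite_range fun x : F × Fin 3 => (x.1, corner x.2)).subset ?_
    rintro ⟨f', z'⟩ ⟨hz', h⟩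
    obtain ⟨k, hk⟩ := (τ.cell_mem_iff hz').1 (h ▸ (τ.cell_mem_iff hz).2 ⟨j, rfl⟩)
    exact ⟨(f', k), by simp only at hk ⊢; rw [hk]⟩

end Triangulation

/-! ### Connectedness -/

theorem isPreconnected_ball_diff_center (z : ℂ) {r : ℝ} (hr : 0 < r) :
    IsPreconnected (Metric.ball z r \ {z}) := by
  have hU : Convex ℝ {ξ : ℂ | ξ.re < Real.log r} := convex_halfSpace_re_lt _
  have : Metric.ball z r \ {z} = (fun ξ => z + Complex.exp ξ) '' {ξ : ℂ | ξ.re < Real.log r} := by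
    ext w
    constructor
    · rintro ⟨hw, hne⟩
      have hne' : w - z ≠ 0 := sub_ne_zero.2 hne
      refine ⟨Complex.log (w - z), ?_, by simp [Complex.exp_log hne']⟩
      change (Complex.log (w - z)).re < Real.log r
      rw [Complex.log_re]
      exact Real.log_lt_log (norm_pos_iff.2 hne') (by simpa [dist_eq_norm] using hw)
    · rintro ⟨ξ, hξ, rfl⟩
      have hξ' : ξ.re < Real.log r := hξ
      refine ⟨?_, by simp [Complex.exp_ne_zero]⟩
      simpa [dist_eq_norm, Complex.norm_exp, ← Real.lt_log_iff_exp_lt hr] using hξ'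
  rw [this]
  exact hU.isPreconnected.image _ (by fun_prop)

/-- Points of a surface have arbitrarily small neighbourhoods whose puncture is connected. -/
theorem exists_punctured_nhds {S : Type*} [TopologicalSpace S] (e : OpenPartialHomeomorph S ℂ) {p : S}
    (hp : p ∈ e.source) {U : Set S} (hU : U ∈ 𝓝 p) :
    ∃ V ∈ 𝓝 p, V ⊆ U ∧ V ⊆ e.source ∧ IsPreconnected (V \ {p}) ∧ IsOpen V ∧ p ∈ V := by
  have h1 : e.symm ⁻¹' U ∈ 𝓝 (e p) :=
    (e.continuousAt_symm (e.map_source hp)) (by rwa [e.left_inv hp])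
  obtain ⟨r, hr, hball⟩ := Metric.mem_nhds_iff.1
    (inter_mem h1 (e.open_target.mem_nhds (e.map_source hp)))
  have hsub : e.symm '' Metric.ball (e p) r ⊆ e.source := by
    rintro _ ⟨w, hw, rfl⟩
    exact e.map_target (hball hw).2
  have hopen : IsOpen (e.symm '' Metric.ball (e p) r) :=
    e.symm.isOpen_image_of_subset_source Metric.isOpen_ball fun w hw => (hball hw).2
  have hmem : p ∈ e.symm '' Metric.ball (e p) r :=
    ⟨e p, Metric.mem_ball_self hr, e.left_inv hp⟩
  refine ⟨_, hopen.mem_nhds hmem, ?_, hsub, ?_, hopen, hmem⟩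
  · rintro _ ⟨w, hw, rfl⟩
    exact (hball hw).1
  · have : (e.symm '' Metric.ball (e p) r) \ {p} = e.symm '' (Metric.ball (e p) r \ {e p}) := by
      ext q
      constructor
      · rintro ⟨⟨w, hw, rfl⟩, hne⟩
        refine ⟨w, ⟨hw, fun h => hne ?_⟩, rfl⟩
        rw [mem_singleton_iff.1 h]; exact e.left_inv hp
      · rintro ⟨w, ⟨hw, hne⟩, rfl⟩
        refine ⟨⟨w, hw, rfl⟩, fun h => hne ?_⟩
        rw [mem_singleton_iff, ← mem_singleton_iff.1 h, e.right_inv (hball hw).2]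
    rw [this]
    exact (isPreconnected_ball_diff_center _ hr).image _
      (e.continuousOn_symm.mono fun w hw => (hball hw.1).2)

namespace Triangulation

variable {S : Type*} [TopologicalSpace S] [ChartedSpace ℂ S] {Z : Set S} {E F : Type*}
  (τ : Triangulation S Z E F)

theorem nonempty_faces (τ : Triangulation S Z E F) [Nonempty S] : Nonempty F := by
  obtain ⟨f, -⟩ := τ.covers (Classical.arbitrary S)
  exact ⟨f⟩

theorem faceConnected [T2Space S] [ConnectedSpace S] : τ.toRibbonGraph.FaceConnected := by
  have := τ.finite_faces
  intro A hA hstep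
  by_contra hne
  obtain ⟨g, hg⟩ : ∃ g, g ∉ A := by
    by_contra! h; exact hne (eq_univ_of_forall h)
  let K : Set F → Set S := fun B => ⋃ f ∈ B, τ.cell f '' refTriangle
  have hK : ∀ B, IsClosed (K B) := fun B =>
    (toFinite B).isClosed_biUnion fun f _ => (τ.isCompact_cell f).isClosed
  have hcover : K A ∪ K Aᶜ = univ := by
    refine eq_univ_of_forall fun p => ?_
    obtain ⟨f, z, hz, rfl⟩ := τ.covers p
    by_cases hf : f ∈ A
    · exact Or.inl (mem_biUnion hf ⟨z, hz, rfl⟩)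
    · exact Or.inr (mem_biUnion hf ⟨z, hz, rfl⟩)
  have hstep' : ∀ h : F × Fin 3, h.1 ∈ A ↔ (τ.partner h).1 ∈ A := fun h =>
    ⟨hstep h, fun h' => by simpa [τ.partner_partner] using hstep _ h'⟩
  have hinter : ∀ p ∈ K A, p ∈ K Aᶜ → p ∈ Z := by
    intro p hp hp'
    obtain ⟨f, hf, z, hz, rfl⟩ := mem_iUnion₂.1 hp
    obtain ⟨f', hf', z', hz', he⟩ := mem_iUnion₂.1 hp'
    rcases refTriangle_cases hz with hi | ⟨j, s, hs, rfl⟩ | hc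
    · obtain ⟨rfl, -⟩ := τ.face_inj f f' z hi z' hz' he.symm
      exact absurd hf hf'
    · rcases τ.fiber_side (h := (f, j)) hs hz' he.symm with ⟨rfl, -⟩ | ⟨h1, -⟩
      · exact absurd hf hf'
      · rw [h1] at hf'
        exact absurd ((hstep' (f, j)).1 hf) hf'
    · exact (τ.cell_mem_iff hz).2 hc
  have hdisj : ∀ p ∈ K A, p ∉ K Aᶜ := by
    intro p hp hp'
    have hpZ := hinter p hp hp'
    have hU : (Z \ {p})ᶜ ∈ 𝓝 p :=
      (τ.finite_vertices.subset sdiff_subset).isClosed.isOpen_compl.mem_nhds (by simp)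
    obtain ⟨V, hV, hVU, -, hVc, -, -⟩ := exists_punctured_nhds (chartAt ℂ p) (mem_chart_source ℂ p) hU
    have hmeet : ∀ B, p ∈ K B → ((V \ {p}) ∩ K B).Nonempty := by
      intro B hB
      obtain ⟨f, hf, z, hz, hzp⟩ := mem_iUnion₂.1 hB
      have h1 : ∀ᶠ z' in 𝓝[interior refTriangle] z, τ.cell f z' ∈ V :=
        (τ.tendsto_cell hz).mono_left (nhdsWithin_mono _ interior_subset) (by rwa [hzp])
      have : (𝓝[interior refTriangle] z).NeBot := mem_closure_iff_nhdsWithin_neBot.1 (mem_closure_interior hz)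
      obtain ⟨z', h2, h3⟩ := (h1.and eventually_mem_nhdsWithin).exists
      refine ⟨τ.cell f z', ⟨h2, fun h4 => ?_⟩, mem_biUnion hf ⟨z', interior_subset h3, rfl⟩⟩
      obtain ⟨j, rfl⟩ := (τ.cell_mem_iff (interior_subset h3)).1 (mem_singleton_iff.1 h4 ▸ hpZ)
      exact corner_notMem_interior j h3
    obtain ⟨q, hq, hqA, hqA'⟩ := isPreconnected_closed_iff.1 hVc _ _ (hK A) (hK Aᶜ)
      (by rw [hcover]; exact subset_univ _) (hmeet A hp) (hmeet Aᶜ hp')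
    exact hVU hq.1 ⟨hinter q hqA hqA', hq.2⟩
  have hcl : IsClopen (K A) := by
    refine ⟨hK A, ?_⟩
    have : K A = (K Aᶜ)ᶜ := by
      ext p
      refine ⟨hdisj p, fun hp => ?_⟩
      exact ((hcover ▸ mem_univ p : p ∈ K A ∪ K Aᶜ)).resolve_right hp
    rw [this]; exact (hK _).isOpen_compl
  obtain ⟨f, hf⟩ := hA
  rcases isClopen_iff.1 hcl with h | h
  · have : τ.cell f (corner 0) ∈ K A := mem_biUnion hf ⟨_, corner_mem 0, rfl⟩
    rw [h] at this; exact this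
  · have h1 : τ.cell g (corner 0) ∈ K Aᶜ := mem_biUnion hg ⟨_, corner_mem 0, rfl⟩
    exact hdisj _ (h ▸ mem_univ _) h1

end Triangulation

/-! ### Piecewise linear primitives -/

/-- The affine map of the reference triangle to the triangle with the side vectors of `v` at the face
`f`, normalized to map `corner 0` to zero. -/
noncomputable def faceMap {F : Type*} (v : F × Fin 3 → ℂ) (f : F) (z : ℂ) : ℂ :=
  z.re * v (f, 0) - z.im * v (f, 2)

section FaceMap

variable {F : Type*} {v : F × Fin 3 → ℂ}

theorem continuous_faceMap (v : F × Fin 3 → ℂ) (f : F) : Continuous (faceMap v f) := by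
  unfold faceMap; fun_prop

theorem faceMap_sub (v : F × Fin 3 → ℂ) (f : F) (z w : ℂ) :
    faceMap v f z - faceMap v f w = faceMap v f (z - w) := by
  simp [faceMap]; ring

theorem faceMap_add (v : F × Fin 3 → ℂ) (f : F) (z w : ℂ) :
    faceMap v f (z + w) = faceMap v f z + faceMap v f w := by
  simp [faceMap]; ring

theorem faceMap_smul (v : F × Fin 3 → ℂ) (f : F) (r : ℝ) (z : ℂ) :
    faceMap v f (r • z) = r * faceMap v f z := by
  simp [faceMap]; ring

theorem faceMap_sub_corner (hv : ∀ f, ∑ j, v (f, j) = 0) (f : F) (j : Fin 3) :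
    faceMap v f (corner (j + 1)) - faceMap v f (corner j) = v (f, j) := by
  have h := hv f
  rw [Fin.sum_univ_three] at h
  fin_cases j <;> simp [faceMap, corner]
  linear_combination -h

/-- Coordinates of a point of a triangle with respect to the sides at a corner. -/
theorem faceMap_sub_corner_eq (hv : ∀ f, ∑ j, v (f, j) = 0) (f : F) (j : Fin 3) (z : ℂ) :
    faceMap v f z - faceMap v f (corner j) = bary (j + 1) z * v (f, j) - bary (j + 2) z * v (f, j + 2) := by
  have h := hv f
  rw [Fin.sum_univ_three] at h
  fin_cases j <;> simp [faceMap, corner, bary]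
  · linear_combination -h * z.im
  · linear_combination (z.re : ℂ) * h

theorem faceMap_side_sub (hv : ∀ f, ∑ j, v (f, j) = 0) (f : F) (j : Fin 3) (s t : ℝ) :
    faceMap v f (side j s) - faceMap v f (side j t) = ((s - t : ℝ) : ℂ) * v (f, j) := by
  have h1 := faceMap_sub_corner_eq hv f j (side j s)
  have h2 := faceMap_sub_corner_eq hv f j (side j t)
  rw [bary_side_add_one, bary_side_add_two] at h1 h2
  push_cast
  linear_combination h1 - h2

/-- The inverse of `faceMap`. -/
noncomputable def faceInv (v : F × Fin 3 → ℂ) (f : F) (w : ℂ) : ℂ :=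
  ⟨cross (v (f, 2)) w / cross (v (f, 2)) (v (f, 0)), cross (v (f, 0)) w / cross (v (f, 2)) (v (f, 0))⟩

theorem continuous_faceInv (v : F × Fin 3 → ℂ) (f : F) : Continuous (faceInv v f) := by
  have h : faceInv v f = fun w => (cross (v (f, 2)) w / cross (v (f, 2)) (v (f, 0)) : ℝ) +
      (cross (v (f, 0)) w / cross (v (f, 2)) (v (f, 0)) : ℝ) * Complex.I := by
    ext w; exact Complex.mk_eq_add_mul_I _ _
  rw [h]; unfold cross; fun_prop

theorem faceInv_zero (v : F × Fin 3 → ℂ) (f : F) : faceInv v f 0 = 0 := by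
  simp [faceInv, cross, Complex.ext_iff]

theorem RibbonGraph.IsPositive.cross_two_zero (hp : RibbonGraph.IsPositive v) (f : F) :
    0 < cross (v (f, 2)) (v (f, 0)) := hp (f, 2)

theorem faceMap_faceInv_of_cross_ne {f : F} (h : cross (v (f, 2)) (v (f, 0)) ≠ 0) (w : ℂ) :
    faceMap v f (faceInv v f w) = w := by
  have h' : (v (f, 2)).re * (v (f, 0)).im - (v (f, 2)).im * (v (f, 0)).re ≠ 0 := h
  apply Complex.ext
  · simp only [faceMap, faceInv, cross, Complex.sub_re, Complex.mul_re, Complex.ofReal_re,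
      Complex.ofReal_im, zero_mul, sub_zero]
    field_simp
    ring
  · simp only [faceMap, faceInv, cross, Complex.sub_im, Complex.mul_im, Complex.ofReal_re,
      Complex.ofReal_im, zero_mul, add_zero]
    field_simp
    ring

theorem faceMap_faceInv (hp : RibbonGraph.IsPositive v) (f : F) (w : ℂ) :
    faceMap v f (faceInv v f w) = w :=
  faceMap_faceInv_of_cross_ne (hp.cross_two_zero f).ne' w

theorem faceMap_injective_of_cross_ne {f : F} (hc : cross (v (f, 2)) (v (f, 0)) ≠ 0) :
    Function.Injective (faceMap v f) := by
  intro z w h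
  have h0 : faceMap v f (z - w) = 0 := by rw [← faceMap_sub, h, sub_self]
  set u := z - w with hu
  have h1 : u.re * cross (v (f, 2)) (v (f, 0)) = cross (v (f, 2)) (faceMap v f u) := by
    simp only [faceMap, cross, Complex.sub_im, Complex.mul_im, Complex.ofReal_re,
      Complex.ofReal_im, Complex.sub_re, Complex.mul_re]; ring
  have h2 : u.im * cross (v (f, 2)) (v (f, 0)) = cross (v (f, 0)) (faceMap v f u) := by
    simp only [faceMap, cross, Complex.sub_im, Complex.mul_im, Complex.ofReal_re,
      Complex.ofReal_im, Complex.sub_re, Complex.mul_re]; ring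
  rw [h0] at h1 h2
  have e : ∀ a, cross a 0 = 0 := fun a => by simp [cross]
  rw [e] at h1 h2
  have : u = 0 := Complex.ext ((mul_eq_zero.1 h1).resolve_right hc)
    ((mul_eq_zero.1 h2).resolve_right hc)
  rwa [hu, sub_eq_zero] at this

theorem faceMap_injective (hp : RibbonGraph.IsPositive v) (f : F) :
    Function.Injective (faceMap v f) :=
  faceMap_injective_of_cross_ne (hp.cross_two_zero f).ne'

theorem faceInv_faceMap (hp : RibbonGraph.IsPositive v) (f : F) (z : ℂ) :
    faceInv v f (faceMap v f z) = z :=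
  faceMap_injective hp f (faceMap_faceInv hp f _)

/-- The triangle lies to the left of each side. -/
theorem cross_faceMap_sub_side (hv : ∀ f, ∑ j, v (f, j) = 0) (f : F) (j : Fin 3) (z : ℂ) (s : ℝ) :
    cross (v (f, j)) (faceMap v f z - faceMap v f (side j s)) =
      bary (j + 2) z * cross (v (f, j + 2)) (v (f, j)) := by
  have h1 := faceMap_sub_corner_eq hv f j z
  have h2 := faceMap_sub_corner_eq hv f j (side j s)
  rw [bary_side_add_one, bary_side_add_two, Complex.ofReal_zero, zero_mul, sub_zero] at h2
  have : faceMap v f z - faceMap v f (side j s) =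
      (bary (j + 1) z - s : ℝ) * v (f, j) - bary (j + 2) z * v (f, j + 2) := by
    push_cast; linear_combination h1 - h2
  rw [this]
  simp only [cross, Complex.sub_im, Complex.mul_im, Complex.ofReal_re,
      Complex.ofReal_im, Complex.sub_re, Complex.mul_re]; ring

theorem RibbonGraph.IsPositive.cross_add_two (hp : RibbonGraph.IsPositive v) (f : F) (j : Fin 3) :
    0 < cross (v (f, j + 2)) (v (f, j)) := by
  have := hp (f, j + 2)
  rwa [RibbonGraph.shift, add_assoc, show (2 + 1 : Fin 3) = 0 from rfl, add_zero] at this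

/-- Near an interior point of a side, a triangle is a half plane. -/
theorem eventually_half_plane (hv : ∀ f, ∑ j, v (f, j) = 0) (hp : RibbonGraph.IsPositive v)
    {h : F × Fin 3} {s : ℝ} (hs : s ∈ Ioo (0 : ℝ) 1) {Q : ℂ → Prop}
    (hQ : ∀ᶠ z in 𝓝[refTriangle] (side h.2 s), Q z) :
    ∀ᶠ u in 𝓝 (0 : ℂ), 0 ≤ cross (v h) u →
      (side h.2 s + faceInv v h.1 u ∈ refTriangle ∧ Q (side h.2 s + faceInv v h.1 u)) := by
  have hc : Continuous fun u => side h.2 s + faceInv v h.1 u :=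
    continuous_const.add (continuous_faceInv v h.1)
  have h0 : side h.2 s + faceInv v h.1 0 = side h.2 s := by rw [faceInv_zero, add_zero]
  have ht : Tendsto (fun u => side h.2 s + faceInv v h.1 u) (𝓝 0) (𝓝 (side h.2 s)) :=
    hc.tendsto' _ _ h0
  have hb : ∀ k, 0 < bary k (side h.2 s) → ∀ᶠ u in 𝓝 (0 : ℂ), 0 < bary k (side h.2 s + faceInv v h.1 u) :=
    fun k hk => ht.eventually ((continuous_bary k).continuousAt.eventually (lt_mem_nhds hk))
  have hb1 := hb h.2 (by rw [bary_side_self]; linarith [hs.2])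
  have hb2 := hb (h.2 + 1) (by rw [bary_side_add_one]; exact hs.1)
  rw [eventually_nhdsWithin_iff] at hQ
  have hQ' : ∀ᶠ u in 𝓝 (0 : ℂ), side h.2 s + faceInv v h.1 u ∈ refTriangle →
      Q (side h.2 s + faceInv v h.1 u) := ht.eventually hQ
  filter_upwards [hb1, hb2, hQ'] with u h1 h2 h3 hu
  have hmem : side h.2 s + faceInv v h.1 u ∈ refTriangle := by
    rw [mem_refTriangle_iff]
    have h4 := cross_faceMap_sub_side hv h.1 h.2 (side h.2 s + faceInv v h.1 u) s
    rw [faceMap_add, faceMap_faceInv hp, add_sub_cancel_left] at h4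
    have h5 : 0 ≤ bary (h.2 + 2) (side h.2 s + faceInv v h.1 u) := by
      have h6 := hp.cross_add_two h.1 h.2
      rw [show v (h.1, h.2) = v h from rfl] at h4 h6
      rw [h4] at hu
      exact nonneg_of_mul_nonneg_left hu h6
    have h7 : ∀ k j : Fin 3, k = j ∨ k = j + 1 ∨ k = j + 2 := by decide
    intro k
    rcases h7 k h.2 with rfl | rfl | rfl
    exacts [h1.le, h2.le, h5]
  exact ⟨hmem, h3 hmem⟩

end FaceMap

namespace Triangulation

variable {S : Type*} [TopologicalSpace S] [ChartedSpace ℂ S] {Z : Set S} {E F : Type*}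
  (τ : Triangulation S Z E F)

/-- The value of `faceMap` as a linear functional of the side vectors. -/
noncomputable def faceFunctional (f : F) (z : ℂ) : τ.cycleSpace →ₗ[ℂ] ℂ where
  toFun v := faceMap v f z
  map_add' v w := by simp [faceMap]; ring
  map_smul' c v := by simp [faceMap]; ring

theorem exists_fiber_separation (p : S) : ∃ δ > 0,
    (∀ f, ∀ z ∈ refTriangle, τ.cell f z = p → ∀ z' ∈ refTriangle, τ.cell f z' = p →
      dist z z' < 10 * δ → z = z') ∧
    ∀ f, ∀ z ∈ refTriangle, τ.cell f z = p → ∀ j, bary j z < 10 * δ → bary j z = 0 := by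
  set Φ := {x : F × ℂ | x.2 ∈ refTriangle ∧ τ.cell x.1 x.2 = p} with hΦ
  have hfin : Φ.Finite := τ.finite_fiber p
  have ht : Tendsto (fun δ : ℝ => 10 * δ) (𝓝[>] 0) (𝓝 0) :=
    (Continuous.tendsto' (by fun_prop) 0 0 (by simp)).mono_left nhdsWithin_le_nhds
  have h1 : ∀ᶠ δ : ℝ in 𝓝[>] 0, ∀ x ∈ Φ, ∀ y ∈ Φ, dist x.2 y.2 < 10 * δ → x.2 = y.2 := by
    refine (eventually_all_finite hfin).2 fun x _ => (eventually_all_finite hfin).2 fun y _ => ?_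
    by_cases hxy : x.2 = y.2
    · exact Eventually.of_forall fun _ _ => hxy
    · filter_upwards [ht.eventually (gt_mem_nhds (dist_pos.2 hxy))] with δ hδ h
      exact absurd h (not_lt.2 hδ.le)
  have h2 : ∀ᶠ δ : ℝ in 𝓝[>] 0, ∀ x ∈ Φ, ∀ j, bary j x.2 < 10 * δ → bary j x.2 = 0 := by
    refine (eventually_all_finite hfin).2 fun x hx => eventually_all.2 fun j => ?_
    rcases (mem_refTriangle_iff.1 hx.1 j).eq_or_lt with h | h
    · exact Eventually.of_forall fun _ _ => h.symm
    · filter_upwards [ht.eventually (gt_mem_nhds h)] with δ hδ h'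
      exact absurd h' (not_lt.2 hδ.le)
  obtain ⟨δ, ⟨h3, h4⟩, h5⟩ := ((h1.and h2).and (eventually_mem_nhdsWithin (s := Ioi (0 : ℝ)))).exists
  exact ⟨δ, h5, fun f z hz hzp z' hz' hzp' h => h3 (f, z) ⟨hz, hzp⟩ (f, z') ⟨hz', hzp'⟩ h,
    fun f z hz hzp j h => h4 (f, z) ⟨hz, hzp⟩ j h⟩

/-- Near every point the affine maps of the faces fit together to a function, depending linearly on
the side vectors. -/
theorem exists_localPrimitive (p : S) : ∃ P : S → (τ.cycleSpace →ₗ[ℂ] ℂ),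
    ∀ f, ∀ z ∈ refTriangle, τ.cell f z = p → ∀ᶠ z' in 𝓝[refTriangle] z,
      P (τ.cell f z') = τ.faceFunctional f z' - τ.faceFunctional f z := by
  classical
  obtain ⟨δ, hδ, hsep, hbary⟩ := τ.exists_fiber_separation p
  let C : S → F × ℂ × ℂ → Prop := fun q x => x.2.1 ∈ refTriangle ∧ τ.cell x.1 x.2.1 = p ∧
    x.2.2 ∈ refTriangle ∧ τ.cell x.1 x.2.2 = q ∧ dist x.2.1 x.2.2 < δ
  have key : ∀ q x y, C q x → C q y →
      τ.faceFunctional x.1 x.2.2 - τ.faceFunctional x.1 x.2.1 =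
        τ.faceFunctional y.1 y.2.2 - τ.faceFunctional y.1 y.2.1 := by
    rintro q ⟨f₁, z₁, z₁'⟩ ⟨f₂, z₂, z₂'⟩ ⟨hz₁, hp₁, hz₁', hq₁, hd₁⟩ ⟨hz₂, hp₂, hz₂', hq₂, hd₂⟩
    simp only at *
    have hsame : f₁ = f₂ → z₁' = z₂' → τ.faceFunctional f₁ z₁' - τ.faceFunctional f₁ z₁ =
        τ.faceFunctional f₂ z₂' - τ.faceFunctional f₂ z₂ := by
      rintro rfl rfl
      have : z₁ = z₂ := hsep f₁ z₁ hz₁ hp₁ z₂ hz₂ hp₂ (by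
        have := dist_triangle_right z₁ z₂ z₁'
        linarith)
      rw [this]
    have hbd : ∀ k, bary k z₁' = 0 → bary k z₁ = 0 := fun k hk => by
      refine hbary f₁ z₁ hz₁ hp₁ k ?_
      have := bary_lipschitz k z₁ z₁'
      rw [hk, sub_zero] at this
      linarith [le_abs_self (bary k z₁)]
    rcases refTriangle_cases hz₁' with hi | ⟨j, s, hs, rfl⟩ | ⟨j, rfl⟩
    · obtain ⟨h1, h2⟩ := τ.face_inj f₁ f₂ z₁' hi z₂' hz₂' (hq₁.trans hq₂.symm)
      exact hsame h1 h2
    · rcases τ.fiber_side (h := (f₁, j)) hs hz₂' (hq₁.trans hq₂.symm) with ⟨h1, h2⟩ | ⟨h1, h2⟩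
      · exact hsame h1.symm h2.symm
      · have h3 := eq_side_of_bary (hbd (j + 2) (bary_side_add_two j s))
        set s₀ := bary (j + 1) z₁ with hs₀
        have hs₀I : s₀ ∈ Icc (0 : ℝ) 1 := by
          refine ⟨mem_refTriangle_iff.1 hz₁ _, ?_⟩
          linarith [bary_sum j z₁, mem_refTriangle_iff.1 hz₁ j, mem_refTriangle_iff.1 hz₁ (j + 2)]
        have h4 := τ.cell_side_partner (f₁, j) hs₀I
        have hss : |s - s₀| ≤ 2 * δ := by
          have := bary_lipschitz (j + 1) z₁ (side j s)
          rw [bary_side_add_one, ← hs₀, abs_sub_comm] at this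
          linarith
        have h5 : z₂ = side (τ.partner (f₁, j)).2 (1 - s₀) := by
          refine hsep f₂ z₂ hz₂ hp₂ _ (side_mem _ ⟨by linarith [hs₀I.2], by linarith [hs₀I.1]⟩) ?_ ?_
          · rw [h1, ← h4, ← hp₁, ← h3]
          · have e1 := dist_side (τ.partner (f₁, j)).2 (1 - s) (1 - s₀)
            rw [← h2, show 1 - s - (1 - s₀) = -(s - s₀) by ring, abs_neg] at e1
            have e2 := dist_triangle z₂ z₂' (side (τ.partner (f₁, j)).2 (1 - s₀))
            linarith
        ext v
        change faceMap v f₁ (side j s) - faceMap v f₁ z₁ = faceMap v f₂ z₂' - faceMap v f₂ z₂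
        rw [h5, h2, h1, h3, faceMap_side_sub v.2.1, faceMap_side_sub v.2.1]
        have h6 : (v : F × Fin 3 → ℂ) ((τ.partner (f₁, j)).1, (τ.partner (f₁, j)).2) =
          -(v : F × Fin 3 → ℂ) (f₁, j) := v.2.2 (f₁, j)
        rw [h6]; push_cast; ring
    · have h1 : z₁ = corner j := by
        refine bary_ext (j + 1) ?_ ?_
        · rw [hbd (j + 1) (by rw [bary_corner]; simp), bary_corner]; simp
        · rw [hbd (j + 1 + 1) (by rw [bary_corner]; simp [add_assoc]), bary_corner]
          simp [add_assoc]
      have h2 : z₂ = z₂' := hsep f₂ z₂ hz₂ hp₂ z₂' hz₂' (by rw [hq₂, ← hq₁, ← h1, hp₁]) (by linarith)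
      rw [h1, h2, sub_self, sub_self]
  refine ⟨fun q => if h : ∃ x, C q x then τ.faceFunctional h.choose.1 h.choose.2.2 -
    τ.faceFunctional h.choose.1 h.choose.2.1 else 0, fun f z hz hzp => ?_⟩
  filter_upwards [eventually_mem_nhdsWithin, nhdsWithin_le_nhds (Metric.ball_mem_nhds z hδ)]
    with z' hz' hd
  have hC : C (τ.cell f z') (f, z, z') := ⟨hz, hzp, hz', rfl, by rwa [dist_comm]⟩
  have hex : ∃ x, C (τ.cell f z') x := ⟨_, hC⟩
  rw [dif_pos hex]
  exact key _ _ _ hex.choose_spec hC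

/-- `P` is a primitive, on the faces near `q`, of the flat metric with side vectors `v`. -/
def IsFlatAt (v : F × Fin 3 → ℂ) (P : S → ℂ) (q : S) : Prop :=
  ∀ f, ∀ z ∈ refTriangle, τ.cell f z = q → ∀ᶠ z' in 𝓝[refTriangle] z,
    P (τ.cell f z') - P q = faceMap v f z' - faceMap v f z

theorem exists_isFlatAt {v : F × Fin 3 → ℂ} (hv : v ∈ τ.cycleSpace) (p : S) :
    ∃ P : S → ℂ, P p = 0 ∧ τ.IsFlatAt v P p := by
  obtain ⟨P, hP⟩ := τ.exists_localPrimitive p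
  have h0 : P p ⟨v, hv⟩ = 0 := by
    obtain ⟨f, z, hz, rfl⟩ := τ.covers p
    rw [(hP f z hz rfl).self_of_nhdsWithin hz, sub_self, LinearMap.zero_apply]
  refine ⟨fun q => P q ⟨v, hv⟩, h0, fun f z hz hzp => ?_⟩
  filter_upwards [hP f z hz hzp] with z' hz'
  rw [h0, hz', sub_zero]
  rfl

section Flat

variable {τ} {v : F × Fin 3 → ℂ} {P : S → ℂ} {q : S}

theorem IsFlatAt.eventually [T2Space S] (h : τ.IsFlatAt v P q) : ∀ᶠ q' in 𝓝 q, τ.IsFlatAt v P q' := by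
  refine τ.eventually_fiber (Q := fun f z => ∀ᶠ z' in 𝓝[refTriangle] z,
    P (τ.cell f z') - P (τ.cell f z) = faceMap v f z' - faceMap v f z) (fun f z hz hzq => ?_)
      |>.mono fun q' hq' f z hz hzq => ?_
  · filter_upwards [eventually_eventually_nhdsWithin.2 (h f z hz hzq), h f z hz hzq] with z' h1 h2
    filter_upwards [h1] with z'' h3
    linear_combination h3 - h2
  · simpa only [hzq] using hq' f z hz hzq

theorem IsFlatAt.continuousAt [T2Space S] (h : τ.IsFlatAt v P q) : ContinuousAt P q := by
  rw [ContinuousAt, Metric.tendsto_nhds]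
  intro ε hε
  refine τ.eventually_nhds fun f z hz hzq => ?_
  have h1 : ∀ᶠ z' in 𝓝[refTriangle] z, dist (faceMap v f z') (faceMap v f z) < ε :=
    nhdsWithin_le_nhds ((continuous_faceMap v f).continuousAt.eventually (Metric.ball_mem_nhds _ hε))
  filter_upwards [h1, h f z hz hzq] with z' h2 h3
  rwa [dist_eq_norm, h3, ← dist_eq_norm]

theorem IsFlatAt.eventually_ne [T2Space S] (h : τ.IsFlatAt v P q) (hp : RibbonGraph.IsPositive v) :
    ∀ᶠ q' in 𝓝 q, P q' = P q → q' = q := by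
  refine τ.eventually_nhds fun f z hz hzq => ?_
  filter_upwards [h f z hz hzq] with z' h1 h2
  rw [h2, sub_self] at h1
  rw [faceMap_injective hp f (sub_eq_zero.1 h1.symm), hzq]

theorem IsFlatAt.nhds_le (h : τ.IsFlatAt v P q) (hv : v ∈ τ.cycleSpace)
    (hp : RibbonGraph.IsPositive v) (hq : q ∉ Z) : 𝓝 (P q) ≤ map P (𝓝 q) := by
  intro N hN
  have hN' : ∀ᶠ q' in 𝓝 q, P q' ∈ N := hN
  have hsub : Tendsto (fun w => w - P q) (𝓝 (P q)) (𝓝 0) :=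
    Continuous.tendsto' (by fun_prop) _ _ (sub_self _)
  have aux : ∀ f, ∀ z ∈ refTriangle, τ.cell f z = q →
      ∀ᶠ z' in 𝓝[refTriangle] z, P q + (faceMap v f z' - faceMap v f z) ∈ N := by
    intro f z hz hzq
    filter_upwards [h f z hz hzq, (hzq ▸ τ.tendsto_cell hz).eventually hN'] with z' h1 h2
    rwa [← h1, add_sub_cancel]
  obtain ⟨f, z, hz, hzq⟩ := τ.covers q
  rcases refTriangle_cases hz with hi | ⟨j, s, hs, rfl⟩ | hc
  · have h1 := aux f z hz hzq
    rw [interior_mem_nhdsWithin hi] at h1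
    have hc : Continuous fun u => z + faceInv v f u :=
      continuous_const.add (continuous_faceInv v f)
    have h2 : Tendsto (fun u => z + faceInv v f u) (𝓝 0) (𝓝 z) :=
      hc.tendsto' 0 z (by rw [faceInv_zero, add_zero])
    filter_upwards [hsub.eventually (h2.eventually h1)] with w hw
    rw [faceMap_add, faceMap_faceInv hp] at hw
    simpa using hw
  · have h1 := eventually_half_plane hv.1 hp (h := (f, j)) hs (aux f _ hz hzq)
    have hs' : 1 - s ∈ Ioo (0 : ℝ) 1 := ⟨by linarith [hs.2], by linarith [hs.1]⟩
    have h2 := eventually_half_plane hv.1 hp (h := τ.partner (f, j)) hs'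
      (aux (τ.partner (f, j)).1 _ (side_mem _ (Ioo_subset_Icc_self hs'))
        ((τ.cell_side_partner (f, j) (Ioo_subset_Icc_self hs)).symm.trans hzq))
    filter_upwards [hsub.eventually h1, hsub.eventually h2] with w h3 h4
    rcases le_total 0 (cross (v (f, j)) (w - P q)) with h5 | h5
    · have h6 := (h3 h5).2
      rw [faceMap_add, faceMap_faceInv hp] at h6
      simpa using h6
    · have h6 := (h4 (by rw [hv.2]; simp only [cross, Complex.neg_re, Complex.neg_im] at h5 ⊢; linarith)).2
      rw [faceMap_add, faceMap_faceInv hp] at h6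
      simpa using h6
  · exact absurd ((τ.cell_mem_iff hz).2 hc) (hzq ▸ hq)

theorem IsFlatAt.exists_injOn [T2Space S] (h : τ.IsFlatAt v P q) (hv : v ∈ τ.cycleSpace)
    (hp : RibbonGraph.IsPositive v) (hq : q ∉ Z) : ∃ N ∈ 𝓝 q, InjOn P N := by
  obtain ⟨f, z, hz, hzq⟩ := τ.covers q
  have hlocal : ∀ {f z z₁ z₂}, P (τ.cell f z₁) - P q = faceMap v f z₁ - faceMap v f z →
      P (τ.cell f z₂) - P q = faceMap v f z₂ - faceMap v f z →
      P (τ.cell f z₁) = P (τ.cell f z₂) → τ.cell f z₁ = τ.cell f z₂ := by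
    intro f z z₁ z₂ h1 h2 h3
    rw [faceMap_injective hp f (a₁ := z₁) (a₂ := z₂) (by linear_combination h2 - h1 + h3)]
  rcases refTriangle_cases hz with hi | ⟨j, s, hs, rfl⟩ | hc
  · have h1 := τ.eventually_fiber (p := q) (Q := fun f' z' => f' = f ∧
      P (τ.cell f z') - P q = faceMap v f z' - faceMap v f z) (fun f' z' hz' hzq' => by
        obtain ⟨rfl, rfl⟩ := τ.face_inj f f' z hi z' hz' (hzq.trans hzq'.symm)
        filter_upwards [h f z hz hzq] with w hw
        exact ⟨rfl, hw⟩)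
    refine ⟨_, h1, fun q₁ hq₁ q₂ hq₂ he => ?_⟩
    obtain ⟨f₁, z₁, hz₁, rfl⟩ := τ.covers q₁
    obtain ⟨f₂, z₂, hz₂, rfl⟩ := τ.covers q₂
    obtain ⟨rfl, h2⟩ := hq₁ f₁ z₁ hz₁ rfl
    obtain ⟨rfl, h3⟩ := hq₂ f₂ z₂ hz₂ rfl
    exact hlocal h2 h3 he
  · set h' := τ.partner (f, j) with hh'
    have hs' : 1 - s ∈ Ioo (0 : ℝ) 1 := ⟨by linarith [hs.2], by linarith [hs.1]⟩
    have hzq' : τ.cell h'.1 (side h'.2 (1 - s)) = q :=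
      (τ.cell_side_partner (f, j) (Ioo_subset_Icc_self hs)).symm.trans hzq
    have h1 := τ.eventually_fiber (p := q) (Q := fun g z' => (g = f ∧
      P (τ.cell f z') - P q = faceMap v f z' - faceMap v f (side j s)) ∨ (g = h'.1 ∧
      P (τ.cell h'.1 z') - P q = faceMap v h'.1 z' - faceMap v h'.1 (side h'.2 (1 - s))))
      (fun g z' hz' hzq'' => by
        rcases τ.fiber_side (h := (f, j)) hs hz' (hzq.trans hzq''.symm) with ⟨h1, h2⟩ | ⟨h1, h2⟩ <;>
          rw [h1, h2]
        · filter_upwards [h f _ hz hzq] with w hw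
          exact Or.inl ⟨rfl, hw⟩
        · filter_upwards [h h'.1 _ (side_mem _ (Ioo_subset_Icc_self hs')) hzq'] with w hw
          exact Or.inr ⟨rfl, hw⟩)
    have hmixed : ∀ {z₁ z₂}, z₁ ∈ refTriangle → z₂ ∈ refTriangle →
        P (τ.cell f z₁) - P q = faceMap v f z₁ - faceMap v f (side j s) →
        P (τ.cell h'.1 z₂) - P q = faceMap v h'.1 z₂ - faceMap v h'.1 (side h'.2 (1 - s)) →
        P (τ.cell f z₁) = P (τ.cell h'.1 z₂) → τ.cell f z₁ = τ.cell h'.1 z₂ := by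
      intro z₁ z₂ hz₁ hz₂ h2 h3 h4
      have e1 := cross_faceMap_sub_side hv.1 f j z₁ s
      have e2 := cross_faceMap_sub_side hv.1 h'.1 h'.2 z₂ (1 - s)
      have hvh : v (h'.1, h'.2) = -v (f, j) := hv.2 (f, j)
      have hd : faceMap v h'.1 z₂ - faceMap v h'.1 (side h'.2 (1 - s)) =
          faceMap v f z₁ - faceMap v f (side j s) := by rw [← h2, ← h3, h4]
      have e3 : cross (v (h'.1, h'.2)) (faceMap v f z₁ - faceMap v f (side j s)) =
          -cross (v (f, j)) (faceMap v f z₁ - faceMap v f (side j s)) := by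
        rw [hvh]; simp only [cross, Complex.neg_re, Complex.neg_im]; ring
      rw [hd, e3, e1] at e2
      have p1 := hp.cross_add_two f j
      have p2 := hp.cross_add_two h'.1 h'.2
      have b1 := mem_refTriangle_iff.1 hz₁ (j + 2)
      have b2 := mem_refTriangle_iff.1 hz₂ (h'.2 + 2)
      have c1 : bary (j + 2) z₁ = 0 := by
        have := mul_nonneg b1 p1.le
        have := mul_nonneg b2 p2.le
        exact (mul_eq_zero.1 (by linarith)).resolve_right p1.ne'
      have c2 : bary (h'.2 + 2) z₂ = 0 := by
        rw [c1, zero_mul, neg_zero] at e2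
        exact (mul_eq_zero.1 e2.symm).resolve_right p2.ne'
      have d1 := eq_side_of_bary c1
      have d2 := eq_side_of_bary c2
      set s₁ := bary (j + 1) z₁ with hs₁
      set s₂ := bary (h'.2 + 1) z₂ with hs₂
      rw [d1, d2, faceMap_side_sub hv.1, faceMap_side_sub hv.1, hvh] at hd
      have hss : s₂ = 1 - s₁ := by
        have h5 : ((s₂ - (1 - s) + (s₁ - s) : ℝ) : ℂ) * v (f, j) = 0 := by
          push_cast at hd ⊢; linear_combination -hd
        have h6 := (mul_eq_zero.1 h5).resolve_right (hp.ne_zero _)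
        have h7 : s₂ - (1 - s) + (s₁ - s) = 0 := by exact_mod_cast h6
        linarith
      rw [d1, d2, hss]
      refine τ.cell_side_partner (f, j) ⟨mem_refTriangle_iff.1 hz₁ _, ?_⟩
      linarith [bary_sum j z₁, mem_refTriangle_iff.1 hz₁ j]
    refine ⟨_, h1, fun q₁ hq₁ q₂ hq₂ he => ?_⟩
    obtain ⟨f₁, z₁, hz₁, rfl⟩ := τ.covers q₁
    obtain ⟨f₂, z₂, hz₂, rfl⟩ := τ.covers q₂
    rcases hq₁ f₁ z₁ hz₁ rfl with ⟨h2, h3⟩ | ⟨h2, h3⟩ <;>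
      rcases hq₂ f₂ z₂ hz₂ rfl with ⟨h4, h5⟩ | ⟨h4, h5⟩ <;> rw [h2, h4] at he ⊢
    · exact hlocal h3 h5 he
    · exact hmixed hz₁ hz₂ h3 h5 he
    · exact (hmixed hz₂ hz₁ h5 h3 he.symm).symm
    · exact hlocal h3 h5 he
  · exact absurd ((τ.cell_mem_iff hz).2 hc) (hzq ▸ hq)

end Flat

end Triangulation

/-- A function that is locally injective, continuous and open near `p` is a chart near `p`. -/
theorem exists_openPartialHomeomorph {S : Type*} [TopologicalSpace S] {P : S → ℂ} {p : S}
    {N : Set S} (hN : N ∈ 𝓝 p) (hi : InjOn P N)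
    (h : ∀ᶠ q in 𝓝 p, ContinuousAt P q ∧ 𝓝 (P q) ≤ map P (𝓝 q)) :
    ∃ e : OpenPartialHomeomorph S ℂ, p ∈ e.source ∧ e.source ⊆ N ∧ ⇑e = P := by
  have : Nonempty S := ⟨p⟩
  obtain ⟨U, hU, hUo, hpU⟩ := eventually_nhds_iff.1 (h.and hN)
  have hUN : U ⊆ N := fun q hq => (hU q hq).2
  refine ⟨OpenPartialHomeomorph.ofContinuousOpenRestrict ((hi.mono hUN).toPartialEquiv P U)
    (fun q hq => (hU q hq).1.1.continuousWithinAt) ?_ hUo, hpU, hUN, rfl⟩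
  rw [isOpenMap_iff_nhds_le]
  rintro ⟨q, hq⟩
  have hq' : q ∈ U := hq
  have key : map (U.domRestrict P) (𝓝 ⟨q, hq'⟩) = map P (𝓝 q) := by
    rw [domRestrict_eq, ← Filter.map_map, map_nhds_subtype_coe_eq_nhds hq' (hUo.mem_nhds hq')]
  exact (hU q hq').1.2.trans key.ge

/-! ### Isolated branch points -/

/-- The punctured disk of radius `ρ` around zero. -/
def puncturedDisk (ρ : ℝ) : Set ℂ := {w | w ≠ 0 ∧ ‖w‖ < ρ}

/-- The preimage of the punctured disk of radius `ρ` under the exponential function. -/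
def logDisk (ρ : ℝ) : Set ℂ := {ξ | Real.exp ξ.re < ρ}

theorem exp_mem_puncturedDisk {ρ : ℝ} {ξ : ℂ} : Complex.exp ξ ∈ puncturedDisk ρ ↔ ξ ∈ logDisk ρ := by
  simp only [puncturedDisk, logDisk, Set.mem_ofPred_eq, Complex.norm_exp, ne_eq, Complex.exp_ne_zero,
    not_false_eq_true, true_and]

theorem isOpen_logDisk (ρ : ℝ) : IsOpen (logDisk ρ) :=
  isOpen_lt (by fun_prop) continuous_const

theorem convex_logDisk {ρ : ℝ} (hρ : 0 < ρ) : Convex ℝ (logDisk ρ) := by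
  have : logDisk ρ = {ξ | ξ.re < Real.log ρ} := by
    ext ξ; exact (Real.lt_log_iff_exp_lt hρ).symm
  rw [this]
  exact convex_halfSpace_re_lt _

/-- The exponential function from `logDisk` to `puncturedDisk`. -/
noncomputable def expDisk (ρ : ℝ) : C(logDisk ρ, puncturedDisk ρ) :=
  ⟨fun ξ => ⟨Complex.exp ξ, exp_mem_puncturedDisk.2 ξ.2⟩, by fun_prop⟩

/-- Translation of `logDisk` by a multiple of the period of the exponential function. -/
noncomputable def logTranslate (ρ : ℝ) (k : ℤ) : C(logDisk ρ, logDisk ρ) :=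
  ⟨fun ξ => ⟨ξ + k * (2 * Real.pi * Complex.I), by
    have h : Real.exp ξ.1.re < ρ := ξ.2
    change Real.exp (ξ.1 + k * (2 * Real.pi * Complex.I)).re < ρ
    simpa using h⟩, by fun_prop⟩

theorem coe_logTranslate {ρ : ℝ} (k : ℤ) (ξ : logDisk ρ) :
    (logTranslate ρ k ξ : ℂ) = ξ + k * (2 * Real.pi * Complex.I) := rfl

theorem expDisk_logTranslate {ρ : ℝ} (k : ℤ) (ξ : logDisk ρ) :
    expDisk ρ (logTranslate ρ k ξ) = expDisk ρ ξ := by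
  apply Subtype.ext
  change Complex.exp (ξ + k * (2 * Real.pi * Complex.I)) = Complex.exp ξ
  exact Complex.exp_eq_exp_iff_exists_int.2 ⟨k, rfl⟩

theorem expDisk_eq_iff {ρ : ℝ} {ξ ξ' : logDisk ρ} :
    expDisk ρ ξ = expDisk ρ ξ' ↔ ∃ k, ξ' = logTranslate ρ k ξ := by
  refine ⟨fun h => ?_, fun ⟨k, hk⟩ => by rw [hk, expDisk_logTranslate]⟩
  obtain ⟨k, hk⟩ := Complex.exp_eq_exp_iff_exists_int.1 (Subtype.ext_iff.1 h.symm)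
  exact ⟨k, Subtype.ext hk⟩

theorem expDisk_surjective (ρ : ℝ) : Function.Surjective (expDisk ρ) := by
  rintro ⟨w, hw⟩
  have h : Complex.exp (Complex.log w) = w := Complex.exp_log hw.1
  exact ⟨⟨Complex.log w, exp_mem_puncturedDisk.1 (h.symm ▸ hw)⟩, Subtype.ext h⟩

theorem isOpenMap_expDisk (ρ : ℝ) : IsOpenMap (expDisk ρ) :=
  (Complex.isOpenMap_exp.comp (isOpen_logDisk ρ).isOpenMap_subtype_val).subtype_mk _

theorem IsLocalHomeomorph.isOpenMap_of_comp {A T B : Type*} [TopologicalSpace A] [TopologicalSpace T]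
    [TopologicalSpace B] {c : T → B} (hc : IsLocalHomeomorph c) {Q : A → T} (hQ : Continuous Q)
    (h : IsOpenMap (c ∘ Q)) : IsOpenMap Q := by
  rw [isOpenMap_iff_nhds_le]
  intro a V hV
  obtain ⟨e, he, rfl⟩ := hc (Q a)
  have h2 : ∀ᶠ b in 𝓝 a, Q b ∈ V ∧ Q b ∈ e.source :=
    (show ∀ᶠ b in 𝓝 a, Q b ∈ V from hV).and
      (hQ.continuousAt.eventually (e.open_source.mem_nhds he))
  have h3 := h.image_mem_nhds h2
  filter_upwards [e.continuousAt he h3, e.open_source.mem_nhds he] with t ht hts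
  obtain ⟨b, ⟨hb1, hb2⟩, hb3⟩ := ht
  rwa [← e.injOn hb2 hts hb3]

/-- A component of a finite covering of the punctured disk is, like the punctured disk, a quotient of a half
plane by a translation. -/
theorem exists_exp_lift {T : Type*} [TopologicalSpace T] {ρ : ℝ} (hρ : 0 < ρ)
    {c : T → puncturedDisk ρ} (hc : IsCoveringMap c) (hfin : ∀ w, (c ⁻¹' {w}).Finite)
    {W : Set T} (hW : IsPreconnected W) (hne : W.Nonempty) :
    ∃ (Q : C(logDisk ρ, T)) (n : ℕ), 0 < n ∧ c ∘ Q = expDisk ρ ∧ W ⊆ range Q ∧ IsOpenMap Q ∧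
      ∀ ξ ξ', Q ξ = Q ξ' ↔ ∃ k : ℤ, ξ' = logTranslate ρ (k * n) ξ := by
  have hconv := convex_logDisk hρ
  obtain ⟨u₀, hu₀⟩ := hne
  obtain ⟨ξ₀, hξ₀⟩ := expDisk_surjective ρ (c u₀)
  have := hconv.contractibleSpace ⟨ξ₀.1, ξ₀.2⟩
  have : SimplyConnectedSpace (logDisk ρ) := SimplyConnectedSpace.ofContractible _
  have : LocallyPathConnectedSpace (logDisk ρ) := (isOpen_logDisk ρ).locallyPathConnectedSpace
  have hlift : ∀ u ξ, expDisk ρ ξ = c u → ∃ Q : C(logDisk ρ, T), Q ξ = u ∧ c ∘ Q = expDisk ρ :=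
    fun u ξ h => (hc.existsUnique_continuousMap_lifts (expDisk ρ) ξ u h.symm).exists
  have huniq : ∀ Q Q' : C(logDisk ρ, T), c ∘ Q = expDisk ρ → c ∘ Q' = expDisk ρ → ∀ ξ k,
      Q' (logTranslate ρ k ξ) = Q ξ → ∀ ξ, Q' (logTranslate ρ k ξ) = Q ξ := by
    intro Q Q' h h' ξ k hk
    refine congrFun (hc.eq_of_comp_eq (g₁ := Q' ∘ logTranslate ρ k) (g₂ := Q) (by fun_prop) (by fun_prop) ?_ ξ hk)
    rw [← Function.comp_assoc, h', h]
    ext1 ξ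
    exact expDisk_logTranslate k ξ
  have hopen : ∀ Q : C(logDisk ρ, T), c ∘ Q = expDisk ρ → IsOpenMap Q := fun Q h =>
    hc.isLocalHomeomorph.isOpenMap_of_comp Q.continuous (h ▸ isOpenMap_expDisk ρ)
  obtain ⟨Q, hQ₀, hQ⟩ := hlift u₀ ξ₀ hξ₀
  have htrans : ∀ (Q' : C(logDisk ρ, T)), c ∘ Q' = expDisk ρ → (range Q ∩ range Q').Nonempty →
      range Q' ⊆ range Q := by
    rintro Q' hQ' ⟨_, ⟨ξ, rfl⟩, ⟨ξ', hξ'⟩⟩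
    have h1 : expDisk ρ ξ = expDisk ρ ξ' :=
      (congrFun hQ ξ).symm.trans ((congrArg c hξ').symm.trans (congrFun hQ' ξ'))
    obtain ⟨k, rfl⟩ := expDisk_eq_iff.1 h1.symm
    rintro _ ⟨η, rfl⟩
    exact ⟨_, huniq Q' Q hQ' hQ ξ' k hξ'.symm η⟩
  let G : AddSubgroup ℤ :=
    { carrier := {k | ∀ ξ, Q (logTranslate ρ k ξ) = Q ξ}
      zero_mem' := fun ξ => congrArg Q (Subtype.ext (by simp [coe_logTranslate]))
      add_mem' := fun {a b} ha hb ξ => by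
        rw [← hb ξ, ← ha (logTranslate ρ b ξ)]
        exact congrArg Q (Subtype.ext (by simp only [coe_logTranslate]; push_cast; ring))
      neg_mem' := fun {a} ha ξ => by
        rw [← ha (logTranslate ρ (-a) ξ)]
        exact congrArg Q (Subtype.ext (by simp only [coe_logTranslate]; push_cast; ring)) }
  have hG : ∀ ξ k, Q (logTranslate ρ k ξ) = Q ξ → k ∈ G := fun ξ k h => huniq Q Q hQ hQ ξ k h
  obtain ⟨a, ha⟩ := Int.subgroup_cyclic G
  have hmem : ∀ k, k ∈ G ↔ ∃ m : ℤ, k = m * a := fun k => by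
    rw [ha, AddSubgroup.mem_closure_singleton]
    simp [eq_comm]
  have ha0 : a ≠ 0 := by
    rintro rfl
    have hinj : Function.Injective fun k : ℤ => Q (logTranslate ρ k ξ₀) := fun k l h => by
      have h1 : k - l ∈ G := hG (logTranslate ρ l ξ₀) _ (by
        rw [← show _ = Q (logTranslate ρ l ξ₀) from h]
        exact congrArg Q (Subtype.ext (by simp only [coe_logTranslate]; push_cast; ring)))
      obtain ⟨m, hm⟩ := (hmem _).1 h1
      linarith
    refine infinite_of_injective_forall_mem hinj (s := c ⁻¹' {c u₀}) (fun k => ?_) (hfin _)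
    change c (Q (logTranslate ρ k ξ₀)) = c u₀
    rw [← Function.comp_apply (f := c), hQ, expDisk_logTranslate, hξ₀]
  refine ⟨Q, a.natAbs, Int.natAbs_pos.2 ha0, hQ, ?_, hopen Q hQ, fun ξ ξ' => ⟨fun h => ?_, ?_⟩⟩
  · let V : Set T := ⋃ (Q' : C(logDisk ρ, T)) (_ : c ∘ Q' = expDisk ρ)
      (_ : ¬ (range Q ∩ range Q').Nonempty), range Q'
    have hV : IsOpen V := isOpen_iUnion fun Q' => isOpen_iUnion fun h => isOpen_iUnion fun _ =>
      (hopen Q' h).isOpen_range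
    by_contra hcon
    obtain ⟨u, huW, huQ⟩ := not_subset.1 hcon
    have hcov : W ⊆ range Q ∪ V := by
      intro t _
      by_cases ht : t ∈ range Q
      · exact Or.inl ht
      · obtain ⟨ξ, hξ⟩ := expDisk_surjective ρ (c t)
        obtain ⟨Q', h1, h2⟩ := hlift t ξ hξ
        refine Or.inr (mem_iUnion.2 ⟨Q', mem_iUnion.2 ⟨h2, mem_iUnion.2 ⟨fun h => ?_, ξ, h1⟩⟩⟩)
        exact ht (htrans Q' h2 h ⟨ξ, h1⟩)
    obtain ⟨t, -, ht1, ht2⟩ := hW _ _ (hopen Q hQ).isOpen_range hV hcov ⟨u₀, hu₀, ξ₀, hQ₀⟩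
      ⟨u, huW, (hcov huW).resolve_left huQ⟩
    simp only [V, mem_iUnion] at ht2
    obtain ⟨Q', -, h2, h3⟩ := ht2
    exact h2 ⟨t, ht1, h3⟩
  · have h1 : expDisk ρ ξ = expDisk ρ ξ' := by
      rw [← hQ, Function.comp_apply, h, Function.comp_apply]
    obtain ⟨k, rfl⟩ := expDisk_eq_iff.1 h1
    obtain ⟨m, rfl⟩ := (hmem k).1 (hG ξ k h.symm)
    rcases Int.natAbs_eq a with h2 | h2
    · exact ⟨m, by rw [← h2]⟩
    · refine ⟨-m, by rw [show -m * (a.natAbs : ℤ) = m * a by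
        nth_rewrite 2 [h2]; ring]⟩
  · rintro ⟨k, rfl⟩
    have : k * (a.natAbs : ℤ) ∈ G := by
      rw [hmem]
      rcases Int.natAbs_eq a with h2 | h2
      · exact ⟨k, by rw [← h2]⟩
      · exact ⟨-k, by nth_rewrite 2 [h2]; ring⟩
    exact (this ξ).symm

/-- Near an isolated zero outside of which it is a local homeomorphism, a function is a power of a
coordinate. -/
theorem exists_root_coordinate {S : Type*} [TopologicalSpace S] [T2Space S]
    (χ : OpenPartialHomeomorph S ℂ) {p : S} (hp : p ∈ χ.source) {P : S → ℂ} (h0 : P p = 0)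
    (hcont : ∀ᶠ q in 𝓝 p, ContinuousAt P q) (hne : ∀ᶠ q in 𝓝 p, P q = 0 → q = p)
    (hloc : ∀ᶠ q in 𝓝 p, q ≠ p → (∃ N ∈ 𝓝 q, InjOn P N) ∧ 𝓝 (P q) ≤ map P (𝓝 q)) :
    ∃ (n : ℕ) (ζ : OpenPartialHomeomorph S ℂ), 0 < n ∧ p ∈ ζ.source ∧ ζ p = 0 ∧
      ∀ q ∈ ζ.source, P q = ζ q ^ n / n := by
  classical
  obtain ⟨K, hKc, hpK, hK⟩ : ∃ K : Set S, IsCompact K ∧ K ∈ 𝓝 p ∧ ∀ q ∈ K, ContinuousAt P q ∧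
      (P q = 0 → q = p) ∧
      (q ≠ p → (∃ N ∈ 𝓝 q, InjOn P N) ∧ 𝓝 (P q) ≤ map P (𝓝 q)) := by
    have h1 := (hcont.and (hne.and hloc)).and (χ.open_source.mem_nhds hp)
    have h2 : χ.symm ⁻¹' {q | (ContinuousAt P q ∧ (P q = 0 → q = p) ∧
        (q ≠ p → (∃ N ∈ 𝓝 q, InjOn P N) ∧ 𝓝 (P q) ≤ map P (𝓝 q))) ∧ q ∈ χ.source} ∈ 𝓝 (χ p) :=
      (χ.continuousAt_symm (χ.map_source hp)) (by rw [χ.left_inv hp]; exact h1)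
    obtain ⟨r, hr, hball⟩ := Metric.nhds_basis_closedBall.mem_iff.1
      (inter_mem h2 (χ.open_target.mem_nhds (χ.map_source hp)))
    refine ⟨χ.symm '' Metric.closedBall (χ p) r, (isCompact_closedBall _ _).image_of_continuousOn
      (χ.continuousOn_symm.mono fun w hw => (hball hw).2), ?_, ?_⟩
    · have := χ.symm.image_mem_nhds (x := χ p) (χ.map_source hp) (Metric.closedBall_mem_nhds _ hr)
      rwa [χ.left_inv hp] at this
    · rintro _ ⟨w, hw, rfl⟩
      exact (hball hw).1.1
  have hKcont : ContinuousOn P K := fun q hq => (hK q hq).1.continuousWithinAt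
  have hsmall : ∀ {A : Set S}, IsOpen A → p ∈ A → ∃ r > 0, ∀ q ∈ K, ‖P q‖ < r → q ∈ A := by
    intro A hA hpA
    rcases (K \ A).eq_empty_or_nonempty with he | hne'
    · exact ⟨1, one_pos, fun q hq _ => sdiff_eq_empty.1 he hq⟩
    · obtain ⟨q₀, hq₀, hmin⟩ := (hKc.diff hA).exists_isMinOn hne' (hKcont.mono sdiff_subset).norm
      refine ⟨‖P q₀‖, norm_pos_iff.2 fun h => hq₀.2 ?_, fun q hq hlt => ?_⟩
      · rw [(hK q₀ hq₀.1).2.1 h]; exact hpA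
      · by_contra h
        exact absurd (hmin ⟨hq, h⟩) (not_le.2 hlt)
  obtain ⟨ρ, hρ, hρK⟩ : ∃ ρ > 0, ∀ q ∈ K, ‖P q‖ < ρ → K ∈ 𝓝 q := by
    obtain ⟨ρ, hρ, h⟩ := hsmall isOpen_interior (mem_interior_iff_mem_nhds.2 hpK)
    exact ⟨ρ, hρ, fun q hq hlt => mem_interior_iff_mem_nhds.1 (h q hq hlt)⟩
  have : CompactSpace K := isCompact_iff_compactSpace.1 hKc
  let f : K → ℂ := fun q => P q
  have hf : Continuous f := continuousOn_iff_continuous_domRestrict.1 hKcont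
  have hpo : IsOpen (f ⁻¹' puncturedDisk ρ) :=
    ((isOpen_ne (x := (0 : ℂ))).inter (isOpen_lt continuous_norm continuous_const)).preimage hf
  have hpne : ∀ q : K, f q ∈ puncturedDisk ρ → (q : S) ≠ p := fun q hq h => hq.1 (by
    change P q = 0; rw [h, h0])
  have hlocK : ∀ q : K, f q ∈ puncturedDisk ρ → ∃ e : OpenPartialHomeomorph K ℂ, q ∈ e.source ∧ ⇑e = f := by
    intro q hq
    obtain ⟨⟨N, hN, hNi⟩, -⟩ := (hK q q.2).2.2 (hpne q hq)
    obtain ⟨e, h1, -, h3⟩ := exists_openPartialHomeomorph (P := f) (p := q)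
      (N := Subtype.val ⁻¹' N) (continuous_subtype_val.continuousAt hN)
      (fun a ha b hb hab => Subtype.ext (hNi ha hb hab)) (by
        filter_upwards [hpo.mem_nhds hq] with q' hq'
        refine ⟨hf.continuousAt, ?_⟩
        have h4 := ((hK q' q'.2).2.2 (hpne q' hq')).2
        rwa [← map_nhds_subtype_coe_eq_nhds q'.2 (hρK q' q'.2 hq'.2), Filter.map_map] at h4)
    exact ⟨e, h1, h3⟩
  have hfinK : ∀ w ∈ puncturedDisk ρ, (f ⁻¹' {w}).Finite := by
    intro w hw
    refine (isClosed_singleton.preimage hf).isCompact.finite ?_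
    rw [isDiscrete_iff_nhdsNE]
    intro q hq
    have hqw : f q = w := hq
    obtain ⟨e, h1, h2⟩ := hlocK q (by rw [hqw]; exact hw)
    rw [inf_principal_eq_bot]
    rw [mem_nhdsWithin]
    refine ⟨e.source, e.open_source, h1, fun q' ⟨hq', hne'⟩ hmem => hne' ?_⟩
    have hqw' : f q' = w := hmem
    exact e.injOn hq' h1 (by rw [h2, hqw, hqw'])
  have hcov : IsCoveringMapOn f (puncturedDisk ρ) :=
    hf.isClosedMap.isCoveringMapOn_of_isLocalHomeomorphOn hfinK
      (IsLocalHomeomorphOn.mk f _ fun q hq => by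
        obtain ⟨e, h1, h2⟩ := hlocK q hq
        exact ⟨e, h1, fun _ _ => by rw [h2]⟩)
  let c := (puncturedDisk ρ).restrictPreimage f
  have hc : IsCoveringMap c := hcov.isCoveringMap_restrictPreimage
  have hfin : ∀ w, (c ⁻¹' {w}).Finite := fun w =>
    ((hfinK w w.2).preimage Subtype.val_injective.injOn).subset fun t ht => Subtype.ext_iff.1 ht
  have hnear : {q | ‖P q‖ < ρ} ∩ K ∈ 𝓝 p :=
    inter_mem ((hK p (mem_of_mem_nhds hpK)).1.norm.eventually_lt_const (by simpa [h0] using hρ))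
      hpK
  obtain ⟨V, -, hVU, hVχ, hVc, hVo, hpV⟩ := exists_punctured_nhds χ hp hnear
  have hmemT : ∀ q ∈ V, q ≠ p → ∃ t : f ⁻¹' puncturedDisk ρ, ((t : K) : S) = q := fun q hq hqp =>
    ⟨⟨⟨q, (hVU hq).2⟩, fun h => hqp ((hK q (hVU hq).2).2.1 h), (hVU hq).1⟩, rfl⟩
  let W : Set (f ⁻¹' puncturedDisk ρ) := {t | ((t : K) : S) ∈ V \ {p}}
  have hW : IsPreconnected W := by
    have hind : IsInducing fun t : f ⁻¹' puncturedDisk ρ => ((t : K) : S) :=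
      IsInducing.subtypeVal.comp IsInducing.subtypeVal
    rw [← hind.isPreconnected_image]
    convert! hVc
    ext q
    refine ⟨?_, fun hq => ?_⟩
    · rintro ⟨t, ht, rfl⟩; exact ht
    · obtain ⟨t, rfl⟩ := hmemT q hq.1 hq.2
      exact ⟨t, hq, rfl⟩
  have hWne : W.Nonempty := by
    by_contra hcon
    have hVp : V = {p} := by
      refine subset_antisymm (fun q hq => ?_) (singleton_subset_iff.2 hpV)
      by_contra hqp
      obtain ⟨t, ht⟩ := hmemT q hq hqp
      exact hcon ⟨t, (ht ▸ ⟨hq, hqp⟩ : ((t : K) : S) ∈ V \ {p})⟩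
    have h1 := χ.isOpen_image_of_subset_source hVo hVχ
    rw [hVp, image_singleton] at h1
    exact not_isOpen_singleton _ h1
  obtain ⟨Q, n, hn, hQ, hWQ, hQo, hper⟩ := exists_exp_lift hρ hc hfin hW hWne
  let q' : logDisk ρ → S := fun ξ => ((Q ξ : K) : S)
  have hq'inj : ∀ {ξ ξ'}, q' ξ = q' ξ' ↔ Q ξ = Q ξ' := fun {ξ ξ'} =>
    ⟨fun h => Subtype.ext (Subtype.ext h), fun h => by simp only [q', h]⟩
  have hPq : ∀ ξ, P (q' ξ) = Complex.exp ξ := fun ξ => congrArg Subtype.val (congrFun hQ ξ)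
  have hq'p : ∀ ξ, q' ξ ≠ p := fun ξ h => Complex.exp_ne_zero (ξ : ℂ) (by rw [← hPq, h, h0])
  have hn0 : (n : ℂ) ≠ 0 := by exact_mod_cast hn.ne'
  let g : ℂ → ℂ := fun ξ => Complex.exp ((ξ + Complex.log n) * (n : ℂ)⁻¹)
  have hgn : ∀ ξ, g ξ ^ n / n = Complex.exp ξ := fun ξ => by
    simp only [g]
    rw [← Complex.exp_nat_mul, show (n : ℂ) * ((ξ + Complex.log n) * (n : ℂ)⁻¹) = ξ + Complex.log n by
      field_simp, Complex.exp_add, Complex.exp_log hn0]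
    field_simp
  have hgo : IsOpenMap g :=
    Complex.isOpenMap_exp.comp ((Homeomorph.addRight (Complex.log n)).trans
      (Homeomorph.mulRight₀ (n : ℂ)⁻¹ (inv_ne_zero hn0))).isOpenMap
  have hgeq : ∀ ξ ξ' : logDisk ρ, g ξ = g ξ' ↔ q' ξ = q' ξ' := by
    intro ξ ξ'
    rw [hq'inj, hper, eq_comm]
    simp only [g]
    rw [Complex.exp_eq_exp_iff_exists_int]
    refine exists_congr fun k => ?_
    rw [Subtype.ext_iff, coe_logTranslate]
    push_cast
    field_simp
    constructor <;> intro h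
    · linear_combination h
    · linear_combination h
  let ζ : S → ℂ := fun q => if h : ∃ ξ, q' ξ = q then g h.choose else 0
  have hζ : ∀ ξ, ζ (q' ξ) = g ξ := fun ξ => by
    have h : ∃ ξ', q' ξ' = q' ξ := ⟨ξ, rfl⟩
    simp only [ζ, dif_pos h]
    exact (hgeq _ _).2 h.choose_spec
  have hζp : ζ p = 0 := dif_neg fun ⟨ξ, h⟩ => hq'p ξ h
  obtain ⟨r, hr, hrV⟩ := hsmall hVo hpV
  have hcases : ∀ q ∈ K, ‖P q‖ < r → q = p ∨ ∃ ξ, q' ξ = q := fun q hq hqr => by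
    by_cases hqp : q = p
    · exact Or.inl hqp
    · obtain ⟨t, rfl⟩ := hmemT q (hrV q hq hqr) hqp
      obtain ⟨ξ, rfl⟩ := hWQ (show t ∈ W from ⟨hrV _ hq hqr, hqp⟩)
      exact Or.inr ⟨ξ, rfl⟩
  have hN : {q | ‖P q‖ < r} ∩ K ∈ 𝓝 p :=
    inter_mem ((hK p (mem_of_mem_nhds hpK)).1.norm.eventually_lt_const (by simpa [h0] using hr))
      hpK
  have hpow : ∀ q ∈ {q | ‖P q‖ < r} ∩ K, P q = ζ q ^ n / n := by
    rintro q ⟨hq1, hq2⟩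
    rcases hcases q hq2 hq1 with rfl | ⟨ξ, rfl⟩
    · rw [hζp, h0, zero_pow hn.ne', zero_div]
    · rw [hζ, hgn, hPq]
  have hinj : InjOn ζ ({q | ‖P q‖ < r} ∩ K) := by
    rintro a ⟨ha1, ha2⟩ b ⟨hb1, hb2⟩ hab
    rcases hcases a ha2 ha1 with rfl | ⟨ξ, rfl⟩ <;> rcases hcases b hb2 hb1 with rfl | ⟨ξ', rfl⟩
    · rfl
    · rw [hζp, hζ] at hab
      exact absurd hab.symm (Complex.exp_ne_zero _)
    · rw [hζp, hζ] at hab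
      exact absurd hab (Complex.exp_ne_zero _)
    · rw [hζ, hζ] at hab
      exact (hgeq _ _).1 hab
  have hnhds : ∀ ξ, 𝓝 (q' ξ) = map q' (𝓝 ξ) := fun ξ => by
    have h1 : map Q (𝓝 ξ) = 𝓝 (Q ξ) := le_antisymm Q.continuous.continuousAt (hQo.nhds_le ξ)
    have h2 : map (fun t : f ⁻¹' puncturedDisk ρ => (t : K)) (𝓝 (Q ξ)) = 𝓝 (Q ξ : K) :=
      map_nhds_subtype_coe_eq_nhds (Q ξ).2 (hpo.mem_nhds (Q ξ).2)
    have h3 : map (fun t : K => (t : S)) (𝓝 (Q ξ : K)) = 𝓝 (q' ξ) :=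
      map_nhds_subtype_coe_eq_nhds (Q ξ : K).2 (hρK _ (Q ξ : K).2 (Q ξ).2.2)
    rw [← h3, ← h2, ← h1, Filter.map_map, Filter.map_map]
    rfl
  have hζq : ζ ∘ q' = g ∘ Subtype.val := funext hζ
  obtain ⟨e, he1, he2, he3⟩ := exists_openPartialHomeomorph hN hinj (by
    filter_upwards [hN] with q hq
    rcases hcases q hq.2 hq.1 with rfl | ⟨ξ, rfl⟩
    · refine ⟨?_, fun B hB => ?_⟩
      · rw [ContinuousAt, hζp, Metric.tendsto_nhds]
        intro ε hε
        have h1 : ∀ᶠ q' in 𝓝 q, n * ‖P q'‖ < ε ^ n := by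
          refine (continuousAt_const.mul (hK q hq.2).1.norm).eventually_lt_const ?_
          simpa [h0] using pow_pos hε n
        filter_upwards [h1, hN] with a ha haN
        rw [dist_zero_right]
        refine lt_of_pow_lt_pow_left₀ n hε.le ?_
        rw [hpow a haN, norm_div, norm_pow, Complex.norm_natCast, mul_div_cancel₀] at ha
        · exact ha
        · exact_mod_cast hn.ne'
      · rw [hζp]
        have hB' : ∀ᶠ a in 𝓝 q, ζ a ∈ B := hB
        obtain ⟨A, hA, hAo, hqA⟩ := eventually_nhds_iff.1 hB'
        obtain ⟨s, hs, hsA⟩ := hsmall hAo hqA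
        have h1 : ∀ᶠ w : ℂ in 𝓝 0, ‖w ^ n / n‖ < min s ρ := by
          refine (Continuous.continuousAt (f := fun w : ℂ => ‖w ^ n / n‖) (by fun_prop)).eventually_lt_const ?_
          simpa [hn.ne'] using ⟨hs, hρ⟩
        filter_upwards [h1] with w hw
        rcases eq_or_ne w 0 with rfl | hw0
        · rw [← hζp]; exact hA q hqA
        · have hξ : Complex.exp (n * Complex.log w - Complex.log n) = w ^ n / n := by
            rw [Complex.exp_sub, Complex.exp_log hn0, Complex.exp_nat_mul, Complex.exp_log hw0]
          have hmem : (n * Complex.log w - Complex.log n : ℂ) ∈ logDisk ρ := by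
            rw [← exp_mem_puncturedDisk, hξ]
            exact ⟨div_ne_zero (pow_ne_zero _ hw0) hn0, hw.trans_le (min_le_right _ _)⟩
          have h2 : ζ (q' ⟨_, hmem⟩) = w := by
            rw [hζ]; simp only [g]
            rw [sub_add_cancel, mul_comm (n : ℂ), mul_inv_cancel_right₀ hn0, Complex.exp_log hw0]
          rw [← h2]
          refine hA _ (hsA _ (Q ⟨_, hmem⟩ : K).2 ?_)
          rw [hPq, hξ]
          exact hw.trans_le (min_le_left _ _)
    · rw [ContinuousAt, Tendsto, hnhds, Filter.map_map, hζq, hζ]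
      have h1 : map (fun t : logDisk ρ => (t : ℂ)) (𝓝 ξ) = 𝓝 (ξ : ℂ) :=
        map_nhds_subtype_coe_eq_nhds ξ.2 ((isOpen_logDisk ρ).mem_nhds ξ.2)
      rw [← Filter.map_map, h1]
      have hgc : Continuous g := by fun_prop
      exact ⟨hgc.continuousAt, hgo.nhds_le _⟩)
  exact ⟨n, e, hn, he1, by rw [he3, hζp], fun q hq => by rw [he3]; exact hpow q (he2 hq)⟩

/-! ### The flat structure with given side vectors -/

theorem collinear_iff_cross_eq_zero (w : Fin 3 → ℂ) :
    Collinear ℝ (range w) ↔ cross (w 1 - w 0) (w 2 - w 0) = 0 := by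
  rw [collinear_iff_of_mem (mem_range_self (0 : Fin 3))]
  constructor
  · rintro ⟨d, hd⟩
    obtain ⟨r, hr⟩ := hd _ (mem_range_self 1)
    obtain ⟨s, hs⟩ := hd _ (mem_range_self 2)
    rw [hr, hs]
    simp only [vadd_eq_add, add_sub_cancel_right, cross, Complex.real_smul, Complex.mul_re,
      Complex.mul_im, Complex.ofReal_re, Complex.ofReal_im]
    ring
  · intro h
    have key : ∃ d : ℂ, ∃ r s : ℝ, w 1 - w 0 = r • d ∧ w 2 - w 0 = s • d := by
      by_cases ha : w 1 - w 0 = 0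
      · exact ⟨w 2 - w 0, 0, 1, by simp [ha], by simp⟩
      · set a := w 1 - w 0
        set b := w 2 - w 0
        refine ⟨a, 1, (a.re * b.re + a.im * b.im) / Complex.normSq a, by simp, ?_⟩
        have hn : a.re * a.re + a.im * a.im ≠ 0 := by
          rw [← Complex.normSq_apply]; exact fun h => ha (Complex.normSq_eq_zero.1 h)
        simp only [cross] at h
        apply Complex.ext <;> simp only [Complex.normSq_apply, Complex.real_smul, Complex.mul_re,
          Complex.mul_im, Complex.ofReal_re, Complex.ofReal_im, zero_mul, sub_zero, add_zero]
        · rw [div_mul_eq_mul_div, eq_div_iff hn]; linear_combination -a.im * h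
        · rw [div_mul_eq_mul_div, eq_div_iff hn]; linear_combination a.re * h
    obtain ⟨d, r, s, h1, h2⟩ := key
    refine ⟨d, ?_⟩
    rintro _ ⟨j, rfl⟩
    fin_cases j
    · exact ⟨0, by simp⟩
    · exact ⟨r, by simp [← h1]⟩
    · exact ⟨s, by simp [← h2]⟩

theorem affineIndependent_iff_cross_ne_zero (w : Fin 3 → ℂ) :
    AffineIndependent ℝ w ↔ cross (w 1 - w 0) (w 2 - w 0) ≠ 0 := by
  rw [affineIndependent_iff_not_collinear, collinear_iff_cross_eq_zero]

section FaceMap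

variable {F : Type*} {v : F × Fin 3 → ℂ}

theorem faceMap_image_convexHull (v : F × Fin 3 → ℂ) (f : F) (s : Set ℂ) :
    faceMap v f '' convexHull ℝ s = convexHull ℝ (faceMap v f '' s) := by
  have h : IsLinearMap ℝ (faceMap v f) := ⟨faceMap_add v f, fun r z => by
    rw [faceMap_smul]; simp⟩
  exact h.image_convexHull s

theorem faceMap_side (v : F × Fin 3 → ℂ) (f : F) (j : Fin 3) (s : ℝ) :
    faceMap v f (side j s) =
      AffineMap.lineMap (faceMap v f (corner j)) (faceMap v f (corner (j + 1))) s := by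
  simp only [side, AffineMap.lineMap_apply, vsub_eq_sub, vadd_eq_add, faceMap_add, faceMap_smul,
    faceMap_sub]
  rw [Complex.real_smul]

theorem hasLocalDegree_faceMap (hp : RibbonGraph.IsPositive v) (f : F) (z : ℂ) :
    HasLocalDegree (faceMap v f) z 1 := by
  filter_upwards [self_mem_nhdsWithin] with r hr
  have hc : 0 < cross (v (f, 0)) (-v (f, 2)) := by
    have := hp.cross_two_zero f
    simp only [cross, Complex.neg_re, Complex.neg_im] at this ⊢
    linarith
  convert (hasWinding_linear _ _ hr).1 hc using 2 with t
  rw [faceMap_sub, show circleMap z r t - z = ⟨r * Real.cos t, r * Real.sin t⟩ by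
    simp [circleMap, Complex.ext_iff, Complex.exp_re, Complex.exp_im]]
  simp only [faceMap]
  push_cast; ring

end FaceMap

namespace Triangulation

variable {S : Type*} [TopologicalSpace S] [ChartedSpace ℂ S] {Z : Set S} {E F : Type*}
  {τ : Triangulation S Z E F} {v : F × Fin 3 → ℂ}

theorem IsFlatAt.sub_eq [T2Space S] {P P' : S → ℂ} {q : S} (h : τ.IsFlatAt v P q)
    (h' : τ.IsFlatAt v P' q) : ∀ᶠ q' in 𝓝 q, P' q' - P' q = P q' - P q := by
  refine τ.eventually_nhds fun f z hz hzq => ?_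
  filter_upwards [h f z hz hzq, h' f z hz hzq] with z' h1 h2
  rw [h1, h2]

theorem IsFlatAt.exists_chart [T2Space S] {P : S → ℂ} {q : S} (h : τ.IsFlatAt v P q)
    (hv : v ∈ τ.cycleSpace) (hp : RibbonGraph.IsPositive v) (hq : q ∉ Z) :
    ∃ e : OpenPartialHomeomorph S ℂ, q ∈ e.source ∧ e.source ⊆ Zᶜ ∧
      (∀ q' ∈ e.source, τ.IsFlatAt v e q') ∧ ⇑e = P := by
  obtain ⟨N, hN, hNi⟩ := h.exists_injOn hv hp hq
  have hZ : Zᶜ ∈ 𝓝 q := τ.finite_vertices.isClosed.isOpen_compl.mem_nhds hq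
  have hev := h.eventually.and hZ
  obtain ⟨e, h1, h2, h3⟩ := exists_openPartialHomeomorph (P := P) (p := q)
    (N := N ∩ {q' | τ.IsFlatAt v P q' ∧ q' ∉ Z}) (inter_mem hN hev) (hNi.mono inter_subset_left)
    (hev.mono fun q' hq' => ⟨hq'.1.continuousAt, hq'.1.nhds_le hv hp hq'.2⟩)
  exact ⟨e, h1, fun q' hq' => (h2 hq').2.2, fun q' hq' => by rw [h3]; exact (h2 hq').2.1, h3⟩

theorem tendsto_chart_cell {f : F} {z : ℂ} (hz : z ∈ refTriangle)
    {χ : OpenPartialHomeomorph S ℂ} (hχ : τ.cell f z ∈ χ.source) :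
    Tendsto (χ ∘ τ.cell f) (𝓝[refTriangle] z) (𝓝 (χ (τ.cell f z))) :=
  (χ.continuousAt hχ).tendsto.comp (τ.tendsto_cell hz)

theorem continuousAt_cell {f : F} {z : ℂ} (hz : z ∈ interior refTriangle) :
    ContinuousAt (τ.cell f) z := by
  have h := τ.tendsto_cell (f := f) (interior_subset hz)
  rwa [interior_mem_nhdsWithin hz] at h

theorem hasLocalDegree_chart_cell [OrientedSurface S] {f : F} {z : ℂ}
    (hz : z ∈ interior refTriangle) {χ : OpenPartialHomeomorph S ℂ} (hχ : χ ∈ atlas ℂ S)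
    (hmem : τ.cell f z ∈ χ.source) : HasLocalDegree (χ ∘ τ.cell f) z 1 := by
  set χ' := chartAt ℂ (τ.cell f z)
  have hmem' : τ.cell f z ∈ χ'.source := mem_chart_source ℂ _
  have h1 : HasLocalDegree (χ' ∘ τ.cell f) z 1 := orientationPreservingAt_iff.1 (τ.oriented f z hz)
  have h2 : HasLocalDegree (χ ∘ χ'.symm) (χ' (τ.cell f z)) 1 := orientationPreservingAt_iff.1
    (OrientedSurface.oriented χ' (chart_mem_atlas ℂ _) χ hχ _ ⟨hmem', hmem⟩)
  have hc : ContinuousAt (χ' ∘ τ.cell f) z :=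
    (χ'.continuousAt hmem').comp (τ.continuousAt_cell hz)
  have hV := (χ'.symm.trans χ).open_source.mem_nhds (x := χ' (τ.cell f z)) (by
    simp [hmem, hmem'])
  have h3 := h1.comp hc hV (χ'.symm.trans χ).continuousOn (χ'.symm.trans χ).injOn h2
  refine h3.congr ?_
  filter_upwards [(τ.continuousAt_cell hz).eventually (χ'.open_source.mem_nhds hmem')] with x hx
  simp only [Function.comp_apply, OpenPartialHomeomorph.trans_apply, χ'.left_inv hx, χ'.left_inv hmem']

theorem IsFlatAt.orientationPreservingAt [T2Space S] [OrientedSurface S]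
    (hp : RibbonGraph.IsPositive v)
    {e : OpenPartialHomeomorph S ℂ} (he : ∀ q ∈ e.source, τ.IsFlatAt v e q) {p : S}
    (hpe : p ∈ e.source) {χ : OpenPartialHomeomorph S ℂ} (hχ : χ ∈ atlas ℂ S)
    (hmem : p ∈ χ.source) : OrientationPreservingAt (e ∘ χ.symm) (χ p) := by
  rw [orientationPreservingAt_iff]
  obtain ⟨n, hn⟩ := exists_hasLocalDegree
    ((χ.symm.trans e).open_source.mem_nhds (x := χ p) (by simp [hmem, hpe]))
    (χ.symm.trans e).continuousOn (χ.symm.trans e).injOn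
  obtain ⟨f, z, hz, rfl⟩ := τ.covers p
  have hne : (𝓝[interior refTriangle] z).NeBot := mem_closure_iff_nhdsWithin_neBot.1 (mem_closure_interior hz)
  have hle : 𝓝[interior refTriangle] z ≤ 𝓝[refTriangle] z := nhdsWithin_mono z interior_subset
  have h1 : ∀ᶠ x in 𝓝[interior refTriangle] z, _ := hle ((tendsto_chart_cell hz hmem).eventually hn)
  have h2 : ∀ᶠ x in 𝓝[interior refTriangle] z, _ := hle ((τ.tendsto_cell hz).eventually
    ((e.open_source.inter χ.open_source).mem_nhds ⟨hpe, hmem⟩))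
  obtain ⟨z', ⟨h3, h4e, h4χ⟩, h5⟩ := ((h1.and h2).and self_mem_nhdsWithin).exists
  have h6 := hasLocalDegree_chart_cell h5 hχ h4χ
  have hc : ContinuousAt (χ ∘ τ.cell f) z' := (χ.continuousAt h4χ).comp (τ.continuousAt_cell h5)
  have h7 := h6.comp hc
    ((χ.symm.trans e).open_source.mem_nhds (x := χ (τ.cell f z')) (by simp [h4χ, h4e]))
    (χ.symm.trans e).continuousOn (χ.symm.trans e).injOn h3
  have h8 := he _ h4e f z' (interior_subset h5) rfl
  rw [interior_mem_nhdsWithin h5] at h8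
  have h9 : HasLocalDegree (faceMap v f) z' (1 * n) := by
    refine h7.congr ?_
    filter_upwards [h8, (τ.continuousAt_cell h5).eventually (χ.open_source.mem_nhds h4χ)] with x hx hx'
    rw [← hx]
    simp only [Function.comp_apply, OpenPartialHomeomorph.trans_apply, χ.left_inv hx', χ.left_inv h4χ]
  have h10 : 1 * n = 1 := h9.unique (hasLocalDegree_faceMap hp f z')
  rw [one_mul] at h10
  subst h10
  exact hn.self_of_nhds

variable (τ v) in
/-- The flat structure with side vectors `v` has a zero of order `κ z` at every vertex `z`. -/
def HasOrders (κ : Z → ℕ) : Prop :=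
  ∀ z : Z, ∃ (P : S → ℂ) (ζ : OpenPartialHomeomorph S ℂ), (z : S) ∈ ζ.source ∧ ζ z = 0 ∧
    ∀ q ∈ ζ.source, τ.IsFlatAt v P q ∧ P q = ζ q ^ (κ z + 1) / (κ z + 1)

theorem exists_hasOrders [T2Space S] (hv : v ∈ τ.cycleSpace) (hp : RibbonGraph.IsPositive v) :
    ∃ κ, τ.HasOrders v κ := by
  have key : ∀ z : Z, ∃ k : ℕ, ∃ (P : S → ℂ) (ζ : OpenPartialHomeomorph S ℂ), (z : S) ∈ ζ.source ∧
      ζ z = 0 ∧ ∀ q ∈ ζ.source, τ.IsFlatAt v P q ∧ P q = ζ q ^ (k + 1) / (k + 1) := by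
    intro z
    obtain ⟨P, h0, hP⟩ := τ.exists_isFlatAt hv (z : S)
    have hZ : ∀ᶠ q in 𝓝 (z : S), q ≠ (z : S) → q ∉ Z := by
      have h1 : (Z \ {(z : S)})ᶜ ∈ 𝓝 (z : S) :=
        (τ.finite_vertices.subset sdiff_subset).isClosed.isOpen_compl.mem_nhds fun h => h.2 rfl
      filter_upwards [h1] with q hq hqz hqZ
      exact hq ⟨hqZ, hqz⟩
    obtain ⟨n, ζ, hn, h1, h2, h3⟩ := exists_root_coordinate (chartAt ℂ (z : S)) (mem_chart_source ℂ _) h0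
      (hP.eventually.mono fun q hq => hq.continuousAt)
      (by simpa only [h0] using hP.eventually_ne hp)
      (by
        filter_upwards [hZ, hP.eventually] with q hq hqP hqz
        exact ⟨hqP.exists_injOn hv hp (hq hqz), hqP.nhds_le hv hp (hq hqz)⟩)
    obtain ⟨k, rfl⟩ : ∃ k, n = k + 1 := ⟨n - 1, by omega⟩
    obtain ⟨U, hU, hUo, hzU⟩ := eventually_nhds_iff.1 hP.eventually
    refine ⟨k, P, ζ.restrOpen U hUo, ⟨h1, hzU⟩, h2, fun q hq => ⟨hU q hq.2, ?_⟩⟩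
    have := h3 q hq.1
    push_cast at this
    exact this
  choose κ hκ using key
  exact ⟨κ, hκ⟩

/-- The translation structure for which the faces are triangles with side vectors `v`. -/
def flatStructure [T2Space S] [OrientedSurface S] (hv : v ∈ τ.cycleSpace)
    (hp : RibbonGraph.IsPositive v) {κ : Z → ℕ} (hκ : τ.HasOrders v κ) :
    TranslationStructure S Z κ where
  charts := {e | e.source ⊆ Zᶜ ∧ ∀ q ∈ e.source, τ.IsFlatAt v e q}
  covers := by
    refine subset_antisymm (iUnion₂_subset fun e he => he.1) fun q hq => ?_
    obtain ⟨P, -, hP⟩ := τ.exists_isFlatAt hv q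
    obtain ⟨e, h1, h2, h3, -⟩ := hP.exists_chart hv hp hq
    exact mem_biUnion (show e ∈ {e : OpenPartialHomeomorph S ℂ | e.source ⊆ Zᶜ ∧ ∀ q ∈ e.source, τ.IsFlatAt v e q}
      from ⟨h2, h3⟩) h1
  translation := fun e he e' he' p hp hp' => (he.2 p hp).sub_eq (he'.2 p hp')
  oriented := fun e he p hpe =>
    IsFlatAt.orientationPreservingAt hp he.2 hpe (chart_mem_atlas ℂ p) (mem_chart_source ℂ p)
  zeros := fun z => by
    obtain ⟨P, ζ, h1, h2, h3⟩ := hκ z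
    refine ⟨ζ, h1, h2, fun e he p hp hp' => ?_⟩
    filter_upwards [(h3 p hp').1.sub_eq (he.2 p hp), ζ.open_source.mem_nhds hp'] with q hq hqζ
    rw [hq, (h3 q hqζ).2, (h3 p hp').2, sub_div]

theorem cross_faceMap_corner (hv : ∀ f, ∑ j, v (f, j) = 0) (f : F) :
    cross (faceMap v f (corner 1) - faceMap v f (corner 0))
      (faceMap v f (corner 2) - faceMap v f (corner 0)) = cross (v (f, 2)) (v (f, 0)) := by
  rw [show (1 : Fin 3) = 0 + 1 from rfl, faceMap_sub_corner hv,
    ← neg_sub, show (0 : Fin 3) = 2 + 1 from rfl, faceMap_sub_corner hv]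
  simp only [cross, Complex.neg_re, Complex.neg_im, show (2 + 1 : Fin 3) = 0 from rfl]; ring

theorem bijOn_faceMap (hp : RibbonGraph.IsPositive v) (f : F) : BijOn (faceMap v f) refTriangle
    (convexHull ℝ (range fun j => faceMap v f (corner j))) := by
  have h : convexHull ℝ (range fun j => faceMap v f (corner j)) = faceMap v f '' refTriangle := by
    rw [refTriangle, faceMap_image_convexHull, ← range_comp]; rfl
  rw [h]
  exact (faceMap_injective hp f).injOn.bijOn_image

theorem isEuclideanFace_flatStructure [T2Space S] [OrientedSurface S] (hv : v ∈ τ.cycleSpace)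
    (hp : RibbonGraph.IsPositive v) {κ : Z → ℕ} (hκ : τ.HasOrders v κ) (f : F) :
    τ.IsEuclideanFace (flatStructure hv hp hκ) f (fun j => faceMap v f (corner j)) (faceMap v f) where
  nondegenerate := by
    rw [affineIndependent_iff_cross_ne_zero, cross_faceMap_corner hv.1]
    exact (hp.cross_two_zero f).ne'
  continuousOn := (continuous_faceMap v f).continuousOn
  bijOn := bijOn_faceMap hp f
  corners := fun _ => rfl
  sides := fun j => by
    rw [segment_eq_image_lineMap, image_image]
    exact image_congr fun s _ => faceMap_side v f j s
  primitive := fun z hz e he hze => by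
    filter_upwards [he.2 _ hze f z hz rfl] with z' hz'
    exact hz'.symm

end Triangulation

/-! ### Integration along paths -/

theorem IsPreconnected.eq_of_eventually_eq {T Y : Type*} [TopologicalSpace T] {U : Set T}
    (hU : IsPreconnected U) {φ : T → Y} (h : ∀ t ∈ U, ∀ᶠ s in 𝓝[U] t, φ s = φ t) {s t : T}
    (hs : s ∈ U) (ht : t ∈ U) : φ s = φ t := by
  let : TopologicalSpace Y := ⊥
  have : DiscreteTopology Y := ⟨rfl⟩
  exact hU.constant (f := φ) (fun t ht => (tendsto_pure.2 (h t ht)).mono_right (pure_le_nhds _)) hs ht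

/-- A system of local primitives with values in `W`: every point has one, a primitive near `p` is a primitive
near all points close to `p`, and primitives are unique up to constants. -/
structure IsPrimitiveSystem {S W : Type*} [TopologicalSpace S] [AddCommGroup W]
    (Pr : S → (S → W) → Prop) : Prop where
  exists_primitive : ∀ p, ∃ P, Pr p P
  eventually : ∀ {p P}, Pr p P → ∀ᶠ q in 𝓝 p, Pr q P
  sub_eq : ∀ {p P P'}, Pr p P → Pr p P' → ∀ᶠ q in 𝓝 p, P' q - P' p = P q - P p

/-- `G` is a primitive along `γ`. -/
def HasIntegral {S T W : Type*} [TopologicalSpace S] [TopologicalSpace T] [AddCommGroup W]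
    (Pr : S → (S → W) → Prop) (γ : T → S) (G : T → W) : Prop :=
  ∀ t, ∃ P, Pr (γ t) P ∧ ∀ᶠ s in 𝓝 t, G s - G t = P (γ s) - P (γ t)

namespace IsPrimitiveSystem

variable {S T W : Type*} [TopologicalSpace S] [TopologicalSpace T] [AddCommGroup W]
  {Pr : S → (S → W) → Prop}

theorem hasIntegral_sub (hPr : IsPrimitiveSystem Pr) {γ : T → S} (hγ : Continuous γ) {G : T → W}
    (hG : HasIntegral Pr γ G) {t : T} {P : S → W} (hP : Pr (γ t) P) :
    ∀ᶠ s in 𝓝 t, G s - G t = P (γ s) - P (γ t) := by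
  obtain ⟨P', h1, h2⟩ := hG t
  filter_upwards [h2, hγ.continuousAt.eventually (hPr.sub_eq h1 hP)] with s h3 h4
  rw [h3, h4]

theorem sub_eq_of_isPreconnected (hPr : IsPrimitiveSystem Pr) {γ : T → S} (hγ : Continuous γ)
    {G : T → W} (hG : HasIntegral Pr γ G) {U : Set T} (hU : IsPreconnected U) {P : S → W}
    (hP : ∀ t ∈ U, Pr (γ t) P) {s t : T} (hs : s ∈ U) (ht : t ∈ U) :
    G s - G t = P (γ s) - P (γ t) := by
  have h := hU.eq_of_eventually_eq (φ := fun t => G t - P (γ t)) (fun t ht => by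
    filter_upwards [nhdsWithin_le_nhds (hPr.hasIntegral_sub hγ hG (hP t ht))] with s hs
    rw [sub_eq_sub_iff_sub_eq_sub, hs]) hs ht
  rwa [sub_eq_sub_iff_sub_eq_sub] at h

theorem integral_unique (hPr : IsPrimitiveSystem Pr) [PreconnectedSpace T] {γ : T → S}
    (hγ : Continuous γ) {G G' : T → W} (hG : HasIntegral Pr γ G) (hG' : HasIntegral Pr γ G') (s t : T) :
    G s - G t = G' s - G' t := by
  have h := isPreconnected_univ.eq_of_eventually_eq (φ := fun t => G t - G' t) (fun t _ => by
    obtain ⟨P, hP⟩ := hPr.exists_primitive (γ t)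
    filter_upwards [nhdsWithin_le_nhds (hPr.hasIntegral_sub hγ hG hP),
      nhdsWithin_le_nhds (hPr.hasIntegral_sub hγ hG' hP)] with s h1 h2
    rw [sub_eq_sub_iff_sub_eq_sub, h1, h2]) (mem_univ s) (mem_univ t)
  rwa [sub_eq_sub_iff_sub_eq_sub] at h

theorem sum_clamp (φ : unitInterval → W) {t : ℕ → unitInterval} (ht : Monotone t) (h0 : t 0 = 0)
    (s : unitInterval) (n : ℕ) :
    ∑ i ∈ Finset.range n, (φ (max (t i) (min s (t (i + 1)))) - φ (t i)) = φ (min s (t n)) - φ 0 := by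
  induction n with
  | zero => simp [h0]
  | succ n ih =>
    rw [Finset.sum_range_succ, ih]
    rcases le_total s (t n) with h | h
    · have h' : s ≤ t (n + 1) := h.trans (ht n.le_succ)
      rw [min_eq_left h', max_eq_left h, min_eq_left h]; abel
    · rw [min_eq_right h, max_eq_right (le_min h (ht n.le_succ))]; abel

theorem exists_integral (hPr : IsPrimitiveSystem Pr) {γ : unitInterval → S} (hγ : Continuous γ) :
    ∃ G, HasIntegral Pr γ G := by
  have hloc : ∀ s : unitInterval, ∃ P, ∃ U : Set S, IsOpen U ∧ γ s ∈ U ∧ ∀ q ∈ U, Pr q P := fun s => by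
    obtain ⟨P, hP⟩ := hPr.exists_primitive (γ s)
    obtain ⟨U, h1, h2, h3⟩ := eventually_nhds_iff.1 (hPr.eventually hP)
    exact ⟨P, U, h2, h3, h1⟩
  choose P₀ U hUo hU hP₀ using hloc
  obtain ⟨t, ht0, ht, ⟨n, hn⟩, hsub⟩ := exists_monotone_Icc_subset_open_cover_unitInterval
    (c := fun s => γ ⁻¹' U s) (fun s => (hUo s).preimage hγ) (fun s _ => mem_iUnion.2 ⟨s, hU s⟩)
  choose k hk using hsub
  let c : ℕ → unitInterval → unitInterval := fun i s => max (t i) (min s (t (i + 1)))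
  have hc : ∀ i, Continuous (c i) := fun i => by fun_prop
  refine ⟨fun s => ∑ i ∈ Finset.range n, (P₀ (k i) (γ (c i s)) - P₀ (k i) (γ (t i))), fun s => ?_⟩
  obtain ⟨P, hP⟩ := hPr.exists_primitive (γ s)
  refine ⟨P, hP, ?_⟩
  have key : ∀ i, ∀ᶠ s' in 𝓝 s, P₀ (k i) (γ (c i s')) - P₀ (k i) (γ (c i s)) =
      P (γ (c i s')) - P (γ (c i s)) := by
    intro i
    rcases lt_or_ge s (t i) with h | h
    · filter_upwards [gt_mem_nhds h] with s' h'
      have e : ∀ x, x < t i → c i x = t i := fun x hx => max_eq_left ((min_le_left _ _).trans hx.le)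
      rw [e s h, e s' h']; simp
    rcases lt_or_ge (t (i + 1)) s with h' | h'
    · filter_upwards [lt_mem_nhds h'] with s' h''
      have e : ∀ x, t (i + 1) < x → c i x = t (i + 1) := fun x hx => by
        simp only [c]
        rw [min_eq_right hx.le, max_eq_right (ht i.le_succ)]
      rw [e s h', e s' h'']; simp
    · have e : c i s = s := by
        simp only [c]
        rw [min_eq_left h', max_eq_right h]
      rw [e]
      have h1 : Tendsto (fun s' => γ (c i s')) (𝓝 s) (𝓝 (γ s)) :=
        (hγ.comp (hc i)).tendsto' _ _ (by simp [e])
      exact h1.eventually (hPr.sub_eq hP (hP₀ (k i) _ (hk i ⟨h, h'⟩)))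
  filter_upwards [(eventually_all_finite (Finset.range n).finite_toSet).2 fun i _ => key i] with s' hs'
  rw [← Finset.sum_sub_distrib]
  have h1 : ∀ x, ∑ i ∈ Finset.range n, (P (γ (c i x)) - P (γ (t i))) = P (γ x) - P (γ 0) := fun x => by
    have := sum_clamp (fun x => P (γ x)) ht ht0 x n
    rwa [hn n le_rfl, min_eq_left unitInterval.le_one'] at this
  calc _ = ∑ i ∈ Finset.range n, ((P (γ (c i s')) - P (γ (t i))) - (P (γ (c i s)) - P (γ (t i)))) := by
        refine Finset.sum_congr rfl fun i hi => ?_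
        have := hs' i hi
        rw [sub_sub_sub_cancel_right, sub_sub_sub_cancel_right, this]
    _ = _ := by rw [Finset.sum_sub_distrib, h1, h1, sub_sub_sub_cancel_right]

/-- Integrals are invariant under homotopies relative to the endpoints. -/
theorem integral_homotopy (hPr : IsPrimitiveSystem Pr) {K : unitInterval × unitInterval → S}
    (hK : Continuous K) {a b : S} (ha : ∀ t, K (t, 0) = a) (hb : ∀ t, K (t, 1) = b)
    {G : unitInterval → unitInterval → W} (hG : ∀ t, HasIntegral Pr (fun s => K (t, s)) (G t))
    (t t' : unitInterval) : G t 1 - G t 0 = G t' 1 - G t' 0 := by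
  have hKs : ∀ t, Continuous fun s => K (t, s) := fun t => by fun_prop
  have hstrip : ∀ t₀ s₀, ∃ P : S → W, ∃ J : Set unitInterval, J ∈ 𝓝 s₀ ∧
      (∀ s ∈ J, Pr (K (t₀, s)) P) ∧
      ∀ᶠ t in 𝓝 t₀, ∀ s ∈ J, ∀ s' ∈ J, G t s - G t s' = P (K (t, s)) - P (K (t, s')) := by
    intro t₀ s₀
    obtain ⟨P, hP⟩ := hPr.exists_primitive (K (t₀, s₀))
    have h1 : ∀ᶠ x in 𝓝 (t₀, s₀), Pr (K x) P := hK.continuousAt.eventually (hPr.eventually hP)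
    rw [nhds_prod_eq, eventually_prod_iff] at h1
    obtain ⟨A, hA, B, hB, h2⟩ := h1
    obtain ⟨b, c, -, hJ1, hJ2⟩ := exists_Icc_mem_subset_of_mem_nhds hB
    refine ⟨P, Icc b c, hJ1, fun s hs => h2 hA.self_of_nhds (hJ2 hs), ?_⟩
    filter_upwards [hA] with t hAt s hs s' hs'
    exact hPr.sub_eq_of_isPreconnected (hKs t) (hG t) isPreconnected_Icc
      (fun s hs => h2 hAt (hJ2 hs)) hs hs'
  let good : unitInterval → unitInterval → Prop := fun t₀ s₀ => ∀ P, Pr (K (t₀, s₀)) P →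
    ∀ᶠ t in 𝓝 t₀, (G t s₀ - G t 0) - (G t₀ s₀ - G t₀ 0) = P (K (t, s₀)) - P (K (t₀, s₀))
  have hgood : ∀ t₀ s, good t₀ s := by
    intro t₀ s
    have h := isPreconnected_univ.eq_of_eventually_eq (φ := fun s => good t₀ s) (fun s₀ _ => by
      obtain ⟨P, J, hJ, hPJ, hev⟩ := hstrip t₀ s₀
      have tr : ∀ s ∈ J, ∀ s' ∈ J, good t₀ s → good t₀ s' := by
        intro s hs s' hs' hgs P' hP'
        have hc : ∀ s, Tendsto (fun t => K (t, s)) (𝓝 t₀) (𝓝 (K (t₀, s))) := fun s =>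
          Continuous.tendsto (by fun_prop) t₀
        filter_upwards [hgs P (hPJ s hs), hev, (hc s').eventually (hPr.sub_eq (hPJ s' hs') hP')]
          with t h1 h2 h3
        rw [h3]
        have h4 := h2 s' hs' s hs
        have h5 := hev.self_of_nhds s' hs' s hs
        calc _ = (G t s' - G t s) - (G t₀ s' - G t₀ s) + ((G t s - G t 0) - (G t₀ s - G t₀ 0)) := by abel
          _ = _ := by rw [h4, h5, h1]; abel
      filter_upwards [nhdsWithin_le_nhds hJ] with s hs
      exact propext ⟨tr s hs s₀ (mem_of_mem_nhds hJ), tr s₀ (mem_of_mem_nhds hJ) s hs⟩)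
      (mem_univ s) (mem_univ 0)
    rw [h]
    intro P _
    exact Eventually.of_forall fun t => by simp [ha]
  have h := isPreconnected_univ.eq_of_eventually_eq (φ := fun t => G t 1 - G t 0) (fun t₀ _ => by
    obtain ⟨P, hP⟩ := hPr.exists_primitive (K (t₀, 1))
    filter_upwards [nhdsWithin_le_nhds (hgood t₀ 1 P hP)] with t ht
    rw [hb, hb, sub_self] at ht
    exact sub_eq_zero.1 ht) (mem_univ t) (mem_univ t')
  exact h

end IsPrimitiveSystem

/-! ### Periods -/

namespace TranslationStructure

variable {S : Type*} [TopologicalSpace S] [ChartedSpace ℂ S] {Z : Set S} {κ : Z → ℕ}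
  (X : TranslationStructure S Z κ)

theorem isPrimitiveAt_chart {e : OpenPartialHomeomorph S ℂ} (he : e ∈ X.charts) {p : S}
    (hp : p ∈ e.source) : X.IsPrimitiveAt p e := by
  filter_upwards [e.open_source.mem_nhds hp] with q hq
  exact ⟨e.continuousAt hq, fun e' he' hq' => X.translation e' he' e he q hq' hq⟩

variable {X} in
theorem IsPrimitiveAt.sub_eq [T2Space S] (hZ : Z.Finite) {p : S} {P P' : S → ℂ}
    (h : X.IsPrimitiveAt p P) (h' : X.IsPrimitiveAt p P') :
    ∀ᶠ q in 𝓝 p, P' q - P' p = P q - P p := by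
  by_cases hp : p ∈ Z
  · have h1 : (Z \ {p})ᶜ ∈ 𝓝 p :=
      (hZ.subset sdiff_subset).isClosed.isOpen_compl.mem_nhds fun h => h.2 rfl
    obtain ⟨V, -, hV1, hV2, hVc, hVo, hpV⟩ := exists_punctured_nhds (chartAt ℂ p) (mem_chart_source ℂ p)
      (inter_mem (h.and h') h1)
    have hloc : ∀ q ∈ V \ {p}, ∀ᶠ q' in 𝓝 q, P' q' - P q' = P' q - P q := fun q hq => by
      have hqZ : q ∉ Z := fun hqZ => (hV1 hq.1).2 ⟨hqZ, hq.2⟩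
      obtain ⟨e, he, hqe⟩ := X.exists_chart hqZ
      filter_upwards [(hV1 hq.1).1.1.2 e he hqe, (hV1 hq.1).1.2.2 e he hqe] with q' h3 h4
      linear_combination h4 - h3
    have hconst : ∀ q ∈ V \ {p}, ∀ q' ∈ V \ {p}, P' q - P q = P' q' - P q' := fun q hq q' hq' =>
      hVc.eq_of_eventually_eq (φ := fun q => P' q - P q)
        (fun q hq => nhdsWithin_le_nhds (hloc q hq)) hq hq'
    filter_upwards [hVo.mem_nhds hpV] with q hq
    by_cases hqp : q = p
    · rw [hqp]; ring
    · have hne : (𝓝[V \ {p}] p).NeBot := by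
        rw [sdiff_eq, inter_comm, nhdsWithin_inter_of_mem' (nhdsWithin_le_nhds (hVo.mem_nhds hpV))]
        by_contra hcon
        rw [neBot_iff, not_not, ← isOpen_singleton_iff_punctured_nhds] at hcon
        have h3 := (chartAt ℂ p).isOpen_image_of_subset_source hcon
          (singleton_subset_iff.2 (mem_chart_source ℂ p))
        rw [image_singleton] at h3
        exact not_isOpen_singleton _ h3
      have hcont : Tendsto (fun q => P' q - P q) (𝓝[V \ {p}] p) (𝓝 (P' p - P p)) :=
        ((h'.self_of_nhds.1.tendsto).sub (h.self_of_nhds.1.tendsto)).mono_left nhdsWithin_le_nhds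
      have hcont' : Tendsto (fun q => P' q - P q) (𝓝[V \ {p}] p) (𝓝 (P' q - P q)) :=
        tendsto_const_nhds.congr' (by
          filter_upwards [self_mem_nhdsWithin] with q' hq'
          exact hconst q ⟨hq, hqp⟩ q' hq')
      have := tendsto_nhds_unique hcont hcont'
      linear_combination -this
  · obtain ⟨e, he, hpe⟩ := X.exists_chart hp
    filter_upwards [h.self_of_nhds.2 e he hpe, h'.self_of_nhds.2 e he hpe] with q h1 h2
    rw [h1, h2]

theorem isPrimitiveSystem [T2Space S] (hZ : Z.Finite) : IsPrimitiveSystem X.IsPrimitiveAt where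
  exists_primitive := fun p => by
    by_cases hp : p ∈ Z
    · obtain ⟨ζ, h1, h2, h3⟩ := X.zeros ⟨p, hp⟩
      refine ⟨fun q => ζ q ^ (κ ⟨p, hp⟩ + 1) / (κ ⟨p, hp⟩ + 1), ?_⟩
      filter_upwards [ζ.open_source.mem_nhds h1] with q hq
      refine ⟨((ζ.continuousAt hq).pow _).div_const _, fun e he hqe => ?_⟩
      filter_upwards [h3 e he q hqe hq] with q' hq'
      rw [hq', sub_div]
    · obtain ⟨e, he, hpe⟩ := X.exists_chart hp
      exact ⟨e, X.isPrimitiveAt_chart he hpe⟩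
  eventually := fun h => eventually_eventually_nhds.2 h
  sub_eq := fun h h' => h.sub_eq hZ h'

end TranslationStructure

theorem HasIntegral.comp {S T T' W : Type*} [TopologicalSpace S] [TopologicalSpace T]
    [TopologicalSpace T'] [AddCommGroup W] {Pr : S → (S → W) → Prop} {γ : T → S} {G : T → W}
    (h : HasIntegral Pr γ G) {σ : T' → T} (hσ : Continuous σ) : HasIntegral Pr (γ ∘ σ) (G ∘ σ) := by
  intro t
  obtain ⟨P, h1, h2⟩ := h (σ t)
  exact ⟨P, h1, hσ.continuousAt.eventually h2⟩

namespace TranslationStructure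

variable {S : Type*} [TopologicalSpace S] [ChartedSpace ℂ S] {Z : Set S} {κ : Z → ℕ}
  {X X' : TranslationStructure S Z κ}

theorem hasPeriod_iff {a b : S} {γ : Path a b} {c : ℂ} : X.HasPeriod γ c ↔
    ∃ G : unitInterval → ℂ, HasIntegral X.IsPrimitiveAt γ G ∧ G 1 - G 0 = c :=
  exists_congr fun _ => and_comm

theorem exists_hasPeriod [T2Space S] (hZ : Z.Finite) {a b : S} (γ : Path a b) : ∃ c, X.HasPeriod γ c := by
  obtain ⟨G, hG⟩ := (X.isPrimitiveSystem hZ).exists_integral γ.continuous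
  exact ⟨_, hasPeriod_iff.2 ⟨G, hG, rfl⟩⟩

theorem HasPeriod.unique [T2Space S] (hZ : Z.Finite) {a b : S} {γ : Path a b} {c c' : ℂ} (h : X.HasPeriod γ c)
    (h' : X.HasPeriod γ c') : c = c' := by
  obtain ⟨G, h1, rfl⟩ := hasPeriod_iff.1 h
  obtain ⟨G', h2, rfl⟩ := hasPeriod_iff.1 h'
  exact (X.isPrimitiveSystem hZ).integral_unique γ.continuous h1 h2 1 0

theorem hasPeriod_period [T2Space S] (hZ : Z.Finite) {a b : S} (γ : Path a b) : X.HasPeriod γ (X.period γ) :=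
  Classical.epsilon_spec (exists_hasPeriod hZ γ)

theorem HasPeriod.period_eq [T2Space S] (hZ : Z.Finite) {a b : S} {γ : Path a b} {c : ℂ} (h : X.HasPeriod γ c) :
    X.period γ = c :=
  (hasPeriod_period hZ γ).unique hZ h

theorem period_scale [T2Space S] (hZ : Z.Finite) (c : ℂˣ) {a b : S} (γ : Path a b) :
    (X.scale c).period γ = c * X.period γ := by
  refine HasPeriod.period_eq hZ ?_
  obtain ⟨G, h1, h2⟩ := hasPeriod_iff.1 (hasPeriod_period hZ γ (X := X))
  refine hasPeriod_iff.2 ⟨fun t => c * G t, fun t => ?_, by rw [← h2]; ring⟩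
  obtain ⟨P, h3, h4⟩ := h1 t
  refine ⟨fun q => c * P q, ?_, ?_⟩
  · filter_upwards [h3] with q hq
    refine ⟨continuousAt_const.mul hq.1, ?_⟩
    rintro _ ⟨e, he, rfl⟩ hqe
    filter_upwards [hq.2 e he hqe] with q' hq'
    simp [← mul_sub, hq']
  · filter_upwards [h4] with s hs
    rw [← mul_sub, ← mul_sub, hs]

theorem Equivalent.period_eq [T2Space S] (hZ : Z.Finite) (h : X.Equivalent X') {a b : Z} (γ : Path (a : S) (b : S)) :
    X.period γ = X'.period γ := by
  obtain ⟨ψ, hψ, hI⟩ := h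
  have hfix : ∀ z ∈ Z, ψ z = z := fun z hz => hI.fixes hz
  obtain ⟨G, h1, h2⟩ := hasPeriod_iff.1 (hasPeriod_period hZ γ (X := X))
  have h3 : HasIntegral X'.IsPrimitiveAt (fun s => ψ (γ s)) G := fun t => by
    obtain ⟨P, hP, hPG⟩ := h1 t
    refine ⟨P ∘ ψ.symm, ?_, by simpa using hPG⟩
    have h4 : Tendsto ψ.symm (𝓝 (ψ (γ t))) (𝓝 (γ t)) :=
      ψ.symm.continuous.tendsto' _ _ (ψ.symm_apply_apply _)
    filter_upwards [h4.eventually hP] with q hq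
    refine ⟨ContinuousAt.comp hq.1 ψ.symm.continuous.continuousAt, fun e' he' hqe' => ?_⟩
    have hqZ : ψ.symm q ∉ Z := fun hqZ => by
      have h5 := hfix _ hqZ
      rw [ψ.apply_symm_apply] at h5
      exact X'.notMem_of_mem_source he' hqe' (h5 ▸ hqZ)
    obtain ⟨e, he, hqe⟩ := X.exists_chart hqZ
    have h6 := hψ e he e' he' (ψ.symm q) hqe (by rwa [ψ.apply_symm_apply])
    filter_upwards [ψ.symm.continuous.continuousAt.eventually h6,
      ψ.symm.continuous.continuousAt.eventually (hq.2 e he hqe)] with q' h7 h8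
    simp only [ψ.apply_symm_apply] at h7
    simp only [Function.comp_apply]
    rw [h7, h8]
  obtain ⟨H, hH1, hH2, hH3, hH4⟩ := hI
  let K : unitInterval × unitInterval → S := fun x => (H (x.1, γ x.2)).2
  have hK : Continuous K := by fun_prop
  have hPr := X'.isPrimitiveSystem hZ
  have hKt : ∀ t, Continuous fun s => K (t, s) := fun t => by fun_prop
  choose G' hG' using fun t => hPr.exists_integral (hKt t)
  have h5 := hPr.integral_homotopy hK (a := a) (b := b) (fun t => by simp [K, hH2 t a a.2])
    (fun t => by simp [K, hH2 t b b.2]) hG' 1 0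
  have h6 := hPr.integral_unique (hKt 1) (hG' 1) (G' := G) (by simpa [K, hH4] using h3) 1 0
  symm
  refine HasPeriod.period_eq hZ (hasPeriod_iff.2 ⟨G' 0, by simpa [K, hH3] using hG' 0, ?_⟩)
  rw [← h5, h6, h2]

theorem period_mk [T2Space S] (hZ : Z.Finite) {a b : Z} (γ : Path (a : S) (b : S)) (X : TranslationStructure S Z κ) :
    (Stratum.mk X).period γ = X.period γ :=
  Equivalent.period_eq hZ (Quotient.mk_out (s := teichmullerSetoid Z κ) X) γ

end TranslationStructure

theorem convex_refTriangle_diff_corner (j : Fin 3) : Convex ℝ (refTriangle \ {corner j}) := by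
  have h : refTriangle \ {corner j} = refTriangle ∩ {z | bary j z < 1} := by
    ext z
    refine and_congr_right fun hz => ?_
    have hz' := mem_refTriangle_iff.1 hz
    have hs := bary_sum j z
    have hle : bary j z ≤ 1 := by linarith [hz' (j + 1), hz' (j + 2)]
    refine ⟨fun hne => lt_of_le_of_ne hle fun h1 => hne ?_, ?_⟩
    · refine bary_ext j (by rw [h1, bary_corner, if_pos rfl]) ?_
      rw [bary_corner, if_neg (by simp)]
      linarith [hz' (j + 1), hz' (j + 2)]
    · rintro h1 rfl
      have h2 : bary j (corner j) < 1 := h1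
      rw [bary_corner, if_pos rfl] at h2
      exact lt_irrefl _ h2
  rw [h]
  refine convex_refTriangle.inter fun z hz w hw a b ha hb hab => ?_
  have hz' : bary j z < 1 := hz
  have hw' : bary j w < 1 := hw
  change bary j (a • z + b • w) < 1
  rw [bary_combo j hab]
  rcases ha.eq_or_lt with rfl | ha
  · obtain rfl : b = 1 := by linarith
    simpa using hw'
  · nlinarith [mul_lt_mul_of_pos_left hz' ha, mul_le_mul_of_nonneg_left hw'.le hb]

namespace Triangulation

variable {S : Type*} [TopologicalSpace S] [ChartedSpace ℂ S] {Z : Set S} {E F : Type*}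
  {κ : Z → ℕ} {τ : Triangulation S Z E F} {X : TranslationStructure S Z κ}

theorem IsEuclideanFace.sub_eq {f : F} {w : Fin 3 → ℂ} {D : ℂ → ℂ} (h : τ.IsEuclideanFace X f w D)
    {z : ℂ} (hz : z ∈ refTriangle) {P : S → ℂ} (hP : X.IsPrimitiveAt (τ.cell f z) P) :
    ∀ᶠ z' in 𝓝[refTriangle] z, D z' - D z = P (τ.cell f z') - P (τ.cell f z) := by
  have hgen : ∀ x ∈ refTriangle, τ.cell f x ∉ Z → X.IsPrimitiveAt (τ.cell f x) P →
      ∀ᶠ z' in 𝓝[refTriangle] x, D z' - D x = P (τ.cell f z') - P (τ.cell f x) := by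
    intro x hx hxZ hPx
    obtain ⟨e, he, hxe⟩ := X.exists_chart hxZ
    filter_upwards [h.primitive x hx e he hxe,
      (τ.tendsto_cell hx).eventually (hPx.self_of_nhds.2 e he hxe)] with z' h1 h2
    rw [h1, h2]
  by_cases hzZ : τ.cell f z ∈ Z
  · obtain ⟨j, rfl⟩ := (τ.cell_mem_iff hz).1 hzZ
    have h1 : ∀ᶠ z' in 𝓝[refTriangle] (corner j), X.IsPrimitiveAt (τ.cell f z') P :=
      (τ.tendsto_cell hz).eventually (eventually_eventually_nhds.2 hP)
    have h2 : ∀ᶠ z' in 𝓝[refTriangle] (corner j), τ.cell f z' ∈ Z → z' = corner j := by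
      have h3 : ∀ᶠ z' in 𝓝 (corner j), ∀ k, z' = corner k → k = j := by
        rw [eventually_all]
        intro k
        by_cases hkj : k = j
        · exact Eventually.of_forall fun _ _ => hkj
        · have hne : corner k ≠ corner j := fun h => by
            have h4 := congrArg (bary j) h
            rw [bary_corner, bary_corner, if_neg (Ne.symm hkj), if_pos rfl] at h4
            exact zero_ne_one h4
          filter_upwards [isOpen_ne.mem_nhds hne.symm] with z' h5 h6
          exact absurd h6 h5
      filter_upwards [nhdsWithin_le_nhds h3, self_mem_nhdsWithin] with z' h4 h5 h6
      obtain ⟨k, rfl⟩ := (τ.cell_mem_iff h5).1 h6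
      rw [h4 k rfl]
    obtain ⟨r, hr, hball⟩ := Metric.mem_nhdsWithin_iff.1 (h1.and h2)
    have hconv : Convex ℝ (Metric.ball (corner j) r ∩ (refTriangle \ {corner j})) :=
      (convex_ball _ _).inter (convex_refTriangle_diff_corner j)
    have hsub : ∀ x ∈ Metric.ball (corner j) r ∩ (refTriangle \ {corner j}),
        ∀ᶠ z' in 𝓝[refTriangle] x, D z' - D x = P (τ.cell f z') - P (τ.cell f x) := fun x hx => by
      have h3 := hball ⟨hx.1, hx.2.1⟩
      exact hgen x hx.2.1 (fun h => hx.2.2 (h3.2 h)) h3.1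
    have hconst : ∀ x ∈ Metric.ball (corner j) r ∩ (refTriangle \ {corner j}),
        ∀ y ∈ Metric.ball (corner j) r ∩ (refTriangle \ {corner j}),
        D x - P (τ.cell f x) = D y - P (τ.cell f y) := fun x hx y hy =>
      hconv.isPreconnected.eq_of_eventually_eq (φ := fun x => D x - P (τ.cell f x)) (fun x hx => by
        filter_upwards [nhdsWithin_mono x (inter_subset_right.trans sdiff_subset) (hsub x hx)] with y hy
        linear_combination hy) hx hy
    filter_upwards [nhdsWithin_le_nhds (Metric.ball_mem_nhds _ hr), self_mem_nhdsWithin] with y hy hyT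
    by_cases hyj : y = corner j
    · rw [hyj]; ring
    have hne : (𝓝[Metric.ball (corner j) r ∩ (refTriangle \ {corner j})] (corner j)).NeBot := by
      rw [← mem_closure_iff_nhdsWithin_neBot]
      have h4 : corner j ∈ closure (openSegment ℝ (corner j) y) :=
        segment_subset_closure_openSegment (left_mem_segment ℝ _ _)
      refine closure_mono (fun x hx => ?_) h4
      have h5 := openSegment_subset_segment ℝ _ _ hx
      refine ⟨(convex_ball _ _).segment_subset (Metric.mem_ball_self hr) hy h5,
        convex_refTriangle.segment_subset hz hyT h5, ?_⟩
      rintro rfl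
      exact hyj (left_mem_openSegment_iff.1 hx).symm
    have hcont : Tendsto (fun x => D x - P (τ.cell f x))
        (𝓝[Metric.ball (corner j) r ∩ (refTriangle \ {corner j})] (corner j))
        (𝓝 (D (corner j) - P (τ.cell f (corner j)))) :=
      ((h.continuousOn _ hz).sub ((hP.self_of_nhds.1.tendsto).comp (τ.tendsto_cell hz))).mono_left
        (nhdsWithin_mono _ (inter_subset_right.trans sdiff_subset))
    have hcont' : Tendsto (fun x => D x - P (τ.cell f x))
        (𝓝[Metric.ball (corner j) r ∩ (refTriangle \ {corner j})] (corner j))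
        (𝓝 (D y - P (τ.cell f y))) :=
      tendsto_const_nhds.congr' (by
        filter_upwards [self_mem_nhdsWithin] with x hx
        exact hconst y ⟨hy, hyT, hyj⟩ x hx)
    have := tendsto_nhds_unique hcont hcont'
    linear_combination -this
  · exact hgen z hz hzZ hP

theorem vertex_mem (τ : Triangulation S Z E F) (f : F) (j : Fin 3) : τ.cell f (corner j) ∈ Z :=
  (τ.vertices _).2 ⟨f, j, rfl⟩

variable (τ) in
/-- The side `h` as a path. -/
noncomputable def edgePath (h : F × Fin 3) : Path (τ.cell h.1 (corner h.2)) (τ.cell h.1 (corner (h.2 + 1))) where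
  toFun s := τ.cell h.1 (side h.2 s)
  continuous_toFun := (τ.continuousOn_cell h.1).comp_continuous
    ((continuous_side h.2).comp continuous_subtype_val) fun s => side_mem _ s.2
  source' := by simp [side_zero]
  target' := by simp [side_one]

theorem edgePath_apply (h : F × Fin 3) (s : unitInterval) :
    τ.edgePath h s = τ.cell h.1 (side h.2 s) := rfl

theorem edgePath_partner (h : F × Fin 3) :
    (τ.edgePath (τ.partner h) : unitInterval → S) = τ.edgePath h ∘ unitInterval.symm := by
  ext s
  have h1 := τ.cell_side_partner h (s := 1 - s) ⟨by linarith [s.2.2], by linarith [s.2.1]⟩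
  rw [sub_sub_cancel] at h1
  simp [edgePath_apply, h1]

theorem IsEuclideanFace.hasIntegral_edge [T2Space S] {f : F} {w : Fin 3 → ℂ} {D : ℂ → ℂ}
    (h : τ.IsEuclideanFace X f w D) (j : Fin 3) :
    HasIntegral X.IsPrimitiveAt (τ.edgePath (f, j)) fun s => D (side j s) := by
  intro s
  obtain ⟨P, hP⟩ := (X.isPrimitiveSystem τ.finite_vertices).exists_primitive (τ.edgePath (f, j) s)
  refine ⟨P, hP, ?_⟩
  have h1 : Tendsto (fun s : unitInterval => side j s) (𝓝 s) (𝓝[refTriangle] (side j s)) :=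
    tendsto_nhdsWithin_of_tendsto_nhds_of_eventually_within _
      (((continuous_side j).comp continuous_subtype_val).tendsto s)
      (Eventually.of_forall fun s => side_mem j s.2)
  exact h1.eventually (h.sub_eq (side_mem j s.2) hP)

theorem IsEuclideanFace.hasPeriod_edge [T2Space S] {f : F} {w : Fin 3 → ℂ} {D : ℂ → ℂ}
    (h : τ.IsEuclideanFace X f w D) (j : Fin 3) :
    X.HasPeriod (τ.edgePath (f, j)) (w (j + 1) - w j) := by
  refine TranslationStructure.hasPeriod_iff.2 ⟨_, h.hasIntegral_edge j, ?_⟩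
  simp [side_zero, side_one, h.corners]

/-- The side vectors of a translation structure. -/
noncomputable def sideVector (τ : Triangulation S Z E F) (X : TranslationStructure S Z κ)
    (h : F × Fin 3) : ℂ := X.period (τ.edgePath h)

theorem IsEuclideanFace.sideVector_eq [T2Space S] {f : F} {w : Fin 3 → ℂ} {D : ℂ → ℂ}
    (h : τ.IsEuclideanFace X f w D) (j : Fin 3) : τ.sideVector X (f, j) = w (j + 1) - w j :=
  (h.hasPeriod_edge j).period_eq τ.finite_vertices

theorem sideVector_partner [T2Space S] (X : TranslationStructure S Z κ) (h : F × Fin 3) :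
    τ.sideVector X (τ.partner h) = -τ.sideVector X h := by
  obtain ⟨G, h1, h2⟩ := TranslationStructure.hasPeriod_iff.1
    (TranslationStructure.hasPeriod_period τ.finite_vertices (τ.edgePath h) (X := X))
  have h3 := h1.comp unitInterval.continuous_symm
  rw [← edgePath_partner] at h3
  refine (TranslationStructure.HasPeriod.period_eq τ.finite_vertices
    (TranslationStructure.hasPeriod_iff.2 ⟨_, h3, ?_⟩))
  simp only [Function.comp_apply, unitInterval.symm_one, unitInterval.symm_zero]
  rw [sideVector, ← h2]; ring

theorem IsGeometric.sideVector_mem [T2Space S] (h : τ.IsGeometric X) :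
    τ.sideVector X ∈ τ.cycleSpace := by
  refine ⟨fun f => ?_, fun h => sideVector_partner X h⟩
  obtain ⟨w, D, hw⟩ := h f
  rw [Fin.sum_univ_three, hw.sideVector_eq, hw.sideVector_eq, hw.sideVector_eq]
  simp only [show (0 + 1 : Fin 3) = 1 from rfl, show (1 + 1 : Fin 3) = 2 from rfl,
    show (2 + 1 : Fin 3) = 0 from rfl]
  ring

end Triangulation

/-! ### The gauge of the reference triangle -/

/-- The linear part of the barycentric coordinate `bary k`. -/
def baryLin (k : Fin 3) (y : ℂ) : ℝ := ![-(y.re + y.im), y.re, y.im] k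

theorem bary_add (k : Fin 3) (z y : ℂ) : bary k (z + y) = bary k z + baryLin k y := by
  fin_cases k <;> simp [bary, baryLin]; ring

theorem bary_barycenter_add (k : Fin 3) (y : ℂ) : bary k (barycenter + y) = 1 / 3 + baryLin k y := by
  rw [bary_add, bary_barycenter]

theorem baryLin_smul (k : Fin 3) (r : ℝ) (y : ℂ) : baryLin k (r * y) = r * baryLin k y := by
  fin_cases k <;> simp [baryLin]; ring

theorem continuous_baryLin (k : Fin 3) : Continuous (baryLin k) := by
  fin_cases k
  · change Continuous fun y : ℂ => -(y.re + y.im)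
    fun_prop
  · exact Complex.continuous_re
  · exact Complex.continuous_im

/-- The gauge of the reference triangle with respect to its barycenter. -/
noncomputable def triGauge (y : ℂ) : ℝ := 3 * max (max (-baryLin 0 y) (-baryLin 1 y)) (-baryLin 2 y)

theorem continuous_triGauge : Continuous triGauge := by
  have h0 := continuous_baryLin 0
  have h1 := continuous_baryLin 1
  have h2 := continuous_baryLin 2
  unfold triGauge; fun_prop

theorem triGauge_le_iff {y : ℂ} {c : ℝ} : triGauge y ≤ c ↔ ∀ k, -(3 * baryLin k y) ≤ c := by
  rw [Fin.forall_fin_succ, Fin.forall_fin_two, triGauge]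
  simp only [Fin.succ_zero_eq_one, Fin.succ_one_eq_two]
  constructor
  · intro h
    have h1 : max (max (-baryLin 0 y) (-baryLin 1 y)) (-baryLin 2 y) ≤ c / 3 := by linarith
    simp only [max_le_iff] at h1
    exact ⟨by linarith [h1.1.1], by linarith [h1.1.2], by linarith [h1.2]⟩
  · rintro ⟨h0, h1, h2⟩
    have : max (max (-baryLin 0 y) (-baryLin 1 y)) (-baryLin 2 y) ≤ c / 3 :=
      max_le (max_le (by linarith) (by linarith)) (by linarith)
    linarith

theorem neg_baryLin_le (k : Fin 3) (y : ℂ) : -(3 * baryLin k y) ≤ triGauge y :=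
  triGauge_le_iff.1 le_rfl k

theorem exists_baryLin_eq (y : ℂ) : ∃ k, triGauge y = -(3 * baryLin k y) := by
  unfold triGauge
  rcases max_choice (max (-baryLin 0 y) (-baryLin 1 y)) (-baryLin 2 y) with h | h
  · rcases max_choice (-baryLin 0 y) (-baryLin 1 y) with h' | h'
    · exact ⟨0, by rw [h, h']; ring⟩
    · exact ⟨1, by rw [h, h']; ring⟩
  · exact ⟨2, by rw [h]; ring⟩

theorem triGauge_smul {r : ℝ} (hr : 0 ≤ r) (y : ℂ) : triGauge (r * y) = r * triGauge y := by
  simp only [triGauge, baryLin_smul]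
  rw [← mul_neg, ← mul_neg, ← mul_neg, ← mul_max_of_nonneg _ _ hr, ← mul_max_of_nonneg _ _ hr]
  ring

theorem baryLin_sum (y : ℂ) : baryLin 0 y + baryLin 1 y + baryLin 2 y = 0 := by
  simp [baryLin]

theorem triGauge_pos {y : ℂ} (hy : y ≠ 0) : 0 < triGauge y := by
  by_contra h
  have h1 := triGauge_le_iff.1 (not_lt.1 h)
  have hs := baryLin_sum y
  have a0 := h1 0
  have a1 := h1 1
  have a2 := h1 2
  refine hy (Complex.ext ?_ ?_)
  · change baryLin 1 y = 0; linarith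
  · change baryLin 2 y = 0; linarith

theorem triGauge_le_one_iff {y : ℂ} : triGauge y ≤ 1 ↔ barycenter + y ∈ refTriangle := by
  rw [triGauge_le_iff, mem_refTriangle_iff]
  refine forall_congr' fun k => ?_
  rw [bary_barycenter_add]
  constructor <;> intro h <;> linarith

theorem exists_bary_eq_zero {y : ℂ} (hy : triGauge y = 1) : ∃ k, bary k (barycenter + y) = 0 := by
  obtain ⟨k, hk⟩ := exists_baryLin_eq y
  exact ⟨k, by rw [bary_barycenter_add]; linarith⟩

/-! ### Homeomorphisms of the reference triangle that preserve the sides -/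

/-- A homeomorphism of the reference triangle that maps every side to itself. -/
structure IsTriangleHomeo (g : ℂ → ℂ) : Prop where
  continuousOn : ContinuousOn g refTriangle
  bijOn : BijOn g refTriangle refTriangle
  bary_eq_zero_iff : ∀ z ∈ refTriangle, ∀ k, bary k (g z) = 0 ↔ bary k z = 0

namespace IsTriangleHomeo

variable {g : ℂ → ℂ}

theorem mem (hg : IsTriangleHomeo g) {z : ℂ} (hz : z ∈ refTriangle) : g z ∈ refTriangle := hg.bijOn.mapsTo hz

theorem bary_pos (hg : IsTriangleHomeo g) {z : ℂ} (hz : z ∈ interior refTriangle) (k : Fin 3) : 0 < bary k (g z) := by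
  have hz' := interior_subset hz
  refine lt_of_le_of_ne (mem_refTriangle_iff.1 (hg.mem hz') k) fun h => ?_
  exact ((mem_interior_refTriangle_iff.1 hz) k).ne' ((hg.bary_eq_zero_iff z hz' k).1 h.symm)

theorem hasLocalDegree_barycenter (hg : IsTriangleHomeo g) : HasLocalDegree g barycenter 1 := by
  let x : ℝ → ℂ := fun t => Complex.exp (t * Complex.I)
  have hx0 : ∀ t, x t ≠ 0 := fun t => Complex.exp_ne_zero _
  have hxc : Continuous x := by fun_prop
  have hxp : x (2 * Real.pi) = x 0 := by simp [x]
  let ρ : ℝ → ℝ := fun t => (triGauge (x t))⁻¹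
  have hρ : ∀ t, 0 < ρ t := fun t => inv_pos.2 (triGauge_pos (hx0 t))
  have hρc : Continuous ρ := (continuous_triGauge.comp hxc).inv₀ fun t => (triGauge_pos (hx0 t)).ne'
  have hνb : ∀ t, triGauge (ρ t * x t) = 1 := fun t => by
    rw [triGauge_smul (hρ t).le]; exact inv_mul_cancel₀ (triGauge_pos (hx0 t)).ne'
  have hb0 := interior_subset barycenter_mem_interior
  have hgb := fun k => hg.bary_pos barycenter_mem_interior k
  have hbT : ∀ t, barycenter + ρ t * x t ∈ refTriangle := fun t => triGauge_le_one_iff.1 (hνb t).le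
  have w0 : HasWinding (fun t => (ρ t : ℂ) * x t) 1 := by
    refine ⟨fun t => Real.log (ρ t) + t * Complex.I, ?_, fun t => ?_, ?_⟩
    · have : Continuous fun t => Real.log (ρ t) := hρc.log fun t => (hρ t).ne'
      fun_prop
    · rw [Complex.exp_add, ← Complex.ofReal_exp, Real.exp_log (hρ t)]
    · simp only [ρ, hxp]; push_cast; ring
  have hgcb : Continuous fun t => g (barycenter + ρ t * x t) :=
    hg.continuousOn.comp_continuous (by fun_prop) hbT
  have hpb : barycenter + ρ (2 * Real.pi) * x (2 * Real.pi) = barycenter + ρ 0 * x 0 := by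
    simp only [ρ, hxp]
  have w1 : HasWinding (fun t => g (barycenter + ρ t * x t) - g barycenter) 1 := by
    have := HasWinding.homotopy (n := 1) (H := fun p : ℝ × ℝ =>
      (((1 - p.1 : ℝ) : ℂ) * (barycenter + ρ p.2 * x p.2) + (p.1 : ℝ) * g (barycenter + ρ p.2 * x p.2)) -
        (((1 - p.1 : ℝ) : ℂ) * barycenter + (p.1 : ℝ) * g barycenter)) ?_ ?_ ?_ ?_
    · simpa using this
    · refine Continuous.continuousOn ?_
      have h' : Continuous fun p : ℝ × ℝ => g (barycenter + ρ p.2 * x p.2) :=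
        hgcb.comp continuous_snd
      exact ((Continuous.mul (by fun_prop) (by fun_prop)).add (Continuous.mul (by fun_prop) h')).sub
        (by fun_prop)
    · intro s hs t h
      obtain ⟨k, hk⟩ := exists_bary_eq_zero (hνb t)
      have hk' := (hg.bary_eq_zero_iff _ (hbT t) k).2 hk
      have hcombo : ∀ (s : ℝ) (a b : ℂ), bary k (((1 - s : ℝ) : ℂ) * a + (s : ℝ) * b) =
          (1 - s) * bary k a + s * bary k b := fun s a b => by
        rw [← Complex.real_smul, ← Complex.real_smul]; exact bary_combo k (by ring) _ _
      have h1 := congrArg (bary k) (sub_eq_zero.1 h)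
      simp only [hcombo, hk, hk', bary_barycenter] at h1
      have h2 : 0 < (1 - s) * (1 / 3) + s * bary k (g barycenter) := by
        rcases hs.1.eq_or_lt with rfl | h3
        · norm_num
        · have := mul_pos h3 (hgb k)
          have : 0 ≤ (1 - s) * (1 / 3 : ℝ) := mul_nonneg (by linarith [hs.2]) (by norm_num)
          linarith
      linarith
    · intro s _; simp only [hpb]
    · simpa using w0
  have hsmall : ∀ᶠ r : ℝ in 𝓝[>] 0, ∀ t, barycenter + r * x t ∈ refTriangle := by
    obtain ⟨δ, hδ, hball⟩ := Metric.isOpen_iff.1 isOpen_interior _ barycenter_mem_interior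
    filter_upwards [Ioo_mem_nhdsGT hδ] with r hr t
    refine interior_subset (hball ?_)
    rw [Metric.mem_ball, dist_eq_norm, add_sub_cancel_left, norm_mul, Complex.norm_exp_ofReal_mul_I,
      mul_one, Complex.norm_real, Real.norm_eq_abs, abs_of_pos hr.1]
    exact hr.2
  filter_upwards [hsmall, self_mem_nhdsWithin] with r hr hr0
  have hr0' : 0 < r := hr0
  have hcomb : ∀ s ∈ Icc (0 : ℝ) 1, ∀ t, 0 < (1 - s) * ρ t + s * r ∧
      barycenter + ((1 - s) * ρ t + s * r : ℝ) * x t ∈ refTriangle := by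
    intro s hs t
    constructor
    · rcases hs.1.eq_or_lt with rfl | h3
      · simpa using hρ t
      · have := mul_pos h3 hr0'
        have := mul_nonneg (sub_nonneg.2 hs.2) (hρ t).le
        linarith
    · have := convex_refTriangle (hbT t) (hr t) (sub_nonneg.2 hs.2) hs.1 (by ring)
      convert this using 1
      simp only [Complex.real_smul]; push_cast; ring
  have := HasWinding.homotopy (n := 1) (H := fun p : ℝ × ℝ =>
      g (barycenter + ((1 - p.1) * ρ p.2 + p.1 * r : ℝ) * x p.2) - g barycenter) ?_ ?_ ?_ ?_
  · simpa [circleMap, x] using this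
  · refine (hg.continuousOn.comp (Continuous.continuousOn (by fun_prop)) fun p hp => ?_).sub
      continuousOn_const
    exact (hcomb p.1 hp.1 p.2).2
  · intro s hs t h
    have h1 := hg.bijOn.injOn (hcomb s hs t).2 hb0 (sub_eq_zero.1 h)
    rw [add_eq_left, mul_eq_zero] at h1
    rcases h1 with h1 | h1
    · exact (hcomb s hs t).1.ne' (by exact_mod_cast h1)
    · exact hx0 t h1
  · intro s _; simp only [ρ, hxp]
  · simpa using w1

end IsTriangleHomeo

theorem mem_side_image_iff {j : Fin 3} {z : ℂ} (hz : z ∈ refTriangle) :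
    z ∈ side j '' Icc 0 1 ↔ bary (j + 2) z = 0 := by
  constructor
  · rintro ⟨s, -, rfl⟩; exact bary_side_add_two j s
  · intro h
    refine ⟨_, ⟨mem_refTriangle_iff.1 hz (j + 1), ?_⟩, (eq_side_of_bary h).symm⟩
    linarith [bary_sum j z, mem_refTriangle_iff.1 hz j]

/-- The cyclic sums of the side vectors of a triangle have equal cross products. -/
theorem cross_shift {F : Type*} {v : F × Fin 3 → ℂ} (hv : ∀ f, ∑ j, v (f, j) = 0) (f : F) (j : Fin 3) :
    cross (v (f, j)) (v (f, j + 1)) = cross (v (f, 2)) (v (f, 0)) := by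
  have h := hv f
  rw [Fin.sum_univ_three] at h
  have h1 : v (f, 1) = -v (f, 0) - v (f, 2) := by linear_combination h
  fin_cases j
  · simp only [Fin.zero_eta, zero_add, h1, cross, Complex.sub_re, Complex.sub_im, Complex.neg_re,
      Complex.neg_im]
    ring
  · simp only [Fin.mk_one, show (1 + 1 : Fin 3) = 2 from rfl, h1, cross, Complex.sub_re, Complex.sub_im,
      Complex.neg_re, Complex.neg_im]
    ring
  · rfl

namespace Triangulation

variable {S : Type*} [TopologicalSpace S] [ChartedSpace ℂ S] {Z : Set S} {E F : Type*}
  {κ : Z → ℕ} {τ : Triangulation S Z E F} {X : TranslationStructure S Z κ}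

/-- The primitive on a face in affine coordinates. -/
noncomputable def normalized (τ : Triangulation S Z E F) (X : TranslationStructure S Z κ) (f : F)
    (D : ℂ → ℂ) (z : ℂ) : ℂ := faceInv (τ.sideVector X) f (D z - D 0)

section Face

variable [T2Space S] {f : F} {w : Fin 3 → ℂ} {D : ℂ → ℂ}

theorem IsEuclideanFace.cross_ne_zero (h : τ.IsEuclideanFace X f w D) :
    cross (τ.sideVector X (f, 2)) (τ.sideVector X (f, 0)) ≠ 0 := by
  have h1 := (affineIndependent_iff_cross_ne_zero w).1 h.nondegenerate
  rw [h.sideVector_eq, h.sideVector_eq]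
  simp only [show (2 + 1 : Fin 3) = 0 from rfl, show (0 + 1 : Fin 3) = 1 from rfl]
  simp only [cross, Complex.sub_re, Complex.sub_im] at h1 ⊢
  intro h2
  exact h1 (by linarith)

theorem IsEuclideanFace.faceMap_normalized (h : τ.IsEuclideanFace X f w D) (z : ℂ) :
    faceMap (τ.sideVector X) f (τ.normalized X f D z) = D z - D 0 :=
  faceMap_faceInv_of_cross_ne h.cross_ne_zero _

theorem IsEuclideanFace.faceMap_corner (h : τ.IsEuclideanFace X f w D) (j : Fin 3) :
    faceMap (τ.sideVector X) f (corner j) = w j - w 0 := by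
  have h0 := h.sideVector_eq 0
  have h2 := h.sideVector_eq 2
  fin_cases j <;> simp [faceMap, corner, h0, h2]

theorem IsEuclideanFace.isTriangleHomeo (h : τ.IsEuclideanFace X f w D) :
    IsTriangleHomeo (τ.normalized X f D) := by
  have hD0 : D 0 = w 0 := h.corners 0
  have hinj := faceMap_injective_of_cross_ne h.cross_ne_zero
  set A := faceMap (τ.sideVector X) f with hA
  have hhull : (fun z => z - w 0) '' convexHull ℝ (range w) = A '' refTriangle := by
    rw [refTriangle, faceMap_image_convexHull, ← range_comp]
    have h1 : (A ∘ corner) = fun j => w j - w 0 := funext h.faceMap_corner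
    rw [h1]
    have e : (fun z : ℂ => z - w 0) = (AffineEquiv.constVAdd ℝ ℂ (-w 0)).toAffineMap :=
      funext fun z => by simp [sub_eq_neg_add]
    rw [e, AffineMap.image_convexHull, ← range_comp, ← e]
    rfl
  have hseg : ∀ j, (fun z => z - w 0) '' segment ℝ (w j) (w (j + 1)) = A '' (side j '' Icc 0 1) := by
    intro j
    rw [segment_eq_image_lineMap, image_image, image_image]
    refine image_congr fun s _ => ?_
    rw [hA, faceMap_side, h.faceMap_corner, h.faceMap_corner]
    simp only [AffineMap.lineMap_apply, vsub_eq_sub, vadd_eq_add]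
    simp
    ring
  have hg : ∀ z, A (τ.normalized X f D z) = D z - w 0 := fun z => by
    rw [hA, h.faceMap_normalized, hD0]
  have hmem : ∀ z ∈ refTriangle, τ.normalized X f D z ∈ refTriangle := fun z hz => by
    have h1 : D z - w 0 ∈ A '' refTriangle := hhull ▸ ⟨_, h.bijOn.mapsTo hz, rfl⟩
    obtain ⟨y, hy, hy'⟩ := h1
    rwa [← hinj (hy'.trans (hg z).symm)]
  refine ⟨(continuous_faceInv _ _).comp_continuousOn (h.continuousOn.sub continuousOn_const),
    ⟨hmem, ?_, ?_⟩, fun z hz k => ?_⟩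
  · intro z hz y hy hzy
    have h1 := congrArg A hzy
    rw [hg, hg, sub_left_inj] at h1
    exact h.bijOn.injOn hz hy h1
  · intro y hy
    have h1 : A y ∈ (fun z => z - w 0) '' convexHull ℝ (range w) := hhull ▸ ⟨y, hy, rfl⟩
    obtain ⟨x, hx, hx'⟩ := h1
    obtain ⟨z, hz, rfl⟩ := h.bijOn.surjOn hx
    exact ⟨z, hz, hinj ((hg z).trans hx')⟩
  · obtain ⟨j, rfl⟩ : ∃ j : Fin 3, k = j + 2 := ⟨k + 1, by fin_cases k <;> rfl⟩
    rw [← mem_side_image_iff hz, ← mem_side_image_iff (hmem z hz), ← hinj.mem_set_image, hg, ← hseg,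
      ← h.sides]
    constructor
    · rintro ⟨_, ⟨y, hy, rfl⟩, h1⟩
      have hyT : y ∈ refTriangle := by obtain ⟨s, hs, rfl⟩ := hy; exact side_mem j hs
      rwa [← h.bijOn.injOn hyT hz (sub_left_inj.1 h1)]
    · intro h1
      exact ⟨_, ⟨z, h1, rfl⟩, rfl⟩

end Face

theorem IsEuclideanFace.hasLocalDegree [OrientedSurface S] {f : F} {w : Fin 3 → ℂ} {D : ℂ → ℂ}
    (h : τ.IsEuclideanFace X f w D) {z : ℂ} (hz : z ∈ interior refTriangle) : HasLocalDegree D z 1 := by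
  have hzZ : τ.cell f z ∉ Z := fun hzZ => by
    obtain ⟨j, rfl⟩ := (τ.cell_mem_iff (interior_subset hz)).1 hzZ
    exact corner_notMem_interior j hz
  obtain ⟨e, he, hze⟩ := X.exists_chart hzZ
  set χ := chartAt ℂ (τ.cell f z)
  have hχ : τ.cell f z ∈ χ.source := mem_chart_source ℂ _
  have h1 : HasLocalDegree (χ ∘ τ.cell f) z 1 := hasLocalDegree_chart_cell hz (chart_mem_atlas ℂ (τ.cell f z)) hχ
  have h2 : HasLocalDegree (e ∘ χ.symm) (χ (τ.cell f z)) 1 :=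
    orientationPreservingAt_iff.1 (X.oriented e he _ hze)
  have hc : ContinuousAt (χ ∘ τ.cell f) z := (χ.continuousAt hχ).comp (τ.continuousAt_cell hz)
  have h3 := h1.comp hc
    ((χ.symm.trans e).open_source.mem_nhds (x := χ (τ.cell f z)) (by simp [hχ, hze]))
    (χ.symm.trans e).continuousOn (χ.symm.trans e).injOn h2
  have h4 := h.primitive z (interior_subset hz) e he hze
  rw [interior_mem_nhdsWithin hz] at h4
  refine h3.congr ?_
  filter_upwards [h4, (τ.continuousAt_cell hz).eventually (χ.open_source.mem_nhds hχ)] with x hx hx'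
  rw [hx]
  simp only [Function.comp_apply, OpenPartialHomeomorph.trans_apply, χ.left_inv hx', χ.left_inv hχ]

theorem IsGeometric.isPositive [T2Space S] [OrientedSurface S] (h : τ.IsGeometric X) :
    RibbonGraph.IsPositive (τ.sideVector X) := by
  rintro ⟨f, j⟩
  obtain ⟨w, D, hw⟩ := h f
  change 0 < cross (τ.sideVector X (f, j)) (τ.sideVector X (f, j + 1))
  rw [cross_shift h.sideVector_mem.1]
  by_contra hneg
  have hlt : cross (τ.sideVector X (f, 2)) (τ.sideVector X (f, 0)) < 0 :=
    lt_of_le_of_ne (not_lt.1 hneg) hw.cross_ne_zero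
  have hhom := hw.isTriangleHomeo
  have h1 : HasLocalDegree (faceMap (τ.sideVector X) f) (τ.normalized X f D barycenter) (-1) := by
    filter_upwards [self_mem_nhdsWithin] with r hr
    have hc : cross (τ.sideVector X (f, 0)) (-τ.sideVector X (f, 2)) < 0 := by
      simp only [cross, Complex.neg_re, Complex.neg_im] at hlt ⊢
      linarith
    convert (hasWinding_linear _ _ hr).2 hc using 2 with t
    generalize τ.normalized X f D barycenter = z
    rw [faceMap_sub, show circleMap z r t - z = ⟨r * Real.cos t, r * Real.sin t⟩ by
      simp [circleMap, Complex.ext_iff, Complex.exp_re, Complex.exp_im]]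
    simp only [faceMap]
    push_cast; ring
  have hb := interior_subset barycenter_mem_interior
  have h2 := hhom.hasLocalDegree_barycenter.comp
    (hhom.continuousOn.continuousAt (mem_interior_iff_mem_nhds.1 barycenter_mem_interior)) univ_mem
    (continuous_faceMap (τ.sideVector X) f).continuousOn
    (faceMap_injective_of_cross_ne hw.cross_ne_zero).injOn h1
  have h3 : HasLocalDegree D barycenter (1 * -1) := h2.congr (Eventually.of_forall fun x => by
    simp only [Function.comp_apply, hw.faceMap_normalized]; ring)
  have := h3.unique (hw.hasLocalDegree barycenter_mem_interior)
  norm_num at this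

end Triangulation

/-! ### The Alexander isotopy -/

namespace IsTriangleHomeo

variable {g : ℂ → ℂ}

theorem map_corner (hg : IsTriangleHomeo g) (j : Fin 3) : g (corner j) = corner j := by
  have h : ∀ k, k ≠ j → bary k (g (corner j)) = 0 := fun k hk =>
    (hg.bary_eq_zero_iff _ (corner_mem j) k).2 (by rw [bary_corner, if_neg hk])
  refine bary_ext (j + 1) ?_ ?_
  · rw [h (j + 1) (by simp), bary_corner, if_neg (by simp)]
  · rw [h (j + 1 + 1) (by simp [add_assoc]), bary_corner, if_neg (by simp [add_assoc])]

/-- The action of a homeomorphism of the triangle on its side `j`. -/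
noncomputable def sideMap (g : ℂ → ℂ) (j : Fin 3) (s : ℝ) : ℝ := bary (j + 1) (g (side j s))

theorem map_side (hg : IsTriangleHomeo g) (j : Fin 3) {s : ℝ} (hs : s ∈ Icc (0 : ℝ) 1) :
    g (side j s) = side j (sideMap g j s) :=
  eq_side_of_bary ((hg.bary_eq_zero_iff _ (side_mem j hs) _).2 (bary_side_add_two j s))

theorem sideMap_zero (hg : IsTriangleHomeo g) (j : Fin 3) : sideMap g j 0 = 0 := by
  rw [sideMap, side_zero, hg.map_corner, bary_corner, if_neg (by simp)]

theorem sideMap_one (hg : IsTriangleHomeo g) (j : Fin 3) : sideMap g j 1 = 1 := by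
  rw [sideMap, side_one, hg.map_corner, bary_corner, if_pos rfl]

theorem continuousOn_sideMap (hg : IsTriangleHomeo g) (j : Fin 3) :
    ContinuousOn (sideMap g j) (Icc 0 1) :=
  (continuous_bary _).comp_continuousOn
    (hg.continuousOn.comp (continuous_side j).continuousOn fun _ hs => side_mem j hs)

theorem strictMonoOn_sideMap (hg : IsTriangleHomeo g) (j : Fin 3) :
    StrictMonoOn (sideMap g j) (Icc 0 1) := by
  refine (hg.continuousOn_sideMap j).strictMonoOn_of_injOn_Icc zero_le_one
    (by rw [hg.sideMap_zero, hg.sideMap_one]; exact zero_le_one) fun s hs t ht h => ?_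
  refine side_injective j (hg.bijOn.injOn (side_mem j hs) (side_mem j ht) ?_)
  rw [hg.map_side j hs, hg.map_side j ht, h]

theorem sideMap_mem (hg : IsTriangleHomeo g) (j : Fin 3) {s : ℝ} (hs : s ∈ Icc (0 : ℝ) 1) :
    sideMap g j s ∈ Icc (0 : ℝ) 1 := by
  have h0 := (hg.strictMonoOn_sideMap j).monotoneOn (left_mem_Icc.2 zero_le_one) hs hs.1
  have h1 := (hg.strictMonoOn_sideMap j).monotoneOn hs (right_mem_Icc.2 zero_le_one) hs.2
  rw [hg.sideMap_zero] at h0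
  rw [hg.sideMap_one] at h1
  exact ⟨h0, h1⟩

theorem eventually_image (hg : IsTriangleHomeo g) {x : ℂ} (hx : x ∈ refTriangle) {Q : ℂ → Prop}
    (h : ∀ᶠ x' in 𝓝[refTriangle] x, Q (g x')) : ∀ᶠ y in 𝓝[refTriangle] (g x), Q y := by
  obtain ⟨U, hU, hxU, hsub⟩ := mem_nhdsWithin.1 h
  have hcl : IsClosed (g '' (refTriangle \ U)) :=
    ((isCompact_refTriangle.diff hU).image_of_continuousOn (hg.continuousOn.mono sdiff_subset)).isClosed
  have hnot : g x ∉ g '' (refTriangle \ U) := by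
    rintro ⟨x', hx', h'⟩
    exact hx'.2 (hg.bijOn.injOn hx'.1 hx h' ▸ hxU)
  filter_upwards [nhdsWithin_le_nhds (hcl.isOpen_compl.mem_nhds hnot), self_mem_nhdsWithin] with y hy hyT
  obtain ⟨x', hx', rfl⟩ := hg.bijOn.surjOn hyT
  by_cases hxU' : x' ∈ U
  · exact hsub ⟨hxU', hx'⟩
  · exact absurd ⟨x', ⟨hx', hxU'⟩, rfl⟩ hy

/-- The projection of a point to the triangle in the direction of the barycenter, rescaled. -/
noncomputable def retract (t : ℝ) (z : ℂ) : ℂ :=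
  barycenter + ((max t (triGauge (z - barycenter)))⁻¹ : ℝ) * (z - barycenter)

/-- The Alexander isotopy from the identity to `g`, modified to be an isotopy of the sides too. -/
noncomputable def alexander (g : ℂ → ℂ) (t : ℝ) (z : ℂ) : ℂ := z + t * (g (retract t z) - retract t z)

theorem triGauge_sub_le_one {z : ℂ} : triGauge (z - barycenter) ≤ 1 ↔ z ∈ refTriangle := by
  rw [triGauge_le_one_iff, add_sub_cancel]

theorem retract_mem {t : ℝ} (ht : 0 ≤ t) (z : ℂ) : retract t z ∈ refTriangle := by
  rw [retract, ← triGauge_le_one_iff, triGauge_smul (inv_nonneg.2 (le_max_of_le_left ht))]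
  exact inv_mul_le_one_of_le₀ (le_max_right _ _) (le_max_of_le_left ht)

theorem retract_one {z : ℂ} (hz : z ∈ refTriangle) : retract 1 z = z := by
  rw [retract, max_eq_left (triGauge_sub_le_one.2 hz)]; simp

theorem alexander_zero (g : ℂ → ℂ) (z : ℂ) : alexander g 0 z = z := by simp [alexander]

theorem alexander_one (g : ℂ → ℂ) {z : ℂ} (hz : z ∈ refTriangle) : alexander g 1 z = g z := by
  simp [alexander, retract_one hz]

theorem alexander_side (hg : IsTriangleHomeo g) {t : ℝ} (ht : t ∈ Icc (0 : ℝ) 1) (j : Fin 3) {s : ℝ}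
    (hs : s ∈ Icc (0 : ℝ) 1) :
    alexander g t (side j s) = side j ((1 - t) * s + t * sideMap g j s) := by
  have h1 : triGauge (side j s - barycenter) = 1 := by
    refine le_antisymm (triGauge_sub_le_one.2 (side_mem j hs)) ?_
    have h2 := neg_baryLin_le (j + 2) (side j s - barycenter)
    have h3 := bary_barycenter_add (j + 2) (side j s - barycenter)
    rw [add_sub_cancel, bary_side_add_two] at h3
    linarith
  have h2 : retract t (side j s) = side j s := by
    rw [retract, h1, max_eq_right ht.2]; simp
  rw [alexander, h2, hg.map_side j hs]
  simp only [side_eq, Complex.real_smul]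
  push_cast
  ring

theorem continuousOn_alexander (hg : IsTriangleHomeo g) :
    ContinuousOn (fun x : ℝ × ℂ => alexander g x.1 x.2) (Icc 0 1 ×ˢ refTriangle) := by
  obtain ⟨C, hC⟩ := isCompact_refTriangle.isBounded.exists_norm_le
  have hnorm : ∀ t ≥ 0, ∀ z, ‖g (retract t z) - retract t z‖ ≤ C + C := fun t ht z =>
    (norm_sub_le _ _).trans (add_le_add (hC _ (hg.mem (retract_mem ht z))) (hC _ (retract_mem ht z)))
  rintro ⟨t, z⟩ ⟨ht, hz⟩
  by_cases h0 : max t (triGauge (z - barycenter)) = 0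
  · have ht0 : t = 0 := le_antisymm (h0 ▸ le_max_left _ _) ht.1
    have h1 : Tendsto (fun x : ℝ × ℂ => (x.1 : ℂ) * (g (retract x.1 x.2) - retract x.1 x.2))
        (𝓝[Icc 0 1 ×ˢ refTriangle] (t, z)) (𝓝 0) := by
      have h2 : Tendsto (fun x : ℝ × ℂ => |x.1| * (C + C)) (𝓝[Icc 0 1 ×ˢ refTriangle] (t, z)) (𝓝 0) :=
        (Continuous.tendsto' (by fun_prop) _ _ (by simp [ht0])).mono_left nhdsWithin_le_nhds
      refine squeeze_zero_norm' ?_ h2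
      filter_upwards [self_mem_nhdsWithin] with x hx
      rw [norm_mul, Complex.norm_real, Real.norm_eq_abs]
      exact mul_le_mul_of_nonneg_left (hnorm _ hx.1.1 _) (abs_nonneg _)
    have h3 : Tendsto (fun x : ℝ × ℂ => x.2) (𝓝[Icc 0 1 ×ˢ refTriangle] (t, z)) (𝓝 z) :=
      continuous_snd.continuousAt.tendsto.mono_left nhdsWithin_le_nhds
    have h4 := h3.add h1
    have e : alexander g t z = z := by rw [ht0, alexander_zero]
    change Tendsto _ _ (𝓝 (alexander g t z))
    rw [e]
    rwa [add_zero] at h4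
  · have hr : ContinuousAt (fun x : ℝ × ℂ => retract x.1 x.2) (t, z) := by
      unfold retract
      have hν := continuous_triGauge
      have h1 : ContinuousAt (fun x : ℝ × ℂ => (max x.1 (triGauge (x.2 - barycenter)))⁻¹) (t, z) :=
        ContinuousAt.inv₀ (Continuous.continuousAt (by fun_prop)) h0
      exact continuousAt_const.add ((Complex.continuous_ofReal.continuousAt.comp h1).mul
        (Continuous.continuousAt (by fun_prop)))
    have hgr : ContinuousWithinAt (fun x : ℝ × ℂ => g (retract x.1 x.2)) (Icc 0 1 ×ˢ refTriangle) (t, z) :=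
      ContinuousWithinAt.comp (hg.continuousOn _ (retract_mem ht.1 z)) hr.continuousWithinAt
        fun x hx => retract_mem hx.1.1 x.2
    unfold alexander
    exact (continuous_snd.continuousWithinAt).add
      (((Complex.continuous_ofReal.comp continuous_fst).continuousWithinAt).mul
        (hgr.sub hr.continuousWithinAt))

/-- A convex combination of the identity and `g` on the boundary of the triangle. -/
theorem combination_injective (hg : IsTriangleHomeo g) {σ : ℝ} (hσ : 0 ≤ σ) (hσ1 : σ < 1) {x y : ℂ}
    (hx : x ∈ refTriangle) (hy : y ∈ refTriangle) {k : Fin 3} (hk : bary k x = 0)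
    (h : (1 - σ) • x + σ • g x = (1 - σ) • y + σ • g y) : x = y := by
  obtain ⟨j, rfl⟩ : ∃ j : Fin 3, k = j + 2 := ⟨k + 1, by fin_cases k <;> rfl⟩
  have hky : bary (j + 2) y = 0 := by
    have h1 := congrArg (bary (j + 2)) h
    rw [bary_combo _ (by ring), bary_combo _ (by ring), hk, (hg.bary_eq_zero_iff x hx _).2 hk] at h1
    have h2 := mul_nonneg (sub_nonneg.2 hσ1.le) (mem_refTriangle_iff.1 hy (j + 2))
    have h3 := mul_nonneg hσ (mem_refTriangle_iff.1 (hg.mem hy) (j + 2))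
    exact (mul_eq_zero.1 (by linarith : (1 - σ) * bary (j + 2) y = 0)).resolve_left (by linarith)
  obtain ⟨s, hs, rfl⟩ := (mem_side_image_iff hx).2 hk
  obtain ⟨s', hs', rfl⟩ := (mem_side_image_iff hy).2 hky
  have h1 := congrArg (bary (j + 1)) h
  rw [bary_combo _ (by ring), bary_combo _ (by ring), bary_side_add_one, bary_side_add_one] at h1
  change (1 - σ) * s + σ * sideMap g j s = (1 - σ) * s' + σ * sideMap g j s' at h1
  have hm := hg.strictMonoOn_sideMap j
  rcases lt_trichotomy s s' with hlt | rfl | hlt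
  · have := mul_le_mul_of_nonneg_left (hm hs hs' hlt).le hσ
    nlinarith
  · rfl
  · have := mul_le_mul_of_nonneg_left (hm hs' hs hlt).le hσ
    nlinarith

theorem combination_surjective (hg : IsTriangleHomeo g) (σ : ℝ) {y : ℂ} (hy : y ∈ refTriangle) {k : Fin 3} (hk : bary k y = 0) :
    ∃ x ∈ refTriangle, bary k x = 0 ∧ (1 - σ) • x + σ • g x = y := by
  obtain ⟨j, rfl⟩ : ∃ j : Fin 3, k = j + 2 := ⟨k + 1, by fin_cases k <;> rfl⟩
  obtain ⟨s, hs, rfl⟩ := (mem_side_image_iff hy).2 hk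
  have hc : ContinuousOn (fun s => (1 - σ) * s + σ * sideMap g j s) (Icc 0 1) :=
    (Continuous.continuousOn (by fun_prop)).add (continuousOn_const.mul (hg.continuousOn_sideMap j))
  have h1 := intermediate_value_Icc zero_le_one hc
  simp only [hg.sideMap_zero, hg.sideMap_one] at h1
  obtain ⟨s', hs', h2⟩ := h1 (show s ∈ _ by simpa using hs)
  refine ⟨side j s', side_mem j hs', bary_side_add_two j s', ?_⟩
  rw [hg.map_side j hs', ← h2]
  simp only [side_eq, Complex.real_smul]
  push_cast
  ring

theorem alexander_eq {t : ℝ} {z : ℂ} {L : ℝ} (hL : max t (triGauge (z - barycenter)) = L)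
    (hL0 : 0 < L) : alexander g t z = barycenter + L *
      (((1 - t / L : ℝ) • retract t z + (t / L) • g (retract t z)) - barycenter) := by
  have h1 : (L : ℂ) ≠ 0 := by exact_mod_cast hL0.ne'
  have h2 : z = barycenter + L * (retract t z - barycenter) := by
    rw [retract, hL]; push_cast; field_simp; ring
  rw [alexander]
  nth_rewrite 1 [h2]
  simp only [Complex.real_smul]
  push_cast
  field_simp
  ring

theorem max_triGauge_alexander (hg : IsTriangleHomeo g) {t : ℝ} (ht : t ∈ Icc (0 : ℝ) 1) {z : ℂ} :
    max t (triGauge (alexander g t z - barycenter)) = max t (triGauge (z - barycenter)) := by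
  set L := max t (triGauge (z - barycenter)) with hL
  have hL0 : 0 ≤ L := le_max_of_le_left ht.1
  rcases hL0.eq_or_lt with h0 | hL0
  · have ht0 : t = 0 := le_antisymm (h0 ▸ le_max_left _ _) ht.1
    rw [ht0, alexander_zero, ← ht0]
  have hσ : t / L ∈ Icc (0 : ℝ) 1 := ⟨div_nonneg ht.1 hL0.le, (div_le_one hL0).2 (le_max_left _ _)⟩
  have hr := retract_mem ht.1 z
  rw [alexander_eq hL.symm hL0, add_sub_cancel_left, triGauge_smul hL0.le]
  set c := (1 - t / L : ℝ) • retract t z + (t / L) • g (retract t z) with hc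
  have hcT : c ∈ refTriangle := convex_refTriangle hr (hg.mem hr) (sub_nonneg.2 hσ.2) hσ.1 (by ring)
  have hle := triGauge_sub_le_one.2 hcT
  rcases (le_max_left t (triGauge (z - barycenter))).eq_or_lt with h | h
  · rw [← hL] at h
    rw [← h, max_eq_left]
    exact mul_le_of_le_one_right ht.1 hle
  · have hν : L = triGauge (z - barycenter) := by
      rcases max_choice t (triGauge (z - barycenter)) with h' | h'
      · exact absurd h' h.ne'
      · rw [hL, h']
    have h1 : triGauge (retract t z - barycenter) = 1 := by
      rw [retract, add_sub_cancel_left, triGauge_smul (inv_nonneg.2 (le_max_of_le_left ht.1)), ← hL, ← hν,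
        inv_mul_cancel₀ hL0.ne']
    obtain ⟨k, hk⟩ := exists_bary_eq_zero h1
    rw [add_sub_cancel] at hk
    have hk' := (hg.bary_eq_zero_iff _ hr k).2 hk
    have h2 : bary k c = 0 := by rw [hc, bary_combo _ (by ring), hk, hk']; ring
    have h3 : triGauge (c - barycenter) = 1 := by
      refine le_antisymm hle ?_
      have h4 := neg_baryLin_le k (c - barycenter)
      have h5 := bary_barycenter_add k (c - barycenter)
      rw [add_sub_cancel, h2] at h5
      linarith
    rw [h3, mul_one, max_eq_right]
    rw [hL]; exact le_max_left _ _

theorem bijOn_alexander (hg : IsTriangleHomeo g) {t : ℝ} (ht : t ∈ Icc (0 : ℝ) 1) :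
    BijOn (alexander g t) refTriangle refTriangle := by
  have hret : ∀ {z : ℂ} {L : ℝ}, max t (triGauge (z - barycenter)) = L → 0 < L →
      z = barycenter + L * (retract t z - barycenter) := fun {z L} hL hL0 => by
    have h1 : (L : ℂ) ≠ 0 := by exact_mod_cast hL0.ne'
    rw [retract, hL]; push_cast; field_simp; ring
  have hbd : ∀ {z : ℂ}, t < triGauge (z - barycenter) → ∃ k, bary k (retract t z) = 0 := fun {z} h => by
    have h1 : triGauge (retract t z - barycenter) = 1 := by
      rw [retract, add_sub_cancel_left, triGauge_smul (inv_nonneg.2 (le_max_of_le_left ht.1)),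
        max_eq_right h.le, inv_mul_cancel₀ (ht.1.trans_lt h).ne']
    obtain ⟨k, hk⟩ := exists_bary_eq_zero h1
    exact ⟨k, by rwa [add_sub_cancel] at hk⟩
  refine ⟨fun z hz => ?_, fun z hz z' hz' h => ?_, fun y hy => ?_⟩
  · rw [← triGauge_sub_le_one]
    refine (le_max_right t _).trans ?_
    rw [hg.max_triGauge_alexander ht]
    exact max_le ht.2 (triGauge_sub_le_one.2 hz)
  · have hL := hg.max_triGauge_alexander ht (z := z)
    rw [h, hg.max_triGauge_alexander ht] at hL
    set L := max t (triGauge (z - barycenter)) with hLz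
    have hL0 : 0 ≤ L := le_max_of_le_left ht.1
    rcases hL0.eq_or_lt with h0 | hL0
    · have ht0 : t = 0 := le_antisymm (h0 ▸ le_max_left _ _) ht.1
      rwa [ht0, alexander_zero, alexander_zero] at h
    have hL' : (L : ℂ) ≠ 0 := by exact_mod_cast hL0.ne'
    rw [alexander_eq hLz.symm hL0, alexander_eq hL hL0, add_right_inj, mul_right_inj' hL', sub_left_inj] at h
    have hrr : retract t z = retract t z' := by
      rcases (le_max_left t (triGauge (z - barycenter))).eq_or_lt with h1 | h1
      · rw [← hLz] at h1
        rw [h1, div_self hL0.ne'] at h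
        simp only [sub_self, zero_smul, one_smul, zero_add] at h
        rw [h1]
        exact hg.bijOn.injOn (retract_mem hL0.le z) (retract_mem hL0.le z') h
      · obtain ⟨k, hk⟩ := hbd (z := z) (by
          rcases max_choice t (triGauge (z - barycenter)) with h' | h'
          · exact absurd h' h1.ne'
          · rwa [h'] at h1)
        exact hg.combination_injective (div_nonneg ht.1 hL0.le) ((div_lt_one hL0).2 h1)
          (retract_mem ht.1 z) (retract_mem ht.1 z') hk h
    rw [hret hLz.symm hL0, hret hL hL0, hrr]
  · set L := max t (triGauge (y - barycenter)) with hLy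
    have hL0 : 0 ≤ L := le_max_of_le_left ht.1
    rcases hL0.eq_or_lt with h0 | hL0
    · have ht0 : t = 0 := le_antisymm (h0 ▸ le_max_left _ _) ht.1
      exact ⟨y, hy, by rw [ht0, alexander_zero]⟩
    have hL' : (L : ℂ) ≠ 0 := by exact_mod_cast hL0.ne'
    have key : ∀ x ∈ refTriangle, max t (L * triGauge (x - barycenter)) = L →
        (1 - t / L : ℝ) • x + (t / L) • g x = retract t y → ∃ z ∈ refTriangle, alexander g t z = y := by
      intro x hx hmax hcomb
      have e : barycenter + L * (x - barycenter) - barycenter = L * (x - barycenter) := by ring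
      have h1 : max t (triGauge (barycenter + L * (x - barycenter) - barycenter)) = L := by
        rw [e, triGauge_smul hL0.le, hmax]
      have h2 : retract t (barycenter + L * (x - barycenter)) = x := by
        rw [retract, h1, e]; push_cast; field_simp; ring
      refine ⟨barycenter + L * (x - barycenter), ?_, ?_⟩
      · rw [← triGauge_sub_le_one]
        refine (le_max_right t _).trans (h1.le.trans ?_)
        exact max_le ht.2 (triGauge_sub_le_one.2 hy)
      · rw [alexander_eq h1 hL0, h2, hcomb]
        exact (hret hLy.symm hL0).symm
    rcases (le_max_left t (triGauge (y - barycenter))).eq_or_lt with h1 | h1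
    · rw [← hLy] at h1
      obtain ⟨x, hx, hx'⟩ := hg.bijOn.surjOn (retract_mem ht.1 y)
      refine key x hx ?_ ?_
      · rw [← h1]
        exact max_eq_left (mul_le_of_le_one_right ht.1 (triGauge_sub_le_one.2 hx))
      · rw [← h1, div_self (h1 ▸ hL0.ne' : t ≠ 0)]
        simp [hx']
    · have hν : triGauge (y - barycenter) = L := by
        rcases max_choice t (triGauge (y - barycenter)) with h' | h'
        · exact absurd h' h1.ne'
        · rw [hLy, h']
      obtain ⟨k, hk⟩ := hbd (z := y) (by rwa [hν])
      obtain ⟨x, hx, hxk, hx'⟩ := hg.combination_surjective (t / L) (retract_mem ht.1 y) hk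
      refine key x hx ?_ hx'
      have h3 : triGauge (x - barycenter) = 1 := by
        refine le_antisymm (triGauge_sub_le_one.2 hx) ?_
        have h4 := neg_baryLin_le k (x - barycenter)
        have h5 := bary_barycenter_add k (x - barycenter)
        rw [add_sub_cancel, hxk] at h5
        linarith
      rw [h3, mul_one]
      exact max_eq_right h1.le

end IsTriangleHomeo

namespace Triangulation

variable {S : Type*} [TopologicalSpace S] [ChartedSpace ℂ S] {Z : Set S} {E F : Type*}
  {κ : Z → ℕ} {τ : Triangulation S Z E F} {X : TranslationStructure S Z κ}

section Glue

open IsTriangleHomeo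

variable {g : F → ℂ → ℂ}

theorem cell_alexander_eq_iff (hg : ∀ f, IsTriangleHomeo (g f))
    (hc : ∀ h, ∀ s ∈ Icc (0 : ℝ) 1,
      sideMap (g (τ.partner h).1) (τ.partner h).2 (1 - s) = 1 - sideMap (g h.1) h.2 s)
    {t : ℝ} (ht : t ∈ Icc (0 : ℝ) 1) {f f' : F} {z z' : ℂ} (hz : z ∈ refTriangle)
    (hz' : z' ∈ refTriangle) :
    τ.cell f (alexander (g f) t z) = τ.cell f' (alexander (g f') t z') ↔ τ.cell f z = τ.cell f' z' := by
  have hcor : ∀ f j, alexander (g f) t (corner j) = corner j := fun f j => by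
    have := (hg f).alexander_side ht j (s := 0) (left_mem_Icc.2 zero_le_one)
    rwa [(hg f).sideMap_zero, mul_zero, mul_zero, add_zero, side_zero] at this
  have hinj := fun f => ((hg f).bijOn_alexander ht).injOn
  have hmem := fun f => ((hg f).bijOn_alexander ht).mapsTo
  have hmid : ∀ f j, ∀ s ∈ Icc (0 : ℝ) 1, (1 - t) * s + t * sideMap (g f) j s ∈ Icc (0 : ℝ) 1 := by
    intro f j s hs
    have := convex_Icc (0 : ℝ) 1 hs ((hg f).sideMap_mem j hs) (sub_nonneg.2 ht.2) ht.1 (by ring)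
    simpa using this
  have hpart : ∀ h : F × Fin 3, ∀ s ∈ Icc (0 : ℝ) 1,
      alexander (g (τ.partner h).1) t (side (τ.partner h).2 (1 - s)) =
        side (τ.partner h).2 (1 - ((1 - t) * s + t * sideMap (g h.1) h.2 s)) := by
    intro h s hs
    rw [(hg _).alexander_side ht _ ⟨by linarith [hs.2], by linarith [hs.1]⟩, hc h s hs]
    congr 1; ring
  constructor
  · intro h
    rcases refTriangle_cases (hmem f hz) with hi | ⟨j, s, hs, hzs⟩ | ⟨j, hj⟩
    · obtain ⟨rfl, h1⟩ := τ.face_inj f f' _ hi _ (hmem f' hz') h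
      rw [hinj f hz hz' h1]
    · rw [hzs] at h
      rcases τ.fiber_side (h := (f, j)) hs (hmem f' hz') h with ⟨h1, h2⟩ | ⟨h1, h2⟩
      · subst h1
        rw [hinj f' hz hz' (hzs.trans h2.symm)]
      · have hcont : ContinuousOn (fun s => (1 - t) * s + t * sideMap (g f) j s) (Icc 0 1) :=
          (Continuous.continuousOn (by fun_prop)).add
            (continuousOn_const.mul ((hg f).continuousOn_sideMap j))
        have h3 := intermediate_value_Icc zero_le_one hcont
        simp only [(hg f).sideMap_zero, (hg f).sideMap_one] at h3
        obtain ⟨s₀, hs₀, h4⟩ := h3 (show s ∈ _ by simpa using Ioo_subset_Icc_self hs)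
        have h4' : (1 - t) * s₀ + t * sideMap (g f) j s₀ = s := h4
        have h5 : z = side j s₀ := by
          refine hinj f hz (side_mem j hs₀) ?_
          rw [hzs, (hg f).alexander_side ht j hs₀, h4']
        have hs₀' : 1 - s₀ ∈ Icc (0 : ℝ) 1 := ⟨by linarith [hs₀.2], by linarith [hs₀.1]⟩
        subst h1
        have h6 : z' = side (τ.partner (f, j)).2 (1 - s₀) := by
          refine hinj (τ.partner (f, j)).1 hz' (side_mem _ hs₀') ?_
          rw [h2, hpart (f, j) s₀ hs₀]
          simp only
          rw [h4']
        rw [h5, h6]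
        exact τ.cell_side_partner (f, j) hs₀
    · have h1 : z = corner j := hinj f hz (corner_mem j) (by rw [hcor, ← hj])
      have h2 : τ.cell f' (alexander (g f') t z') ∈ Z := by rw [← h, hj]; exact τ.vertex_mem f j
      obtain ⟨j', hj'⟩ := (τ.cell_mem_iff (hmem f' hz')).1 h2
      have h3 : z' = corner j' := hinj f' hz' (corner_mem j') (by rw [hcor, ← hj'])
      rw [hj, hj'] at h
      rw [h1, h3]
      exact h
  · intro h
    rcases refTriangle_cases hz with hi | ⟨j, s, hs, rfl⟩ | ⟨j, rfl⟩
    · obtain ⟨rfl, rfl⟩ := τ.face_inj f f' _ hi _ hz' h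
      rfl
    · rcases τ.fiber_side (h := (f, j)) hs hz' h with ⟨h1, h2⟩ | ⟨h1, h2⟩
      · rw [h1, h2]
      · rw [h1, h2, hpart (f, j) s (Ioo_subset_Icc_self hs),
          (hg f).alexander_side ht j (Ioo_subset_Icc_self hs)]
        exact τ.cell_side_partner (f, j) (hmid f j s (Ioo_subset_Icc_self hs))
    · have h2 : τ.cell f' z' ∈ Z := by rw [← h]; exact τ.vertex_mem f j
      obtain ⟨j', rfl⟩ := (τ.cell_mem_iff hz').1 h2
      rwa [hcor, hcor]

/-- Compatible homeomorphisms of the faces define a homeomorphism of the surface isotopic to the identity. -/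
theorem exists_glued_homeomorph [T2Space S] [CompactSpace S] (hg : ∀ f, IsTriangleHomeo (g f))
    (hc : ∀ h, ∀ s ∈ Icc (0 : ℝ) 1,
      sideMap (g (τ.partner h).1) (τ.partner h).2 (1 - s) = 1 - sideMap (g h.1) h.2 s) :
    ∃ ψ : S ≃ₜ S, (∀ f, ∀ z ∈ refTriangle, ψ (τ.cell f z) = τ.cell f (g f z)) ∧ IsotopicToId Z ψ := by
  have hfin := τ.finite_faces
  let : TopologicalSpace F := ⊥
  have : DiscreteTopology F := ⟨rfl⟩
  choose fc zc hzc hfz using τ.covers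
  let K : unitInterval × S → unitInterval × S := fun x =>
    (x.1, τ.cell (fc x.2) (alexander (g (fc x.2)) x.1 (zc x.2)))
  have hK : ∀ (t : unitInterval) f, ∀ z ∈ refTriangle,
      K (t, τ.cell f z) = (t, τ.cell f (alexander (g f) t z)) := fun t f z hz =>
    Prod.ext rfl ((cell_alexander_eq_iff hg hc t.2 (hzc _) hz).2 (hfz _))
  have hinj : Function.Injective K := by
    rintro ⟨t, p⟩ ⟨t', p'⟩ h
    obtain ⟨f, z, hz, rfl⟩ := τ.covers p
    obtain ⟨f', z', hz', rfl⟩ := τ.covers p'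
    rw [hK t f z hz, hK t' f' z' hz'] at h
    obtain ⟨rfl, h2⟩ := Prod.ext_iff.1 h
    exact Prod.ext rfl ((cell_alexander_eq_iff hg hc t.2 hz hz').1 h2)
  have hsurj : Function.Surjective K := by
    rintro ⟨t, p⟩
    obtain ⟨f, z, hz, rfl⟩ := τ.covers p
    obtain ⟨y, hy, rfl⟩ := ((hg f).bijOn_alexander t.2).surjOn hz
    exact ⟨(t, τ.cell f y), hK t f y hy⟩
  let π : unitInterval × (F × refTriangle) → unitInterval × S := fun x => (x.1, τ.cell x.2.1 x.2.2)
  have hcell : Continuous fun x : F × refTriangle => τ.cell x.1 x.2 :=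
    continuous_prod_of_discrete_left.2 fun f =>
      continuousOn_iff_continuous_domRestrict.1 (τ.continuousOn_cell f)
  have hπ : Continuous π := continuous_fst.prodMk (hcell.comp continuous_snd)
  have : CompactSpace refTriangle := isCompact_iff_compactSpace.1 isCompact_refTriangle
  have hπq : IsQuotientMap π := hπ.isClosedMap.isQuotientMap hπ (by
    rintro ⟨t, p⟩
    obtain ⟨f, z, hz, rfl⟩ := τ.covers p
    exact ⟨(t, f, ⟨z, hz⟩), rfl⟩)
  have hKc : Continuous K := by
    rw [hπq.continuous_iff]
    have h1 : K ∘ π = fun x => (x.1, τ.cell x.2.1 (alexander (g x.2.1) x.1 x.2.2)) :=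
      funext fun x => hK _ _ _ x.2.2.2
    rw [h1]
    refine continuous_fst.prodMk ?_
    have h2 : Continuous fun y : F × (unitInterval × refTriangle) =>
        τ.cell y.1 (alexander (g y.1) y.2.1 y.2.2) := by
      refine continuous_prod_of_discrete_left.2 fun f => ?_
      have h3 : Continuous fun y : unitInterval × refTriangle => alexander (g f) y.1 y.2 :=
        (hg f).continuousOn_alexander.comp_continuous (f := fun y : unitInterval × refTriangle =>
          ((y.1 : ℝ), (y.2 : ℂ))) (by fun_prop) fun y => ⟨y.1.2, y.2.2⟩
      exact (τ.continuousOn_cell f).comp_continuous h3 fun y =>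
        ((hg f).bijOn_alexander y.1.2).mapsTo y.2.2
    exact h2.comp (f := fun x : unitInterval × (F × refTriangle) => (x.2.1, (x.1, x.2.2)))
      (by fun_prop)
  let H : (unitInterval × S) ≃ₜ (unitInterval × S) :=
    Continuous.homeoOfEquivCompactToT2 (f := Equiv.ofBijective K ⟨hinj, hsurj⟩) hKc
  have hH : ∀ x, H x = K x := fun _ => rfl
  have hH1 : ∀ x, (H x).1 = x.1 := fun _ => rfl
  have hH1' : ∀ x, (H.symm x).1 = x.1 := fun x => by
    have := hH1 (H.symm x)
    rw [H.apply_symm_apply] at this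
    exact this.symm
  let ψ : S ≃ₜ S :=
    { toFun := fun p => (H (1, p)).2
      invFun := fun p => (H.symm (1, p)).2
      left_inv := fun p => by
        have : ((1 : unitInterval), (H (1, p)).2) = H (1, p) := Prod.ext (hH1 _).symm rfl
        simp only [this, H.symm_apply_apply]
      right_inv := fun p => by
        have : ((1 : unitInterval), (H.symm (1, p)).2) = H.symm (1, p) := Prod.ext (hH1' (1, p)).symm rfl
        simp only [this, H.apply_symm_apply]
      continuous_toFun := by fun_prop
      continuous_invFun := by fun_prop }
  refine ⟨ψ, fun f z hz => ?_, H, hH1, fun t p hp => ?_, fun p => ?_, fun p => Prod.ext (hH1 _) rfl⟩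
  · change (K (1, τ.cell f z)).2 = _
    rw [hK 1 f z hz]
    simp only [Set.Icc.coe_one, alexander_one (g f) hz]
  · obtain ⟨f, j, rfl⟩ := (τ.vertices p).1 hp
    rw [hH, hK t f _ (corner_mem j)]
    have := (hg f).alexander_side t.2 j (s := 0) (left_mem_Icc.2 zero_le_one)
    rw [(hg f).sideMap_zero, mul_zero, mul_zero, add_zero, side_zero] at this
    rw [this]
  · obtain ⟨f, z, hz, rfl⟩ := τ.covers p
    rw [hH, hK 0 f z hz]
    simp only [Set.Icc.coe_zero, alexander_zero]

end Glue

open IsTriangleHomeo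

theorem IsEuclideanFace.sideMap_mul [T2Space S] (hX : τ.IsGeometric X) {f : F} {w : Fin 3 → ℂ} {D : ℂ → ℂ}
    (h : τ.IsEuclideanFace X f w D) (j : Fin 3) {s : ℝ} (hs : s ∈ Icc (0 : ℝ) 1) :
    sideMap (τ.normalized X f D) j s * τ.sideVector X (f, j) = D (side j s) - D (side j 0) := by
  have h1 := faceMap_side_sub hX.sideVector_mem.1 f j (sideMap (τ.normalized X f D) j s) 0
  rw [← h.isTriangleHomeo.map_side j hs, side_zero, ← h.isTriangleHomeo.map_corner j,
    h.faceMap_normalized, h.faceMap_normalized, sub_zero, sub_sub_sub_cancel_right] at h1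
  rw [side_zero, h1]

theorem sideMap_partner [T2Space S] [OrientedSurface S] (hX : τ.IsGeometric X) {w : F → Fin 3 → ℂ}
    {D : F → ℂ → ℂ} (hw : ∀ f, τ.IsEuclideanFace X f (w f) (D f)) (h : F × Fin 3) {s : ℝ}
    (hs : s ∈ Icc (0 : ℝ) 1) :
    sideMap (τ.normalized X (τ.partner h).1 (D (τ.partner h).1)) (τ.partner h).2 (1 - s) =
      1 - sideMap (τ.normalized X h.1 (D h.1)) h.2 s := by
  set h' := τ.partner h with hh'
  have hs' : 1 - s ∈ Icc (0 : ℝ) 1 := ⟨by linarith [hs.2], by linarith [hs.1]⟩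
  have h1 := ((hw h.1).hasIntegral_edge h.2).comp unitInterval.continuous_symm
  have h2 := (hw h'.1).hasIntegral_edge h'.2
  have e : (τ.edgePath (h'.1, h'.2) : unitInterval → S) = τ.edgePath (h.1, h.2) ∘ unitInterval.symm :=
    edgePath_partner h
  rw [← e] at h1
  have h3 := (X.isPrimitiveSystem τ.finite_vertices).integral_unique (τ.edgePath h').continuous h1 h2
    ⟨1 - s, hs'⟩ 0
  simp only [Function.comp_apply, unitInterval.coe_symm_eq, Set.Icc.coe_zero, sub_sub_cancel,
    sub_zero] at h3
  have h4 := (hw h.1).sideMap_mul hX h.2 hs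
  have h5 := (hw h'.1).sideMap_mul hX h'.2 hs'
  have h6 := (hw h.1).sideMap_mul hX h.2 (s := 1) (right_mem_Icc.2 zero_le_one)
  rw [(hw h.1).isTriangleHomeo.sideMap_one] at h6
  have h7 : τ.sideVector X (h'.1, h'.2) = -τ.sideVector X (h.1, h.2) := sideVector_partner X h
  rw [h7] at h5
  have hne := hX.isPositive.ne_zero (h.1, h.2)
  have h8 : (sideMap (τ.normalized X h'.1 (D h'.1)) h'.2 (1 - s) : ℂ) =
      1 - sideMap (τ.normalized X h.1 (D h.1)) h.2 s := by
    refine mul_right_cancel₀ hne ?_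
    push_cast at h6
    linear_combination -h5 + h3 - h6 + h4
  exact_mod_cast h8

/-- A translation structure for which `τ` is geometric is equivalent to the flat structure with the
same side vectors. -/
theorem IsGeometric.exists_equivalent [T2Space S] [CompactSpace S] [OrientedSurface S]
    (hX : τ.IsGeometric X) : ∃ hκ : τ.HasOrders (τ.sideVector X) κ,
      X.Equivalent (flatStructure hX.sideVector_mem hX.isPositive hκ) := by
  have hX' : ∀ f, ∃ w D, τ.IsEuclideanFace X f w D := hX
  choose w D hw using hX'
  have hg := fun f => (hw f).isTriangleHomeo
  obtain ⟨ψ, hψ, hI⟩ := exists_glued_homeomorph (τ := τ) hg fun h s hs => sideMap_partner hX hw h hs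
  have hflat : ∀ {P : S → ℂ} {q : S}, X.IsPrimitiveAt q P →
      τ.IsFlatAt (τ.sideVector X) (P ∘ ψ.symm) (ψ q) := by
    intro P q hP f y hy hyq
    obtain ⟨x, hx, rfl⟩ := (hg f).bijOn.surjOn hy
    rw [← hψ f x hx, ψ.injective.eq_iff] at hyq
    refine (hg f).eventually_image hx ?_
    filter_upwards [(hw f).sub_eq hx (hyq ▸ hP), self_mem_nhdsWithin] with x' h1 h2
    rw [(hw f).faceMap_normalized, (hw f).faceMap_normalized, sub_sub_sub_cancel_right, h1, ← hψ f x' h2]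
    simp [hyq]
  refine ⟨fun z => ?_, ψ, fun e he e' he' p hp hp' => ?_, hI⟩
  · obtain ⟨ζ, h1, h2, h3⟩ := X.zeros z
    have hz : ψ.symm z = z := by rw [ψ.symm_apply_eq, hI.fixes z.2]
    refine ⟨(fun q => ζ q ^ (κ z + 1) / (κ z + 1)) ∘ ψ.symm,
      ψ.symm.toOpenPartialHomeomorph.trans ζ, ?_, ?_, fun q hq => ?_⟩
    · simp [hz, h1]
    · simp [hz, h2]
    · have hq' : ψ.symm q ∈ ζ.source := by simpa using hq
      refine ⟨?_, by simp⟩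
      have := hflat (P := fun q => ζ q ^ (κ z + 1) / (κ z + 1)) (q := ψ.symm q) (by
        filter_upwards [ζ.open_source.mem_nhds hq'] with q' hq'
        refine ⟨((ζ.continuousAt hq').pow _).div_const _, fun e he hqe => ?_⟩
        filter_upwards [h3 e he q' hqe hq'] with q'' hq''
        rw [hq'', sub_div])
      rwa [ψ.apply_symm_apply] at this
  · have h1 := hflat (X.isPrimitiveAt_chart he hp)
    have h2 := h1.sub_eq (he'.2 _ hp')
    filter_upwards [ψ.continuous.continuousAt.eventually h2] with q hq
    simpa using hq

end Triangulation

/-! ### Variation of the flat structure with its side vectors -/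

theorem hasLocalDegree_id (z : ℂ) : HasLocalDegree id z 1 := by
  filter_upwards [self_mem_nhdsWithin] with r hr
  refine ⟨fun t => Complex.log r + t * Complex.I, by fun_prop, fun t => ?_, by push_cast; ring⟩
  have h0 : (r : ℂ) ≠ 0 := Complex.ofReal_ne_zero.2 (ne_of_gt hr)
  rw [Complex.exp_add, Complex.exp_log h0]
  simp [circleMap]

theorem OpenPartialHomeomorph.exists_hasLocalDegree {S : Type*} [TopologicalSpace S]
    (χ ζ : OpenPartialHomeomorph S ℂ) {p : S} (hχ : p ∈ χ.source) (hζ : p ∈ ζ.source) :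
    ∃ m : ℤ, IsUnit m ∧ HasLocalDegree (ζ ∘ χ.symm) (χ p) m := by
  have aux : ∀ χ ζ : OpenPartialHomeomorph S ℂ, p ∈ χ.source → p ∈ ζ.source →
      (χ.symm.trans ζ).source ∈ 𝓝 (χ p) := fun χ ζ hχ hζ =>
    (χ.symm.trans ζ).open_source.mem_nhds (by simp [hχ, hζ])
  obtain ⟨m, hm⟩ := _root_.exists_hasLocalDegree (aux χ ζ hχ hζ) (χ.symm.trans ζ).continuousOn (χ.symm.trans ζ).injOn
  obtain ⟨n, hn⟩ := _root_.exists_hasLocalDegree (aux ζ χ hζ hχ) (ζ.symm.trans χ).continuousOn (ζ.symm.trans χ).injOn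
  have hm' : HasLocalDegree (ζ ∘ χ.symm) (χ p) m := hm.self_of_nhds
  have hpt : (ζ ∘ χ.symm) (χ p) = ζ p := by simp [hχ]
  have hc := (χ.symm.trans ζ).continuousAt (mem_of_mem_nhds (aux χ ζ hχ hζ))
  have h1 := hm'.comp hc (hpt ▸ aux ζ χ hζ hχ) (ζ.symm.trans χ).continuousOn (ζ.symm.trans χ).injOn
    (hpt ▸ hn.self_of_nhds)
  have h2 : HasLocalDegree id (χ p) (m * n) := by
    refine h1.congr ?_
    filter_upwards [aux χ ζ hχ hζ] with x hx
    have hx1 : x ∈ χ.target := by simpa using hx.1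
    have hx2 : χ.symm x ∈ ζ.source := by simpa using hx.2
    simp [hx1, hx2, hχ, hζ]
  exact ⟨m, IsUnit.of_mul_eq_one n (h2.unique (hasLocalDegree_id _)), hm'⟩

theorem HasWinding.pow_div {γ : ℝ → ℂ} {m : ℤ} (h : HasWinding γ m) (k : ℕ) :
    HasWinding (fun t => γ t ^ (k + 1) / (k + 1)) (m * (k + 1)) := by
  obtain ⟨g, h1, h2, h3⟩ := h
  have h0 : (k + 1 : ℂ) ≠ 0 := Nat.cast_add_one_ne_zero k
  refine ⟨fun t => (k + 1) * g t - Complex.log (k + 1), by fun_prop, fun t => ?_, ?_⟩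
  · beta_reduce
    rw [Complex.exp_sub, Complex.exp_log h0, ← h2, ← Complex.exp_nat_mul]
    push_cast; rfl
  · simp only [h3]; push_cast; ring

namespace Triangulation

variable {S : Type*} [TopologicalSpace S] [ChartedSpace ℂ S] {Z : Set S} {E F : Type*}
  {τ : Triangulation S Z E F} {v : F × Fin 3 → ℂ}

variable (τ) in
/-- `P` is a primitive near `q` of the universal flat structure, with side vectors in the dual of the
cycle space. -/
def IsFunctionalPrimitive (q : S) (P : S → (τ.cycleSpace →ₗ[ℂ] ℂ)) : Prop :=
  ∀ f, ∀ z ∈ refTriangle, τ.cell f z = q → ∀ᶠ z' in 𝓝[refTriangle] z,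
    P (τ.cell f z') - P q = τ.faceFunctional f z' - τ.faceFunctional f z

theorem IsFunctionalPrimitive.isFlatAt {q : S} {P : S → (τ.cycleSpace →ₗ[ℂ] ℂ)}
    (h : τ.IsFunctionalPrimitive q P) (v : τ.cycleSpace) : τ.IsFlatAt v (fun q => P q v) q := by
  intro f z hz hzq
  filter_upwards [h f z hz hzq] with z' hz'
  exact congrArg (fun L => L v) hz'

theorem IsFunctionalPrimitive.eventually [T2Space S] {q : S} {P : S → (τ.cycleSpace →ₗ[ℂ] ℂ)}
    (h : τ.IsFunctionalPrimitive q P) : ∀ᶠ q' in 𝓝 q, τ.IsFunctionalPrimitive q' P := by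
  refine τ.eventually_fiber (Q := fun f z => ∀ᶠ z' in 𝓝[refTriangle] z,
    P (τ.cell f z') - P (τ.cell f z) = τ.faceFunctional f z' - τ.faceFunctional f z)
      (fun f z hz hzq => ?_) |>.mono fun q' hq' f z hz hzq => ?_
  · filter_upwards [eventually_eventually_nhdsWithin.2 (h f z hz hzq), h f z hz hzq] with z' h1 h2
    filter_upwards [h1] with z'' h3
    rw [← sub_sub_sub_cancel_right _ _ (P q), h3, h2, sub_sub_sub_cancel_right]
  · simpa only [hzq] using hq' f z hz hzq

theorem exists_functionalPrimitive (p : S) :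
    ∃ P, P p = 0 ∧ τ.IsFunctionalPrimitive p P := by
  obtain ⟨P, hP⟩ := τ.exists_localPrimitive p
  have h0 : P p = 0 := by
    obtain ⟨f, z, hz, rfl⟩ := τ.covers p
    rw [(hP f z hz rfl).self_of_nhdsWithin hz, sub_self]
  refine ⟨P, h0, fun f z hz hzp => ?_⟩
  filter_upwards [hP f z hz hzp] with z' hz'
  rw [h0, hz', sub_zero]

theorem isPrimitiveSystem_functional [T2Space S] :
    IsPrimitiveSystem (τ.IsFunctionalPrimitive) where
  exists_primitive p := let ⟨P, h⟩ := exists_functionalPrimitive p; ⟨P, h.2⟩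
  eventually h := h.eventually
  sub_eq h h' := τ.eventually_nhds fun f z hz hzq => by
    filter_upwards [h f z hz hzq, h' f z hz hzq] with z' h1 h2
    rw [h1, h2]

theorem IsFlatAt.isPrimitiveAt [T2Space S] [OrientedSurface S] {P : S → ℂ} {q : S}
    (h : τ.IsFlatAt v P q) (hv : v ∈ τ.cycleSpace) (hp : RibbonGraph.IsPositive v) {κ : Z → ℕ}
    (hκ : τ.HasOrders v κ) : (flatStructure hv hp hκ).IsPrimitiveAt q P := by
  filter_upwards [h.eventually] with q' hq'
  exact ⟨hq'.continuousAt, fun e he hqe => (he.2 q' hqe).sub_eq hq'⟩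

/-- The periods of the flat structures depend linearly on the side vectors. -/
theorem exists_linear_period [T2Space S] [OrientedSurface S] {a b : S} (γ : Path a b) :
    ∃ L : τ.cycleSpace →ₗ[ℂ] ℂ, ∀ (v : τ.cycleSpace) (hp : RibbonGraph.IsPositive (v : F × Fin 3 → ℂ))
      (κ : Z → ℕ) (hκ : τ.HasOrders v κ), (flatStructure v.2 hp hκ).period γ = L v := by
  obtain ⟨G, hG⟩ := (isPrimitiveSystem_functional (τ := τ)).exists_integral γ.continuous
  refine ⟨G 1 - G 0, fun v hp κ hκ => ?_⟩
  refine TranslationStructure.HasPeriod.period_eq τ.finite_vertices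
    (TranslationStructure.hasPeriod_iff.2 ⟨fun t => G t v, fun t => ?_, rfl⟩)
  obtain ⟨P, h1, h2⟩ := hG t
  refine ⟨fun q => P q v, (h1.isFlatAt v).isPrimitiveAt v.2 hp hκ, ?_⟩
  filter_upwards [h2] with s hs
  exact congrArg (fun L => L v) hs

theorem IsFunctionalPrimitive.eventually_ne [T2Space S] {q : S} {P : S → (τ.cycleSpace →ₗ[ℂ] ℂ)}
    (h : τ.IsFunctionalPrimitive q P) : ∀ᶠ q' in 𝓝 q, ∀ v : τ.cycleSpace,
      RibbonGraph.IsPositive (v : F × Fin 3 → ℂ) → P q' v = P q v → q' = q := by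
  refine τ.eventually_nhds fun f z hz hzq => ?_
  filter_upwards [h f z hz hzq] with z' h1 v hp h2
  have h3 : P (τ.cell f z') v - P q v = faceMap v f z' - faceMap v f z := congrArg (fun L => L v) h1
  rw [h2, sub_self] at h3
  rw [faceMap_injective hp f (sub_eq_zero.1 h3.symm), hzq]

theorem HasOrders.eventually_hasWinding [T2Space S] {κ : Z → ℕ} {v : τ.cycleSpace} (hκ : τ.HasOrders v κ)
    (z : Z) {P : S → (τ.cycleSpace →ₗ[ℂ] ℂ)} (hP0 : P z = 0) (hP : τ.IsFunctionalPrimitive (z : S) P) :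
    ∃ m : ℤ, IsUnit m ∧ ∀ᶠ r : ℝ in 𝓝[>] 0, HasWinding
      (fun t => P ((chartAt ℂ (z : S)).symm (circleMap (chartAt ℂ (z : S) z) r t)) v) (m * (κ z + 1)) := by
  set χ := chartAt ℂ (z : S) with hχ
  have hz : (z : S) ∈ χ.source := mem_chart_source ℂ _
  obtain ⟨Q, ζ, h1, h2, h3⟩ := hκ z
  obtain ⟨m, hm, hd⟩ := χ.exists_hasLocalDegree ζ hz h1
  refine ⟨m, hm, ?_⟩
  have h4 : ∀ᶠ q in 𝓝 (z : S), P q v = ζ q ^ (κ z + 1) / (κ z + 1) := by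
    filter_upwards [(h3 z h1).1.sub_eq (hP.isFlatAt v), ζ.open_source.mem_nhds h1] with q h5 h6
    rw [(h3 q h6).2, (h3 z h1).2, h2, hP0] at h5
    simpa using h5
  have h5 : ∀ᶠ x in 𝓝 (χ z), P (χ.symm x) v = ζ (χ.symm x) ^ (κ z + 1) / (κ z + 1) :=
    (χ.symm.continuousAt (χ.map_source hz)).eventually (by rwa [χ.left_inv hz])
  obtain ⟨ε, hε, h6⟩ := Metric.eventually_nhds_iff.1 h5
  filter_upwards [hd, Ioo_mem_nhdsGT hε] with r h7 h8
  have h9 := h7.pow_div (κ z)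
  convert h9 using 2 with t
  rw [h6 (by rw [dist_circleMap _ h8.1]; exact h8.2)]
  simp [χ.left_inv hz, h2]

/-- The orders of the zeros do not change along a path of flat structures. -/
theorem HasOrders.eq_of_path [T2Space S] {V : ℝ → τ.cycleSpace}
    (hV : ∀ h, ContinuousOn (fun s => (V s : F × Fin 3 → ℂ) h) (Icc 0 1))
    (hp : ∀ s ∈ Icc (0 : ℝ) 1, RibbonGraph.IsPositive (V s : F × Fin 3 → ℂ)) {κ κ' : Z → ℕ}
    (hκ : τ.HasOrders (V 0) κ) (hκ' : τ.HasOrders (V 1) κ') : κ = κ' := by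
  have hfin := τ.finite_faces
  funext z
  obtain ⟨P, hP0, hP⟩ := τ.exists_functionalPrimitive (z : S)
  obtain ⟨m, hm, h1⟩ := hκ.eventually_hasWinding z hP0 hP
  obtain ⟨m', hm', h1'⟩ := hκ'.eventually_hasWinding z hP0 hP
  set χ := chartAt ℂ (z : S) with hχ
  have hz : (z : S) ∈ χ.source := mem_chart_source ℂ _
  have h2 : ∀ᶠ x in 𝓝 (χ z), (∀ v : τ.cycleSpace, RibbonGraph.IsPositive (v : F × Fin 3 → ℂ) →
      P (χ.symm x) v = 0 → χ.symm x = z) ∧ (∀ v, ContinuousAt (fun q => P q v) (χ.symm x)) ∧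
        x ∈ χ.target := by
    have hc : Tendsto χ.symm (𝓝 (χ z)) (𝓝 z) := by
      have := χ.symm.continuousAt (χ.map_source hz)
      rwa [ContinuousAt, χ.left_inv hz] at this
    refine Eventually.and ?_ (Eventually.and ?_ (χ.open_target.mem_nhds (χ.map_source hz)))
    · refine hc.eventually (p := fun q => ∀ v : τ.cycleSpace, RibbonGraph.IsPositive
        (v : F × Fin 3 → ℂ) → P q v = 0 → q = z) ?_
      filter_upwards [hP.eventually_ne] with q hq v hv h
      exact hq v hv (by rw [h, hP0]; rfl)
    · refine hc.eventually (p := fun q' => ∀ v, ContinuousAt (fun q => P q v) q') ?_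
      filter_upwards [hP.eventually] with q hq v
      exact (hq.isFlatAt v).continuousAt
  obtain ⟨ε, hε, h3⟩ := Metric.eventually_nhds_iff.1 h2
  obtain ⟨r, ⟨h4, h4'⟩, hr⟩ := ((h1.and h1').and (Ioo_mem_nhdsGT hε)).exists
  have h5 : ∀ t, _ := fun t => h3 (show dist (circleMap (χ z) r t) (χ z) < ε by
    rw [dist_circleMap _ hr.1]; exact hr.2)
  have hVc : ContinuousOn V (Icc 0 1) := by
    rw [continuousOn_iff_continuous_domRestrict]
    refine Continuous.subtype_mk (continuous_pi fun h => ?_) _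
    exact continuousOn_iff_continuous_domRestrict.1 (hV h)
  let b := Module.finBasis ℂ τ.cycleSpace
  have h6 : ContinuousOn (fun x : ℝ × ℝ => P (χ.symm (circleMap (χ z) r x.2)) (V x.1)) (Icc 0 1 ×ˢ univ) := by
    have h7 : ∀ x : ℝ × ℝ, P (χ.symm (circleMap (χ z) r x.2)) (V x.1) =
        ∑ i, b.coord i (V x.1) * P (χ.symm (circleMap (χ z) r x.2)) (b i) := fun x => by
      conv_lhs => rw [← b.sum_repr (V x.1), map_sum]
      simp
    simp only [h7]
    refine continuousOn_finsetSum _ fun i _ => ContinuousOn.mul ?_ ?_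
    · exact (LinearMap.continuous_of_finiteDimensional (b.coord i)).comp_continuousOn
        (hVc.comp continuousOn_fst fun x hx => hx.1)
    · refine Continuous.continuousOn (continuous_iff_continuousAt.2 fun x => ?_)
      have h8 : ContinuousAt (fun x : ℝ × ℝ => χ.symm (circleMap (χ z) r x.2)) x :=
        ContinuousAt.comp (f := fun x : ℝ × ℝ => circleMap (χ z) r x.2) (χ.symm.continuousAt (h5 x.2).2.2)
          (((continuous_circleMap _ _).comp continuous_snd).continuousAt)
      exact ContinuousAt.comp (f := fun x : ℝ × ℝ => χ.symm (circleMap (χ z) r x.2))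
        (g := fun q => P q (b i)) ((h5 x.2).2.1 (b i)) h8
  have h7 := HasWinding.homotopy h6 (fun s hs t h0 => ?_) (fun s _ => by
    simp only [circleMap_two_pi]) h4
  · have h8 := h7.unique h4'
    have h9 := congrArg Int.natAbs h8
    rw [Int.natAbs_mul, Int.natAbs_mul, Int.isUnit_iff_natAbs_eq.1 hm, Int.isUnit_iff_natAbs_eq.1 hm'] at h9
    omega
  · have h8 := (h5 t).1 _ (hp s hs) h0
    have h9 := χ.right_inv (h5 t).2.2
    rw [h8] at h9
    have h10 := dist_circleMap (χ z) hr.1 t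
    rw [← h9, dist_self] at h10
    exact hr.1.ne h10

end Triangulation

/-! ### The angle map -/

section Strata

variable {S : Type*} [TopologicalSpace S] [ChartedSpace ℂ S] {Z : Set S} {κ : Z → ℕ}

theorem Stratum.continuous_period {a b : Z} (γ : Path (a : S) (b : S)) :
    Continuous (Stratum.period (κ := κ) γ) :=
  continuous_iInf_dom (continuous_iInf_dom (continuous_iInf_dom continuous_induced_dom))

theorem Stratum.continuous_iff {T : Type*} [TopologicalSpace T] {g : T → Stratum Z κ} :
    Continuous g ↔ ∀ (a b : Z) (γ : Path (a : S) (b : S)), Continuous fun t => (g t).period γ := by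
  refine ⟨fun h a b γ => (Stratum.continuous_period γ).comp h, fun h => ?_⟩
  exact continuous_iInf_rng.2 fun a => continuous_iInf_rng.2 fun b => continuous_iInf_rng.2 fun γ =>
    continuous_induced_rng.2 (h a b γ)

theorem Stratum.mk_eq_mk {X X' : TranslationStructure S Z κ} :
    Stratum.mk X = Stratum.mk X' ↔ X.Equivalent X' :=
  Quotient.eq

theorem ProjStratum.mk_scale (c : ℂˣ) (X : TranslationStructure S Z κ) :
    ProjStratum.mk (X.scale c) = ProjStratum.mk X :=
  (Quot.sound ⟨c, X, rfl, rfl⟩).symm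

theorem ProjStratum.mk_eq_of_equivalent {X X' : TranslationStructure S Z κ} (h : X.Equivalent X') :
    ProjStratum.mk X = ProjStratum.mk X' :=
  congrArg (Quot.mk _) (Stratum.mk_eq_mk.2 h)

end Strata

namespace Triangulation

variable {S : Type*} [TopologicalSpace S] [ChartedSpace ℂ S] {Z : Set S} {E F : Type*}
  {κ : Z → ℕ} {τ : Triangulation S Z E F} {X : TranslationStructure S Z κ}

variable (τ) in
/-- The periods along the sides of the triangulation. -/
noncomputable def stratumVector (M : Stratum Z κ) (h : F × Fin 3) : ℂ :=
  M.period (a := ⟨_, τ.vertex_mem h.1 h.2⟩) (b := ⟨_, τ.vertex_mem h.1 (h.2 + 1)⟩) (τ.edgePath h)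

theorem stratumVector_mk [T2Space S] (X : TranslationStructure S Z κ) :
    τ.stratumVector (Stratum.mk X) = τ.sideVector X :=
  funext fun _ => TranslationStructure.period_mk τ.finite_vertices _ X

theorem continuous_stratumVector (h : F × Fin 3) :
    Continuous fun M : Stratum Z κ => τ.stratumVector M h :=
  Stratum.continuous_period _

theorem stratumVector_of_sameOrbit [T2Space S] {M M' : Stratum Z κ} (h : M.SameOrbit M') :
    ∃ c : ℂˣ, ∀ h, τ.stratumVector M' h = c * τ.stratumVector M h := by
  obtain ⟨c, X, rfl, rfl⟩ := h
  refine ⟨c, fun h => ?_⟩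
  rw [stratumVector_mk, stratumVector_mk]
  exact TranslationStructure.period_scale τ.finite_vertices c _

variable (τ) in
/-- The angles between the vectors along the sides of the faces. -/
noncomputable def periodAngles [T2Space S] : ProjStratum Z κ → F × Fin 3 → ℝ :=
  Quot.lift (fun M => RibbonGraph.angleOf (τ.stratumVector M)) fun M M' h => by
    obtain ⟨c, hc⟩ := stratumVector_of_sameOrbit (τ := τ) h
    funext h
    simp only [RibbonGraph.angleOf, hc, ← mul_neg]
    rw [Complex.angle_mul_left c.ne_zero]

theorem periodAngles_mk [T2Space S] (X : TranslationStructure S Z κ) :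
    τ.periodAngles (ProjStratum.mk X) = RibbonGraph.angleOf (τ.sideVector X) := by
  rw [← stratumVector_mk]; rfl

theorem IsEuclideanFace.angle_eq [T2Space S] {f : F} {w : Fin 3 → ℂ} {D : ℂ → ℂ}
    (h : τ.IsEuclideanFace X f w D) (j : Fin 3) :
    EuclideanGeometry.angle (w j) (w (j + 1)) (w (j + 2)) =
      RibbonGraph.angleOf (τ.sideVector X) (f, j) := by
  have h2 : j + 1 + 1 = j + 2 := by rw [add_assoc]; rfl
  have h1 := h.sideVector_eq (j + 1)
  rw [h2] at h1
  rw [RibbonGraph.angleOf, RibbonGraph.shift, h.sideVector_eq, h1, neg_sub]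
  rfl

theorem angleMap_eq [T2Space S] (M : τ.isoTriangulable κ) : τ.angleMap κ M = τ.periodAngles (M : ProjStratum Z κ) := by
  funext h
  rw [← M.2.choose_spec.2, periodAngles_mk]
  obtain ⟨D, hD⟩ := (M.2.choose_spec.1 h.1).choose_spec
  exact hD.angle_eq h.2

theorem continuousOn_periodAngles [T2Space S] [OrientedSurface S] :
    ContinuousOn (τ.periodAngles (κ := κ)) (τ.isoTriangulable κ) := by
  have hfin := τ.finite_faces
  let U : Set (ProjStratum Z κ) := Quot.lift (fun M => ∀ h, τ.stratumVector M h ≠ 0) fun M M' h => by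
    obtain ⟨c, hc⟩ := stratumVector_of_sameOrbit (τ := τ) h
    simp [hc]
  let π : Stratum Z κ → ProjStratum Z κ := Quot.mk _
  have hq : IsQuotientMap π := isQuotientMap_quot_mk
  have hpre : π ⁻¹' U = {M | ∀ h, τ.stratumVector M h ≠ 0} := rfl
  have hU : IsOpen U := by
    refine hq.isOpen_preimage.1 ?_
    rw [hpre, ofPred_forall]
    exact isOpen_iInter_of_finite fun h => isOpen_ne.preimage (continuous_stratumVector h)
  have hsub : τ.isoTriangulable κ ⊆ U := by
    rintro _ ⟨X, hX, rfl⟩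
    change ∀ h, τ.stratumVector (Stratum.mk X) h ≠ 0
    rw [stratumVector_mk]
    exact hX.isPositive.ne_zero
  refine ContinuousOn.mono ?_ hsub
  rw [hq.continuousOn_isOpen_iff hU, hpre]
  refine continuousOn_pi.2 fun h M hM => ContinuousAt.continuousWithinAt ?_
  exact ContinuousAt.comp (f := fun M : Stratum Z κ => (-τ.stratumVector M h, τ.stratumVector M (RibbonGraph.shift 1 h)))
    (InnerProductGeometry.continuousAt_angle (neg_ne_zero.2 (hM h)) (hM _))
    ((continuous_stratumVector h).neg.prodMk (continuous_stratumVector _)).continuousAt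

theorem IsFlatAt.const_mul {v : F × Fin 3 → ℂ} {P : S → ℂ} {q : S} (h : τ.IsFlatAt v P q) (c : ℂ) :
    τ.IsFlatAt (fun h => c * v h) (fun q => c * P q) q := by
  intro f z hz hzq
  filter_upwards [h f z hz hzq] with z' hz'
  rw [← mul_sub, hz']
  simp only [faceMap]; ring

theorem HasOrders.const_mul {v : F × Fin 3 → ℂ} {κ : Z → ℕ} (h : τ.HasOrders v κ) {c : ℂ} (hc : c ≠ 0) :
    τ.HasOrders (fun h => c * v h) κ := by
  intro z
  obtain ⟨P, ζ, h1, h2, h3⟩ := h z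
  obtain ⟨μ, hμ⟩ := IsAlgClosed.exists_pow_nat_eq c (n := κ z + 1) (by omega)
  have hμ0 : μ ≠ 0 := by
    rintro rfl
    exact hc (by rw [← hμ]; simp)
  refine ⟨fun q => c * P q, ζ.transHomeomorph (Homeomorph.mulLeft₀ μ hμ0), h1, by simp [h2],
    fun q hq => ⟨(h3 q hq).1.const_mul c, ?_⟩⟩
  simp only [OpenPartialHomeomorph.transHomeomorph_apply, Function.comp_apply,
    Homeomorph.coe_mulLeft₀, mul_pow, hμ, (h3 q hq).2]
  ring

section Flat

variable [T2Space S] [OrientedSurface S] {v v' : F × Fin 3 → ℂ}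

theorem isGeometric_flatStructure (hv : v ∈ τ.cycleSpace) (hp : RibbonGraph.IsPositive v)
    (hκ : τ.HasOrders v κ) : τ.IsGeometric (flatStructure hv hp hκ) :=
  fun f => ⟨_, _, isEuclideanFace_flatStructure hv hp hκ f⟩

theorem sideVector_flatStructure (hv : v ∈ τ.cycleSpace) (hp : RibbonGraph.IsPositive v)
    (hκ : τ.HasOrders v κ) : τ.sideVector (flatStructure hv hp hκ) = v := by
  funext ⟨f, j⟩
  rw [(isEuclideanFace_flatStructure hv hp hκ f).sideVector_eq, faceMap_sub_corner hv.1]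

theorem projMk_flatStructure_eq (hv : v ∈ τ.cycleSpace) (hp : RibbonGraph.IsPositive v)
    (hκ : τ.HasOrders v κ) (hv' : v' ∈ τ.cycleSpace) (hp' : RibbonGraph.IsPositive v')
    (hκ' : τ.HasOrders v' κ) {c : ℂ} (hc : c ≠ 0) (h : ∀ h, v' h = c * v h) :
    ProjStratum.mk (flatStructure hv hp hκ) = ProjStratum.mk (flatStructure hv' hp' hκ') := by
  obtain rfl : v' = fun h => c * v h := funext h
  rw [← ProjStratum.mk_scale (Units.mk0 c hc)]
  refine ProjStratum.mk_eq_of_equivalent ⟨Homeomorph.refl S, ?_, Homeomorph.refl _, fun _ => rfl,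
    fun _ _ _ => rfl, fun _ => rfl, fun _ => rfl⟩
  rintro _ ⟨e, he, rfl⟩ e' he' p hpe hpe'
  exact ((he.2 p hpe).const_mul c).sub_eq (he'.2 p hpe')

theorem projMk_eq_of_geometric [CompactSpace S] (hX : τ.IsGeometric X) :
    ∃ hκ : τ.HasOrders (τ.sideVector X) κ,
      ProjStratum.mk X = ProjStratum.mk (flatStructure hX.sideVector_mem hX.isPositive hκ) := by
  obtain ⟨hκ, h⟩ := hX.exists_equivalent
  exact ⟨hκ, ProjStratum.mk_eq_of_equivalent h⟩

theorem injOn_periodAngles [CompactSpace S] [ConnectedSpace S] :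
    InjOn (τ.periodAngles (κ := κ)) (τ.isoTriangulable κ) := by
  have := τ.nonempty_faces
  rintro _ ⟨X, hX, rfl⟩ _ ⟨X', hX', rfl⟩ h
  rw [periodAngles_mk, periodAngles_mk] at h
  obtain ⟨c, hc, hcv⟩ := RibbonGraph.exists_smul_of_angleOf_eq τ.faceConnected hX.sideVector_mem
    hX'.sideVector_mem hX.isPositive hX'.isPositive h
  obtain ⟨hκ, h1⟩ := projMk_eq_of_geometric hX
  obtain ⟨hκ', h1'⟩ := projMk_eq_of_geometric hX'
  rw [h1, h1']
  exact projMk_flatStructure_eq _ _ _ _ _ _ hc hcv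

end Flat

end Triangulation

/-! ### Delaunay triangulations satisfy the angle condition -/

theorem eq_or_eq_conj_of_isometric {G : ℂ → ℂ} {ε : ℝ} (hε : 0 < ε) (h0 : G 0 = 0)
    (hε' : G (ε : ℂ) = ε)
    (hG : ∀ x y : ℂ, ‖x‖ ≤ ε → ‖y‖ ≤ ε → dist (G x) (G y) = dist x y) :
    (∀ y : ℂ, ‖y‖ ≤ ε → G y = y) ∨ ∀ y : ℂ, ‖y‖ ≤ ε → G y = (starRingEnd ℂ) y := by
  have hn : ‖(ε : ℂ)‖ ≤ ε := by simp [abs_of_pos hε]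
  have hi : ‖(ε : ℂ) * Complex.I‖ ≤ ε := by simp [abs_of_pos hε]
  have hsq : ∀ x y : ℂ, ‖x‖ ≤ ε → ‖y‖ ≤ ε →
      ((G x).re - (G y).re) ^ 2 + ((G x).im - (G y).im) ^ 2 = (x.re - y.re) ^ 2 + (x.im - y.im) ^ 2 := by
    intro x y hx hy
    have h1 := hG x y hx hy
    rw [Complex.dist_eq_re_im, Complex.dist_eq_re_im] at h1
    exact (Real.sqrt_inj (by positivity) (by positivity)).1 h1
  have hre : ∀ y : ℂ, ‖y‖ ≤ ε → (G y).re = y.re ∧ (G y).im ^ 2 = y.im ^ 2 := by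
    intro y hy
    have h1 := hsq y 0 hy (by simpa using hε.le)
    have h2 := hsq y ε hy hn
    rw [h0] at h1
    rw [hε'] at h2
    simp only [Complex.zero_re, Complex.zero_im, Complex.ofReal_re, Complex.ofReal_im, sub_zero] at h1 h2
    have h3 : (G y).re = y.re := by
      have : 2 * ε * ((G y).re - y.re) = 0 := by linear_combination h1 - h2
      have := (mul_eq_zero.1 this).resolve_left (by positivity)
      linarith
    exact ⟨h3, by rw [h3] at h1; linarith⟩
  obtain ⟨h1, h2⟩ := hre _ hi
  simp only [Complex.mul_im, Complex.ofReal_re, Complex.I_im, mul_one, Complex.ofReal_im,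
    Complex.I_re, mul_zero, add_zero, Complex.mul_re, sub_zero] at h1 h2
  have key : ∀ y : ℂ, ‖y‖ ≤ ε → (G y).im * (G (ε * Complex.I)).im = y.im * ε := by
    intro y hy
    have h3 := hsq y _ hy hi
    simp only [Complex.mul_im, Complex.ofReal_re, Complex.I_im, mul_one, Complex.ofReal_im,
      Complex.I_re, mul_zero, add_zero, Complex.mul_re, sub_zero, h1, (hre y hy).1] at h3
    linear_combination -h3 / 2 + (hre y hy).2 / 2 + h2 / 2
  rcases sq_eq_sq_iff_eq_or_eq_neg.1 h2 with h3 | h3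
  · refine Or.inl fun y hy => Complex.ext (hre y hy).1 ?_
    have := key y hy
    rw [h3] at this
    exact mul_right_cancel₀ hε.ne' this
  · refine Or.inr fun y hy => Complex.ext (by simpa using (hre y hy).1) ?_
    have := key y hy
    rw [h3] at this
    simp only [Complex.conj_im]
    exact mul_right_cancel₀ hε.ne' (by linarith)

theorem exists_linearIsometryEquiv_of_isometric {g : ℂ → ℂ} {z : ℂ}
    (h : ∀ᶠ x in 𝓝 (z, z), dist (g x.1) (g x.2) = dist x.1 x.2) :
    ∃ ℓ : ℂ ≃ₗᵢ[ℝ] ℂ, ∀ᶠ y in 𝓝 z, g y - g z = ℓ (y - z) := by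
  obtain ⟨δ, hδ, hd⟩ := Metric.eventually_nhds_iff.1 h
  have hε : 0 < δ / 2 := by positivity
  set ε := δ / 2 with hεδ
  have hg : ∀ x y : ℂ, ‖x‖ ≤ ε → ‖y‖ ≤ ε → dist (g (z + x)) (g (z + y)) = dist x y := by
    intro x y hx hy
    have := hd (y := (z + x, z + y)) (by
      rw [Prod.dist_eq, max_lt_iff]
      simp only [dist_self_add_left]
      constructor <;> linarith)
    simpa using this
  have hn : ‖(ε : ℂ)‖ = ε := by simp [abs_of_pos hε]
  have hεC : (ε : ℂ) ≠ 0 := Complex.ofReal_ne_zero.2 hε.ne'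
  set A : ℂ := (g (z + ε) - g z) / ε with hA
  have hA1 : ‖A‖ = 1 := by
    have := hg ε 0 hn.le (by simpa using hε.le)
    rw [add_zero, dist_eq_norm, dist_zero_right, hn] at this
    rw [hA, norm_div, this, hn, div_self hε.ne']
  have hA0 : A ≠ 0 := norm_ne_zero_iff.1 (by rw [hA1]; exact one_ne_zero)
  obtain ⟨a, ha⟩ : ∃ a : Circle, (a : ℂ) = A := ⟨⟨A, mem_sphere_zero_iff_norm.2 hA1⟩, rfl⟩
  have key := eq_or_eq_conj_of_isometric (G := fun y => (g (z + y) - g z) / A) hε (by simp) (by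
      simp only [hA]
      have : g (z + ε) - g z ≠ 0 := fun h0 => hA0 (by rw [hA, h0, zero_div])
      field_simp) (fun x y hx hy => by
      rw [dist_eq_norm, ← sub_div, norm_div, hA1, div_one, sub_sub_sub_cancel_right, ← dist_eq_norm, hg x y hx hy])
  have hnear : ∀ᶠ y in 𝓝 z, ‖y - z‖ ≤ ε := by
    filter_upwards [Metric.closedBall_mem_nhds z hε] with y hy
    rwa [← dist_eq_norm]
  rcases key with h1 | h1
  · refine ⟨rotation a, ?_⟩
    filter_upwards [hnear] with y hy
    have := h1 _ hy
    simp only [add_sub_cancel] at this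
    rw [div_eq_iff hA0] at this
    rw [this, rotation_apply, ha, mul_comm]
  · refine ⟨Complex.conjLIE.trans (rotation a), ?_⟩
    filter_upwards [hnear] with y hy
    have := h1 _ hy
    simp only [add_sub_cancel] at this
    rw [div_eq_iff hA0] at this
    rw [this, LinearIsometryEquiv.trans_apply, rotation_apply, ha, mul_comm]
    rfl

namespace TranslationStructure

variable {S : Type*} [TopologicalSpace S] [ChartedSpace ℂ S] {Z : Set S} {κ : Z → ℕ}
  {X : TranslationStructure S Z κ} {d : ℂ → S} {c : ℂ} {r : ℝ}

/-- An empty disk that is immersed by local inverses of primitives of the differential. -/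
structure IsDevelopedDisk (X : TranslationStructure S Z κ) (d : ℂ → S) (c : ℂ) (r : ℝ) : Prop where
  pos : 0 < r
  continuousOn : ContinuousOn d (Metric.closedBall c r)
  empty : ∀ z ∈ Metric.ball c r, d z ∉ Z
  developed : ∀ z ∈ Metric.ball c r, ∀ e ∈ X.charts, d z ∈ e.source →
    ∀ᶠ y in 𝓝 z, e (d y) - e (d z) = y - z

theorem IsDevelopedDisk.continuousAt (h : X.IsDevelopedDisk d c r) {z : ℂ} (hz : z ∈ Metric.ball c r) :
    ContinuousAt d z :=
  h.continuousOn.continuousAt (mem_of_superset (Metric.isOpen_ball.mem_nhds hz) Metric.ball_subset_closedBall)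

theorem IsEmptyDisk.exists_linearIsometryEquiv (h : X.IsEmptyDisk d c r) :
    ∃ ℓ : ℂ ≃ₗᵢ[ℝ] ℂ, ∀ z ∈ Metric.ball c r, ∀ e ∈ X.charts, d z ∈ e.source →
      ∀ᶠ y in 𝓝 z, e (d y) - e (d z) = ℓ (y - z) := by
  have hcont : ∀ z ∈ Metric.ball c r, ContinuousAt d z := fun z hz =>
    h.continuousOn.continuousAt (mem_of_superset (Metric.isOpen_ball.mem_nhds hz) Metric.ball_subset_closedBall)
  have h1 : ∀ z : ℂ, ∃ ℓ : ℂ ≃ₗᵢ[ℝ] ℂ, z ∈ Metric.ball c r → ∀ e ∈ X.charts, d z ∈ e.source →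
      ∀ᶠ y in 𝓝 z, e (d y) - e (d z) = ℓ (y - z) := by
    intro z
    by_cases hz : z ∈ Metric.ball c r
    · obtain ⟨e, he, hze⟩ := X.exists_chart (h.empty z hz)
      obtain ⟨ℓ, hℓ⟩ := exists_linearIsometryEquiv_of_isometric (g := e ∘ d) (h.isometric z hz e he hze)
      refine ⟨ℓ, fun _ e' he' hze' => ?_⟩
      filter_upwards [hℓ, (hcont z hz).eventually (X.translation e he e' he' _ hze hze')] with y h2 h3
      rw [h3, ← h2]; rfl
    · exact ⟨LinearIsometryEquiv.refl ℝ ℂ, fun h => absurd h hz⟩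
  choose ℓ hℓ using h1
  refine ⟨ℓ c, fun z hz => ?_⟩
  have h2 : ℓ z = ℓ c := by
    refine (convex_ball c r).isPreconnected.eq_of_eventually_eq (φ := ℓ) (fun z hz => ?_) hz
      (Metric.mem_ball_self h.pos)
    obtain ⟨e, he, hze⟩ := X.exists_chart (h.empty z hz)
    filter_upwards [nhdsWithin_le_nhds (eventually_eventually_nhds.2 (hℓ z hz e he hze)),
      nhdsWithin_le_nhds ((hcont z hz).eventually (e.open_source.mem_nhds hze)),
      self_mem_nhdsWithin] with y h3 h4 h5
    have h6 : ∀ᶠ y' in 𝓝 y, ℓ y (y' - y) = ℓ z (y' - y) := by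
      filter_upwards [hℓ y h5 e he h4, h3] with y' h7 h8
      have h9 := h3.self_of_nhds
      rw [← h7, ← sub_sub_sub_cancel_right y' y z, map_sub, ← h8, ← h9]
      ring
    ext1 u
    have h7 : Tendsto (fun t : ℝ => y + t * u) (𝓝[>] 0) (𝓝 y) :=
      (Continuous.tendsto' (by fun_prop) _ _ (by simp)).mono_left nhdsWithin_le_nhds
    obtain ⟨t, h8, ht⟩ := ((h7.eventually h6).and self_mem_nhdsWithin).exists
    have ht' : (0 : ℝ) < t := ht
    rw [add_sub_cancel_left, ← Complex.real_smul, map_smul, map_smul] at h8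
    exact smul_right_injective ℂ ht'.ne' h8
  rw [← h2]
  exact hℓ z hz

theorem IsEmptyDisk.exists_isDevelopedDisk (h : X.IsEmptyDisk d c r) :
    ∃ ℓ : ℂ ≃ₗᵢ[ℝ] ℂ, X.IsDevelopedDisk (d ∘ ℓ.symm) (ℓ c) r := by
  obtain ⟨ℓ, hℓ⟩ := h.exists_linearIsometryEquiv
  have hb : ∀ {y}, y ∈ Metric.ball (ℓ c) r → ℓ.symm y ∈ Metric.ball c r := fun {y} hy => by
    rw [Metric.mem_ball] at hy ⊢
    rwa [← ℓ.symm.dist_map, ℓ.symm_apply_apply] at hy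
  have hb' : ∀ {y}, y ∈ Metric.closedBall (ℓ c) r → ℓ.symm y ∈ Metric.closedBall c r := fun {y} hy => by
    rw [Metric.mem_closedBall] at hy ⊢
    rwa [← ℓ.symm.dist_map, ℓ.symm_apply_apply] at hy
  refine ⟨ℓ, h.pos, h.continuousOn.comp ℓ.symm.continuous.continuousOn fun y hy => hb' hy,
    fun z hz => h.empty _ (hb hz), fun z hz e he hze => ?_⟩
  filter_upwards [ℓ.symm.continuous.continuousAt.eventually (hℓ _ (hb hz) e he hze)] with y hy
  simpa only [Function.comp_apply, ← map_sub, ℓ.apply_symm_apply] using hy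

end TranslationStructure

theorem sq_dist_sub_mul_cross {a b x₀ x c : ℂ} {r : ℝ} (ha : dist a c = r) (hb : dist b c = r)
    (h₀ : dist x₀ c = r) : (dist x c ^ 2 - r ^ 2) * cross (b - x₀) (a - x₀) =
      ((b - x).re * (a - x).re + (b - x).im * (a - x).im) * cross (b - x₀) (a - x₀) -
      ((b - x₀).re * (a - x₀).re + (b - x₀).im * (a - x₀).im) * cross (b - x) (a - x) := by
  have key : ∀ y : ℂ, dist y c ^ 2 = (y.re - c.re) ^ 2 + (y.im - c.im) ^ 2 := fun y => by
    rw [Complex.dist_eq_re_im, Real.sq_sqrt (by positivity)]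
  have ha' := key a
  have hb' := key b
  have h₀' := key x₀
  rw [ha] at ha'
  rw [hb] at hb'
  rw [h₀] at h₀'
  rw [key]
  simp only [cross, Complex.sub_re, Complex.sub_im]
  linear_combination (-((b.re - x₀.re) * (x.im - x₀.im) - (b.im - x₀.im) * (x.re - x₀.re))) * ha' -
    ((x.re - x₀.re) * (a.im - x₀.im) - (x.im - x₀.im) * (a.re - x₀.re)) * hb' -
    ((b.re - x.re) * (a.im - x.im) - (b.im - x.im) * (a.re - x.re)) * h₀'

theorem mem_ball_of_mem_convexHull {s : Set ℂ} {c y : ℂ} {r : ℝ} (hr : 0 < r) (hs : s ⊆ Metric.closedBall c r)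
    (hy : y ∈ convexHull ℝ s) (hys : y ∉ s) : y ∈ Metric.ball c r := by
  have hsub := convexHull_min hs (convex_closedBall c r)
  by_contra hb
  have h1 : y ∈ Metric.sphere c r :=
    le_antisymm (Metric.mem_closedBall.1 (hsub hy)) (not_lt.1 (fun h => hb (Metric.mem_ball.2 h)))
  refine hys (extremePoints_convexHull_subset (𝕜 := ℝ) ?_)
  exact inter_extremePoints_subset_extremePoints_of_subset hsub
    ⟨hy, StrictConvexSpace.sphere_subset_extremePoints_closedBall c hr.ne' h1⟩

theorem convex_refTriangle_diff_corners : Convex ℝ (refTriangle \ range corner) := by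
  have : refTriangle \ range corner = ⋂ j, refTriangle \ {corner j} := by
    ext z
    simp only [Set.mem_sdiff, mem_range, not_exists, mem_iInter, mem_singleton_iff]
    exact ⟨fun h j => ⟨h.1, fun h' => h.2 j h'.symm⟩, fun h => ⟨(h 0).1, fun j h' => (h j).2 h'.symm⟩⟩
  rw [this]
  exact convex_iInter fun j => convex_refTriangle_diff_corner j

namespace RibbonGraph

variable {E F : Type*} {Γ : RibbonGraph E F} {v : F × Fin 3 → ℂ}

/-- The product of a side vector adjacent to the apex opposite `h` and the conjugate of the other one; its
argument is the angle at the apex. -/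
noncomputable def apexProduct (v : F × Fin 3 → ℂ) (h : F × Fin 3) : ℂ :=
  -v (shift 1 h) * (starRingEnd ℂ) (v (shift 2 h))

theorem apexProduct_im (v : F × Fin 3 → ℂ) (h : F × Fin 3) :
    (apexProduct v h).im = cross (v (shift 1 h)) (v (shift 2 h)) := by
  simp only [apexProduct, cross, Complex.mul_im, Complex.neg_re, Complex.neg_im, Complex.conj_re,
    Complex.conj_im]
  ring

theorem IsPositive.apexProduct_im_pos (hp : IsPositive v) (h : F × Fin 3) : 0 < (apexProduct v h).im := by
  rw [apexProduct_im]
  have := hp (shift 1 h)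
  rwa [shift_shift] at this

theorem IsPositive.exists_apexProduct_eq (hp : IsPositive v) (h : F × Fin 3) :
    ∃ ρ : ℝ, 0 < ρ ∧ apexProduct v h = ρ * Complex.exp (angleOf v (shift 1 h) * Complex.I) := by
  obtain ⟨r, hr, h1⟩ := neg_div_eq hp (shift 1 h)
  rw [shift_shift] at h1
  refine ⟨r * Complex.normSq (v (shift 2 h)), mul_pos hr (Complex.normSq_pos.2 (hp.ne_zero _)), ?_⟩
  rw [apexProduct, h1]
  push_cast
  rw [Complex.normSq_eq_conj_mul_self]
  ring

theorem IsPositive.apexProduct_mul_im_pos_iff (hp : IsPositive v) (h h' : F × Fin 3) :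
    0 < (apexProduct v h * apexProduct v h').im ↔
      angleOf v (shift 1 h) + angleOf v (shift 1 h') < Real.pi := by
  obtain ⟨ρ, hρ, h1⟩ := hp.exists_apexProduct_eq h
  obtain ⟨ρ', hρ', h1'⟩ := hp.exists_apexProduct_eq h'
  have h2 : apexProduct v h * apexProduct v h' = ((ρ * ρ' : ℝ) : ℂ) *
      Complex.exp (((angleOf v (shift 1 h) + angleOf v (shift 1 h') : ℝ) : ℂ) * Complex.I) := by
    rw [h1, h1']
    push_cast
    rw [add_mul, Complex.exp_add]
    ring
  rw [h2, Complex.im_ofReal_mul, Complex.exp_ofReal_mul_I_im, mul_pos_iff_of_pos_left (mul_pos hρ hρ')]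
  have h3 := (angleOf_mem hp (shift 1 h)).1
  have h4 := (angleOf_mem hp (shift 1 h')).1
  constructor
  · intro h5
    by_contra h6
    refine absurd h5 (not_lt.2 ?_)
    have := Real.sin_nonneg_of_nonneg_of_le_pi
      (x := angleOf v (shift 1 h) + angleOf v (shift 1 h') - Real.pi) (by linarith) (by linarith [h3.2, h4.2])
    rw [Real.sin_sub_pi] at this
    linarith
  · exact fun h5 => Real.sin_pos_of_pos_of_lt_pi (add_pos h3.1 h4.1) h5

theorem angleOf_mem_delaunayAngles_iff (hp : IsPositive v) (hs : ∀ f, ∑ j, v (f, j) = 0) :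
    angleOf v ∈ Γ.delaunayAngles ↔ ∀ h, 0 < (apexProduct v h * apexProduct v (Γ.partner h)).im := by
  constructor
  · intro h h'
    rw [hp.apexProduct_mul_im_pos_iff]
    exact h.2 _ _ (Γ.partner_ne h').symm (Γ.edge_partner h').symm
  · refine fun h => ⟨angleOf_mem_angleSpace hp hs, fun h₁ h₂ hne he => ?_⟩
    rw [Γ.eq_partner hne he, ← hp.apexProduct_mul_im_pos_iff]
    exact h h₁

end RibbonGraph

namespace Triangulation

open TranslationStructure

variable {S : Type*} [TopologicalSpace S] [ChartedSpace ℂ S] {Z : Set S} {E F : Type*}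
  {κ : Z → ℕ} {τ : Triangulation S Z E F} {X : TranslationStructure S Z κ}

theorem injOn_cell (hne : ∀ h, (τ.partner h).1 ≠ h.1) (f : F) :
    InjOn (τ.cell f) (refTriangle \ range corner) := by
  rintro z ⟨hz, hzc⟩ z' ⟨hz', -⟩ h
  rcases refTriangle_cases hz with hi | ⟨j, s, hs, rfl⟩ | ⟨j, rfl⟩
  · exact (τ.face_inj f f _ hi _ hz' h).2
  · rcases τ.fiber_side (h := (f, j)) hs hz' h with h1 | h1
    · exact h1.2.symm
    · exact absurd h1.1.symm (hne (f, j))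
  · exact absurd (mem_range_self j) hzc

theorem cell_notMem {f : F} {z : ℂ} (hz : z ∈ refTriangle \ range corner) : τ.cell f z ∉ Z := fun h => by
  obtain ⟨j, rfl⟩ := (τ.cell_mem_iff hz.1).1 h
  exact hz.2 (mem_range_self j)

section Disk

variable [T2Space S] {f : F} {w : Fin 3 → ℂ} {D : ℂ → ℂ} {d : ℂ → S} {c t₀ : ℂ} {r : ℝ}

theorem IsEuclideanFace.eq_cell_of_isPreconnected (hf : τ.IsEuclideanFace X f w D)
    (hd : X.IsDevelopedDisk d c r) {W : Set ℂ} (hW : IsPreconnected W) (hWT : W ⊆ refTriangle)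
    (hWb : ∀ z ∈ W, D z + t₀ ∈ Metric.ball c r) {z₀ : ℂ} (hz₀ : z₀ ∈ W)
    (h₀ : d (D z₀ + t₀) = τ.cell f z₀) {z : ℂ} (hz : z ∈ W) : d (D z + t₀) = τ.cell f z := by
  have hD : ∀ z ∈ W, Tendsto (fun z => D z + t₀) (𝓝[W] z) (𝓝 (D z + t₀)) := fun z hz =>
    ((hf.continuousOn z (hWT hz)).mono hWT).tendsto.add_const t₀
  have hdD : ∀ z ∈ W, Tendsto (fun z => d (D z + t₀)) (𝓝[W] z) (𝓝 (d (D z + t₀))) := fun z hz =>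
    (hd.continuousAt (hWb z hz)).tendsto.comp (hD z hz)
  have hc : ∀ z ∈ W, Tendsto (τ.cell f) (𝓝[W] z) (𝓝 (τ.cell f z)) := fun z hz =>
    (τ.tendsto_cell (hWT hz)).mono_left (nhdsWithin_mono z hWT)
  have key := hW.eq_of_eventually_eq (φ := fun z => d (D z + t₀) = τ.cell f z) (fun z hz => ?_) hz₀ hz
  · exact key ▸ h₀
  · by_cases h : d (D z + t₀) = τ.cell f z
    · obtain ⟨e, he, hze⟩ := X.exists_chart (hd.empty _ (hWb z hz))
      have hze' : τ.cell f z ∈ e.source := h ▸ hze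
      filter_upwards [(hD z hz).eventually (hd.developed _ (hWb z hz) e he hze),
        nhdsWithin_mono z hWT (hf.primitive z (hWT hz) e he hze'),
        (hdD z hz).eventually (e.open_source.mem_nhds hze),
        (hc z hz).eventually (e.open_source.mem_nhds hze')] with z' h1 h2 h3 h4
      refine propext ⟨fun _ => h, fun _ => e.injOn h3 h4 ?_⟩
      rw [h] at h1
      linear_combination h1 + h2
    · filter_upwards [((hdD z hz).prodMk_nhds (hc z hz)).eventually
        (isClosed_diagonal.isOpen_compl.mem_nhds (x := (d (D z + t₀), τ.cell f z)) h)] with z' h1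
      exact propext ⟨fun h' => absurd h' h1, fun h' => absurd h' h⟩

theorem IsEuclideanFace.eq_cell_of_notMem_corners (hf : τ.IsEuclideanFace X f w D)
    (hd : ContinuousOn d (Metric.closedBall c r))
    (h : ∀ z ∈ refTriangle \ range corner, D z + t₀ ∈ Metric.closedBall c r ∧ d (D z + t₀) = τ.cell f z)
    {z : ℂ} (hz : z ∈ refTriangle) : D z + t₀ ∈ Metric.closedBall c r ∧ d (D z + t₀) = τ.cell f z := by
  have hne : (𝓝[interior refTriangle] z).NeBot := mem_closure_iff_nhdsWithin_neBot.1 (mem_closure_interior hz)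
  have h1 : ∀ᶠ z' in 𝓝[interior refTriangle] z, z' ∈ refTriangle \ range corner := by
    filter_upwards [self_mem_nhdsWithin] with z' hz'
    exact ⟨interior_subset hz', fun ⟨j, hj⟩ => corner_notMem_interior j (hj ▸ hz')⟩
  have hD : Tendsto (fun z => D z + t₀) (𝓝[interior refTriangle] z) (𝓝 (D z + t₀)) :=
    ((hf.continuousOn z hz).mono interior_subset).tendsto.add_const t₀
  have hmem : D z + t₀ ∈ Metric.closedBall c r :=
    Metric.isClosed_closedBall.mem_of_tendsto hD (h1.mono fun z' hz' => (h z' hz').1)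
  refine ⟨hmem, tendsto_nhds_unique ((hd _ hmem).tendsto.comp (tendsto_nhdsWithin_iff.2
    ⟨hD, h1.mono fun z' hz' => (h z' hz').1⟩)) ?_⟩
  refine ((τ.tendsto_cell (f := f) hz).mono_left (nhdsWithin_mono z interior_subset)).congr' ?_
  filter_upwards [h1] with z' hz'
  exact (h z' hz').2.symm

/-- If the face is inscribed in a developed disk, then the disk is its circumscribed disk. -/
theorem IsEuclideanFace.exists_translation (hf : τ.IsEuclideanFace X f w D)
    (hne : ∀ h, (τ.partner h).1 ≠ h.1) (hd : X.IsDevelopedDisk d c r) {p : Fin 3 → ℂ}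
    (hp : {z ∈ Metric.closedBall c r | d z ∈ Z} = range p)
    (hT : d '' convexHull ℝ (range p) = τ.cell f '' refTriangle) :
    ∃ t₀, ∀ z ∈ refTriangle, D z + t₀ ∈ Metric.closedBall c r ∧ d (D z + t₀) = τ.cell f z := by
  have hpb : range p ⊆ Metric.closedBall c r := fun y hy => (hp.symm ▸ hy : y ∈ {z ∈ _ | _}).1
  have hpZ : ∀ {y}, y ∈ range p → d y ∈ Z := fun {y} hy => (hp.symm ▸ hy : y ∈ {z ∈ _ | _}).2
  set W := convexHull ℝ (range p) ∩ Metric.ball c r with hW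
  have hWc : IsPreconnected W := ((convex_convexHull ℝ _).inter (convex_ball c r)).isPreconnected
  have hlift : ∀ y, ∃ z, y ∈ convexHull ℝ (range p) → z ∈ refTriangle ∧ τ.cell f z = d y := fun y => by
    by_cases hy : y ∈ convexHull ℝ (range p)
    · obtain ⟨z, hz⟩ : d y ∈ τ.cell f '' refTriangle := hT ▸ mem_image_of_mem d hy
      exact ⟨z, fun _ => hz⟩
    · exact ⟨0, fun h => absurd h hy⟩
  choose z hz using hlift
  have hcor : ∀ z' ∈ refTriangle, τ.cell f z' ∉ Z → z' ∈ refTriangle \ range corner := fun z' hz' h =>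
    ⟨hz', by rintro ⟨j, rfl⟩; exact h (τ.vertex_mem f j)⟩
  have hconst : ∀ {y y'}, y ∈ W → y' ∈ W → D (z y) - y = D (z y') - y' := by
    intro y y' hy hy'
    refine hWc.eq_of_eventually_eq (φ := fun y => D (z y) - y) (fun y hy => ?_) hy hy'
    obtain ⟨e, he, hye⟩ := X.exists_chart (hd.empty y hy.2)
    obtain ⟨h1, h2⟩ := hz y hy.1
    have h3 : ∀ᶠ q in 𝓝 (d y), ∀ f', ∀ z' ∈ refTriangle, τ.cell f' z' = q →
        (f' = f → D z' - D (z y) = e (τ.cell f z') - e (τ.cell f (z y))) := by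
      refine τ.eventually_fiber fun f' z' hz' hzy => ?_
      by_cases hff : f' = f
      · subst hff
        have h4 : z' = z y := injOn_cell hne f' (hcor z' hz' (hzy ▸ hd.empty y hy.2))
          (hcor _ h1 (h2 ▸ hd.empty y hy.2)) (hzy.trans h2.symm)
        rw [h4]
        filter_upwards [hf.primitive (z y) h1 e he (h2 ▸ hye)] with z'' h5 _
        exact h5
      · exact Eventually.of_forall fun _ h => absurd h hff
    filter_upwards [nhdsWithin_le_nhds ((hd.continuousAt hy.2).eventually h3),
      nhdsWithin_le_nhds (hd.developed y hy.2 e he hye), self_mem_nhdsWithin] with y' h4 h5 h6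
    obtain ⟨h7, h8⟩ := hz y' h6.1
    have h9 := h4 f _ h7 h8 rfl
    rw [h8, h2, h5] at h9
    linear_combination h9
  have hreach : ∀ z' ∈ refTriangle \ range corner, ∃ y ∈ W, z y = z' ∧ d y = τ.cell f z' := by
    intro z' hz'
    obtain ⟨y, hy, hyz⟩ : τ.cell f z' ∈ d '' convexHull ℝ (range p) := hT ▸ mem_image_of_mem _ hz'.1
    have hyZ : d y ∉ Z := hyz ▸ cell_notMem hz'
    have hyW : y ∈ W := ⟨hy, mem_ball_of_mem_convexHull hd.pos hpb hy fun h => hyZ (hpZ h)⟩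
    obtain ⟨h1, h2⟩ := hz y hy
    exact ⟨y, hyW, injOn_cell hne f (hcor _ h1 (h2 ▸ hyZ)) hz' (h2.trans hyz), hyz⟩
  have hb : barycenter ∈ refTriangle \ range corner :=
    ⟨interior_subset barycenter_mem_interior, fun ⟨j, hj⟩ =>
      corner_notMem_interior j (hj ▸ barycenter_mem_interior)⟩
  obtain ⟨y₀, hy₀, -⟩ := hreach _ hb
  refine ⟨y₀ - D (z y₀), fun z' hz' => hf.eq_cell_of_notMem_corners hd.continuousOn (fun z' hz' => ?_) hz'⟩
  obtain ⟨y, hy, rfl, h2⟩ := hreach z' hz'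
  have h3 : D (z y) + (y₀ - D (z y₀)) = y := by linear_combination hconst hy hy₀
  rw [h3]
  exact ⟨Metric.ball_subset_closedBall hy.2, h2⟩

theorem IsEuclideanFace.side_partner {w : F → Fin 3 → ℂ} {D : F → ℂ → ℂ}
    (hw : ∀ f, τ.IsEuclideanFace X f (w f) (D f)) (h : F × Fin 3) {s : ℝ} (hs : s ∈ Icc (0 : ℝ) 1) :
    D h.1 (side h.2 s) - D h.1 (side h.2 1) = D (τ.partner h).1 (side (τ.partner h).2 (1 - s)) -
      D (τ.partner h).1 (side (τ.partner h).2 0) := by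
  set h' := τ.partner h with hh'
  have hs' : 1 - s ∈ Icc (0 : ℝ) 1 := ⟨by linarith [hs.2], by linarith [hs.1]⟩
  have h1 := ((hw h.1).hasIntegral_edge h.2).comp unitInterval.continuous_symm
  have h2 := (hw h'.1).hasIntegral_edge h'.2
  have e : (τ.edgePath (h'.1, h'.2) : unitInterval → S) = τ.edgePath (h.1, h.2) ∘ unitInterval.symm :=
    edgePath_partner h
  rw [← e] at h1
  have h3 := (X.isPrimitiveSystem τ.finite_vertices).integral_unique (τ.edgePath h').continuous h1 h2
    ⟨1 - s, hs'⟩ 0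
  simpa only [Function.comp_apply, unitInterval.coe_symm_eq, Set.Icc.coe_zero, sub_sub_cancel,
    sub_zero] using h3

end Disk

theorem IsNondegenerateDelaunay.angleOf_mem [T2Space S] [OrientedSurface S]
    (hX : τ.IsNondegenerateDelaunay X) (hne : ∀ h, (τ.partner h).1 ≠ h.1) :
    RibbonGraph.angleOf (τ.sideVector X) ∈ τ.delaunayAngles := by
  obtain ⟨hg, hdel⟩ := hX
  have hpos := hg.isPositive
  have hmem := hg.sideVector_mem
  rw [RibbonGraph.angleOf_mem_delaunayAngles_iff hpos hmem.1]
  have hg' : ∀ f, ∃ w D, τ.IsEuclideanFace X f w D := hg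
  choose w D hw using hg'
  by_contra! hcon
  obtain ⟨⟨f, j⟩, hle⟩ := hcon
  obtain ⟨d₀, c₀, r, p₀, hd₀, -, hp₀, hT₀⟩ := hdel f
  obtain ⟨ℓ, hd⟩ := hd₀.exists_isDevelopedDisk
  set d := d₀ ∘ ℓ.symm with hdd
  set c := ℓ c₀ with hc
  have hp : {z ∈ Metric.closedBall c r | d z ∈ Z} = range (ℓ ∘ p₀) := by
    ext y
    have h1 : dist y c = dist (ℓ.symm y) c₀ := by rw [hc, ← ℓ.symm.dist_map, ℓ.symm_apply_apply]
    have h2 : ℓ.symm y ∈ {z ∈ Metric.closedBall c₀ r | d₀ z ∈ Z} ↔ ℓ.symm y ∈ range p₀ := by rw [hp₀]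
    refine Iff.trans ?_ (h2.trans ?_)
    · exact and_congr (by rw [Metric.mem_closedBall, Metric.mem_closedBall, h1]) Iff.rfl
    · exact exists_congr fun k => ℓ.toEquiv.eq_symm_apply
  have hT : d '' convexHull ℝ (range (ℓ ∘ p₀)) = τ.cell f '' refTriangle := by
    rw [← hT₀, hdd, image_comp, range_comp]
    congr 1
    have := (ℓ.toLinearEquiv : ℂ →ₗ[ℝ] ℂ).image_convexHull (range p₀)
    have h2 : ℓ '' convexHull ℝ (range p₀) = convexHull ℝ (ℓ '' range p₀) := this
    rw [← h2, ← image_comp]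
    simp
  clear_value d c
  obtain ⟨t₀, ht₀⟩ := (hw f).exists_translation hne hd hp hT
  set v := τ.sideVector X with hv
  have hj1 : j + 1 + 1 = j + 2 := by fin_cases j <;> rfl
  have hj2 : j + 2 + 1 = j := by fin_cases j <;> rfl
  have hZc : ∀ k, w f k + t₀ ∈ {z ∈ Metric.closedBall c r | d z ∈ Z} := fun k => by
    have := ht₀ _ (corner_mem k)
    rw [(hw f).corners] at this
    exact ⟨this.1, by rw [this.2]; exact τ.vertex_mem f k⟩
  have hsph : ∀ k, dist (w f k + t₀) c = r := fun k => by
    refine le_antisymm (hZc k).1 (not_lt.1 fun h => hd.empty _ h (hZc k).2)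
  have hrange : ∀ y ∈ Metric.closedBall c r, d y ∈ Z → ∃ k, y = w f k + t₀ := by
    have h1 : ∀ k, ∃ i, (ℓ ∘ p₀) i = w f k + t₀ := fun k => (hp ▸ hZc k : _ ∈ range (ℓ ∘ p₀))
    choose σ hσ using h1
    have hinj : Function.Injective σ := fun k k' h => by
      have := (hσ k).symm.trans ((congrArg _ h).trans (hσ k'))
      exact (hw f).nondegenerate.injective (add_right_cancel this)
    intro y hy hyZ
    obtain ⟨i, rfl⟩ : y ∈ range (ℓ ∘ p₀) := hp ▸ (⟨hy, hyZ⟩ : y ∈ {z ∈ Metric.closedBall c r | d z ∈ Z})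
    obtain ⟨k, rfl⟩ := Finite.surjective_of_injective hinj i
    exact ⟨k, hσ k⟩
  obtain ⟨⟨f', j'⟩, hff⟩ : ∃ x, τ.partner (f, j) = x := ⟨_, rfl⟩
  rw [hff] at hle
  have hj1' : j' + 1 + 1 = j' + 2 := by fin_cases j' <;> rfl
  have hj2' : j' + 2 + 1 = j' := by fin_cases j' <;> rfl
  have hsp := fun (s : ℝ) hs => IsEuclideanFace.side_partner hw (f, j) (s := s) hs
  simp only [hff, side_one, side_zero, (hw f).corners, (hw f').corners] at hsp
  have hsp0 := hsp 0 (left_mem_Icc.2 zero_le_one)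
  rw [side_zero, sub_zero, side_one, (hw f).corners, (hw f').corners] at hsp0
  set t₁ := w f (j + 1) + t₀ - w f' j' with ht₁
  have hb : w f' j' + t₁ = w f (j + 1) + t₀ := by rw [ht₁]; ring
  have ha : w f' (j' + 1) + t₁ = w f j + t₀ := by rw [ht₁]; linear_combination -hsp0
  set x := w f' (j' + 2) + t₁ with hx
  have hv0 : v (f, j) = w f (j + 1) - w f j := (hw f).sideVector_eq j
  have hv1 : v (f, j + 1) = w f (j + 2) - w f (j + 1) := by rw [← hj1]; exact (hw f).sideVector_eq (j + 1)
  have hv2 : v (f, j + 2) = w f j - w f (j + 2) := by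
    have := (hw f).sideVector_eq (j + 2); rwa [hj2] at this
  have hv0' : v (f', j') = w f' (j' + 1) - w f' j' := (hw f').sideVector_eq j'
  have hv1' : v (f', j' + 1) = w f' (j' + 2) - w f' (j' + 1) := by
    rw [← hj1']; exact (hw f').sideVector_eq (j' + 1)
  have hv2' : v (f', j' + 2) = w f' j' - w f' (j' + 2) := by
    have := (hw f').sideVector_eq (j' + 2); rwa [hj2'] at this
  have hxr : dist x c ≤ r := by
    have h1 := sq_dist_sub_mul_cross (x := x) (hsph j) (hsph (j + 1)) (hsph (j + 2))
    have e1 : w f (j + 1) + t₀ - (w f (j + 2) + t₀) = -v (f, j + 1) := by rw [hv1]; ring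
    have e2 : w f j + t₀ - (w f (j + 2) + t₀) = v (f, j + 2) := by rw [hv2]; ring
    have e3 : w f (j + 1) + t₀ - x = v (f', j' + 2) := by rw [hv2', ← hb, hx]; ring
    have e4 : w f j + t₀ - x = -v (f', j' + 1) := by rw [hv1', ← ha, hx]; ring
    rw [e1, e2, e3, e4] at h1
    have h2 := hpos.apexProduct_im_pos (f, j)
    have h3 : (dist x c ^ 2 - r ^ 2) * (RibbonGraph.apexProduct v (f, j)).im =
        (RibbonGraph.apexProduct v (f, j) * RibbonGraph.apexProduct v (f', j')).im := by
      simp only [RibbonGraph.apexProduct, RibbonGraph.shift, cross, Complex.mul_im, Complex.mul_re,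
        Complex.neg_re, Complex.neg_im, Complex.conj_re, Complex.conj_im] at h1 ⊢
      linear_combination -h1
    have h4 : dist x c ^ 2 - r ^ 2 ≤ 0 := by
      by_contra! h5
      exact absurd (h3 ▸ mul_pos h5 h2) (not_lt.2 hle)
    exact abs_le_of_sq_le_sq' (by linarith) hd.pos.le |>.2
  have hrw : range (w f') ⊆ Metric.closedBall (c - t₁) r := by
    have aux : ∀ y, dist (y + t₁) c ≤ r → y ∈ Metric.closedBall (c - t₁) r := fun y hy => by
      rw [Metric.mem_closedBall, dist_eq_norm]
      rw [dist_eq_norm] at hy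
      convert hy using 2; ring
    rintro _ ⟨k, rfl⟩
    have hk : k = j' ∨ k = j' + 1 ∨ k = j' + 2 := by fin_cases k <;> fin_cases j' <;> simp
    rcases hk with rfl | rfl | rfl
    · exact aux _ (by rw [hb]; exact (hsph _).le)
    · exact aux _ (by rw [ha]; exact (hsph _).le)
    · exact aux _ hxr
  have hball : ∀ z ∈ refTriangle \ range corner, D f' z + t₁ ∈ Metric.ball c r := by
    intro z hz
    have h1 : D f' z ∈ Metric.ball (c - t₁) r := by
      refine mem_ball_of_mem_convexHull hd.pos hrw ((hw f').bijOn.mapsTo hz.1) ?_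
      rintro ⟨k, hk⟩
      rw [← (hw f').corners] at hk
      exact hz.2 ⟨k, (hw f').bijOn.injOn (corner_mem k) hz.1 hk⟩
    rw [Metric.mem_ball, dist_eq_norm] at h1 ⊢
    convert h1 using 2; ring
  have hhalf : (1 / 2 : ℝ) ∈ Ioo (0 : ℝ) 1 := by norm_num
  have hmid : side j' (1 / 2) ∈ refTriangle \ range corner :=
    ⟨side_mem _ (Ioo_subset_Icc_self hhalf), fun ⟨k, hk⟩ => side_ne_corner j' k hhalf hk.symm⟩
  have hmid' : d (D f' (side j' (1 / 2)) + t₁) = τ.cell f' (side j' (1 / 2)) := by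
    have h1 := hsp (1 / 2) (Ioo_subset_Icc_self hhalf)
    have h2 := τ.cell_side_partner (f, j) (Ioo_subset_Icc_self hhalf)
    have e : (1 - 1 / 2 : ℝ) = 1 / 2 := by norm_num
    rw [hff] at h2
    simp only [e] at h1 h2
    have h3 : D f' (side j' (1 / 2)) + t₁ = D f (side j (1 / 2)) + t₀ := by
      rw [ht₁]; linear_combination -h1
    rw [h3, (ht₀ _ (side_mem _ (Ioo_subset_Icc_self hhalf))).2, h2]
  have hcell := (hw f').eq_cell_of_notMem_corners (t₀ := t₁) hd.continuousOn (fun z hz =>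
    ⟨Metric.ball_subset_closedBall (hball z hz), (hw f').eq_cell_of_isPreconnected hd
      convex_refTriangle_diff_corners.isPreconnected sdiff_subset hball hmid hmid' hz⟩)
      (corner_mem (j' + 2))
  rw [(hw f').corners] at hcell
  obtain ⟨k, hk⟩ := hrange x hcell.1 (by rw [hcell.2]; exact τ.vertex_mem _ _)
  have h1 : cross (v (f, j)) (x - (w f j + t₀)) < 0 := by
    have e1 : x - (w f j + t₀) = v (f', j' + 1) := by rw [hv1', ← ha, hx]; ring
    have e2 : v (f, j) = -v (f', j') := by
      have := hmem.2 (f, j)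
      rw [hff] at this
      rw [this, neg_neg]
    have h2 := hpos (f', j')
    rw [e1, e2]
    simp only [RibbonGraph.shift] at h2
    simp only [cross, Complex.neg_re, Complex.neg_im] at h2 ⊢
    linarith
  have h2 : 0 ≤ cross (v (f, j)) (w f k - w f j) := by
    have hk' : k = j ∨ k = j + 1 ∨ k = j + 2 := by fin_cases k <;> fin_cases j <;> simp
    rcases hk' with rfl | rfl | rfl
    · simp [cross]
    · rw [← hv0]; simp [cross, mul_comm]
    · have h3 := hpos (f, j)
      have e1 : w f (j + 2) - w f j = v (f, j) + v (f, j + 1) := by rw [hv0, hv1]; ring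
      rw [e1]
      simp only [RibbonGraph.shift] at h3
      simp only [cross, Complex.add_re, Complex.add_im] at h3 ⊢
      linarith
  rw [hk, add_sub_add_right_eq_sub] at h1
  linarith

end Triangulation

/-! ### Developing paths -/

theorem IsLocalHomeomorph.exists_extension {A B : Type*} [TopologicalSpace A] [TopologicalSpace B]
    {p : A → B} (hp : IsLocalHomeomorph p) {f : ℝ → B} (hf : Continuous f) {T : ℝ} (hT : 0 ≤ T)
    {c : ℝ → A} (hc : ContinuousOn c (Icc 0 T)) (hcf : ∀ t ∈ Icc 0 T, p (c t) = f t) :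
    ∃ ε > 0, ∃ c' : ℝ → A, ContinuousOn c' (Icc 0 (T + ε)) ∧ c' 0 = c 0 ∧
      ∀ t ∈ Icc 0 (T + ε), p (c' t) = f t := by
  obtain ⟨φ, hφ, rfl⟩ := hp (c T)
  have hTT : T ∈ Icc 0 T := right_mem_Icc.2 hT
  have h1 : f T ∈ φ.target := by rw [← hcf T hTT]; exact φ.map_source hφ
  obtain ⟨ε, hε, h2⟩ := Metric.eventually_nhds_iff.1
    (hf.continuousAt.eventually (φ.open_target.mem_nhds h1))
  have h3 : ∀ t ∈ Icc T (T + ε / 2), f t ∈ φ.target := fun t ht => h2 (by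
    rw [Real.dist_eq, abs_of_nonneg (by linarith [ht.1])]; linarith [ht.2])
  let c' : ℝ → A := fun t => if t ≤ T then c t else φ.symm (f t)
  have e1 : EqOn c' c (Icc 0 T) := fun t ht => if_pos ht.2
  have e2 : EqOn c' (fun t => φ.symm (f t)) (Icc T (T + ε / 2)) := fun t ht => by
    rcases ht.1.eq_or_lt with rfl | hlt
    · simp only [c', le_refl, if_true]
      rw [← hcf T hTT, φ.left_inv hφ]
    · simp only [c', not_le.2 hlt, if_false]
  have hu : Icc 0 (T + ε / 2) = Icc 0 T ∪ Icc T (T + ε / 2) :=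
    (Icc_union_Icc_eq_Icc hT (by linarith)).symm
  refine ⟨ε / 2, by positivity, c', ?_, e1 (left_mem_Icc.2 hT), fun t ht => ?_⟩
  · rw [hu]
    refine ContinuousOn.union_of_isClosed (hc.congr e1) (ContinuousOn.congr ?_ e2) isClosed_Icc isClosed_Icc
    exact φ.continuousOn_symm.comp hf.continuousOn h3
  · rw [hu] at ht
    rcases ht with ht | ht
    · rw [e1 ht, hcf t ht]
    · rw [e2 ht, φ.right_inv (h3 t ht)]

/-- Paths lift along a separated local homeomorphism as soon as partial lifts have limits. -/
theorem IsLocalHomeomorph.exists_path_lift {A B : Type*} [TopologicalSpace A] [TopologicalSpace B]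
    [T2Space B] {p : A → B} (hp : IsLocalHomeomorph p) (hs : IsSeparatedMap p) {f : ℝ → B}
    (hf : Continuous f) {a : A} (ha : p a = f 0)
    (hlim : ∀ T ∈ Ioc (0 : ℝ) 1, ∀ c : ℝ → A, ContinuousOn c (Ico 0 T) → c 0 = a →
      (∀ t ∈ Ico 0 T, p (c t) = f t) → ∃ e, Tendsto c (𝓝[<] T) (𝓝 e)) :
    ∃ c : ℝ → A, ContinuousOn c (Icc 0 1) ∧ c 0 = a ∧ ∀ t ∈ Icc (0 : ℝ) 1, p (c t) = f t := by
  let I : Set ℝ := {T | T ∈ Icc (0 : ℝ) 1 ∧ ∃ c : ℝ → A, ContinuousOn c (Icc 0 T) ∧ c 0 = a ∧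
    ∀ t ∈ Icc (0 : ℝ) T, p (c t) = f t}
  have h0 : (0 : ℝ) ∈ I := ⟨by simp, fun _ => a, continuousOn_const, rfl, fun t ht => by
    rw [ha, le_antisymm ht.2 ht.1]⟩
  have hbdd : BddAbove I := ⟨1, fun T hT => hT.1.2⟩
  have hex : ∀ T, ∃ c : ℝ → A, T ∈ I → ContinuousOn c (Icc 0 T) ∧ c 0 = a ∧
      ∀ t ∈ Icc (0 : ℝ) T, p (c t) = f t := fun T => by
    by_cases hT : T ∈ I
    · exact ⟨hT.2.choose, fun _ => hT.2.choose_spec⟩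
    · exact ⟨fun _ => a, fun h => absurd h hT⟩
  choose c hc using hex
  have hdown : ∀ T ∈ I, ∀ t ∈ Icc 0 T, t ∈ I := fun T hT t ht =>
    ⟨⟨ht.1, ht.2.trans hT.1.2⟩, c T, (hc T hT).1.mono (Icc_subset_Icc_right ht.2), (hc T hT).2.1,
      fun s hs => (hc T hT).2.2 s ⟨hs.1, hs.2.trans ht.2⟩⟩
  have hcoh : ∀ T ∈ I, ∀ t ∈ Icc 0 T, c t t = c T t := fun T hT t ht => by
    have htI := hdown T hT t ht
    refine hs.eqOn_of_comp_eqOn hp.isLocallyInjective isPreconnected_Icc (hc t htI).1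
      ((hc T hT).1.mono (Icc_subset_Icc_right ht.2)) (fun s hs => ?_) (left_mem_Icc.2 ht.1)
      ((hc t htI).2.1.trans (hc T hT).2.1.symm) (right_mem_Icc.2 ht.1)
    exact ((hc t htI).2.2 s hs).trans ((hc T hT).2.2 s ⟨hs.1, hs.2.trans ht.2⟩).symm
  set T := sSup I with hTdef
  have hT0 : 0 ≤ T := le_csSup hbdd h0
  have hT1 : T ≤ 1 := csSup_le ⟨0, h0⟩ fun T hT => hT.1.2
  have hTI : T ∈ I := by
    rcases hT0.eq_or_lt with h | hpos
    · rw [← h]; exact h0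
    have hcd : ContinuousOn (fun t => c t t) (Ico 0 T) := fun t ht => by
      obtain ⟨T', hT', hlt⟩ := exists_lt_of_lt_csSup ⟨0, h0⟩ ht.2
      have h1 : ContinuousWithinAt (fun t => c t t) (Icc 0 T') t :=
        ((hc T' hT').1.congr fun s hs => hcoh T' hT' s hs) t ⟨ht.1, hlt.le⟩
      refine h1.mono_of_mem_nhdsWithin ?_
      filter_upwards [self_mem_nhdsWithin, nhdsWithin_le_nhds (Iio_mem_nhds hlt)] with s hs hs'
      exact ⟨hs.1, (le_of_lt hs' : s ≤ T')⟩
    have hI : ∀ t ∈ Ico 0 T, t ∈ I := fun t ht => by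
      obtain ⟨T', hT', hlt⟩ := exists_lt_of_lt_csSup ⟨0, h0⟩ ht.2
      exact hdown T' hT' t ⟨ht.1, hlt.le⟩
    have hcf : ∀ t ∈ Ico 0 T, p (c t t) = f t := fun t ht =>
      (hc t (hI t ht)).2.2 t (right_mem_Icc.2 ht.1)
    obtain ⟨e, he⟩ := hlim T ⟨hpos, hT1⟩ (fun t => c t t) hcd (hc 0 h0).2.1 hcf
    have hpe : p e = f T := by
      refine tendsto_nhds_unique (hp.continuous.continuousAt.tendsto.comp he)
        ((hf.continuousAt.tendsto.mono_left nhdsWithin_le_nhds).congr' ?_)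
      filter_upwards [Ico_mem_nhdsLT hpos] with t ht
      exact (hcf t ht).symm
    refine ⟨⟨hT0, hT1⟩, Function.update (fun t => c t t) T e, ?_, ?_, fun t ht => ?_⟩
    · rw [continuousOn_update_iff, Icc_sdiff_right]
      exact ⟨hcd, fun _ => by rwa [nhdsWithin_Ico_eq_nhdsLT hpos]⟩
    · rw [Function.update_of_ne hpos.ne]; exact (hc 0 h0).2.1
    · rcases ht.2.eq_or_lt with h | hlt
      · rw [h, Function.update_self, hpe]
      · rw [Function.update_of_ne hlt.ne]; exact hcf t ⟨ht.1, hlt⟩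
  have hT1' : T = 1 := by
    by_contra hne
    obtain ⟨h1, h2, h3⟩ := hc T hTI
    obtain ⟨ε, hε, c', h4, h5, h6⟩ := hp.exists_extension hf hT0 h1 h3
    have hm : T < min (T + ε) 1 := lt_min (by linarith) (lt_of_le_of_ne hT1 hne)
    have : min (T + ε) 1 ∈ I := ⟨⟨hT0.trans hm.le, min_le_right _ _⟩, c',
      h4.mono (Icc_subset_Icc_right (min_le_left _ _)), h5.trans h2,
      fun t ht => h6 t ⟨ht.1, ht.2.trans (min_le_left _ _)⟩⟩
    exact absurd (le_csSup hbdd this) (not_le.2 hm)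
  rw [← hT1']
  exact ⟨c T, hc T hTI⟩

namespace Triangulation

variable {S : Type*} [TopologicalSpace S] [ChartedSpace ℂ S] {Z : Set S} {E F : Type*}

/-- A point of the surface with a position in the plane; the points form the space of germs of developing maps
of the flat structure with side vectors `v`. -/
structure DevelopedPoint (τ : Triangulation S Z E F) (v : F × Fin 3 → ℂ) where
  pos : ℂ
  pt : S
  notMem : pt ∉ Z

namespace DevelopedPoint

variable {τ : Triangulation S Z E F} {v : F × Fin 3 → ℂ}

/-- The topology for which the positions are primitives of the flat structure. -/
instance : TopologicalSpace (τ.DevelopedPoint v) where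
  IsOpen U := ∀ x ∈ U, ∀ P, τ.IsFlatAt v P x.pt →
    ∀ᶠ q in 𝓝 x.pt, ∀ hq : q ∉ Z, (⟨x.pos + (P q - P x.pt), q, hq⟩ : τ.DevelopedPoint v) ∈ U
  isOpen_univ := fun _ _ _ _ => Eventually.of_forall fun _ _ => trivial
  isOpen_inter U U' h h' := fun x hx P hP => by
    filter_upwards [h x hx.1 P hP, h' x hx.2 P hP] with q h1 h2 hq
    exact ⟨h1 hq, h2 hq⟩
  isOpen_sUnion A h := by
    rintro x ⟨U, hU, hx⟩ P hP
    filter_upwards [h U hU x hx P hP] with q h1 hq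
    exact ⟨U, hU, h1 hq⟩

theorem mem_nhds_iff [T2Space S] (hv : v ∈ τ.cycleSpace) {x : τ.DevelopedPoint v} {P : S → ℂ}
    (hP : τ.IsFlatAt v P x.pt) {A : Set (τ.DevelopedPoint v)} : A ∈ 𝓝 x ↔
      ∀ᶠ q in 𝓝 x.pt, ∀ hq : q ∉ Z, (⟨x.pos + (P q - P x.pt), q, hq⟩ : τ.DevelopedPoint v) ∈ A := by
  constructor
  · intro h
    obtain ⟨U, hUA, hU, hx⟩ := _root_.mem_nhds_iff.1 h
    filter_upwards [hU x hx P hP] with q h1 hq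
    exact hUA (h1 hq)
  · intro h
    refine _root_.mem_nhds_iff.2 ⟨{y | ∀ P, τ.IsFlatAt v P y.pt → ∀ᶠ q in 𝓝 y.pt, ∀ hq : q ∉ Z,
      (⟨y.pos + (P q - P y.pt), q, hq⟩ : τ.DevelopedPoint v) ∈ A}, fun y hy => ?_, fun y hy P hP => ?_,
      fun P' hP' => ?_⟩
    · obtain ⟨P, -, hP⟩ := τ.exists_isFlatAt hv y.pt
      have h1 := (hy P hP).self_of_nhds y.notMem
      rwa [sub_self, add_zero] at h1
    · filter_upwards [eventually_eventually_nhds.2 (hy P hP), hP.eventually] with q h1 h2 hq P' hP'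
      filter_upwards [h1, h2.sub_eq hP'] with q' h3 h4 hq'
      have h5 := h3 hq'
      simp only [h4]
      convert h5 using 2
      ring
    · filter_upwards [h, hP.sub_eq hP'] with q h1 h2 hq
      rw [h2]
      exact h1 hq

theorem tendsto_iff [T2Space S] (hv : v ∈ τ.cycleSpace) {x : τ.DevelopedPoint v} {P : S → ℂ}
    (hP : τ.IsFlatAt v P x.pt) {B : Type*} {l : Filter B} {c : B → τ.DevelopedPoint v} :
    Tendsto c l (𝓝 x) ↔ Tendsto (fun t => (c t).pt) l (𝓝 x.pt) ∧
      ∀ᶠ t in l, (c t).pos = x.pos + (P (c t).pt - P x.pt) := by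
  constructor
  · intro h
    refine ⟨fun U hU => ?_, ?_⟩
    · refine h (show pt ⁻¹' U ∈ 𝓝 x from (mem_nhds_iff hv hP).2 ?_)
      filter_upwards [hU] with q hq _
      exact hq
    · refine h.eventually (p := fun y => y.pos = x.pos + (P y.pt - P x.pt)) ((mem_nhds_iff hv hP).2 ?_)
      exact Eventually.of_forall fun q _ => rfl
  · rintro ⟨h1, h2⟩ A hA
    refine mem_map.2 ?_
    filter_upwards [h1.eventually ((mem_nhds_iff hv hP).1 hA), h2] with t h3 h4
    have h5 := h3 (c t).notMem
    rw [← h4] at h5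
    exact h5

theorem continuous_pt [T2Space S] (hv : v ∈ τ.cycleSpace) :
    Continuous (pt : τ.DevelopedPoint v → S) := by
  refine continuous_iff_continuousAt.2 fun x => ?_
  obtain ⟨P, -, hP⟩ := τ.exists_isFlatAt hv x.pt
  exact ((tendsto_iff hv hP).1 tendsto_id).1

theorem continuous_pos [T2Space S] (hv : v ∈ τ.cycleSpace) :
    Continuous (pos : τ.DevelopedPoint v → ℂ) := by
  refine continuous_iff_continuousAt.2 fun x => ?_
  obtain ⟨P, -, hP⟩ := τ.exists_isFlatAt hv x.pt
  have h := ((tendsto_iff hv hP).1 (tendsto_id (x := 𝓝 x))).2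
  have h1 : Tendsto (fun y : τ.DevelopedPoint v => x.pos + (P y.pt - P x.pt)) (𝓝 x) (𝓝 x.pos) := by
    have := (hP.continuousAt.tendsto.comp (continuous_pt hv).continuousAt).sub_const (P x.pt)
    simpa using this.const_add x.pos
  exact h1.congr' (h.mono fun y hy => hy.symm)

theorem t2Space [T2Space S] (hv : v ∈ τ.cycleSpace) : T2Space (τ.DevelopedPoint v) :=
  T2Space.of_injective_continuous (f := fun x : τ.DevelopedPoint v => (x.pos, x.pt))
    (fun x y h => by
      cases x; cases y
      simpa using h) ((continuous_pos hv).prodMk (continuous_pt hv))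

theorem isLocalHomeomorph_pos [T2Space S] (hv : v ∈ τ.cycleSpace) (hp : RibbonGraph.IsPositive v) :
    IsLocalHomeomorph (pos : τ.DevelopedPoint v → ℂ) := by
  intro x
  obtain ⟨P, -, hP⟩ := τ.exists_isFlatAt hv x.pt
  obtain ⟨N, hN, hi⟩ := hP.exists_injOn hv hp x.notMem
  have hmap : ∀ y : τ.DevelopedPoint v, 𝓝 y.pos ≤ map pos (𝓝 y) := by
    intro y A hA
    obtain ⟨P, -, hP⟩ := τ.exists_isFlatAt hv y.pt
    have h1 : ∀ᶠ q in 𝓝 y.pt, ∀ hq : q ∉ Z, y.pos + (P q - P y.pt) ∈ A :=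
      (mem_nhds_iff hv hP).1 (mem_map.1 hA)
    have h2 : ∀ᶠ q in 𝓝 y.pt, y.pos + (P q - P y.pt) ∈ A := by
      filter_upwards [h1, τ.finite_vertices.isClosed.isOpen_compl.mem_nhds y.notMem] with q h3 h4
      exact h3 h4
    have h3 : ∀ᶠ w in 𝓝 (P y.pt), y.pos + (w - P y.pt) ∈ A := hP.nhds_le hv hp y.notMem h2
    have h4 : Tendsto (fun w => w - y.pos + P y.pt) (𝓝 y.pos) (𝓝 (P y.pt)) :=
      Continuous.tendsto' (by fun_prop) _ _ (by simp)
    filter_upwards [h4.eventually h3] with w hw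
    convert hw using 1
    ring
  obtain ⟨φ, h1, -, h2⟩ := exists_openPartialHomeomorph (P := pos) (p := x)
    (N := {y | y.pt ∈ N ∧ y.pos = x.pos + (P y.pt - P x.pt)}) (by
      refine (mem_nhds_iff hv hP).2 ?_
      filter_upwards [hN] with q hq _
      exact ⟨hq, rfl⟩) (by
      rintro y ⟨hy, hy'⟩ z ⟨hz, hz'⟩ h
      have h3 : P y.pt = P z.pt := by linear_combination h - hy' + hz'
      have h4 := hi hy hz h3
      cases y; cases z
      simp_all) (Eventually.of_forall fun y => ⟨(continuous_pos hv).continuousAt, hmap y⟩)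
  exact ⟨φ, h1, h2.symm⟩

/-- A developed path that moves little stays near its starting point. -/
theorem exists_trap [T2Space S] [CompactSpace S] (hv : v ∈ τ.cycleSpace) (hp : RibbonGraph.IsPositive v) (p : S)
    {V : Set S} (hV : V ∈ 𝓝 p) : ∃ V' ∈ 𝓝 p, ∃ m > 0, ∀ {B : Type} [TopologicalSpace B] {J : Set B}
      {c : B → τ.DevelopedPoint v}, IsPreconnected J → ContinuousOn c J → ∀ s₀ ∈ J, (c s₀).pt ∈ V' →
        (∀ s ∈ J, dist (c s).pos (c s₀).pos ≤ m) → ∀ s ∈ J, (c s).pt ∈ V := by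
  obtain ⟨P, hP0, hP⟩ := τ.exists_isFlatAt hv p
  obtain ⟨K, hK, hKc, hKV⟩ := exists_mem_nhds_isClosed_subset
    (inter_mem hV (inter_mem hP.eventually (hP.eventually_ne hp)))
  have hflat : ∀ q ∈ K, τ.IsFlatAt v P q := fun q hq => (hKV hq).2.1
  have hne : ∀ q ∈ K, P q = 0 → q = p := fun q hq h => (hKV hq).2.2 (h.trans hP0.symm)
  have hfr : IsCompact (K \ interior K) := (hKc.sdiff isOpen_interior).isCompact
  obtain ⟨m, hm, hmin⟩ : ∃ m > 0, ∀ q ∈ K \ interior K, 3 * m ≤ ‖P q‖ := by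
    rcases (K \ interior K).eq_empty_or_nonempty with h | h
    · exact ⟨1, one_pos, fun q hq => absurd hq (by rw [h]; exact notMem_empty q)⟩
    · obtain ⟨q, hq, hqm⟩ := hfr.exists_isMinOn h (f := fun q => ‖P q‖) fun q hq =>
        (hflat q hq.1).continuousAt.norm.continuousWithinAt
      refine ⟨‖P q‖ / 3, ?_, fun q' hq' => by linarith [isMinOn_iff.1 hqm q' hq']⟩
      have : P q ≠ 0 := fun h0 => hq.2 (by rw [hne q hq.1 h0]; exact mem_interior_iff_mem_nhds.2 hK)
      have := norm_pos_iff.2 this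
      positivity
  have hsmall : ∀ᶠ q in 𝓝 p, ‖P q‖ < m := by
    have := hP.continuousAt.norm.tendsto
    rw [hP0, norm_zero] at this
    exact this.eventually (gt_mem_nhds hm)
  refine ⟨interior K ∩ {q | ‖P q‖ < m}, inter_mem (interior_mem_nhds.2 hK) hsmall, m, hm, ?_⟩
  intro B _ J c hJ hc s₀ hs₀ hstart hmove s hs
  have hloc : ∀ s ∈ J, (c s).pt ∈ K → ∀ᶠ s' in 𝓝[J] s,
      (c s').pos = (c s).pos + (P (c s').pt - P (c s).pt) := fun s hs hsK =>
    ((tendsto_iff hv (hflat _ hsK)).1 (hc s hs)).2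
  have hpt : ∀ s ∈ J, Tendsto (fun s => (c s).pt) (𝓝[J] s) (𝓝 (c s).pt) := fun s hs =>
    (continuous_pt hv).continuousAt.tendsto.comp (hc s hs)
  have key := hJ.eq_of_eventually_eq (φ := fun s => (c s).pt ∈ interior K ∧
    P (c s).pt - P (c s₀).pt = (c s).pos - (c s₀).pos) (fun s hs => ?_) hs₀ hs
  · have h1 := key.mp ⟨hstart.1, by rw [sub_self, sub_self]⟩
    exact (hKV (interior_subset h1.1)).1
  · by_cases hsK : (c s).pt ∈ K
    · by_cases hB : (c s).pt ∈ interior K ∧ P (c s).pt - P (c s₀).pt = (c s).pos - (c s₀).pos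
      · filter_upwards [hloc s hs hsK, (hpt s hs).eventually (isOpen_interior.mem_nhds hB.1)] with s' h1 h2
        exact propext ⟨fun _ => hB, fun _ => ⟨h2, by rw [h1]; linear_combination hB.2⟩⟩
      · filter_upwards [hloc s hs hsK] with s' h1
        refine propext ⟨fun h2 => ?_, fun h => absurd h hB⟩
        have h3 : P (c s).pt - P (c s₀).pt = (c s).pos - (c s₀).pos := by
          linear_combination h2.2 + h1
        refine ⟨?_, h3⟩
        by_contra hKint
        have h4 := hmin _ ⟨hsK, hKint⟩
        have h5 : P (c s).pt = ((c s).pos - (c s₀).pos) + P (c s₀).pt := by linear_combination h3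
        have h6 := norm_add_le ((c s).pos - (c s₀).pos) (P (c s₀).pt)
        rw [← h5, ← dist_eq_norm] at h6
        have h7 : ‖P (c s₀).pt‖ < m := hstart.2
        linarith [hmove s hs]
    · filter_upwards [(hpt s hs).eventually (hKc.isOpen_compl.mem_nhds hsK)] with s' h1
      exact propext ⟨fun h => absurd (interior_subset h.1) h1, fun h => absurd (interior_subset h.1) hsK⟩

/-- A developed path on a half-open interval has a limit on the surface. -/
theorem exists_tendsto_pt [T2Space S] [CompactSpace S] (hv : v ∈ τ.cycleSpace)
    (hp : RibbonGraph.IsPositive v) {T : ℝ} (hT : 0 < T) {c : ℝ → τ.DevelopedPoint v}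
    (hc : ContinuousOn c (Ico 0 T)) {σ : ℝ → ℂ} (hσ : Continuous σ) (hcσ : ∀ t ∈ Ico 0 T, (c t).pos = σ t) :
    ∃ q, Tendsto (fun t => (c t).pt) (𝓝[<] T) (𝓝 q) := by
  obtain ⟨q, -, hq⟩ := isCompact_univ.exists_clusterPt (f := map (fun t => (c t).pt) (𝓝[<] T))
    (le_principal_iff.2 univ_mem)
  refine ⟨q, fun V hV => ?_⟩
  obtain ⟨V', hV', m, hm, htrap⟩ := exists_trap hv hp q hV
  have h1 : ∀ᶠ t in 𝓝[<] T, t ∈ Ico 0 T ∧ dist (σ t) (σ T) < m / 2 :=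
    (show ∀ᶠ t in 𝓝[<] T, t ∈ Ico 0 T from Ico_mem_nhdsLT hT).and
      (nhdsWithin_le_nhds (hσ.continuousAt.eventually (Metric.ball_mem_nhds _ (half_pos hm))))
  obtain ⟨a, haT, ha⟩ := mem_nhdsLT_iff_exists_Ioo_subset.1 h1
  have h2 : ∃ᶠ t in 𝓝[<] T, (c t).pt ∈ V' := (frequently_map.1 (hq.frequently hV'))
  obtain ⟨s₀, hs₀, hs₀a⟩ := (h2.and_eventually (Ioo_mem_nhdsLT haT)).exists
  have hJ : ∀ s ∈ Ico s₀ T, s ∈ Ioo a T := fun s hs => ⟨hs₀a.1.trans_le hs.1, hs.2⟩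
  refine mem_map.2 ?_
  filter_upwards [Ioo_mem_nhdsLT hs₀a.2] with t ht
  refine htrap isPreconnected_Ico (hc.mono fun s hs => (ha (hJ s hs)).1) s₀
    (left_mem_Ico.2 hs₀a.2) hs₀ (fun s hs => ?_) t ⟨ht.1.le, ht.2⟩
  rw [hcσ s (ha (hJ s hs)).1, hcσ s₀ (ha hs₀a).1]
  have h3 : dist (σ s) (σ T) < m / 2 := (ha (hJ s hs)).2
  have h4 : dist (σ s₀) (σ T) < m / 2 := (ha hs₀a).2
  linarith [dist_triangle_right (σ s) (σ s₀) (σ T)]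

/-- The limit of a developed path on the surface is a limit of developed points unless it is a vertex. -/
theorem exists_tendsto [T2Space S] (hv : v ∈ τ.cycleSpace) {T : ℝ} (hT : 0 < T)
    {c : ℝ → τ.DevelopedPoint v} (hc : ContinuousOn c (Ico 0 T)) {σ : ℝ → ℂ} (hσ : Continuous σ)
    (hcσ : ∀ t ∈ Ico 0 T, (c t).pos = σ t) {q : S} (hq : q ∉ Z)
    (hlim : Tendsto (fun t => (c t).pt) (𝓝[<] T) (𝓝 q)) : ∃ e, Tendsto c (𝓝[<] T) (𝓝 e) := by
  obtain ⟨P, hP0, hP⟩ := τ.exists_isFlatAt hv q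
  refine ⟨⟨σ T, q, hq⟩, (tendsto_iff hv hP).2 ⟨hlim, ?_⟩⟩
  have h1 : ∀ᶠ t in 𝓝[<] T, t ∈ Ico 0 T ∧ τ.IsFlatAt v P (c t).pt :=
    (show ∀ᶠ t in 𝓝[<] T, t ∈ Ico 0 T from Ico_mem_nhdsLT hT).and (hlim.eventually hP.eventually)
  obtain ⟨a, haT, ha⟩ := mem_nhdsLT_iff_exists_Ioo_subset.1 h1
  have hconst : ∀ s ∈ Ioo a T, ∀ t ∈ Ioo a T, P (c s).pt - σ s = P (c t).pt - σ t := fun s hs t ht => by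
    refine isPreconnected_Ioo.eq_of_eventually_eq (φ := fun s => P (c s).pt - σ s) (fun s hs => ?_) hs ht
    have h2 : ContinuousWithinAt c (Ioo a T) s := (hc.mono fun s hs => (ha hs).1) s hs
    filter_upwards [((tendsto_iff hv (ha hs).2).1 h2).2, self_mem_nhdsWithin] with s' h3 h4
    rw [hcσ s' (ha h4).1, hcσ s (ha hs).1] at h3
    linear_combination -h3
  filter_upwards [Ioo_mem_nhdsLT haT] with t ht
  have h2 : Tendsto (fun s => P (c s).pt - σ s) (𝓝[<] T) (𝓝 (P q - σ T)) :=
    (hP.continuousAt.tendsto.comp hlim).sub (hσ.continuousAt.tendsto.mono_left nhdsWithin_le_nhds)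
  have h3 : Tendsto (fun s => P (c s).pt - σ s) (𝓝[<] T) (𝓝 (P (c t).pt - σ t)) :=
    tendsto_const_nhds.congr' (by
      filter_upwards [Ioo_mem_nhdsLT haT] with s hs
      exact hconst t ht s hs)
  have h4 := tendsto_nhds_unique h2 h3
  rw [hcσ t (ha ht).1]
  linear_combination h4

end DevelopedPoint

end Triangulation

/-! ### The power function of the circumscribed circles -/

/-- A function with local affine majorants lies above its chords. -/
theorem chord_le_of_local_majorant {N : ℝ → ℝ} {a b : ℝ} (hN : ContinuousOn N (Icc a b))
    (hloc : ∀ t ∈ Ioo a b, ∃ L : ℝ → ℝ, L t = N t ∧ (∀ s, L (t + s) + L (t - s) = 2 * L t) ∧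
      ∀ᶠ s in 𝓝 t, N s ≤ L s) {t : ℝ} (ht : t ∈ Icc a b) :
    (b - t) * N a + (t - a) * N b ≤ (b - a) * N t := by
  by_contra! hcon
  have hab : a < b := by
    rcases ht.1.eq_or_lt with rfl | h1
    · rcases ht.2.eq_or_lt with rfl | h2
      · simp at hcon
      · exact h2
    · exact h1.trans_le ht.2
  obtain ⟨η, hη⟩ : ∃ η, η = (b - t) * N a + (t - a) * N b - (b - a) * N t := ⟨_, rfl⟩
  have hη0 : 0 < η := by linarith
  obtain ⟨δ, hδ⟩ : ∃ δ, δ = η / (2 * (b - a) ^ 2) := ⟨_, rfl⟩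
  have hba : 0 < b - a := sub_pos.2 hab
  have hδ0 : 0 < δ := by rw [hδ]; positivity
  let K : ℝ → ℝ := fun s => (b - a) * N s - ((b - s) * N a + (s - a) * N b) + δ * ((s - a) * (b - s))
  have hKc : ContinuousOn K (Icc a b) := by
    refine ((continuousOn_const.mul hN).sub ?_).add ?_ <;> exact Continuous.continuousOn (by fun_prop)
  obtain ⟨t₂, ht₂, hmin⟩ := isCompact_Icc.exists_isMinOn ⟨t, ht⟩ hKc
  have hmin' := isMinOn_iff.1 hmin
  have hKt : K t < 0 := by
    have h1 : (t - a) * (b - t) ≤ (b - a) ^ 2 := by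
      nlinarith [ht.1, ht.2, mul_nonneg (sub_nonneg.2 ht.1) (sub_nonneg.2 ht.2)]
    have h2 : δ * ((t - a) * (b - t)) ≤ η / 2 := by
      calc δ * ((t - a) * (b - t)) ≤ δ * (b - a) ^ 2 := mul_le_mul_of_nonneg_left h1 hδ0.le
        _ = η / 2 := by rw [hδ]; field_simp
    simp only [K]
    linarith
  have hK₂ : K t₂ < 0 := (hmin' t ht).trans_lt hKt
  have ht₂' : t₂ ∈ Ioo a b := by
    refine ⟨lt_of_le_of_ne ht₂.1 fun h => ?_, lt_of_le_of_ne ht₂.2 fun h => ?_⟩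
    · rw [← h] at hK₂; simp [K] at hK₂
    · rw [h] at hK₂; simp [K] at hK₂
  obtain ⟨L, hL1, hL2, hL3⟩ := hloc t₂ ht₂'
  obtain ⟨ε, hε, h4⟩ := Metric.eventually_nhds_iff.1 (hL3.and (Icc_mem_nhds ht₂'.1 ht₂'.2))
  have hp := h4 (y := t₂ + ε / 2) (by rw [Real.dist_eq, add_sub_cancel_left, abs_of_pos (by positivity)]; linarith)
  have hm := h4 (y := t₂ - ε / 2) (by
    rw [Real.dist_eq, sub_sub_cancel_left, abs_neg, abs_of_pos (by positivity)]; linarith)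
  have h5 := hmin' _ hp.2
  have h6 := hmin' _ hm.2
  have h7 := mul_le_mul_of_nonneg_left hp.1 hba.le
  have h8 := mul_le_mul_of_nonneg_left hm.1 hba.le
  have h9 := hL2 (ε / 2)
  have h10 : 0 < δ * (ε / 2) ^ 2 := by positivity
  simp only [K] at h5 h6
  have h11 : (b - a) * L (t₂ + ε / 2) + (b - a) * L (t₂ - ε / 2) = 2 * ((b - a) * N t₂) := by
    rw [← hL1]; linear_combination (b - a) * h9
  nlinarith

open RibbonGraph

section Circle

variable {F : Type*} {v : F × Fin 3 → ℂ}

/-- The centre of the circle circumscribed to the face `g`, placed with its first vertex at the origin. -/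
noncomputable def circumcenter (v : F × Fin 3 → ℂ) (g : F) : ℂ :=
  v (g, 0) * (1 + ((apexProduct v (g, 0)).re / (apexProduct v (g, 0)).im : ℝ) * Complex.I) / 2

/-- The power of a point with respect to the circle circumscribed to the face `g`. -/
noncomputable def power (v : F × Fin 3 → ℂ) (g : F) (y : ℂ) : ℝ :=
  dist y (circumcenter v g) ^ 2 - ‖circumcenter v g‖ ^ 2

theorem continuous_power (v : F × Fin 3 → ℂ) (g : F) : Continuous (power v g) := by
  unfold power; fun_prop

theorem power_eq (v : F × Fin 3 → ℂ) (g : F) (y : ℂ) :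
    power v g y = y.re ^ 2 + y.im ^ 2 - 2 * (y.re * (circumcenter v g).re + y.im * (circumcenter v g).im) := by
  rw [power, Complex.dist_eq_re_im, Real.sq_sqrt (by positivity), Complex.sq_norm, Complex.normSq_apply]
  ring

theorem power_corner (hv : ∀ f, ∑ j, v (f, j) = 0) (hp : IsPositive v) (g : F) (j : Fin 3) :
    power v g (faceMap v g (corner j)) = 0 := by
  have him := (hp.apexProduct_im_pos (g, 0)).ne'
  have hsum := hv g
  rw [Fin.sum_univ_three] at hsum
  obtain ⟨k, hk⟩ : ∃ k, k = (apexProduct v (g, 0)).re / (apexProduct v (g, 0)).im := ⟨_, rfl⟩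
  have hc : circumcenter v g = v (g, 0) * (1 + (k : ℂ) * Complex.I) / 2 := by rw [circumcenter, hk]
  have hre : (circumcenter v g).re = ((v (g, 0)).re - k * (v (g, 0)).im) / 2 := by
    rw [hc, Complex.div_re]; simp [Complex.normSq_ofNat]; ring
  have him' : (circumcenter v g).im = ((v (g, 0)).im + k * (v (g, 0)).re) / 2 := by
    rw [hc, Complex.div_im]; simp [Complex.normSq_ofNat]; ring
  have hk' : k * (apexProduct v (g, 0)).im = (apexProduct v (g, 0)).re := by
    rw [hk, div_mul_cancel₀ _ him]
  have h1 : v (g, 1) = -v (g, 0) - v (g, 2) := by linear_combination hsum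
  simp only [apexProduct, RibbonGraph.shift, zero_add, h1, Complex.mul_im, Complex.mul_re, Complex.neg_re,
    Complex.neg_im, Complex.sub_re, Complex.sub_im, Complex.conj_re, Complex.conj_im] at hk'
  rw [power_eq, hre, him']
  fin_cases j
  · simp [faceMap, corner]
  · simp [faceMap, corner]; ring
  · simp [faceMap, corner]
    linear_combination -hk'

theorem dist_corner_circumcenter (hv : ∀ f, ∑ j, v (f, j) = 0) (hp : IsPositive v) (g : F) (j : Fin 3) :
    dist (faceMap v g (corner j)) (circumcenter v g) = ‖circumcenter v g‖ := by
  have := power_corner hv hp g j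
  rw [power, sub_eq_zero] at this
  exact (sq_eq_sq₀ dist_nonneg (norm_nonneg _)).1 this

theorem norm_circumcenter_pos (hp : IsPositive v) (g : F) : 0 < ‖circumcenter v g‖ := by
  rw [norm_pos_iff, circumcenter]
  refine div_ne_zero (mul_ne_zero (hp.ne_zero _) fun h => ?_) two_ne_zero
  have := congrArg Complex.re h
  simp at this

theorem power_mul_im (hv : ∀ f, ∑ j, v (f, j) = 0) (hp : IsPositive v) (g : F) (j : Fin 3) (y : ℂ) :
    power v g y * (apexProduct v (g, j)).im =
      ((faceMap v g (corner (j + 1)) - y).re * (faceMap v g (corner j) - y).re +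
        (faceMap v g (corner (j + 1)) - y).im * (faceMap v g (corner j) - y).im) * (apexProduct v (g, j)).im +
      (apexProduct v (g, j)).re *
        cross (faceMap v g (corner (j + 1)) - y) (faceMap v g (corner j) - y) := by
  have hj1 : j + 1 + 1 = j + 2 := by fin_cases j <;> rfl
  have hj2 : j + 2 + 1 = j := by fin_cases j <;> rfl
  have h := sq_dist_sub_mul_cross (x := y) (dist_corner_circumcenter hv hp g j)
    (dist_corner_circumcenter hv hp g (j + 1)) (dist_corner_circumcenter hv hp g (j + 2))
  have e1 : faceMap v g (corner (j + 1)) - faceMap v g (corner (j + 2)) = -v (g, j + 1) := by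
    rw [← faceMap_sub_corner hv g (j + 1), hj1, neg_sub]
  have e2 : faceMap v g (corner j) - faceMap v g (corner (j + 2)) = v (g, j + 2) := by
    rw [← faceMap_sub_corner hv g (j + 2), hj2]
  rw [e1, e2] at h
  rw [power]
  simp only [apexProduct, RibbonGraph.shift]
  simp only [cross, Complex.mul_im, Complex.mul_re, Complex.neg_re, Complex.neg_im, Complex.conj_re,
    Complex.conj_im] at h ⊢
  linear_combination -h

theorem power_side (hv : ∀ f, ∑ j, v (f, j) = 0) (hp : IsPositive v) (g : F) (j : Fin 3) (s : ℝ) :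
    power v g (faceMap v g (side j s)) = -(s * (1 - s)) * Complex.normSq (v (g, j)) := by
  have h := power_mul_im hv hp g j (faceMap v g (side j s))
  have e1 := faceMap_side_sub hv g j 1 s
  have e2 := faceMap_side_sub hv g j 0 s
  rw [side_one] at e1
  rw [side_zero] at e2
  rw [e1, e2] at h
  refine mul_right_cancel₀ (hp.apexProduct_im_pos (g, j)).ne' (h.trans ?_)
  simp only [cross, Complex.re_ofReal_mul, Complex.im_ofReal_mul, Complex.normSq_apply]
  ring

theorem im_apexProduct_eq (hv : ∀ f, ∑ j, v (f, j) = 0) (g : F) (j : Fin 3) :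
    (apexProduct v (g, j)).im = cross (v (g, j + 2)) (v (g, j)) := by
  have hj1 : j + 1 + 1 = j + 2 := by fin_cases j <;> rfl
  have hj2 : j + 2 + 1 = j := by fin_cases j <;> rfl
  have h1 := cross_shift hv g (j + 1)
  have h2 := cross_shift hv g (j + 2)
  rw [hj1] at h1
  rw [hj2] at h2
  rw [apexProduct_im]
  exact h1.trans h2.symm

end Circle

namespace Triangulation

variable {S : Type*} [TopologicalSpace S] [ChartedSpace ℂ S] {Z : Set S} {E F : Type*}
  {τ : Triangulation S Z E F} {v : F × Fin 3 → ℂ}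

theorem faceMap_partner (hv : v ∈ τ.cycleSpace) (h : F × Fin 3) (s s' : ℝ) :
    faceMap v h.1 (side h.2 s) - faceMap v h.1 (side h.2 s') =
      faceMap v (τ.partner h).1 (side (τ.partner h).2 (1 - s)) -
        faceMap v (τ.partner h).1 (side (τ.partner h).2 (1 - s')) := by
  have h1 := faceMap_side_sub hv.1 h.1 h.2 s s'
  have h2 := faceMap_side_sub hv.1 (τ.partner h).1 (τ.partner h).2 (1 - s) (1 - s')
  have h3 : v ((τ.partner h).1, (τ.partner h).2) = -v (h.1, h.2) := hv.2 h
  rw [h1, h2, h3]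
  push_cast
  ring

theorem power_sub_power_partner (hv : v ∈ τ.cycleSpace) (hp : IsPositive v) (h : F × Fin 3) {y : ℂ} {s : ℝ}
    {z' : ℂ} (hy : y - faceMap v h.1 (side h.2 s) =
      faceMap v (τ.partner h).1 z' - faceMap v (τ.partner h).1 (side (τ.partner h).2 (1 - s))) :
    (power v h.1 y - power v (τ.partner h).1 (faceMap v (τ.partner h).1 z')) * (apexProduct v h).im =
      bary ((τ.partner h).2 + 2) z' * (apexProduct v h * apexProduct v (τ.partner h)).im := by
  obtain ⟨g, j⟩ := h
  have hp1 := faceMap_partner hv (g, j) 0 s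
  have hp2 := faceMap_partner hv (g, j) 1 s
  obtain ⟨⟨g', j'⟩, hg⟩ : ∃ x, τ.partner (g, j) = x := ⟨_, rfl⟩
  rw [hg] at hp1 hp2 hy ⊢
  simp only [side_zero, side_one, sub_zero, sub_self] at hp1 hp2 hy
  set y' := faceMap v g' z' with hy'
  have e1 : faceMap v g (corner (j + 1)) - y = faceMap v g' (corner j') - y' := by
    linear_combination hp2 - hy
  have e2 : faceMap v g (corner j) - y = faceMap v g' (corner (j' + 1)) - y' := by
    linear_combination hp1 - hy
  have h1 := power_mul_im hv.1 hp g j y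
  have h2 := power_mul_im hv.1 hp g' j' y'
  rw [e1, e2] at h1
  have h3 := cross_faceMap_sub_side hv.1 g' j' z' 0
  rw [side_zero, ← im_apexProduct_eq hv.1, ← hy'] at h3
  have e3 : faceMap v g' (corner (j' + 1)) - y' =
      v (g', j') - (y' - faceMap v g' (corner j')) := by
    rw [← faceMap_sub_corner hv.1]; ring
  have e4 : faceMap v g' (corner j') - y' = -(y' - faceMap v g' (corner j')) := by ring
  rw [e3, e4] at h1 h2
  set w := y' - faceMap v g' (corner j') with hw
  have him := (hp.apexProduct_im_pos (g', j')).ne'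
  refine mul_right_cancel₀ him ?_
  simp only [cross, Complex.neg_re, Complex.neg_im, Complex.sub_re, Complex.sub_im] at h1 h2 h3
  rw [Complex.mul_im]
  simp only
  linear_combination (apexProduct v (g', j')).im * h1 - (apexProduct v (g, j)).im * h2 +
    ((apexProduct v (g, j)).re * (apexProduct v (g', j')).im + (apexProduct v (g, j)).im *
      (apexProduct v (g', j')).re) * h3

theorem power_eq_of_cell_eq (hv : v ∈ τ.cycleSpace) (hp : IsPositive v) {g g' : F} {z z' : ℂ}
    (hz : z ∈ refTriangle) (hz' : z' ∈ refTriangle) (h : τ.cell g z = τ.cell g' z') :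
    power v g (faceMap v g z) = power v g' (faceMap v g' z') := by
  rcases refTriangle_cases hz with hi | ⟨j, s, hs, rfl⟩ | ⟨j, rfl⟩
  · obtain ⟨rfl, rfl⟩ := τ.face_inj g g' _ hi _ hz' h
    rfl
  · rcases τ.fiber_side (h := (g, j)) hs hz' h with ⟨h1, h2⟩ | ⟨h1, h2⟩
    · rw [h1, h2]
    · have h3 : v ((τ.partner (g, j)).1, (τ.partner (g, j)).2) = -v (g, j) := hv.2 (g, j)
      rw [h1, h2, power_side hv.1 hp, power_side hv.1 hp, h3, Complex.normSq_neg]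
      ring
  · have h2 : τ.cell g' z' ∈ Z := by rw [← h]; exact τ.vertex_mem g j
    obtain ⟨j', rfl⟩ := (τ.cell_mem_iff hz').1 h2
    rw [power_corner hv.1 hp, power_corner hv.1 hp]

variable (τ v) in
/-- The power of a point of the surface with respect to the circle circumscribed to its face. -/
noncomputable def facePower (q : S) : ℝ :=
  power v (τ.covers q).choose (faceMap v (τ.covers q).choose (τ.covers q).choose_spec.choose)

theorem facePower_cell (hv : v ∈ τ.cycleSpace) (hp : IsPositive v) {g : F} {z : ℂ}
    (hz : z ∈ refTriangle) : τ.facePower v (τ.cell g z) = power v g (faceMap v g z) :=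
  power_eq_of_cell_eq hv hp (τ.covers (τ.cell g z)).choose_spec.choose_spec.1 hz
    (τ.covers (τ.cell g z)).choose_spec.choose_spec.2

theorem continuous_facePower [T2Space S] (hv : v ∈ τ.cycleSpace) (hp : IsPositive v) :
    Continuous (τ.facePower v) := by
  refine continuous_iff_continuousAt.2 fun q => ?_
  rw [ContinuousAt, Metric.tendsto_nhds]
  intro ε hε
  refine τ.eventually_nhds fun f z hz hzq => ?_
  have hc : Continuous fun z => power v f (faceMap v f z) :=
    (continuous_power v f).comp (continuous_faceMap v f)
  have h1 : ∀ᶠ z' in 𝓝[refTriangle] z, dist (power v f (faceMap v f z')) (power v f (faceMap v f z)) < ε :=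
    nhdsWithin_le_nhds (hc.continuousAt.eventually (Metric.ball_mem_nhds _ hε))
  filter_upwards [h1, self_mem_nhdsWithin] with z' h2 h3
  rwa [← hzq, facePower_cell hv hp h3, facePower_cell hv hp hz]

theorem facePower_eq_zero (hv : v ∈ τ.cycleSpace) (hp : IsPositive v) {q : S} (hq : q ∈ Z) :
    τ.facePower v q = 0 := by
  obtain ⟨f, j, rfl⟩ := (τ.vertices q).1 hq
  rw [facePower_cell hv hp (corner_mem j), power_corner hv.1 hp]

theorem eventually_facePower_eq [T2Space S] (hv : v ∈ τ.cycleSpace) (hp : IsPositive v) {g : F} {z : ℂ}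
    (hz : z ∈ interior refTriangle) {P : S → ℂ} (hP : τ.IsFlatAt v P (τ.cell g z)) :
    ∀ᶠ q in 𝓝 (τ.cell g z),
      τ.facePower v q = power v g (faceMap v g z + (P q - P (τ.cell g z))) := by
  refine τ.eventually_nhds fun f z' hz' h => ?_
  obtain ⟨rfl, rfl⟩ := τ.face_inj g f z hz z' hz' h.symm
  filter_upwards [hP g z hz' rfl, self_mem_nhdsWithin] with z'' h1 h2
  rw [h1, facePower_cell hv hp h2, add_sub_cancel]

/-- Under the Delaunay condition the circumscribed circle of a face has the largest power near the face. -/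
theorem eventually_facePower_le [T2Space S] (hv : v ∈ τ.cycleSpace) (hp : IsPositive v)
    (hD : ∀ h, 0 < (apexProduct v h * apexProduct v (τ.partner h)).im) {g : F} {z : ℂ}
    (hz : z ∈ refTriangle) (hzZ : τ.cell g z ∉ Z) {P : S → ℂ} (hP : τ.IsFlatAt v P (τ.cell g z)) :
    ∀ᶠ q in 𝓝 (τ.cell g z),
      τ.facePower v q ≤ power v g (faceMap v g z + (P q - P (τ.cell g z))) ∧
      (faceMap v g z + (P q - P (τ.cell g z)) ∉ faceMap v g '' refTriangle →
        τ.facePower v q < power v g (faceMap v g z + (P q - P (τ.cell g z)))) := by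
  refine τ.eventually_nhds fun f z' hz' h => ?_
  have hself : ∀ᶠ z'' in 𝓝[refTriangle] z, τ.facePower v (τ.cell g z'') ≤
        power v g (faceMap v g z + (P (τ.cell g z'') - P (τ.cell g z))) ∧
      (faceMap v g z + (P (τ.cell g z'') - P (τ.cell g z)) ∉ faceMap v g '' refTriangle →
        τ.facePower v (τ.cell g z'') <
          power v g (faceMap v g z + (P (τ.cell g z'') - P (τ.cell g z)))) := by
    filter_upwards [hP g z hz rfl, self_mem_nhdsWithin] with z'' h1 h2
    rw [h1, facePower_cell hv hp h2, add_sub_cancel]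
    exact ⟨le_rfl, fun h3 => absurd (mem_image_of_mem _ h2) h3⟩
  rcases refTriangle_cases hz with hi | ⟨j, s, hs, rfl⟩ | ⟨j, rfl⟩
  · obtain ⟨rfl, rfl⟩ := τ.face_inj g f z hi z' hz' h.symm
    exact hself
  · rcases τ.fiber_side (h := (g, j)) hs hz' h.symm with ⟨h1, h2⟩ | ⟨h1, h2⟩
    · rw [h1, h2]; exact hself
    · have h3 := hP f z' hz' h
      subst h1
      subst h2
      filter_upwards [h3, self_mem_nhdsWithin] with z'' h4 h5
      rw [h4, facePower_cell hv hp h5]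
      have h6 := power_sub_power_partner hv hp (g, j) (s := s) (z' := z'')
        (y := faceMap v g (side j s) + (faceMap v (τ.partner (g, j)).1 z'' -
          faceMap v (τ.partner (g, j)).1 (side (τ.partner (g, j)).2 (1 - s)))) (by ring)
      have h7 := hD (g, j)
      have h8 := hp.apexProduct_im_pos (g, j)
      have h9 := mem_refTriangle_iff.1 h5 ((τ.partner (g, j)).2 + 2)
      have h10 := mul_nonneg h9 h7.le
      refine ⟨?_, fun h11 => ?_⟩
      · by_contra! h12
        have := mul_neg_of_neg_of_pos (sub_neg.2 h12) h8
        linarith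
      · by_contra! h12
        have h13 := mul_nonpos_of_nonpos_of_nonneg (sub_nonpos.2 h12) h8.le
        have h14 : bary ((τ.partner (g, j)).2 + 2) z'' * (apexProduct v (g, j) *
          apexProduct v (τ.partner (g, j))).im = 0 := le_antisymm (h6 ▸ h13) h10
        have h15 := (mul_eq_zero.1 h14).resolve_right h7.ne'
        have h16 := eq_side_of_bary h15
        set s'' := bary ((τ.partner (g, j)).2 + 1) z'' with hs''
        have h17 : s'' ∈ Icc (0 : ℝ) 1 := by
          have h18 := mem_refTriangle_iff.1 h5
          have h19 := bary_sum (τ.partner (g, j)).2 z''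
          exact ⟨h18 _, by linarith [h18 (τ.partner (g, j)).2, h18 ((τ.partner (g, j)).2 + 2)]⟩
        refine h11 ⟨side j (1 - s''), side_mem j ⟨by linarith [h17.2], by linarith [h17.1]⟩, ?_⟩
        have h18 := faceMap_partner hv (g, j) (1 - s'') s
        rw [sub_sub_cancel, ← h16] at h18
        linear_combination h18
  · exact absurd (τ.vertex_mem g j) hzZ

end Triangulation

/-! ### Developing the circumscribed disks -/

open RibbonGraph

theorem power_add_add_power_sub {F : Type*} (v : F × Fin 3 → ℂ) (g : F) (w u : ℂ) :
    power v g (w + u) + power v g (w - u) = 2 * power v g w + 2 * (u.re ^ 2 + u.im ^ 2) := by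
  simp only [power_eq, Complex.add_re, Complex.add_im, Complex.sub_re, Complex.sub_im]
  ring

theorem power_nonneg_iff {F : Type*} {v : F × Fin 3 → ℂ} {g : F} {y : ℂ} :
    0 ≤ power v g y ↔ y ∉ Metric.ball (circumcenter v g) ‖circumcenter v g‖ := by
  rw [power, sub_nonneg, sq_le_sq₀ (norm_nonneg _) dist_nonneg, Metric.mem_ball, not_lt]

theorem lineMap_mem_ball {c b x : ℂ} {r : ℝ} (hb : b ∈ Metric.ball c r) (hx : x ∈ Metric.closedBall c r)
    {t : ℝ} (ht0 : 0 ≤ t) (ht1 : t < 1) : (AffineMap.lineMap b x t : ℂ) ∈ Metric.ball c r := by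
  have e : (AffineMap.lineMap b x t : ℂ) - c = ((1 - t : ℝ) : ℂ) * (b - c) + (t : ℂ) * (x - c) := by
    rw [AffineMap.lineMap_apply, vsub_eq_sub, vadd_eq_add, Complex.real_smul]
    push_cast; ring
  rw [Metric.mem_ball, dist_eq_norm] at hb ⊢
  rw [Metric.mem_closedBall, dist_eq_norm] at hx
  rw [e]
  refine (norm_add_le _ _).trans_lt ?_
  rw [norm_mul, norm_mul, Complex.norm_of_nonneg (by linarith), Complex.norm_of_nonneg ht0]
  nlinarith

section FaceDisk

variable {F : Type*} {v : F × Fin 3 → ℂ} {f : F}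

theorem corner_mem_closedBall (hv : ∀ f, ∑ j, v (f, j) = 0) (hp : IsPositive v) (f : F) :
    (range fun j => faceMap v f (corner j)) ⊆ Metric.closedBall (circumcenter v f) ‖circumcenter v f‖ := by
  rintro _ ⟨j, rfl⟩
  exact (dist_corner_circumcenter hv hp f j).le

theorem corner_notMem_ball (hv : ∀ f, ∑ j, v (f, j) = 0) (hp : IsPositive v) {y : ℂ}
    (hy : y ∈ Metric.ball (circumcenter v f) ‖circumcenter v f‖) :
    y ∉ range fun j => faceMap v f (corner j) := by
  rintro ⟨j, rfl⟩
  exact (Metric.mem_ball.1 hy).ne (dist_corner_circumcenter hv hp f j)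

theorem faceMap_mem_ball (hv : ∀ f, ∑ j, v (f, j) = 0) (hp : IsPositive v) {z : ℂ}
    (hz : z ∈ refTriangle \ range corner) :
    faceMap v f z ∈ Metric.ball (circumcenter v f) ‖circumcenter v f‖ := by
  refine mem_ball_of_mem_convexHull (norm_circumcenter_pos hp f) (corner_mem_closedBall hv hp f)
    ((Triangulation.bijOn_faceMap hp f).mapsTo hz.1) ?_
  rintro ⟨j, hj⟩
  exact hz.2 ⟨j, faceMap_injective hp f hj⟩

/-- The circumscribed disk of the face `f` without the vertices. -/
def faceDisk (v : F × Fin 3 → ℂ) (f : F) : Set ℂ :=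
  Metric.closedBall (circumcenter v f) ‖circumcenter v f‖ \ range fun j => faceMap v f (corner j)

theorem ball_subset_faceDisk (hv : ∀ f, ∑ j, v (f, j) = 0) (hp : IsPositive v) (f : F) :
    Metric.ball (circumcenter v f) ‖circumcenter v f‖ ⊆ faceDisk v f := fun _ hy =>
  ⟨Metric.ball_subset_closedBall hy, corner_notMem_ball hv hp hy⟩

theorem convex_faceDisk (hv : ∀ f, ∑ j, v (f, j) = 0) (hp : IsPositive v) (f : F) :
    Convex ℝ (faceDisk v f) := by
  have h : faceDisk v f =
      ⋂ j, Metric.closedBall (circumcenter v f) ‖circumcenter v f‖ \ {faceMap v f (corner j)} := by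
    ext z
    simp only [faceDisk, Set.mem_sdiff, mem_range, not_exists, mem_iInter, mem_singleton_iff]
    exact ⟨fun h j => ⟨h.1, fun h' => h.2 j h'.symm⟩, fun h => ⟨(h 0).1, fun j h' => (h j).2 h'.symm⟩⟩
  rw [h]
  refine convex_iInter fun j => ((convex_closedBall _ _).mem_extremePoints_iff_convex_sdiff.1 ?_).2
  exact StrictConvexSpace.sphere_subset_extremePoints_closedBall _ (norm_circumcenter_pos hp f).ne'
    (dist_corner_circumcenter hv hp f j)

theorem corner_injective : Function.Injective corner := by
  intro i j h
  fin_cases i <;> fin_cases j <;> simp_all [corner, Complex.ext_iff]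

theorem barycenter_mem : barycenter ∈ refTriangle \ range corner :=
  ⟨interior_subset barycenter_mem_interior, fun ⟨j, hj⟩ =>
    corner_notMem_interior j (hj ▸ barycenter_mem_interior)⟩

end FaceDisk

namespace Triangulation

variable {S : Type*} [TopologicalSpace S] [ChartedSpace ℂ S] {Z : Set S} {E F : Type*}
  {τ : Triangulation S Z E F} {v : F × Fin 3 → ℂ} {f : F}

namespace DevelopedPoint

variable (τ v f) in
/-- The developed points of the face `f`. -/
noncomputable def ofFace (z : ↥(refTriangle \ range corner)) : τ.DevelopedPoint v :=
  ⟨faceMap v f z, τ.cell f z, cell_notMem z.2⟩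

theorem continuous_ofFace [T2Space S] (hv : v ∈ τ.cycleSpace) (f : F) : Continuous (ofFace τ v f) := by
  refine continuous_iff_continuousAt.2 fun z => ?_
  obtain ⟨P, -, hP⟩ := τ.exists_isFlatAt hv (τ.cell f z)
  have h : Tendsto (Subtype.val : ↥(refTriangle \ range corner) → ℂ) (𝓝 z) (𝓝[refTriangle] (z : ℂ)) :=
    tendsto_nhdsWithin_iff.2 ⟨continuous_subtype_val.continuousAt, Eventually.of_forall fun z => z.2.1⟩
  refine (tendsto_iff (x := ofFace τ v f z) hv hP).2 ⟨(τ.tendsto_cell z.2.1).comp h, ?_⟩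
  filter_upwards [h.eventually (hP f z z.2.1 rfl)] with z' hz'
  simp only [ofFace, hz', add_sub_cancel]

/-- A developed path above the face `f` is determined by its starting point. -/
theorem eq_cell [T2Space S] (hv : v ∈ τ.cycleSpace) (hp : IsPositive v) {B : Type*} [TopologicalSpace B]
    {J : Set B} (hJ : IsPreconnected J) {c : B → τ.DevelopedPoint v} (hc : ContinuousOn c J) {y : B → ℂ}
    (hy : ContinuousOn y J) (hyT : ∀ s ∈ J, y s ∈ refTriangle \ range corner)
    (hcy : ∀ s ∈ J, (c s).pos = faceMap v f (y s)) {s₀ : B} (hs₀ : s₀ ∈ J)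
    (h₀ : (c s₀).pt = τ.cell f (y s₀)) {s : B} (hs : s ∈ J) : (c s).pt = τ.cell f (y s) := by
  have := t2Space hv
  have := isPreconnected_iff_preconnectedSpace.1 hJ
  have h1 := (T2Space.isSeparatedMap (pos : τ.DevelopedPoint v → ℂ)).eq_of_comp_eq
    (isLocalHomeomorph_pos hv hp).isLocallyInjective (g₁ := fun s : J => c s)
    (g₂ := fun s : J => ofFace τ v f ⟨y s, hyT s s.2⟩) (continuousOn_iff_continuous_domRestrict.1 hc)
    ((continuous_ofFace hv f).comp (Continuous.subtype_mk (continuousOn_iff_continuous_domRestrict.1 hy) _))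
    (funext fun s => hcy s s.2) ⟨s₀, hs₀⟩ (by
      have h2 := hcy s₀ hs₀
      cases h3 : c s₀
      simp_all [ofFace])
  exact congrArg pt (congrFun h1 ⟨s, hs⟩)

/-- A developed radius of the circumscribed disk does not run into a vertex. -/
theorem radius_vertex [T2Space S] (hv : v ∈ τ.cycleSpace) (hp : IsPositive v)
    (hD : ∀ h, 0 < (apexProduct v h * apexProduct v (τ.partner h)).im) {x : ℂ}
    (hx : x ∈ Metric.closedBall (circumcenter v f) ‖circumcenter v f‖) {T : ℝ} (hT : T ∈ Ioc (0 : ℝ) 1)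
    {c : ℝ → τ.DevelopedPoint v} (hc : ContinuousOn c (Ico 0 T)) (hc0 : (c 0).pt = τ.cell f barycenter)
    (hcσ : ∀ t ∈ Ico 0 T, (c t).pos = AffineMap.lineMap (faceMap v f barycenter) x t) {q : S}
    (hq : q ∈ Z) (hlim : Tendsto (fun t => (c t).pt) (𝓝[<] T) (𝓝 q)) :
    x ∈ range fun j => faceMap v f (corner j) := by
  set σ : ℝ → ℂ := fun t => AffineMap.lineMap (faceMap v f barycenter) x t with hσdef
  have hσ : Continuous σ := AffineMap.lineMap_continuous
  have hb := faceMap_mem_ball (f := f) hv.1 hp barycenter_mem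
  have hσ0 : σ 0 = faceMap v f barycenter := AffineMap.lineMap_apply_zero _ _
  have hσ1 : σ 1 = x := AffineMap.lineMap_apply_one _ _
  have hball : ∀ t, 0 ≤ t → t < 1 → σ t ∈ Metric.ball (circumcenter v f) ‖circumcenter v f‖ :=
    fun t h0 h1 => lineMap_mem_ball hb hx h0 h1
  have hσs : ∀ s t, σ (t + s) - σ t = (s : ℂ) * (x - faceMap v f barycenter) := fun s t => by
    simp only [hσdef, AffineMap.lineMap_apply, vsub_eq_sub, vadd_eq_add, Complex.real_smul]
    push_cast; ring
  let N₀ : ℝ → ℝ := fun t => τ.facePower v (c t).pt - power v f (σ t)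
  let N : ℝ → ℝ := Function.update N₀ T (-power v f (σ T))
  have hNN : ∀ t, t < T → N t = N₀ t := fun t ht => Function.update_of_ne ht.ne _ _
  have hNT : N T = -power v f (σ T) := Function.update_self _ _ _
  have hN : ContinuousOn N (Icc 0 T) := by
    rw [continuousOn_update_iff, Icc_sdiff_right]
    refine ⟨?_, fun _ => ?_⟩
    · exact (((continuous_facePower hv hp).comp (continuous_pt hv)).comp_continuousOn hc).sub
        ((continuous_power v f).comp hσ).continuousOn
    · rw [nhdsWithin_Ico_eq_nhdsLT hT.1, neg_eq_zero_sub, ← facePower_eq_zero hv hp hq]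
      exact ((continuous_facePower hv hp).continuousAt.tendsto.comp hlim).sub
        (((continuous_power v f).comp hσ).continuousAt.tendsto.mono_left nhdsWithin_le_nhds)
  have hflat : ∀ t ∈ Ico 0 T, ∀ P, τ.IsFlatAt v P (c t).pt →
      ∀ᶠ s in 𝓝[Ico 0 T] t, P (c s).pt - P (c t).pt = σ s - σ t := fun t ht P hP => by
    filter_upwards [((tendsto_iff hv hP).1 (hc t ht)).2, self_mem_nhdsWithin] with s h1 h2
    rw [hcσ s h2, hcσ t ht] at h1
    linear_combination -h1
  have hpt : ∀ t ∈ Ico 0 T, Tendsto (fun s => (c s).pt) (𝓝[Ico 0 T] t) (𝓝 (c t).pt) := fun t ht =>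
    (continuous_pt hv).continuousAt.tendsto.comp (hc t ht)
  have hle : ∀ t ∈ Ico 0 T, ∀ g, ∀ z ∈ refTriangle, τ.cell g z = (c t).pt → ∀ᶠ s in 𝓝[Ico 0 T] t,
      τ.facePower v (c s).pt ≤ power v g (faceMap v g z + (σ s - σ t)) ∧
      (faceMap v g z + (σ s - σ t) ∉ faceMap v g '' refTriangle →
        τ.facePower v (c s).pt < power v g (faceMap v g z + (σ s - σ t))) := fun t ht g z hz hzt => by
    obtain ⟨P, -, hP⟩ := τ.exists_isFlatAt hv (c t).pt
    have h1 := hpt t ht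
    have h2 := hflat t ht P hP
    have h3 : τ.cell g z ∉ Z := hzt ▸ (c t).notMem
    rw [← hzt] at hP h1 h2
    filter_upwards [h1.eventually (eventually_facePower_le hv hp hD hz h3 hP), h2] with s h4 h5
    rwa [h5] at h4
  have hloc : ∀ t ∈ Ioo 0 T, ∃ L : ℝ → ℝ, L t = N t ∧ (∀ s, L (t + s) + L (t - s) = 2 * L t) ∧
      ∀ᶠ s in 𝓝 t, N s ≤ L s := fun t ht => by
    obtain ⟨g, z, hz, hzt⟩ := τ.covers (c t).pt
    refine ⟨fun s => power v g (faceMap v g z + (σ s - σ t)) - power v f (σ s), ?_, fun s => ?_, ?_⟩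
    · rw [hNN t ht.2]
      simp only [N₀, ← hzt, facePower_cell hv hp hz, sub_self, add_zero]
    · have h1 := power_add_add_power_sub v g (faceMap v g z) ((s : ℂ) * (x - faceMap v f barycenter))
      have h2 := power_add_add_power_sub v f (σ t) ((s : ℂ) * (x - faceMap v f barycenter))
      have h3 := hσs s t
      have h4 : σ (t - s) - σ t = -((s : ℂ) * (x - faceMap v f barycenter)) := by
        have := hσs (-s) t
        rw [← sub_eq_add_neg] at this
        rw [this]; push_cast; ring
      have h5 : σ (t + s) = σ t + (s : ℂ) * (x - faceMap v f barycenter) := by rw [← h3]; ring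
      have h6 : σ (t - s) = σ t - (s : ℂ) * (x - faceMap v f barycenter) := by
        linear_combination h4
      simp only [h3, h4, sub_self, add_zero, ← sub_eq_add_neg]
      rw [h5, h6]
      linear_combination h1 - h2
    · have h1 := hle t ⟨ht.1.le, ht.2⟩ g z hz hzt
      rw [nhdsWithin_eq_nhds.2 (Ico_mem_nhds ht.1 ht.2)] at h1
      filter_upwards [h1, Iio_mem_nhds ht.2] with s h2 h3
      rw [hNN s h3]
      exact sub_le_sub_right h2.1 _
  have hchord := fun t ht => chord_le_of_local_majorant hN hloc (t := t) ht
  have h00 : (0 : ℝ) ∈ Ico 0 T := left_mem_Ico.2 hT.1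
  have hzero : ∀ᶠ s in 𝓝[Ico 0 T] 0, N s = 0 := by
    obtain ⟨P, -, hP⟩ := τ.exists_isFlatAt hv (c 0).pt
    have h1 := hpt 0 h00
    have h2 := hflat 0 h00 P hP
    rw [hc0] at hP h1 h2
    filter_upwards [h1.eventually (eventually_facePower_eq hv hp barycenter_mem_interior hP), h2,
      self_mem_nhdsWithin] with s h3 h4 h5
    rw [hNN s h5.2]
    simp only [N₀, h3, h4, hσ0, add_sub_cancel, sub_self]
  have hN0 : N 0 = 0 := hzero.self_of_nhdsWithin h00
  have hNT0 : N T ≤ 0 := by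
    rw [nhdsWithin_Ico_eq_nhdsGE hT.1] at hzero
    obtain ⟨t, ht, htT⟩ := ((hzero.filter_mono (nhdsWithin_mono 0 Ioi_subset_Ici_self)).and
      (Ioo_mem_nhdsGT hT.1)).exists
    have h1 := hchord t ⟨htT.1.le, htT.2.le⟩
    rw [hN0, ht] at h1
    nlinarith [htT.1]
  have hTball := power_nonneg_iff.1 (show 0 ≤ power v f (σ T) by linarith)
  obtain rfl : T = 1 := by
    by_contra hne
    exact hTball (hball T hT.1.le (lt_of_le_of_ne hT.2 hne))
  rw [hσ1] at hTball hNT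
  by_contra hxr
  have hxT : x ∉ faceMap v f '' refTriangle := fun h => hTball (by
    rw [(bijOn_faceMap hp f).image_eq] at h
    exact mem_ball_of_mem_convexHull (norm_circumcenter_pos hp f) (corner_mem_closedBall hv.1 hp f) h hxr)
  have hN1 : N 1 = 0 := by
    have h1 : dist x (circumcenter v f) = ‖circumcenter v f‖ :=
      le_antisymm (Metric.mem_closedBall.1 hx) (not_lt.1 fun h => hTball (Metric.mem_ball.2 h))
    rw [hNT, power, h1, sub_self, neg_zero]
  have hNnonneg : ∀ t ∈ Icc (0 : ℝ) 1, 0 ≤ N t := fun t ht => by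
    have := hchord t ht
    rw [hN0, hN1] at this
    linarith
  let K : Set ℝ := Icc 0 1 ∩ σ ⁻¹' (faceMap v f '' refTriangle)
  have hKc : IsCompact K := isCompact_Icc.inter_right
    ((isCompact_refTriangle.image (continuous_faceMap v f)).isClosed.preimage hσ)
  have h0K : (0 : ℝ) ∈ K := ⟨by simp, barycenter, barycenter_mem.1, hσ0.symm⟩
  obtain ⟨t, htK, htmax⟩ := hKc.exists_isMaxOn ⟨0, h0K⟩ continuousOn_id
  have htmax' : ∀ s ∈ K, s ≤ t := isMaxOn_iff.1 htmax
  have ht1 : t < 1 := lt_of_le_of_ne htK.1.2 fun h => hxT (by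
    have := htK.2
    rwa [h, mem_preimage, hσ1] at this)
  have htI : t ∈ Ico (0 : ℝ) 1 := ⟨htK.1.1, ht1⟩
  obtain ⟨z, hz, hzt⟩ := htK.2
  have hzc : (c t).pt = τ.cell f z := by
    have hconv : ∀ s ∈ Icc 0 t, faceInv v f (σ s) ∈ refTriangle \ range corner := fun s hs => by
      have h1 : Convex ℝ (σ ⁻¹' (faceMap v f '' refTriangle)) := by
        rw [(bijOn_faceMap hp f).image_eq]
        exact (convex_convexHull ℝ _).affine_preimage (AffineMap.lineMap (faceMap v f barycenter) x)
      obtain ⟨z, hz, hzs⟩ := h1.ordConnected.out h0K.2 htK.2 hs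
      rw [← hzs, faceInv_faceMap hp]
      refine ⟨hz, ?_⟩
      rintro ⟨j, rfl⟩
      exact corner_notMem_ball hv.1 hp (hball s hs.1 (hs.2.trans_lt ht1)) ⟨j, hzs⟩
    have h1 := eq_cell (f := f) hv hp isPreconnected_Icc (hc.mono (Icc_subset_Ico_right ht1))
      (y := fun s => faceInv v f (σ s)) ((continuous_faceInv v f).comp hσ).continuousOn hconv
      (fun s hs => by rw [hcσ s ⟨hs.1, hs.2.trans_lt ht1⟩, faceMap_faceInv hp])
      (left_mem_Icc.2 htI.1) (by simp only [hσ0, faceInv_faceMap hp, hc0]) (right_mem_Icc.2 htI.1)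
    rw [h1, ← hzt, faceInv_faceMap hp]
  have h1 := hle t htI f z hz hzc.symm
  have h2 := h1.filter_mono (nhdsWithin_mono t
    (Ioo_subset_Ico_self.trans (Ico_subset_Ico_left htI.1) : Ioo t 1 ⊆ Ico 0 1))
  rw [nhdsWithin_Ioo_eq_nhdsGT ht1] at h2
  obtain ⟨s, hs, hst⟩ := (h2.and (Ioo_mem_nhdsGT ht1)).exists
  simp only [hzt, add_sub_cancel] at hs
  have h3 := hs.2 fun h => absurd (htmax' s ⟨⟨htI.1.trans hst.1.le, hst.2.le⟩, h⟩) (not_le.2 hst.1)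
  have h4 := hNnonneg s ⟨htI.1.trans hst.1.le, hst.2.le⟩
  rw [hNN s hst.2] at h4
  simp only [N₀] at h4
  linarith

/-- The circumscribed disk without the vertices develops. -/
theorem exists_disk [T2Space S] [CompactSpace S] (hv : v ∈ τ.cycleSpace) (hp : IsPositive v)
    (hD : ∀ h, 0 < (apexProduct v h * apexProduct v (τ.partner h)).im) (f : F) :
    ∃ Φ : faceDisk v f → τ.DevelopedPoint v, Continuous Φ ∧ (∀ x, (Φ x).pos = x) ∧
      ∀ z ∈ refTriangle, ∀ x : faceDisk v f, (x : ℂ) = faceMap v f z → (Φ x).pt = τ.cell f z := by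
  have := t2Space hv
  have hloc := isLocalHomeomorph_pos hv hp
  have hsep := T2Space.isSeparatedMap (pos : τ.DevelopedPoint v → ℂ)
  let a := ofFace τ v f ⟨barycenter, barycenter_mem⟩
  have hex : ∀ x : faceDisk v f, ∃ c : ℝ → τ.DevelopedPoint v, ContinuousOn c (Icc 0 1) ∧ c 0 = a ∧ ∀ t ∈ Icc (0 : ℝ) 1, (c t).pos = AffineMap.lineMap (faceMap v f barycenter) (x : ℂ) t := fun x => by
    have hσ : Continuous fun t : ℝ => (AffineMap.lineMap (faceMap v f barycenter) (x : ℂ) t : ℂ) :=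
      AffineMap.lineMap_continuous
    refine hloc.exists_path_lift hsep hσ (by simp [a, ofFace]) fun T hT c hc hc0 hcσ => ?_
    obtain ⟨q, hq⟩ := exists_tendsto_pt hv hp hT.1 hc hσ hcσ
    refine exists_tendsto hv hT.1 hc hσ hcσ (fun hqZ => x.2.2 ?_) hq
    exact radius_vertex hv hp hD x.2.1 hT hc (by rw [hc0]; rfl) hcσ hqZ hq
  choose c hc hc0 hcσ using hex
  have hcont := hloc.continuous_lift hsep
    ⟨fun y : unitInterval × faceDisk v f =>
      (AffineMap.lineMap (faceMap v f barycenter) (y.2 : ℂ) (y.1 : ℝ) : ℂ), by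
        simp only [AffineMap.lineMap_apply]; fun_prop⟩
    (g := fun y => c y.2 y.1) (funext fun y => hcσ y.2 y.1 y.1.2)
    (by simpa only [Set.Icc.coe_zero, hc0] using continuous_const)
    (fun x => continuousOn_iff_continuous_domRestrict.1 (hc x))
  refine ⟨fun x => c x 1, by
    simpa [Function.comp_def] using hcont.comp (Continuous.prodMk_right (1 : unitInterval)), fun x => ?_,
    fun z hz x hx => ?_⟩
  · rw [hcσ x 1 (right_mem_Icc.2 zero_le_one), AffineMap.lineMap_apply_one]
  · have hzc : z ∈ refTriangle \ range corner := ⟨hz, fun ⟨j, hj⟩ => x.2.2 ⟨j, by rw [hx, ← hj]⟩⟩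
    have h1 := eq_cell (f := f) hv hp isPreconnected_Icc (hc x)
      (y := fun t : ℝ => (AffineMap.lineMap barycenter z t : ℂ))
      (AffineMap.lineMap_continuous (R := ℝ)).continuousOn
      (fun t ht => convex_refTriangle_diff_corners.lineMap_mem barycenter_mem hzc ht)
      (fun t ht => by
        rw [hcσ x t ht, hx]
        simp only [AffineMap.lineMap_apply, vsub_eq_sub, vadd_eq_add, faceMap_add]
        rw [faceMap_smul, faceMap_sub, Complex.real_smul])
      (left_mem_Icc.2 zero_le_one) (by rw [hc0]; simp [a, ofFace]) (right_mem_Icc.2 zero_le_one)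
    simpa using h1

end DevelopedPoint

theorem isNondegenerateDelaunay_flatStructure [T2Space S] [CompactSpace S] [OrientedSurface S] {κ : Z → ℕ}
    (hv : v ∈ τ.cycleSpace) (hp : IsPositive v) (hκ : τ.HasOrders v κ)
    (h : angleOf v ∈ τ.delaunayAngles) : τ.IsNondegenerateDelaunay (flatStructure hv hp hκ) := by
  refine ⟨isGeometric_flatStructure hv hp hκ, fun f => ?_⟩
  obtain ⟨Φ, hΦ, hΦpos, hΦcell⟩ := DevelopedPoint.exists_disk hv hp
    ((angleOf_mem_delaunayAngles_iff hp hv.1).1 h) f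
  classical
  set C := circumcenter v f with hC
  set p : Fin 3 → ℂ := fun j => faceMap v f (corner j) with hpdef
  let d : ℂ → S := fun x => if hx : x ∈ faceDisk v f then (Φ ⟨x, hx⟩).pt else τ.cell f (faceInv v f x)
  have hd : ∀ x (hx : x ∈ faceDisk v f), d x = (Φ ⟨x, hx⟩).pt := fun x hx => dif_pos hx
  have hdf : ∀ z ∈ refTriangle, d (faceMap v f z) = τ.cell f z := fun z hz => by
    by_cases hx : faceMap v f z ∈ faceDisk v f
    · rw [hd _ hx]; exact hΦcell z hz _ rfl
    · rw [← faceInv_faceMap hp f z]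
      simp only [d, hx, dif_neg, not_false_eq_true, faceMap_faceInv hp]
  have hdZ : ∀ x ∈ faceDisk v f, d x ∉ Z := fun x hx => by rw [hd x hx]; exact (Φ ⟨x, hx⟩).notMem
  have hball := ball_subset_faceDisk hv.1 hp f
  have hpts : (range p).Finite := finite_range p
  have hdG : ContinuousOn d (faceDisk v f) := by
    rw [continuousOn_iff_continuous_domRestrict]
    exact ((DevelopedPoint.continuous_pt hv).comp hΦ).congr fun x => (hd x x.2).symm
  have hcorner : ∀ j, ContinuousWithinAt d (Metric.closedBall C ‖C‖) (p j) := fun j V hV => by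
    rw [show d (p j) = τ.cell f (corner j) from hdf _ (corner_mem j)] at hV
    obtain ⟨V', hV', m, hm, htrap⟩ := DevelopedPoint.exists_trap hv hp _ hV
    obtain ⟨z, hz, hz1, hz2⟩ : ∃ z ∈ interior refTriangle, τ.cell f z ∈ V' ∧
        faceMap v f z ∈ Metric.ball (p j) (m / 2) := by
      have h1 : ∀ᶠ z in 𝓝[interior refTriangle] (corner j), τ.cell f z ∈ V' :=
        ((τ.tendsto_cell (corner_mem j)).eventually hV').filter_mono (nhdsWithin_mono _ interior_subset)
      have h2 : ∀ᶠ z in 𝓝[interior refTriangle] (corner j), faceMap v f z ∈ Metric.ball (p j) (m / 2) :=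
        nhdsWithin_le_nhds ((continuous_faceMap v f).continuousAt.eventually
          (Metric.ball_mem_nhds _ (half_pos hm)))
      have := mem_closure_iff_nhdsWithin_neBot.1 (mem_closure_interior (corner_mem j))
      obtain ⟨z, ⟨h3, h4⟩, h5⟩ := ((h1.and h2).and self_mem_nhdsWithin).exists
      exact ⟨z, h5, h3, h4⟩
    have hzD : faceMap v f z ∈ faceDisk v f := hball (faceMap_mem_ball hv.1 hp
      ⟨interior_subset hz, fun ⟨i, hi⟩ => corner_notMem_interior i (hi ▸ hz)⟩)
    let J : Set ℂ := faceDisk v f ∩ Metric.ball (p j) (m / 2)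
    have hJ : Convex ℝ J := (convex_faceDisk hv.1 hp f).inter (convex_ball _ _)
    have : PreconnectedSpace J := isPreconnected_iff_preconnectedSpace.1 hJ.isPreconnected
    have htrap' := htrap (J := (univ : Set J)) (c := fun x : J => Φ ⟨x, x.2.1⟩) isPreconnected_univ
      (hΦ.comp (Continuous.subtype_mk continuous_subtype_val _)).continuousOn ⟨_, hzD, hz2⟩ (mem_univ _)
      (by rwa [hΦcell z (interior_subset hz) _ rfl]) (fun x _ => by
        rw [hΦpos, hΦpos]
        have h1 : dist (x : ℂ) (p j) < m / 2 := x.2.2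
        have h2 : dist (faceMap v f z) (p j) < m / 2 := hz2
        have h3 := dist_triangle_right (x : ℂ) (faceMap v f z) (p j)
        exact h3.trans (by linarith))
    have hother : ∀ᶠ x in 𝓝 (p j), x ∉ range p \ {p j} :=
      (hpts.subset sdiff_subset).isClosed.isOpen_compl.mem_nhds fun h => h.2 rfl
    refine mem_map.2 ?_
    filter_upwards [self_mem_nhdsWithin, nhdsWithin_le_nhds hother,
      nhdsWithin_le_nhds (Metric.ball_mem_nhds (p j) (half_pos hm))] with x hx hx1 hx2
    by_cases hxr : x ∈ range p
    · have : x = p j := by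
        by_contra hne
        exact hx1 ⟨hxr, hne⟩
      rw [mem_preimage, this, show d (p j) = τ.cell f (corner j) from hdf _ (corner_mem j)]
      exact mem_of_mem_nhds hV
    · have hxD : x ∈ faceDisk v f := ⟨hx, hxr⟩
      rw [mem_preimage, hd x hxD]
      exact htrap' ⟨x, hxD, hx2⟩ (mem_univ _)
  have hcont : ContinuousOn d (Metric.closedBall C ‖C‖) := fun x hx => by
    by_cases hxr : x ∈ range p
    · obtain ⟨j, rfl⟩ := hxr
      exact hcorner j
    · refine (hdG x ⟨hx, hxr⟩).mono_of_mem_nhdsWithin ?_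
      exact inter_mem self_mem_nhdsWithin (nhdsWithin_le_nhds (hpts.isClosed.isOpen_compl.mem_nhds hxr))
  refine ⟨d, C, ‖C‖, p, ⟨norm_circumcenter_pos hp f, hcont, fun z hz => hdZ z (hball hz), ?_⟩,
    (faceMap_injective hp f).comp corner_injective, ?_, ?_⟩
  · intro z hz e he hze
    have hzD := hball hz
    have hfl := he.2 _ hze
    rw [hd z hzD] at hfl
    have h1 := ((DevelopedPoint.tendsto_iff hv hfl).1 (hΦ.tendsto ⟨z, hzD⟩)).2
    have h2 : ∀ᶠ y in 𝓝 z, y = z + (e (d y) - e (d z)) := by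
      have hmem : faceDisk v f ∈ 𝓝 z := mem_of_superset (Metric.isOpen_ball.mem_nhds hz) hball
      rw [nhds_subtype_eq_comap, eventually_comap] at h1
      filter_upwards [h1, hmem] with y h3 h4
      have h5 := h3 ⟨y, h4⟩ rfl
      rwa [hΦpos, hΦpos, ← hd y h4, ← hd z hzD] at h5
    filter_upwards [h2.prod_inl_nhds z, h2.prod_inr_nhds z] with y h3 h4
    rw [dist_eq_norm, dist_eq_norm]
    congr 1
    linear_combination h4 - h3
  · ext x
    constructor
    · rintro ⟨hx, hxZ⟩
      by_contra hxr
      exact hdZ x ⟨hx, hxr⟩ hxZ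
    · rintro ⟨j, rfl⟩
      refine ⟨corner_mem_closedBall hv.1 hp f ⟨j, rfl⟩, ?_⟩
      rw [show d (p j) = τ.cell f (corner j) from hdf _ (corner_mem j)]
      exact τ.vertex_mem f j
  · rw [← (bijOn_faceMap hp f).image_eq, image_image]
    exact image_congr hdf

end Triangulation

namespace Triangulation

variable {S : Type*} [TopologicalSpace S] [T2Space S]
  [ChartedSpace ℂ S] [OrientedSurface S] {Z : Set S} {E F : Type*} {κ : Z → ℕ}
  {τ : Triangulation S Z E F} {ι : Equiv.Perm (F × Fin 3)}

theorem periodAngles_mem_of_isoDelaunay (hι : τ.IsTriangleMatching ι) {M : ProjStratum Z κ}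
    (hM : M ∈ τ.isoDelaunay κ) :
    τ.periodAngles M ∈ τ.delaunayAngles ∩ RibbonGraph.invariantAngles ι := by
  have := τ.finite_faces
  obtain ⟨X, hX, rfl⟩ := hM
  rw [periodAngles_mk]
  exact ⟨hX.angleOf_mem hι.partner_fst_ne, hι.angleOf_mem_invariantAngles hX.1.sideVector_mem hX.1.isPositive⟩

theorem hasOrders_of_isoTriangulable [CompactSpace S] [ConnectedSpace S] {V : RibbonGraph.invariantAngles ι → τ.cycleSpace}
    (hι : τ.IsTriangleMatching ι) (hV : ∀ h, Continuous fun θ => (V θ : F × Fin 3 → ℂ) h)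
    (hp : ∀ θ, RibbonGraph.IsPositive (V θ : F × Fin 3 → ℂ))
    (ha : ∀ θ : RibbonGraph.invariantAngles ι, RibbonGraph.angleOf (V θ : F × Fin 3 → ℂ) = θ)
    (hne : (τ.isoTriangulable κ).Nonempty) (θ : RibbonGraph.invariantAngles ι) :
    τ.HasOrders (V θ) κ := by
  have := τ.finite_faces
  have := τ.nonempty_faces
  obtain ⟨_, X, hX, -⟩ := hne
  obtain ⟨hκ, -⟩ := projMk_eq_of_geometric hX
  let θ₀ : RibbonGraph.invariantAngles ι :=
    ⟨_, hι.angleOf_mem_invariantAngles hX.sideVector_mem hX.isPositive⟩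
  obtain ⟨c, hc, hcv⟩ := RibbonGraph.exists_smul_of_angleOf_eq τ.faceConnected hX.sideVector_mem
    (V θ₀).2 hX.isPositive (hp θ₀) (ha θ₀).symm
  have h0 : τ.HasOrders (V θ₀) κ := by
    have := hκ.const_mul hc
    rwa [← funext hcv] at this
  obtain ⟨κ', hκ'⟩ := exists_hasOrders (V θ).2 (hp θ)
  have hmem : ∀ s ∈ Icc (0 : ℝ) 1, AffineMap.lineMap (θ₀ : F × Fin 3 → ℝ) (θ : F × Fin 3 → ℝ) s ∈
      RibbonGraph.invariantAngles ι := fun s hs =>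
    (RibbonGraph.convex_invariantAngles ι).lineMap_mem θ₀.2 θ.2 hs
  let σ : ℝ → RibbonGraph.invariantAngles ι := fun s =>
    ⟨AffineMap.lineMap (θ₀ : F × Fin 3 → ℝ) (θ : F × Fin 3 → ℝ) (projIcc (0 : ℝ) 1 zero_le_one s : ℝ),
      hmem _ (projIcc (0 : ℝ) 1 zero_le_one s).2⟩
  have hσ : Continuous σ := Continuous.subtype_mk
    (AffineMap.lineMap_continuous.comp (continuous_subtype_val.comp continuous_projIcc)) _
  have hσ0 : σ 0 = θ₀ := Subtype.ext (by simp [σ])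
  have hσ1 : σ 1 = θ := Subtype.ext (by simp [σ])
  have := HasOrders.eq_of_path (V := fun s => V (σ s)) (fun h => ((hV h).comp hσ).continuousOn)
    (fun s _ => hp _) (κ := κ) (κ' := κ') (by simpa only [hσ0] using h0) (by simpa only [hσ1] using hκ')
  rwa [this]

theorem continuous_projMk_flatStructure {T : Type*} [TopologicalSpace T] {V : T → τ.cycleSpace}
    (hV : ∀ h, Continuous fun t => (V t : F × Fin 3 → ℂ) h)
    (hp : ∀ t, RibbonGraph.IsPositive (V t : F × Fin 3 → ℂ)) (hκ : ∀ t, τ.HasOrders (V t) κ) :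
    Continuous fun t => ProjStratum.mk (flatStructure (V t).2 (hp t) (hκ t)) := by
  have := τ.finite_faces
  have h1 : Continuous fun t => Stratum.mk (flatStructure (V t).2 (hp t) (hκ t)) := by
    refine Stratum.continuous_iff.2 fun a b γ => ?_
    obtain ⟨L, hL⟩ := τ.exists_linear_period γ
    simp only [TranslationStructure.period_mk τ.finite_vertices, hL]
    exact (LinearMap.continuous_of_finiteDimensional L).comp
      (Continuous.subtype_mk (continuous_pi hV) _)
  exact continuous_quot_mk.comp h1

theorem exists_homeomorph [CompactSpace S] [ConnectedSpace S] (hι : τ.IsTriangleMatching ι) (hne : (τ.isoTriangulable κ).Nonempty) :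
    ∃ Φ : τ.isoDelaunay κ ≃ₜ ↥(τ.delaunayAngles ∩ RibbonGraph.invariantAngles ι),
      ∀ M, (Φ M : F × Fin 3 → ℝ) = τ.delaunayAngleMap κ M := by
  have := τ.finite_faces
  have := τ.nonempty_faces
  obtain ⟨V, hV, hp, ha⟩ := hι.exists_continuous_cycle τ.faceConnected
  have hκ := hasOrders_of_isoTriangulable hι hV hp ha hne
  let Ψ : ↥(τ.delaunayAngles ∩ RibbonGraph.invariantAngles ι) → τ.isoDelaunay κ := fun θ =>
    ⟨ProjStratum.mk (flatStructure (V ⟨θ, θ.2.2⟩).2 (hp _) (hκ _)), _,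
      isNondegenerateDelaunay_flatStructure (V ⟨θ, θ.2.2⟩).2 (hp _) (hκ _) (by rw [ha]; exact θ.2.1), rfl⟩
  have hΨ : ∀ θ, τ.periodAngles (Ψ θ : ProjStratum Z κ) = θ := fun θ => by
    rw [periodAngles_mk, sideVector_flatStructure, ha]
  refine ⟨{ toFun := fun M => ⟨τ.periodAngles (M : ProjStratum Z κ), periodAngles_mem_of_isoDelaunay hι M.2⟩
            invFun := Ψ
            left_inv := fun M => Subtype.ext (injOn_periodAngles (τ.isoDelaunay_subset κ (Ψ _).2)
              (τ.isoDelaunay_subset κ M.2) (hΨ _))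
            right_inv := fun θ => Subtype.ext (hΨ θ)
            continuous_toFun := ?_
            continuous_invFun := ?_ }, fun M =>
    (angleMap_eq (⟨M, τ.isoDelaunay_subset κ M.2⟩ : τ.isoTriangulable κ)).symm⟩
  · exact Continuous.subtype_mk (continuousOn_iff_continuous_domRestrict.1
      (continuousOn_periodAngles.mono (τ.isoDelaunay_subset κ))) _
  · refine Continuous.subtype_mk (continuous_projMk_flatStructure
      (V := fun θ : ↥(τ.delaunayAngles ∩ RibbonGraph.invariantAngles ι) => V ⟨θ, θ.2.2⟩) (fun h => ?_) _ _) _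
    exact (hV h).comp (Continuous.subtype_mk continuous_subtype_val _)

theorem exists_isoDelaunay_nonempty [CompactSpace S] [ConnectedSpace S]
    (hι : τ.IsTriangleMatching ι) :
    ∃ κ : Z → ℕ, (τ.isoDelaunay κ).Nonempty := by
  have := τ.finite_faces
  have := τ.nonempty_faces
  obtain ⟨V, hV, hp, ha⟩ := hι.exists_continuous_cycle τ.faceConnected
  have h := RibbonGraph.const_mem τ.toRibbonGraph ι
  obtain ⟨κ, hκ⟩ := exists_hasOrders (V ⟨_, h.2⟩).2 (hp _)
  exact ⟨κ, _, flatStructure (V ⟨_, h.2⟩).2 (hp _) hκ,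
    isNondegenerateDelaunay_flatStructure _ _ _ (by rw [ha]; exact h.1), rfl⟩

end Triangulation

theorem theoremA {S : Type*} [TopologicalSpace S] [T2Space S] [CompactSpace S] [ConnectedSpace S]
    [ChartedSpace ℂ S] [OrientedSurface S] {Z : Set S} {E F : Type*}
    (τ : Triangulation S Z E F) (ι : Equiv.Perm (F × Fin 3))
    (hι : τ.toRibbonGraph.IsTriangleMatching ι) :
    τ.toRibbonGraph.trivialHolonomy = RibbonGraph.invariantAngles ι ∧
    Convex ℝ (τ.toRibbonGraph.delaunayAngles ∩ RibbonGraph.invariantAngles ι) ∧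
    (∃ κ : Z → ℕ, (τ.isoDelaunay κ).Nonempty) ∧
    ∀ κ : Z → ℕ, (τ.isoTriangulable κ).Nonempty →
      (∃ Φ : τ.isoDelaunay κ ≃ₜ
          ↥(τ.toRibbonGraph.delaunayAngles ∩ RibbonGraph.invariantAngles ι),
        ∀ M, (Φ M : F × Fin 3 → ℝ) = τ.delaunayAngleMap κ M) ∧
      ConnectedSpace (τ.isoDelaunay κ) ∧ ContractibleSpace (τ.isoDelaunay κ) := by
  have := τ.finite_faces
  have := τ.nonempty_faces
  have hconv := τ.convex_delaunayAngles.inter (RibbonGraph.convex_invariantAngles ι)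
  refine ⟨hι.trivialHolonomy_eq τ.faceConnected, hconv,
    Triangulation.exists_isoDelaunay_nonempty hι, fun κ hκ => ?_⟩
  obtain ⟨Φ, hΦ⟩ := Triangulation.exists_homeomorph hι hκ
  have := hconv.contractibleSpace ⟨_, RibbonGraph.const_mem τ.toRibbonGraph ι⟩
  have : ContractibleSpace (τ.isoDelaunay κ) := Φ.contractibleSpace
  exact ⟨⟨Φ, hΦ⟩, inferInstance, this⟩
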